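/- Fix $T>0$ and $c>0$. Call a function on $\mathbb R^3$ radial if it depends only on $|x|$. For $s\in\{1,2\}$ and radial data $\Phi(x)=\varphi(|x|)\in H^s(\mathbb R^3)$, $\Psi(x)=\psi(|x|)\in H^{s-1}(\mathbb R^3)$ (with $H^0=L^2$), the Cauchy solution is the unique distributional solution $U\in C([0,T];H^s(\mathbb R^3))\cap C^1([0,T];H^{s-1}(\mathbb R^3))$ of $U_{tt}=c^2\Delta U$ on $(0,T)\times\mathbb R^3$ with $U(0)=\Phi$, $U_t(0)=\Psi$. Let $\beta:[0,\infty)\to[0,\infty)$ be smooth and nondecreasing with $\beta=1$ on $[0,1]$ and $\beta(s)=s$ for $s\ge 2$; let $\chi:[0,\infty)\to[0,\infty)$ be smooth and nondecreasing with $\chi=0$ on $[0,1]$ and $\chi=1$ on $[2,\infty)$. For radial $\Phi_0,\Psi_0\in C_c^\infty(\mathbb R^3)$ with profiles $\varphi_0,\psi_0$ and $\varepsilon>0$: - the exterior Neumann solution $U^{N,\varepsilon}$ with data $(\Phi_0,\Psi_0)$ is the radial solution, smooth on $[0,T]\times\{|x|\ge\varepsilon\}$, of $V_{tt}=c^2\Delta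 V$ on $(0,T)\times\{|x|>\varepsilon\}$ with $V(0,x)=\varphi_0(\varepsilon\beta(|x|/\varepsilon))$, $V_t(0,x)=\psi_0(\varepsilon\beta(|x|/\varepsilon))$ for $|x|>\varepsilon$ and $\partial_rV=0$ along $|x|=\varepsilon$ for $t>0$; its extension $\tilde U^{N,\varepsilon}(t,\cdot)$ to $\mathbb R^3$ equals, on $|x|\le\varepsilon$, the constant boundary value of $U^{N,\varepsilon}(t,\cdot)$ on $|x|=\varepsilon$; - the exterior Dirichlet solution $U^{D,\varepsilon}$ with data $(\Phi_0,\Psi_0)$ is the radial solution, smooth on $[0,T]\times\{|x|\ge\varepsilon\}$, of the same equation with $V(0,x)=\chi(|x|/\varepsilon)\varphi_0(|x|)$, $V_t(0,x)=\chi(|x|/\varepsilon)\psi_0(|x|)$ for $|x|>\varepsilon$ and $V=0$ along $|x|=\varepsilon$ for $t>0$; its extension $\tilde U^{D,\varepsilon}(t,\cdot)$ is $0$ on $|x|\le\varepsilon$. **Theorem.** (i) Let $\Phi\in H^2(\mathbb R^3)$ and $\Psi\in H^1(\mathbb R^3)$ be radial, with Cauchy solution $U$. Then there are radial $\Phi_\varepsilon,\Psi_\varepsilon\in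 C_c^\infty(\mathbb R^3)$, $\varepsilon>0$, with $\Phi_\varepsilon\to\Phi$ in $H^2$ and $\Psi_\varepsilon\to\Psi$ in $H^1$ as $\varepsilon\downarrow0$, such that the extended exterior Neumann solutions $\tilde U^{N,\varepsilon}$ with data $(\Phi_\varepsilon,\Psi_\varepsilon)$ exist, belong to $C([0,T];H^2(\mathbb R^3))$, and satisfy $$\sup_{0\le t\le T}\|U(t)-\tilde U^{N,\varepsilon}(t)\|_{H^2(\mathbb R^3)}\to0\qquad(\varepsilon\downarrow0).$$ (ii) Let $\Phi\in H^1(\mathbb R^3)$ and $\Psi\in L^2(\mathbb R^3)$ be radial, with Cauchy solution $U$. Then there are radial $\Phi_\varepsilon,\Psi_\varepsilon\in C_c^\infty(\mathbb R^3)$, $\varepsilon>0$, with $\Phi_\varepsilon\to\Phi$ in $H^1$ and $\Psi_\varepsilon\to\Psi$ in $L^2$ as $\varepsilon\downarrow0$, such that the extended exterior Dirichlet solutions $\tilde U^{D,\varepsilon}$ with data $(\Phi_\varepsilon,\Psi_\varepsilon)$ exist, belong to $C([0,T];H^1(\mathbb R^3))$, and satisfy $$\sup_{0\le t\le T}\|U(t)-\tilde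 U^{D,\varepsilon}(t)\|_{H^1(\mathbb R^3)}\to0\qquad(\varepsilon\downarrow0).$$ In both parts, if $\Phi,\Psi\in C_c^\infty(\mathbb R^3)$, one can take $\Phi_\varepsilon=\Phi$ and $\Psi_\varepsilon=\Psi$ for all $\varepsilon>0$. -/

import Mathlib

open Filter Topology MeasureTheory
open scoped ContDiff Laplacian

namespace RadialWave

/-- Three-dimensional Euclidean space. -/
abbrev E3 : Type := EuclideanSpace ℝ (Fin 3)

/-- A fixed unit vector, used to read off the profile of a radial function. -/
noncomputable def e₁ : E3 := EuclideanSpace.single 0 1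

section Sobolev

/-- `g` is the weak partial derivative `∂ᵢ f` on `ℝ³`: both functions are locally integrable and
`∫ f ∂ᵢη = - ∫ g η` for all test functions `η ∈ C_c^∞(ℝ³)`. -/
def HasWeakPartial (i : Fin 3) (f g : E3 → ℝ) : Prop :=
  LocallyIntegrable f volume ∧ LocallyIntegrable g volume ∧
    ∀ η : E3 → ℝ, ContDiff ℝ ∞ η → HasCompactSupport η →
      ∫ x, f x * fderiv ℝ η x (EuclideanSpace.single i 1) = - ∫ x, g x * η x

/-- The square of the `H^k(ℝ³)`-norm, as an extended nonnegative number: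
`‖f‖²_{H⁰} = ‖f‖²_{L²}` and `‖f‖²_{H^{k+1}} = ‖f‖²_{L²} + ∑ᵢ ‖∂ᵢ f‖²_{H^k}`.
A weak partial derivative is unique up to null sets, so the infimum is over (at most) one class;
it is `∞` if the weak derivative does not exist. -/
noncomputable def sobolevSq : ℕ → (E3 → ℝ) → ENNReal
  | 0, f => eLpNorm f 2 volume ^ 2
  | k + 1, f => eLpNorm f 2 volume ^ 2 +
      ∑ i : Fin 3, ⨅ (g : E3 → ℝ) (_ : HasWeakPartial i f g), sobolevSq k g

/-- The `H^k(ℝ³)`-norm (`∞` for functions that are not in `H^k`). -/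
noncomputable def sobolevNorm (k : ℕ) (f : E3 → ℝ) : ENNReal := sobolevSq k f ^ (1 / 2 : ℝ)

/-- `f ∈ H^k(ℝ³)`; for `k = 0` this is `f ∈ L²(ℝ³)`. -/
def MemH (k : ℕ) (f : E3 → ℝ) : Prop :=
  AEStronglyMeasurable f volume ∧ sobolevNorm k f < ⊤

/-- `U ∈ C([0,T]; H^k(ℝ³))`. -/
def ContInH (k : ℕ) (T : ℝ) (U : ℝ → E3 → ℝ) : Prop :=
  (∀ t ∈ Set.Icc 0 T, MemH k (U t)) ∧
    ∀ t₀ ∈ Set.Icc 0 T,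
      Tendsto (fun t => sobolevNorm k (U t - U t₀)) (𝓝[Set.Icc 0 T] t₀) (𝓝 0)

/-- `V` is the time derivative of `U` on `[0,T]`, with difference quotients converging
in `H^k(ℝ³)` (one-sided at the end points). -/
def HasTimeDerivInH (k : ℕ) (T : ℝ) (U V : ℝ → E3 → ℝ) : Prop :=
  ∀ t₀ ∈ Set.Icc 0 T,
    Tendsto (fun t => sobolevNorm k ((t - t₀)⁻¹ • (U t - U t₀) - V t₀))
      (𝓝[Set.Icc 0 T \ {t₀}] t₀) (𝓝 0)

end Sobolev

section Radial

/-- `Φ` agrees almost everywhere with a function of `|x|`. -/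
def IsRadialAE (Φ : E3 → ℝ) : Prop := ∃ φ : ℝ → ℝ, ∀ᵐ x, Φ x = φ ‖x‖

/-- `Φ ∈ C^∞_{c,rad}(ℝ³)`. -/
def IsSmoothRadial (Φ : E3 → ℝ) : Prop :=
  ContDiff ℝ ∞ Φ ∧ HasCompactSupport Φ ∧ ∃ φ : ℝ → ℝ, ∀ x, Φ x = φ ‖x‖

/-- The profile `φ` of a radial function `Φ(x) = φ(|x|)`, for arguments `r ≥ 0`. -/
noncomputable def profile (Φ : E3 → ℝ) (r : ℝ) : ℝ := Φ (r • e₁)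

end Radial

section Cauchy

/-- `U` is the solution of `U_tt = c² ΔU` on `(0,T) × ℝ³`, `U(0) = Φ`, `U_t(0) = Ψ`, in
`C([0,T]; H^{k+1}) ∩ C¹([0,T]; H^k)`. The equation holds in the sense of distributions. -/
def IsCauchySolution (c T : ℝ) (k : ℕ) (Φ Ψ : E3 → ℝ) (U : ℝ → E3 → ℝ) : Prop :=
  ContInH (k + 1) T U ∧
  (U 0 =ᵐ[volume] Φ) ∧
  (∃ V : ℝ → E3 → ℝ, ContInH k T V ∧ HasTimeDerivInH k T U V ∧ (V 0 =ᵐ[volume] Ψ)) ∧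
  ∀ η : ℝ × E3 → ℝ, ContDiff ℝ ∞ η → HasCompactSupport η →
    tsupport η ⊆ Set.Ioo 0 T ×ˢ Set.univ →
    ∫ t in Set.Ioo 0 T, ∫ x, U t x *
      (iteratedDeriv 2 (fun τ => η (τ, x)) t - c ^ 2 * Δ (fun y => η (t, y)) x) = 0

end Cauchy

section Exterior

/-- `V` is a smooth (up to the boundary) radial solution of `V_tt = c² ΔV` on
`(0,T) × {|x| > ε}` with `V(0) = Φ`, `V_t(0) = Ψ` for `|x| > ε`. -/
structure IsExteriorSolution (c T ε : ℝ) (Φ Ψ : E3 → ℝ) (V : ℝ → E3 → ℝ) : Prop where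
  smooth : ContDiffOn ℝ ∞ (fun p : ℝ × E3 => V p.1 p.2) (Set.Icc 0 T ×ˢ {x | ε ≤ ‖x‖})
  radial : ∀ t ∈ Set.Icc 0 T, ∀ x y : E3, ε ≤ ‖x‖ → ‖x‖ = ‖y‖ → V t x = V t y
  wave : ∀ t ∈ Set.Ioo 0 T, ∀ x : E3, ε < ‖x‖ →
    iteratedDeriv 2 (fun τ => V τ x) t = c ^ 2 * Δ (V t) x
  init : ∀ x : E3, ε < ‖x‖ → V 0 x = Φ x
  init_deriv : ∀ x : E3, ε < ‖x‖ → HasDerivWithinAt (fun τ => V τ x) (Ψ x) (Set.Ici 0) 0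

/-- Exterior solution with `∂_r V = 0` along `|x| = ε` for `t > 0`. -/
structure IsExteriorNeumannSolution (c T ε : ℝ) (Φ Ψ : E3 → ℝ) (V : ℝ → E3 → ℝ) : Prop
    extends IsExteriorSolution c T ε Φ Ψ V where
  neumann : ∀ t ∈ Set.Ioc 0 T, ∀ e : E3, ‖e‖ = 1 →
    HasDerivWithinAt (fun r : ℝ => V t (r • e)) 0 (Set.Ici ε) ε

/-- Exterior solution with `V = 0` along `|x| = ε` for `t > 0`. -/
structure IsExteriorDirichletSolution (c T ε : ℝ) (Φ Ψ : E3 → ℝ) (V : ℝ → E3 → ℝ) : Prop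
    extends IsExteriorSolution c T ε Φ Ψ V where
  dirichlet : ∀ t ∈ Set.Ioc 0 T, ∀ x : E3, ‖x‖ = ε → V t x = 0

/-- `β : [0,∞) → [0,∞)` is smooth and nondecreasing, `β = 1` on `[0,1]` and
`β(s) = s` for `s ≥ 2`. -/
structure IsNeumannCutoff (β : ℝ → ℝ) : Prop where
  smooth : ContDiffOn ℝ ∞ β (Set.Ici 0)
  mono : MonotoneOn β (Set.Ici 0)
  eq_one : ∀ s ∈ Set.Icc (0 : ℝ) 1, β s = 1
  eq_self : ∀ s : ℝ, 2 ≤ s → β s = s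

/-- `χ : [0,∞) → [0,∞)` is smooth and nondecreasing, `χ = 0` on `[0,1]` and
`χ = 1` on `[2,∞)`. -/
structure IsDirichletCutoff (χ : ℝ → ℝ) : Prop where
  smooth : ContDiffOn ℝ ∞ χ (Set.Ici 0)
  mono : MonotoneOn χ (Set.Ici 0)
  eq_zero : ∀ s ∈ Set.Icc (0 : ℝ) 1, χ s = 0
  eq_one : ∀ s : ℝ, 2 ≤ s → χ s = 1

/-- `Φ^ε(x) = φ(ε β(|x|/ε))`, where `Φ(x) = φ(|x|)`. -/
noncomputable def neumannData (β : ℝ → ℝ) (ε : ℝ) (Φ : E3 → ℝ) : E3 → ℝ :=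
  fun x => profile Φ (ε * β (‖x‖ / ε))

/-- `Φ^ε(x) = χ(|x|/ε) Φ(x)`. -/
noncomputable def dirichletData (χ : ℝ → ℝ) (ε : ℝ) (Φ : E3 → ℝ) : E3 → ℝ :=
  fun x => χ (‖x‖ / ε) * Φ x

open Classical in
/-- The extension of a radial exterior function to `ℝ³`, at each time, as the constant equal to
its boundary value on `|x| ≤ ε`. -/
noncomputable def extendConst (ε : ℝ) (V : ℝ → E3 → ℝ) : ℝ → E3 → ℝ :=
  fun t x => if ‖x‖ ≤ ε then V t (ε • e₁) else V t x

open Classical in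
/-- The extension of an exterior function to `ℝ³` by zero on `|x| ≤ ε`. -/
noncomputable def extendZero (ε : ℝ) (V : ℝ → E3 → ℝ) : ℝ → E3 → ℝ :=
  fun t x => if ‖x‖ ≤ ε then 0 else V t x

end Exterior

end RadialWave

open RadialWave

/-!
The proof rests on explicit formulas for smooth radial data, an energy inequality and density.

*Free solution.* For smooth radial data `(φ, ψ)`, `r` times the Cauchy solution is
`K(ct + r) - K(ct - r)` with `2 K(r) = r φ(r) + c⁻¹ ∫₀^r s ψ(s) ds` (`halfWave`). Written as the
average `∫ K'(ct + r s) ds` over `-1 ≤ s ≤ 1` (`wavg`), it is smooth up to `r = 0`, and it lies in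
`C([0,T]; H²) ∩ C¹([0,T]; H¹)` (`IsWaveProfile.isMild`).

*Exterior solutions.* Here `r` times the solution is `G(ct + r) + H(ct - r)` (`twoWave`). The
incoming wave `G` comes from the cut-off data. The outgoing wave `H` is the outgoing free wave plus
a reflected wave, which in the Dirichlet case is `-G` translated by `2ε` and in the Neumann case
solves the linear equation `b' + b / ε = S` (`robin`).
Extended to `|x| ≤ ε`, these functions lie in `C([0,T]; H¹)` and `C([0,T]; H²)`, respectively.

*Comparison.* The first (Dirichlet) or second (Neumann) radial derivative of `r` times the
difference of the two solutions is bounded by `C (ε + exp(-|ct - r| / ε))`, uniformly in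
`0 ≤ t ≤ T` (`exists_bound_dirichlet`, `exists_bound_neumann`). For the incoming waves this holds
because the data differ only in `r ≤ 2ε`. For the Neumann reflection it holds because the equation
for `b` relaxes at the rate `1 / ε`. Such a bound has an `L²(dr)`-norm of order `ε^(1/2)`, and
integrating it inwards from the region where all the waves vanish controls the lower derivatives;
with the boundary condition this gives `O(ε)` for the squared Sobolev norms of the difference
(`exists_sobolevSq_one_sub_le`, `exists_sobolevSq_two_sub_le`).

*General data.* The Cauchy solution depends continuously on the data
(`exists_sobolevSq_le_of_isMild`), by conservation of energy for distributional solutions, and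
smooth compactly supported radial functions are dense in the radial part of `H^k`
(`exists_test_sobolevSq_sub_lt`). A sequence of smooth data that is run through slowly enough as
`ε → 0` then does what is claimed (`exists_data_tendsto`).
-/

namespace RadialWave

/-! ### Sobolev norms: linearity, uniqueness of weak derivatives -/

/-- `η ∈ C_c^∞(ℝ³)`. -/
structure IsTest (η : E3 → ℝ) : Prop where
  smooth : ContDiff ℝ ∞ η
  compact : HasCompactSupport η

/-- The classical partial derivative `∂ᵢ η`. -/
noncomputable def pd (i : Fin 3) (η : E3 → ℝ) : E3 → ℝ :=
  fun x => fderiv ℝ η x (EuclideanSpace.single i 1)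

lemma contDiff_pd {η : E3 → ℝ} (h : ContDiff ℝ ∞ η) (i : Fin 3) : ContDiff ℝ ∞ (pd i η) :=
  (h.fderiv_right (m := ∞) (by simp)).clm_apply contDiff_const

lemma hasCompactSupport_pd {η : E3 → ℝ} (h : HasCompactSupport η) (i : Fin 3) :
    HasCompactSupport (pd i η) :=
  (h.fderiv ℝ).comp_left (g := fun L : E3 →L[ℝ] ℝ => L (EuclideanSpace.single i 1)) rfl

lemma IsTest.pd {η : E3 → ℝ} (h : IsTest η) (i : Fin 3) : IsTest (pd i η) :=
  ⟨contDiff_pd h.smooth i, hasCompactSupport_pd h.compact i⟩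

lemma IsTest.continuous {η : E3 → ℝ} (h : IsTest η) : Continuous η := h.smooth.continuous

lemma IsTest.mul_left {η m : E3 → ℝ} (h : IsTest η) (hm : ContDiff ℝ ∞ m) :
    IsTest (fun x => m x * η x) :=
  ⟨hm.mul h.smooth, h.compact.mul_left⟩

lemma _root_.MeasureTheory.LocallyIntegrable.integrable_mul_test {f η : E3 → ℝ}
    (hf : LocallyIntegrable f volume)
    (h : Continuous η) (hc : HasCompactSupport η) : Integrable (fun x => f x * η x) volume := by
  simpa [mul_comm] using hf.integrable_smul_left_of_hasCompactSupport h hc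

lemma pd_mul {m η : E3 → ℝ} (hm : ContDiff ℝ ∞ m) (hη : ContDiff ℝ ∞ η) (i : Fin 3) (x : E3) :
    pd i (fun y => m y * η y) x = m x * pd i η x + pd i m x * η x := by
  have h1 := (hm.differentiable (by simp)) x
  have h2 := (hη.differentiable (by simp)) x
  simp only [pd]
  rw [fderiv_fun_mul h1 h2]
  simp [mul_comm]

namespace HasWeakPartial

variable {i : Fin 3} {f g f' g' : E3 → ℝ}

lemma congr (h : HasWeakPartial i f g) (hf : f =ᵐ[volume] f') (hg : g =ᵐ[volume] g') :
    HasWeakPartial i f' g' := by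
  refine ⟨h.1.congr hf, h.2.1.congr hg, fun η h1 h2 => ?_⟩
  have e1 : ∫ x, f' x * fderiv ℝ η x (EuclideanSpace.single i 1) =
      ∫ x, f x * fderiv ℝ η x (EuclideanSpace.single i 1) :=
    integral_congr_ae (by filter_upwards [hf] with x hx; rw [hx])
  have e2 : ∫ x, g' x * η x = ∫ x, g x * η x :=
    integral_congr_ae (by filter_upwards [hg] with x hx; rw [hx])
  rw [e1, e2, h.2.2 η h1 h2]

lemma unique (h : HasWeakPartial i f g) (h' : HasWeakPartial i f' g') (hf : f =ᵐ[volume] f') :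
    g =ᵐ[volume] g' := by
  have h2 := h'.congr hf.symm (EventuallyEq.refl _ _)
  refine ae_eq_of_integral_contDiff_smul_eq h.2.1 h2.2.1 fun η h1 h3 => ?_
  have a := h.2.2 η h1 h3
  have b := h2.2.2 η h1 h3
  simp only [smul_eq_mul, mul_comm (η _)]
  linarith

lemma add (h : HasWeakPartial i f g) (h' : HasWeakPartial i f' g') :
    HasWeakPartial i (f + f') (g + g') := by
  refine ⟨h.1.add h'.1, h.2.1.add h'.2.1, fun η h1 h2 => ?_⟩
  have t : IsTest η := ⟨h1, h2⟩
  have t' := t.pd i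
  have e : ∫ x, f x * pd i η x = _ := h.2.2 η h1 h2
  have e' : ∫ x, f' x * pd i η x = _ := h'.2.2 η h1 h2
  simp only [Pi.add_apply, add_mul]
  change ∫ x, f x * pd i η x + f' x * pd i η x = _
  rw [integral_add (h.1.integrable_mul_test t'.continuous t'.compact)
    (h'.1.integrable_mul_test t'.continuous t'.compact), integral_add
    (h.2.1.integrable_mul_test t.continuous t.compact)
    (h'.2.1.integrable_mul_test t.continuous t.compact), e, e']
  ring

lemma const_smul (h : HasWeakPartial i f g) (a : ℝ) : HasWeakPartial i (a • f) (a • g) := by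
  refine ⟨h.1.smul a, h.2.1.smul a, fun η h1 h2 => ?_⟩
  have e := h.2.2 η h1 h2
  simp only [Pi.smul_apply, smul_eq_mul, mul_assoc]
  rw [integral_const_mul, integral_const_mul, e]
  ring

lemma sub (h : HasWeakPartial i f g) (h' : HasWeakPartial i f' g') :
    HasWeakPartial i (f - f') (g - g') := by
  have := h.add (h'.const_smul (-1))
  simpa [sub_eq_add_neg] using this

/-- Leibniz rule with a smooth factor. -/
lemma smooth_mul (h : HasWeakPartial i f g) {m : E3 → ℝ} (hm : ContDiff ℝ ∞ m) :
    HasWeakPartial i (fun x => m x * f x) (fun x => m x * g x + pd i m x * f x) := by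
  have li : ∀ {u a : E3 → ℝ}, LocallyIntegrable u volume → Continuous a →
      LocallyIntegrable (fun x => a x * u x) volume := by
    intro u a hu ha
    rw [← locallyIntegrableOn_univ] at hu ⊢
    exact hu.continuousOn_mul ha.continuousOn isOpen_univ.isLocallyClosed
  have hpm : Continuous (pd i m) := (contDiff_pd hm i).continuous
  refine ⟨li h.1 hm.continuous, (li h.2.1 hm.continuous).add (li h.1 hpm), fun η h1 h2 => ?_⟩
  have t : IsTest η := ⟨h1, h2⟩
  have tm := t.mul_left hm
  have e := h.2.2 _ tm.smooth tm.compact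
  have t' := t.pd i
  have i1 := (li h.1 hm.continuous).integrable_mul_test t'.continuous t'.compact
  have i2 := (li h.1 hpm).integrable_mul_test t.continuous t.compact
  have i3 := (li h.2.1 hm.continuous).integrable_mul_test t.continuous t.compact
  have e1 : ∫ x, f x * fderiv ℝ (fun y => m y * η y) x (EuclideanSpace.single i 1) =
      (∫ x, m x * f x * pd i η x) + ∫ x, pd i m x * f x * η x := by
    rw [← integral_add i1 i2]
    refine integral_congr_ae (Eventually.of_forall fun x => ?_)
    have := pd_mul hm h1 i x
    simp only [pd] at this ⊢
    rw [this]; ring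
  have e2 : ∫ x, (m x * g x + pd i m x * f x) * η x =
      (∫ x, m x * g x * η x) + ∫ x, pd i m x * f x * η x := by
    rw [← integral_add i3 i2]
    refine integral_congr_ae (Eventually.of_forall fun x => ?_)
    simp only; ring
  have e3 : ∫ x, g x * (m x * η x) = ∫ x, m x * g x * η x :=
    integral_congr_ae (Eventually.of_forall fun x => by simp only; ring)
  rw [e1, e3] at e
  change ∫ x, m x * f x * pd i η x = _
  rw [e2]
  linarith

end HasWeakPartial

lemma hasWeakPartial_of_contDiff {f : E3 → ℝ} (hf : ContDiff ℝ ∞ f) (i : Fin 3) :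
    HasWeakPartial i f (pd i f) := by
  have c1 : LocallyIntegrable f volume := hf.continuous.locallyIntegrable
  have c2 : LocallyIntegrable (pd i f) volume := (contDiff_pd hf i).continuous.locallyIntegrable
  refine ⟨c1, c2, fun η h1 h2 => ?_⟩
  have t : IsTest η := ⟨h1, h2⟩
  exact integral_mul_fderiv_eq_neg_fderiv_mul_of_integrable
    (c2.integrable_mul_test t.continuous t.compact)
    (c1.integrable_mul_test (t.pd i).continuous (t.pd i).compact)
    (c1.integrable_mul_test t.continuous t.compact)
    (fun x _ => hf.differentiable (by simp) x) (fun x _ => h1.differentiable (by simp) x)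

lemma eLpNorm_sq_eq (f : E3 → ℝ) : eLpNorm f 2 volume ^ 2 = ∫⁻ x, ‖f x‖ₑ ^ 2 := by
  have := eLpNorm_nnreal_pow_eq_lintegral (f := f) (μ := (volume : Measure E3)) (p := 2) (by simp)
  have e : ((2 : NNReal) : ℝ) = ((2 : ℕ) : ℝ) := by norm_num
  simpa only [e, ENNReal.rpow_natCast, NNReal.coe_ofNat, ENNReal.coe_ofNat] using this

lemma enorm_sq_eq_ofReal (a : ℝ) : ‖a‖ₑ ^ 2 = ENNReal.ofReal (a ^ 2) := by
  rw [← sq_abs, ENNReal.ofReal_pow (abs_nonneg a), Real.enorm_eq_ofReal_abs]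

lemma enorm_add_sq_le (a b : ℝ) : ‖a + b‖ₑ ^ 2 ≤ 2 * ‖a‖ₑ ^ 2 + 2 * ‖b‖ₑ ^ 2 := by
  simp only [enorm_sq_eq_ofReal]
  rw [← ENNReal.ofReal_ofNat, ← ENNReal.ofReal_mul (by norm_num),
    ← ENNReal.ofReal_mul (by norm_num), ← ENNReal.ofReal_add (by positivity) (by positivity)]
  exact ENNReal.ofReal_le_ofReal (by nlinarith [sq_nonneg (a - b)])

lemma eLpNorm_sq_add_le {f g : E3 → ℝ} (hf : AEStronglyMeasurable f volume) :
    eLpNorm (f + g) 2 volume ^ 2 ≤ 2 * eLpNorm f 2 volume ^ 2 + 2 * eLpNorm g 2 volume ^ 2 := by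
  simp only [eLpNorm_sq_eq]
  rw [← lintegral_const_mul' _ _ (by simp), ← lintegral_const_mul' _ _ (by simp),
    ← lintegral_add_left' ((hf.enorm.pow_const 2).const_mul 2)]
  exact lintegral_mono fun x => enorm_add_sq_le _ _

lemma eLpNorm_sq_smul (a : ℝ) (f : E3 → ℝ) :
    eLpNorm (a • f) 2 volume ^ 2 = ENNReal.ofReal (a ^ 2) * eLpNorm f 2 volume ^ 2 := by
  rw [eLpNorm_const_smul, mul_pow, enorm_sq_eq_ofReal]

lemma sobolevSq_congr {k : ℕ} {f g : E3 → ℝ} (h : f =ᵐ[volume] g) :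
    sobolevSq k f = sobolevSq k g := by
  cases k with
  | zero => simp only [sobolevSq, eLpNorm_congr_ae h]
  | succ k =>
    simp only [sobolevSq, eLpNorm_congr_ae h]
    congr 1
    refine Finset.sum_congr rfl fun i _ => ?_
    refine iInf_congr fun u => ?_
    exact iInf_congr_Prop ⟨fun hu => hu.congr h (EventuallyEq.refl _ _),
      fun hu => hu.congr h.symm (EventuallyEq.refl _ _)⟩ fun _ => rfl

lemma sobolevSq_succ_eq {k : ℕ} {f : E3 → ℝ} {g : Fin 3 → E3 → ℝ}
    (h : ∀ i, HasWeakPartial i f (g i)) :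
    sobolevSq (k + 1) f = eLpNorm f 2 volume ^ 2 + ∑ i, sobolevSq k (g i) := by
  simp only [sobolevSq]
  congr 1
  refine Finset.sum_congr rfl fun i _ => ?_
  refine le_antisymm (iInf₂_le (g i) (h i)) (le_iInf₂ fun u hu => ?_)
  exact (sobolevSq_congr ((h i).unique hu (EventuallyEq.refl _ _))).le

lemma exists_weakPartial {k : ℕ} {f : E3 → ℝ} (h : sobolevSq (k + 1) f < ⊤) :
    ∃ g : Fin 3 → E3 → ℝ, ∀ i, HasWeakPartial i f (g i) := by
  have : ∀ i, ∃ g, HasWeakPartial i f g := by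
    intro i
    by_contra! hc
    have : (⨅ (g : E3 → ℝ) (_ : HasWeakPartial i f g), sobolevSq k g) = ⊤ := by
      simp [hc]
    have h2 := (Finset.single_le_sum (f := fun i : Fin 3 =>
      ⨅ (g : E3 → ℝ) (_ : HasWeakPartial i f g), sobolevSq k g) (fun _ _ => bot_le)
      (Finset.mem_univ i)).trans (le_add_self (b := eLpNorm f 2 volume ^ 2))
    rw [this] at h2
    exact absurd (h2.trans_lt h) (lt_irrefl _)
  choose g hg using this
  exact ⟨g, hg⟩

lemma eLpNorm_sq_le_sobolevSq (k : ℕ) (f : E3 → ℝ) :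
    eLpNorm f 2 volume ^ 2 ≤ sobolevSq k f := by
  cases k with
  | zero => exact le_rfl
  | succ k => exact le_self_add

lemma sobolevSq_add_le (k : ℕ) {f g : E3 → ℝ} (hf : AEStronglyMeasurable f volume) :
    sobolevSq k (f + g) ≤ 2 * sobolevSq k f + 2 * sobolevSq k g := by
  induction k generalizing f g with
  | zero => exact eLpNorm_sq_add_le hf
  | succ k ih =>
    rcases eq_or_ne (sobolevSq (k + 1) f) ⊤ with h1 | h1
    · simp [h1]
    rcases eq_or_ne (sobolevSq (k + 1) g) ⊤ with h2 | h2
    · simp [h2]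
    obtain ⟨u, hu⟩ := exists_weakPartial h1.lt_top
    obtain ⟨v, hv⟩ := exists_weakPartial h2.lt_top
    rw [sobolevSq_succ_eq hu, sobolevSq_succ_eq hv, sobolevSq_succ_eq fun i => (hu i).add (hv i)]
    calc _ ≤ (2 * eLpNorm f 2 volume ^ 2 + 2 * eLpNorm g 2 volume ^ 2) +
        ∑ i, (2 * sobolevSq k (u i) + 2 * sobolevSq k (v i)) :=
          add_le_add (eLpNorm_sq_add_le hf)
            (Finset.sum_le_sum fun i _ => ih (hu i).2.1.aestronglyMeasurable)
      _ = _ := by rw [Finset.sum_add_distrib, ← Finset.mul_sum, ← Finset.mul_sum]; ring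

lemma sobolevSq_smul (k : ℕ) {a : ℝ} (ha : a ≠ 0) (f : E3 → ℝ) :
    sobolevSq k (a • f) = ENNReal.ofReal (a ^ 2) * sobolevSq k f := by
  induction k generalizing f with
  | zero => exact eLpNorm_sq_smul a f
  | succ k ih =>
    by_cases h : ∃ u : Fin 3 → E3 → ℝ, ∀ i, HasWeakPartial i f (u i)
    · obtain ⟨u, hu⟩ := h
      rw [sobolevSq_succ_eq hu, sobolevSq_succ_eq fun i => (hu i).const_smul a, eLpNorm_sq_smul,
        mul_add, Finset.mul_sum]
      simp only [ih]
    · have h' : ¬ ∃ u : Fin 3 → E3 → ℝ, ∀ i, HasWeakPartial i (a • f) (u i) := by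
        rintro ⟨u, hu⟩
        refine h ⟨fun i => a⁻¹ • u i, fun i => ?_⟩
        have := (hu i).const_smul a⁻¹
        rwa [inv_smul_smul₀ ha] at this
      have t1 : sobolevSq (k + 1) f = ⊤ := by
        by_contra hc; exact h (exists_weakPartial (lt_top_iff_ne_top.2 hc))
      have t2 : sobolevSq (k + 1) (a • f) = ⊤ := by
        by_contra hc; exact h' (exists_weakPartial (lt_top_iff_ne_top.2 hc))
      rw [t1, t2, ENNReal.mul_top]
      simpa using by positivity

lemma sobolevSq_neg (k : ℕ) (f : E3 → ℝ) : sobolevSq k (-f) = sobolevSq k f := by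
  have := sobolevSq_smul k (a := -1) (by norm_num) f
  simpa using this

lemma sobolevSq_sub_le (k : ℕ) {f g : E3 → ℝ} (hf : AEStronglyMeasurable f volume) :
    sobolevSq k (f - g) ≤ 2 * sobolevSq k f + 2 * sobolevSq k g := by
  have := sobolevSq_add_le k (g := -g) hf
  rwa [sobolevSq_neg, ← sub_eq_add_neg] at this

lemma sobolevSq_triangle (k : ℕ) {f g h : E3 → ℝ} (hf : AEStronglyMeasurable f volume)
    (hg : AEStronglyMeasurable g volume) :
    sobolevSq k (f - h) ≤ 2 * sobolevSq k (f - g) + 2 * sobolevSq k (g - h) := by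
  have := sobolevSq_add_le k (f := f - g) (g := g - h) (hf.sub hg)
  rwa [sub_add_sub_cancel] at this

lemma sobolevSq_zero (k : ℕ) : sobolevSq k (0 : E3 → ℝ) = 0 := by
  induction k with
  | zero => simp [sobolevSq]
  | succ k ih =>
    have h : ∀ i, HasWeakPartial i (0 : E3 → ℝ) 0 := fun i =>
      ⟨locallyIntegrable_zero, locallyIntegrable_zero, fun η _ _ => by simp⟩
    rw [sobolevSq_succ_eq h]
    simp [ih]

lemma sobolevNorm_lt_top_iff {k : ℕ} {f : E3 → ℝ} : sobolevNorm k f < ⊤ ↔ sobolevSq k f < ⊤ := by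
  simp [sobolevNorm, lt_top_iff_ne_top]

lemma memH_iff {k : ℕ} {f : E3 → ℝ} :
    MemH k f ↔ AEStronglyMeasurable f volume ∧ sobolevSq k f < ⊤ := by
  rw [MemH, sobolevNorm_lt_top_iff]

lemma tendsto_sobolevNorm_iff {α : Type*} {l : Filter α} {k : ℕ} {f : α → E3 → ℝ} :
    Tendsto (fun a => sobolevNorm k (f a)) l (𝓝 0) ↔
      Tendsto (fun a => sobolevSq k (f a)) l (𝓝 0) := by
  constructor
  · intro h
    have := (ENNReal.continuous_rpow_const (y := 2)).tendsto 0 |>.comp h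
    simp only [Function.comp_def, sobolevNorm, ← ENNReal.rpow_mul] at this
    simpa using this
  · intro h
    have := (ENNReal.continuous_rpow_const (y := 1 / 2)).tendsto 0 |>.comp h
    simpa [Function.comp_def, sobolevNorm] using this

lemma MemH.sobolevSq_lt_top {k : ℕ} {f : E3 → ℝ} (h : MemH k f) : sobolevSq k f < ⊤ :=
  (memH_iff.1 h).2

lemma MemH.memLp {k : ℕ} {f : E3 → ℝ} (h : MemH k f) : MemLp f 2 volume := by
  refine ⟨h.1, ?_⟩
  have := (eLpNorm_sq_le_sobolevSq k f).trans_lt h.sobolevSq_lt_top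
  simpa using this

lemma MemH.add {k : ℕ} {f g : E3 → ℝ} (hf : MemH k f) (hg : MemH k g) : MemH k (f + g) := by
  rw [memH_iff] at *
  exact ⟨hf.1.add hg.1, (sobolevSq_add_le k hf.1).trans_lt
    (ENNReal.add_lt_top.2 ⟨ENNReal.mul_lt_top (by simp) hf.2, ENNReal.mul_lt_top (by simp) hg.2⟩)⟩

lemma MemH.neg {k : ℕ} {f : E3 → ℝ} (hf : MemH k f) : MemH k (-f) := by
  rw [memH_iff] at *
  exact ⟨hf.1.neg, by rw [sobolevSq_neg]; exact hf.2⟩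

lemma MemH.sub {k : ℕ} {f g : E3 → ℝ} (hf : MemH k f) (hg : MemH k g) : MemH k (f - g) := by
  rw [sub_eq_add_neg]; exact hf.add hg.neg

lemma MemH.exists_weakPartial {k : ℕ} {f : E3 → ℝ} (hf : MemH (k + 1) f) :
    ∃ g : Fin 3 → E3 → ℝ, (∀ i, HasWeakPartial i f (g i)) ∧ ∀ i, MemH k (g i) := by
  obtain ⟨g, hg⟩ := RadialWave.exists_weakPartial hf.sobolevSq_lt_top
  refine ⟨g, hg, fun i => memH_iff.2 ⟨(hg i).2.1.aestronglyMeasurable, ?_⟩⟩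
  have := hf.sobolevSq_lt_top
  rw [sobolevSq_succ_eq hg] at this
  exact (Finset.single_le_sum (f := fun i => sobolevSq k (g i)) (fun _ _ => bot_le)
    (Finset.mem_univ i)).trans_lt ((le_add_self).trans_lt this)

lemma sobolevSq_weakPartial_le {k : ℕ} {f : E3 → ℝ} {i : Fin 3} {g : E3 → ℝ}
    (h : HasWeakPartial i f g) : sobolevSq k g ≤ sobolevSq (k + 1) f := by
  by_cases hf : sobolevSq (k + 1) f < ⊤
  · obtain ⟨u, hu⟩ := exists_weakPartial hf
    rw [sobolevSq_succ_eq hu, sobolevSq_congr (h.unique (hu i) (EventuallyEq.refl _ _))]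
    exact (Finset.single_le_sum (f := fun i => sobolevSq k (u i)) (fun _ _ => bot_le)
      (Finset.mem_univ i)).trans le_add_self
  · rw [not_lt_top_iff.1 hf]; exact le_top

/-! ### Density of (radial) test functions in Sobolev spaces -/

/-- A smooth radial cutoff: `1` on the unit ball, `0` off the ball of radius `2`. -/
noncomputable def bump (x : E3) : ℝ := Real.smoothTransition (2 - ‖x‖ ^ 2)

lemma bump_smooth : ContDiff ℝ ∞ bump :=
  Real.smoothTransition.contDiff.comp (contDiff_const.sub (contDiff_norm_sq ℝ))

lemma bump_eq_one {x : E3} (h : ‖x‖ ≤ 1) : bump x = 1 :=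
  Real.smoothTransition.one_of_one_le (by nlinarith [norm_nonneg x])

lemma bump_eq_zero {x : E3} (h : 2 ≤ ‖x‖) : bump x = 0 :=
  Real.smoothTransition.zero_of_nonpos (by nlinarith [norm_nonneg x])

lemma bump_nonneg (x : E3) : 0 ≤ bump x := Real.smoothTransition.nonneg _

lemma bump_le_one (x : E3) : bump x ≤ 1 := Real.smoothTransition.le_one _

lemma bump_radial {x y : E3} (h : ‖x‖ = ‖y‖) : bump x = bump y := by simp [bump, h]

lemma bump_isTest : IsTest bump :=
  ⟨bump_smooth, HasCompactSupport.intro (isCompact_closedBall (0 : E3) 2) fun x hx =>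
    bump_eq_zero (by simpa using (not_le.1 fun h => hx (by simpa using h)).le)⟩

lemma IsTest.comp_smul {η : E3 → ℝ} (h : IsTest η) {a : ℝ} (ha : a ≠ 0) :
    IsTest fun x => η (a • x) :=
  ⟨h.smooth.comp (contDiff_const_smul a),
    h.compact.comp_homeomorph (Homeomorph.smulOfNeZero a ha)⟩

lemma pd_comp_smul {η : E3 → ℝ} (h : ContDiff ℝ ∞ η) (i : Fin 3) (a : ℝ) (x : E3) :
    pd i (fun x => η (a • x)) x = a * pd i η (a • x) := by
  have h1 : HasFDerivAt (fun x : E3 => a • x) (a • ContinuousLinearMap.id ℝ E3) x :=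
    (hasFDerivAt_id x).const_smul a
  have h2 := ((h.differentiable (by simp)) (a • x)).hasFDerivAt.comp x h1
  simp only [pd]
  rw [show (fun x => η (a • x)) = η ∘ fun x => a • x from rfl, h2.fderiv]
  simp

lemma IsTest.bounded {η : E3 → ℝ} (h : IsTest η) : ∃ C : ℝ, 0 ≤ C ∧ ∀ x, |η x| ≤ C := by
  obtain ⟨C, hC⟩ := h.compact.exists_bound_of_continuous h.continuous
  exact ⟨C, (norm_nonneg _).trans (hC 0), hC⟩

lemma sobolevSq_le_succ (k : ℕ) (f : E3 → ℝ) : sobolevSq k f ≤ sobolevSq (k + 1) f := by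
  induction k generalizing f with
  | zero => exact eLpNorm_sq_le_sobolevSq 1 f
  | succ k ih =>
    simp only [sobolevSq.eq_2]
    gcongr with i _ g _
    exact ih g

lemma eLpNorm_sq_mul_le {m f : E3 → ℝ} {C : ℝ} (hm : ∀ x, |m x| ≤ C) :
    eLpNorm (fun x => m x * f x) 2 volume ^ 2 ≤
      ENNReal.ofReal (C ^ 2) * eLpNorm f 2 volume ^ 2 := by
  simp only [eLpNorm_sq_eq]
  rw [← lintegral_const_mul' _ _ (by simp)]
  refine lintegral_mono fun x => ?_
  have : 0 ≤ C := (abs_nonneg _).trans (hm x)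
  simp only [enorm_sq_eq_ofReal, mul_pow]
  rw [← ENNReal.ofReal_mul (by positivity)]
  refine ENNReal.ofReal_le_ofReal (mul_le_mul_of_nonneg_right ?_ (sq_nonneg _))
  exact sq_le_sq.2 (by rw [abs_of_nonneg this]; exact hm x)

/-- Multiplication by dilates `m(a·)`, `a ≤ 1`, of a test function is bounded on `H^k`, uniformly
in `a`. -/
lemma exists_sobolevSq_mul_le (k : ℕ) {m : E3 → ℝ} (hm : IsTest m) :
    ∃ C : ENNReal, C ≠ ⊤ ∧ ∀ (a : ℝ), 0 < a → a ≤ 1 → ∀ f : E3 → ℝ, sobolevSq k f < ⊤ →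
      AEStronglyMeasurable f volume →
      sobolevSq k (fun x => m (a • x) * f x) ≤ C * sobolevSq k f := by
  induction k generalizing m with
  | zero =>
    obtain ⟨C, hC0, hC⟩ := hm.bounded
    exact ⟨ENNReal.ofReal (C ^ 2), by simp, fun a _ _ f _ _ => eLpNorm_sq_mul_le fun x => hC _⟩
  | succ k ih =>
    obtain ⟨C, hC0, hC⟩ := hm.bounded
    obtain ⟨C1, hC1, h1⟩ := ih hm
    choose C2 hC2 h2 using fun i => ih (hm.pd i)
    refine ⟨ENNReal.ofReal (C ^ 2) + ∑ i, (2 * C1 + 2 * C2 i), ?_, ?_⟩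
    · simp [ENNReal.add_eq_top, ENNReal.mul_eq_top, hC1, hC2]
    intro a ha ha1 f hf hfm
    obtain ⟨g, hg⟩ := exists_weakPartial hf
    have hgk : ∀ i, sobolevSq k (g i) ≤ sobolevSq (k + 1) f := fun i =>
      sobolevSq_weakPartial_le (hg i)
    have hma := hm.comp_smul ha.ne'
    rw [sobolevSq_succ_eq fun i => (hg i).smooth_mul hma.smooth, add_mul, Finset.sum_mul]
    refine add_le_add ?_ (Finset.sum_le_sum fun i _ => ?_)
    · refine (eLpNorm_sq_mul_le fun x => hC _).trans ?_
      gcongr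
      exact eLpNorm_sq_le_sobolevSq _ _
    · have e : (fun x => m (a • x) * g i x + pd i (fun x => m (a • x)) x * f x) =
          (fun x => m (a • x) * g i x) + a • (fun x => pd i m (a • x) * f x) := by
        funext x
        simp only [Pi.add_apply, Pi.smul_apply, smul_eq_mul, pd_comp_smul hm.smooth]
        ring
      rw [e]
      refine (sobolevSq_add_le k
        (hma.continuous.aestronglyMeasurable.mul (hg i).2.1.aestronglyMeasurable)).trans ?_
      rw [sobolevSq_smul k ha.ne', add_mul]
      refine add_le_add ?_ ?_
      · rw [mul_assoc]
        refine mul_le_mul_right ?_ 2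
        exact (h1 a ha ha1 _ ((hgk i).trans_lt hf) (hg i).2.1.aestronglyMeasurable).trans
          (mul_le_mul_right (hgk i) _)
      · rw [mul_assoc]
        refine mul_le_mul_right ?_ 2
        have : ENNReal.ofReal (a ^ 2) ≤ 1 := by
          rw [← ENNReal.ofReal_one]
          exact ENNReal.ofReal_le_ofReal (by nlinarith)
        calc _ ≤ 1 * sobolevSq k (fun x => pd i m (a • x) * f x) := by gcongr
          _ ≤ C2 i * sobolevSq k f := by
            rw [one_mul]
            exact h2 i a ha ha1 f ((sobolevSq_le_succ k f).trans_lt hf) hfm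
          _ ≤ _ := mul_le_mul_right (sobolevSq_le_succ k f) _

/-- The dilated cutoff `bump (x / (n + 1))`. -/
noncomputable def cut (n : ℕ) (x : E3) : ℝ := bump ((1 / ((n : ℝ) + 1)) • x)

lemma cut_isTest (n : ℕ) : IsTest (cut n) := bump_isTest.comp_smul (by positivity)

lemma tendsto_eLpNorm_sub_cut {f : E3 → ℝ} (hf : MemLp f 2 volume) :
    Tendsto (fun n => eLpNorm (f - fun x => cut n x * f x) 2 volume ^ 2) atTop (𝓝 0) := by
  simp only [eLpNorm_sq_eq]
  have hfin : ∫⁻ x, ‖f x‖ₑ ^ 2 ≠ ⊤ := by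
    rw [← eLpNorm_sq_eq]
    exact ENNReal.pow_ne_top hf.2.ne
  rw [show (0 : ENNReal) = ∫⁻ _ : E3, 0 by simp]
  refine tendsto_lintegral_of_dominated_convergence' (fun x => ‖f x‖ₑ ^ 2) (fun n => ?_)
    (fun n => Eventually.of_forall fun x => ?_) hfin (Eventually.of_forall fun x => ?_)
  · exact ((hf.1.sub ((cut_isTest n).continuous.aestronglyMeasurable.mul hf.1)).enorm).pow_const 2
  · simp only [Pi.sub_apply, enorm_sq_eq_ofReal]
    refine ENNReal.ofReal_le_ofReal ?_
    have h0 := bump_nonneg ((1 / ((n : ℝ) + 1)) • x)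
    have h1 := bump_le_one ((1 / ((n : ℝ) + 1)) • x)
    rw [show f x - cut n x * f x = (1 - cut n x) * f x by ring, mul_pow]
    have : (1 - cut n x) ^ 2 ≤ 1 := by
      unfold cut; nlinarith
    nlinarith [sq_nonneg (f x)]
  · refine tendsto_const_nhds.congr' ?_
    obtain ⟨N, hN⟩ := exists_nat_gt ‖x‖
    filter_upwards [eventually_ge_atTop N] with n hn
    have : cut n x = 1 := by
      refine bump_eq_one ?_
      rw [norm_smul, Real.norm_of_nonneg (by positivity), one_div, inv_mul_le_iff₀ (by positivity)]
      have : (N : ℝ) ≤ n := by exact_mod_cast hn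
      linarith
    simp [this]

lemma tendsto_sobolevSq_sub_cut (k : ℕ) {f : E3 → ℝ} (hf : MemH k f) :
    Tendsto (fun n => sobolevSq k (f - fun x => cut n x * f x)) atTop (𝓝 0) := by
  induction k generalizing f with
  | zero => exact tendsto_eLpNorm_sub_cut hf.memLp
  | succ k ih =>
    obtain ⟨g, hg, hgk⟩ := hf.exists_weakPartial
    choose C hC hCb using fun i => exists_sobolevSq_mul_le k (bump_isTest.pd i)
    have hfk : sobolevSq k f < ⊤ := (sobolevSq_le_succ k f).trans_lt hf.sobolevSq_lt_top
    have hw : ∀ n i, HasWeakPartial i (f - fun x => cut n x * f x)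
        (g i - fun x => cut n x * g i x + pd i (cut n) x * f x) := fun n i =>
      (hg i).sub ((hg i).smooth_mul (cut_isTest n).smooth)
    have hle : ∀ n, sobolevSq (k + 1) (f - fun x => cut n x * f x) ≤
        eLpNorm (f - fun x => cut n x * f x) 2 volume ^ 2 +
        ∑ i, (2 * sobolevSq k (g i - fun x => cut n x * g i x) +
          2 * (ENNReal.ofReal ((1 / ((n : ℝ) + 1)) ^ 2) * (C i * sobolevSq k f))) := by
      intro n
      rw [sobolevSq_succ_eq (hw n)]
      gcongr with i
      have ha : (0 : ℝ) < 1 / ((n : ℝ) + 1) := by positivity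
      have e : (g i - fun x => cut n x * g i x + pd i (cut n) x * f x) =
          (g i - fun x => cut n x * g i x) -
            (1 / ((n : ℝ) + 1)) • (fun x => pd i bump ((1 / ((n : ℝ) + 1)) • x) * f x) := by
        funext x
        have : pd i (cut n) x = (1 / ((n : ℝ) + 1)) * pd i bump ((1 / ((n : ℝ) + 1)) • x) :=
          pd_comp_smul bump_smooth i _ x
        simp only [Pi.sub_apply, Pi.smul_apply, smul_eq_mul, this]
        ring
      rw [e]
      refine (sobolevSq_sub_le k ((hgk i).1.sub
        ((cut_isTest n).continuous.aestronglyMeasurable.mul (hgk i).1))).trans ?_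
      rw [sobolevSq_smul k ha.ne']
      refine add_le_add_right (mul_le_mul_right (mul_le_mul_right ?_ _) _) _
      refine hCb i _ ha ?_ f hfk hf.1
      rw [div_le_one (by positivity)]
      linarith [(Nat.cast_nonneg n : (0 : ℝ) ≤ n)]
    refine tendsto_of_tendsto_of_tendsto_of_le_of_le tendsto_const_nhds ?_ (fun _ => bot_le) hle
    have hlim : Tendsto (fun n : ℕ => ENNReal.ofReal ((1 / ((n : ℝ) + 1)) ^ 2)) atTop (𝓝 0) := by
      have := (tendsto_one_div_add_atTop_nhds_zero_nat (𝕜 := ℝ)).pow 2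
      simpa using ENNReal.tendsto_ofReal this
    have : Tendsto (fun n => eLpNorm (f - fun x => cut n x * f x) 2 volume ^ 2 +
        ∑ i, (2 * sobolevSq k (g i - fun x => cut n x * g i x) +
          2 * (ENNReal.ofReal ((1 / ((n : ℝ) + 1)) ^ 2) * (C i * sobolevSq k f)))) atTop
        (𝓝 (0 + ∑ i : Fin 3, (2 * 0 + 2 * (0 * (C i * sobolevSq k f))))) := by
      refine (tendsto_eLpNorm_sub_cut hf.memLp).add (tendsto_finsetSum _ fun i _ => ?_)
      refine (ENNReal.Tendsto.const_mul (ih (hgk i)) (Or.inr (by simp))).add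
        (ENNReal.Tendsto.const_mul (ENNReal.Tendsto.mul_const hlim (Or.inr ?_)) (Or.inr (by simp)))
      exact ENNReal.mul_ne_top (hC i) hfk.ne
    simpa using this

/-- The mollification `f * b`. -/
noncomputable def mollify (b f : E3 → ℝ) : E3 → ℝ :=
  convolution f b (ContinuousLinearMap.mul ℝ ℝ) volume

lemma mollify_apply (b f : E3 → ℝ) (x : E3) : mollify b f x = ∫ t, f t * b (x - t) := rfl

lemma mollify_contDiff {b f : E3 → ℝ} (hb : IsTest b) (hf : LocallyIntegrable f volume) :
    ContDiff ℝ ∞ (mollify b f) :=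
  hb.compact.contDiff_convolution_right _ hf hb.smooth

lemma mollify_isTest {b f : E3 → ℝ} (hb : IsTest b) (hf : LocallyIntegrable f volume)
    (hc : HasCompactSupport f) : IsTest (mollify b f) :=
  ⟨mollify_contDiff hb hf, HasCompactSupport.convolution _ hc hb.compact⟩

lemma pd_mollify {b f g : E3 → ℝ} {i : Fin 3} (hb : IsTest b) (hf : HasWeakPartial i f g) :
    pd i (mollify b f) = mollify b g := by
  funext x
  have h := hb.compact.hasFDerivAt_convolution_right (ContinuousLinearMap.mul ℝ ℝ) hf.1
    (hb.smooth.of_le (by simp)) x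
  have h1 : pd i (mollify b f) x = ∫ t, f t * pd i b (x - t) := by
    simp only [pd]
    rw [show mollify b f = convolution f b (ContinuousLinearMap.mul ℝ ℝ) volume from rfl, h.fderiv]
    have hc : Continuous (fderiv ℝ b) := hb.smooth.continuous_fderiv (by simp)
    have hex : ConvolutionExists f (fderiv ℝ b)
      ((ContinuousLinearMap.mul ℝ ℝ).precompR E3) volume :=
      (hb.compact.fderiv ℝ).convolutionExists_right _ hf.1 hc
    rw [convolution, ContinuousLinearMap.integral_apply (hex x)]
    rfl
  rw [h1, mollify_apply]
  have ht : IsTest fun t => b (x - t) :=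
    ⟨hb.smooth.comp (contDiff_const.sub contDiff_id),
      hb.compact.comp_homeomorph (Homeomorph.subLeft x)⟩
  have hp : ∀ t, fderiv ℝ (fun t => b (x - t)) t (EuclideanSpace.single i 1) =
      - pd i b (x - t) := by
    intro t
    have h1 : HasFDerivAt (fun t : E3 => x - t) (-ContinuousLinearMap.id ℝ E3) t :=
      (hasFDerivAt_id t).const_sub x
    have h2 := ((hb.smooth.differentiable (by simp)) (x - t)).hasFDerivAt.comp t h1
    rw [show (fun t => b (x - t)) = b ∘ fun t => x - t from rfl, h2.fderiv]
    simp [pd]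
  have := hf.2.2 _ ht.smooth ht.compact
  simp only [hp, mul_neg, integral_neg, neg_inj] at this
  exact this

lemma hasWeakPartial_mollify {b f g : E3 → ℝ} {i : Fin 3} (hb : IsTest b)
    (hf : HasWeakPartial i f g) : HasWeakPartial i (mollify b f) (mollify b g) := by
  have := hasWeakPartial_of_contDiff (mollify_contDiff hb hf.1) i
  rwa [pd_mollify hb hf] at this

lemma mollify_congr {b f g : E3 → ℝ} (h : f =ᵐ[volume] g) : mollify b f = mollify b g := by
  funext x
  exact integral_congr_ae (by filter_upwards [h] with t ht; rw [ht])

/-- Continuity of translations in `L²`. -/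
lemma tendsto_eLpNorm_sub_translate {f : E3 → ℝ} (hf : MemLp f 2 volume) :
    Tendsto (fun t : E3 => eLpNorm (fun x => f x - f (x - t)) 2 volume) (𝓝 0) (𝓝 0) := by
  have : Fact ((1 : ENNReal) ≤ 2) := ⟨by norm_num⟩
  let g : E3 → C(E3, E3) := fun t => ⟨fun x => x - t, by fun_prop⟩
  have hg : Continuous g := by
    refine ContinuousMap.continuous_of_continuous_uncurry _ ?_
    exact (continuous_snd.sub continuous_fst)
  have hgm : ∀ t, MeasurePreserving (g t) (volume : Measure E3) volume := fun t =>
    measurePreserving_sub_right volume t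
  have hc := Continuous.compMeasurePreservingLp (f := fun _ : E3 => hf.toLp f) continuous_const hg
    hgm (by simp)
  have h2 := (((continuous_const (y := hf.toLp f)).sub hc).norm).tendsto 0
  have h3 := ENNReal.tendsto_ofReal h2
  have e : ∀ t, ENNReal.ofReal ‖hf.toLp f - Lp.compMeasurePreserving (g t) (hgm t) (hf.toLp f)‖ =
      eLpNorm (fun x => f x - f (x - t)) 2 volume := by
    intro t
    rw [ofReal_norm, Lp.enorm_def]
    refine eLpNorm_congr_ae ?_
    have a1 := Lp.coeFn_sub (hf.toLp f) (Lp.compMeasurePreserving (g t) (hgm t) (hf.toLp f))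
    have a2 := hf.coeFn_toLp
    have a3 := Lp.coeFn_compMeasurePreserving (hf.toLp f) (hgm t)
    have a4 := (hgm t).quasiMeasurePreserving.ae_eq_comp a2
    filter_upwards [a1, a2, a3, a4] with x b1 b2 b3 b4
    rw [b1, Pi.sub_apply, b2, b3, b4]
    rfl
  simpa [Function.comp_def, e] using h3

/-- If `b ≥ 0` has integral one, `‖f - f * b‖²` is at most the `b`-average of
`‖f - f(· - t)‖²` (Jensen and Tonelli). -/
lemma eLpNorm_sub_mollify_sq_le {b f : E3 → ℝ} (hb : IsTest b) (hb0 : ∀ x, 0 ≤ b x)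
    (hb1 : ∫ x, b x = 1) (hf : MemLp f 2 volume) :
    eLpNorm (f - mollify b f) 2 volume ^ 2 ≤
      ∫⁻ t, ENNReal.ofReal (b t) * eLpNorm (fun x => f x - f (x - t)) 2 volume ^ 2 := by
  wlog hm : StronglyMeasurable f generalizing f
  · have hae := hf.1.ae_eq_mk
    have h := this (f := hf.1.mk f) ((memLp_congr_ae hae).1 hf) hf.1.stronglyMeasurable_mk
    have e1 : f - mollify b f =ᵐ[volume] hf.1.mk f - mollify b (hf.1.mk f) := by
      rw [← mollify_congr hae]
      filter_upwards [hae] with x hx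
      simp [hx]
    rw [eLpNorm_congr_ae e1]
    refine h.trans (le_of_eq (lintegral_congr fun t => ?_))
    have e2 : (fun x => hf.1.mk f x - hf.1.mk f (x - t)) =ᵐ[volume] fun x => f x - f (x - t) := by
      have := (measurePreserving_sub_right
        (volume : Measure E3) t).quasiMeasurePreserving.ae_eq_comp hae
      filter_upwards [hae, this] with x h1 h2
      simp only [Function.comp_def] at h2
      rw [h1, h2]
    rw [eLpNorm_congr_ae e2]
  have hfl : LocallyIntegrable f volume := hf.locallyIntegrable (by norm_num)
  have hcb := hb.continuous
  have hpt : ∀ x, ‖(f - mollify b f) x‖ₑ ^ 2 ≤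
      ∫⁻ t, ENNReal.ofReal (b t) * ‖f x - f (x - t)‖ₑ ^ 2 := by
    intro x
    have hi : Integrable (fun t => f (x - t) * b t) volume := by
      have h1 := hb.compact.convolutionExists_right (ContinuousLinearMap.mul ℝ ℝ) hfl hcb x
      exact h1.integrable_swap
    have e : (f - mollify b f) x = ∫ t, b t * (f x - f (x - t)) := by
      have e1 : mollify b f x = ∫ t, f (x - t) * b t := by
        rw [mollify_apply, ← integral_sub_left_eq_self _ volume x]
        simp
      have e2 : ∫ t, b t * (f x - f (x - t)) = ∫ t, (b t * f x - f (x - t) * b t) :=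
        integral_congr_ae (Eventually.of_forall fun t => by simp only; ring)
      rw [e2, integral_sub ((hcb.integrable_of_hasCompactSupport hb.compact).mul_const _) hi,
        integral_mul_const, hb1, Pi.sub_apply, e1, one_mul]
    set B : E3 → ENNReal := fun t => ENNReal.ofReal (b t) ^ (1 / 2 : ℝ) with hB
    set A : E3 → ENNReal := fun t => ENNReal.ofReal (b t) ^ (1 / 2 : ℝ) * ‖f x - f (x - t)‖ₑ
      with hA
    have hBm : AEMeasurable B volume :=
      (hcb.measurable.ennreal_ofReal.pow_const _).aemeasurable
    have hAm : AEMeasurable A volume := by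
      refine hBm.mul ?_
      have : Measurable fun t => f x - f (x - t) :=
        measurable_const.sub (hm.measurable.comp (measurable_const.sub measurable_id))
      exact this.enorm.aemeasurable
    have hBB : ∀ t, B t * B t = ENNReal.ofReal (b t) := by
      intro t
      simp only [hB]
      rw [← ENNReal.rpow_add_of_nonneg _ _ (by norm_num) (by norm_num)]
      norm_num
    have h1 : ‖(f - mollify b f) x‖ₑ ≤ ∫⁻ t, (B * A) t := by
      rw [e]
      refine (enorm_integral_le_lintegral_enorm _).trans (le_of_eq (lintegral_congr fun t => ?_))
      rw [enorm_mul, Real.enorm_of_nonneg (hb0 t), Pi.mul_apply, ← hBB t, mul_assoc]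
    have h2 := ENNReal.lintegral_mul_le_Lp_mul_Lq (volume : Measure E3)
      Real.HolderConjugate.two_two hBm hAm
    have h3 : ∫⁻ t, B t ^ (2 : ℝ) = 1 := by
      rw [← ENNReal.ofReal_one, ← hb1, ofReal_integral_eq_lintegral_ofReal
        (hcb.integrable_of_hasCompactSupport hb.compact) (Eventually.of_forall hb0)]
      refine lintegral_congr fun t => ?_
      rw [ENNReal.rpow_two, sq, hBB]
    rw [h3, ENNReal.one_rpow, one_mul] at h2
    calc ‖(f - mollify b f) x‖ₑ ^ 2 ≤ ((∫⁻ t, A t ^ (2 : ℝ)) ^ (1 / 2 : ℝ)) ^ 2 := by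
          gcongr; exact h1.trans h2
      _ = ∫⁻ t, A t ^ (2 : ℝ) := by
          rw [← ENNReal.rpow_two, ← ENNReal.rpow_mul]; norm_num
      _ = _ := lintegral_congr fun t => by
          simp only [hA]
          rw [ENNReal.rpow_two, mul_pow, sq (_ ^ _), hBB]
  rw [eLpNorm_sq_eq]
  refine (lintegral_mono hpt).trans ?_
  rw [lintegral_lintegral_swap]
  · refine le_of_eq (lintegral_congr fun t => ?_)
    rw [lintegral_const_mul' _ _ (by simp), eLpNorm_sq_eq]
  · have hmeas : Measurable fun p : E3 × E3 => f p.1 - f (p.1 - p.2) :=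
      (hm.measurable.comp measurable_fst).sub
        (hm.measurable.comp (measurable_fst.sub measurable_snd))
    exact ((hcb.measurable.ennreal_ofReal.comp measurable_snd).mul
      (hmeas.enorm.pow_const 2)).aemeasurable

/-- A radial probability density supported in the ball of radius `2 / (n + 1)`. -/
noncomputable def moll (n : ℕ) (x : E3) : ℝ :=
  (∫ y, bump (((n : ℝ) + 1) • y))⁻¹ * bump (((n : ℝ) + 1) • x)

lemma integral_bump_smul_pos (n : ℕ) : 0 < ∫ y, bump (((n : ℝ) + 1) • y) := by
  have t := bump_isTest.comp_smul (a := (n : ℝ) + 1) (by positivity)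
  refine t.continuous.integral_pos_of_hasCompactSupport_nonneg_nonzero t.compact
    (fun x => bump_nonneg _) (x := 0) ?_
  rw [smul_zero, bump_eq_one (by simp)]
  norm_num

lemma moll_isTest (n : ℕ) : IsTest (moll n) := by
  have t := bump_isTest.comp_smul (a := (n : ℝ) + 1) (by positivity)
  exact t.mul_left contDiff_const

lemma moll_nonneg (n : ℕ) (x : E3) : 0 ≤ moll n x :=
  mul_nonneg (inv_nonneg.2 (integral_bump_smul_pos n).le) (bump_nonneg _)

lemma integral_moll (n : ℕ) : ∫ x, moll n x = 1 := by
  simp only [moll]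
  rw [integral_const_mul, inv_mul_cancel₀ (integral_bump_smul_pos n).ne']

lemma moll_eq_zero (n : ℕ) {x : E3} (h : 2 / ((n : ℝ) + 1) ≤ ‖x‖) : moll n x = 0 := by
  rw [moll, bump_eq_zero, mul_zero]
  rw [norm_smul, Real.norm_of_nonneg (by positivity)]
  rwa [div_le_iff₀' (by positivity)] at h

lemma moll_radial (n : ℕ) {x y : E3} (h : ‖x‖ = ‖y‖) : moll n x = moll n y := by
  rw [moll, moll, bump_radial]
  rw [norm_smul, norm_smul, h]

lemma tendsto_sobolevSq_sub_mollify (k : ℕ) {f : E3 → ℝ} (hf : MemH k f) :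
    Tendsto (fun n => sobolevSq k (f - mollify (moll n) f)) atTop (𝓝 0) := by
  have base : ∀ {f : E3 → ℝ}, MemLp f 2 volume →
      Tendsto (fun n => eLpNorm (f - mollify (moll n) f) 2 volume ^ 2) atTop (𝓝 0) := by
    intro f hf
    rw [ENNReal.tendsto_atTop_zero]
    intro η hη
    have h1 : Tendsto (fun t : E3 => eLpNorm (fun x => f x - f (x - t)) 2 volume ^ 2) (𝓝 0)
        (𝓝 0) := by
      have := ((ENNReal.continuous_pow 2).tendsto 0).comp (tendsto_eLpNorm_sub_translate hf)
      simpa [Function.comp_def] using this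
    have h2 := h1.eventually (ge_mem_nhds hη)
    obtain ⟨δ, hδ, h3⟩ := Metric.eventually_nhds_iff.1 h2
    obtain ⟨N, hN⟩ := exists_nat_gt (2 / δ)
    refine ⟨N, fun n hn => ?_⟩
    refine (eLpNorm_sub_mollify_sq_le (moll_isTest n) (moll_nonneg n) (integral_moll n) hf).trans ?_
    have hNn : (N : ℝ) ≤ n := by exact_mod_cast hn
    calc _ ≤ ∫⁻ t, ENNReal.ofReal (moll n t) * η := by
          refine lintegral_mono fun t => ?_
          rcases lt_or_ge ‖t‖ δ with h | h
          · have := h3 (y := t) (by simpa using h)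
            simp only
            gcongr
          · rw [moll_eq_zero]
            · simp
            · refine le_trans ?_ h
              rw [div_lt_iff₀ hδ] at hN
              rw [div_le_iff₀ (by positivity)]
              nlinarith
      _ = η := by
          rw [lintegral_mul_const'' _
            (moll_isTest n).continuous.measurable.ennreal_ofReal.aemeasurable,
            ← ofReal_integral_eq_lintegral_ofReal
            ((moll_isTest n).continuous.integrable_of_hasCompactSupport (moll_isTest n).compact)
            (Eventually.of_forall (moll_nonneg n)), integral_moll]
          simp
  induction k generalizing f with
  | zero => exact base hf.memLp
  | succ k ih =>
    obtain ⟨g, hg, hgk⟩ := hf.exists_weakPartial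
    have e : ∀ n, sobolevSq (k + 1) (f - mollify (moll n) f) =
        eLpNorm (f - mollify (moll n) f) 2 volume ^ 2 +
          ∑ i, sobolevSq k (g i - mollify (moll n) (g i)) := fun n =>
      sobolevSq_succ_eq fun i => (hg i).sub (hasWeakPartial_mollify (moll_isTest n) (hg i))
    simp only [e]
    simpa using (base hf.memLp).add (tendsto_finsetSum Finset.univ fun i _ => ih (hgk i))

/-- Mollifying a radial function with a radial kernel gives a radial function. -/
lemma mollify_radial {b f : E3 → ℝ} (hb : ∀ x y, ‖x‖ = ‖y‖ → b x = b y) (hf : IsRadialAE f)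
    {x y : E3} (h : ‖x‖ = ‖y‖) : mollify b f x = mollify b f y := by
  obtain ⟨φ, hφ⟩ := hf
  have hφ' : f =ᵐ[volume] fun x => φ ‖x‖ := hφ
  rw [mollify_congr hφ']
  set Q : E3 ≃ₗᵢ[ℝ] E3 := (Submodule.span ℝ {x - y})ᗮ.reflection with hQ
  have hQx : Q x = y := Submodule.reflection_sub h
  have mp : MeasurePreserving Q (volume : Measure E3) volume := Q.measurePreserving
  rw [mollify_apply, mollify_apply, ← hQx,
    ← mp.integral_comp Q.toHomeomorph.measurableEmbedding fun t => φ ‖t‖ * b (Q x - t)]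
  refine integral_congr_ae (Eventually.of_forall fun t => ?_)
  simp only
  rw [Q.norm_map, ← map_sub, hb (Q (x - t)) (x - t) (Q.norm_map _)]

lemma norm_e₁ : ‖e₁‖ = 1 := by simp [e₁]

lemma isRadial_of_forall {f : E3 → ℝ} (h : ∀ x y, ‖x‖ = ‖y‖ → f x = f y) :
    ∃ φ : ℝ → ℝ, ∀ x, f x = φ ‖x‖ :=
  ⟨fun r => f (r • e₁), fun x => h _ _ (by simp [norm_smul, norm_e₁])⟩

/-- Test functions are dense in `H^k`, and radial functions are approximated by radial test
functions. -/
lemma exists_test_sobolevSq_sub_lt (k : ℕ) {f : E3 → ℝ} (hf : MemH k f) {η : ENNReal}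
    (hη : 0 < η) : ∃ g, IsTest g ∧ sobolevSq k (f - g) < η ∧ (IsRadialAE f → IsSmoothRadial g) := by
  have hη4 : 0 < η / 4 := ENNReal.div_pos hη.ne' (by simp)
  obtain ⟨n, hn⟩ := ((tendsto_sobolevSq_sub_cut k hf).eventually (gt_mem_nhds hη4)).exists
  set f' : E3 → ℝ := fun x => cut n x * f x with hf'
  have hmem : MemH k f' := by
    have hfm : AEStronglyMeasurable f' volume :=
      (cut_isTest n).continuous.aestronglyMeasurable.mul hf.1
    have h1 : MemH k (f - f') := memH_iff.2 ⟨hf.1.sub hfm, hn.trans_le le_top⟩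
    simpa using hf.sub h1
  have hloc : LocallyIntegrable f' volume := hmem.memLp.locallyIntegrable (by norm_num)
  obtain ⟨m, hm⟩ := ((tendsto_sobolevSq_sub_mollify k hmem).eventually (gt_mem_nhds hη4)).exists
  have htest : IsTest (mollify (moll m) f') :=
    mollify_isTest (moll_isTest m) hloc (cut_isTest n).compact.mul_right
  refine ⟨_, htest, ?_, fun hr => ⟨htest.smooth, htest.compact, ?_⟩⟩
  · refine (sobolevSq_triangle k hf.1 hmem.1).trans_lt ?_
    calc _ < 2 * (η / 4) + 2 * (η / 4) :=
          ENNReal.add_lt_add ((ENNReal.mul_lt_mul_iff_right (by simp) (by simp)).2 hn)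
            ((ENNReal.mul_lt_mul_iff_right (by simp) (by simp)).2 hm)
      _ = 4 * (η / 4) := by ring
      _ = η := ENNReal.mul_div_cancel (by simp) (by simp)
  · refine isRadial_of_forall fun x y h => mollify_radial (fun x y h => moll_radial m h) ?_ h
    obtain ⟨φ, hφ⟩ := hr
    refine ⟨fun r => cut n (r • e₁) * φ r, ?_⟩
    filter_upwards [hφ] with z hz
    simp only [hf', hz]
    congr 1
    exact bump_radial (by simp [norm_smul, norm_e₁])

/-! ### Conservation of energy in a Hilbert space -/

open scoped InnerProductSpace in
/-- The energy identity for `C¹` curves `w` with time derivative `v`, defined on all of `ℝ`.  The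
relation `hrel` is the wave equation `v' = c² Δw` integrated over `[s, t]` and tested with
increments of `w`; `g i` stands for `∂ᵢ w`.  Only time averages over `[t, t + h]` are
differentiated, so that no second time derivative of `w` is needed. -/
lemma energy_of_hasDerivAt {H : Type*} [NormedAddCommGroup H] [InnerProductSpace ℝ H]
    [CompleteSpace H] {c T : ℝ} {w v : ℝ → H} {g : Fin 3 → ℝ → H}
    (hv : Continuous v) (hg : ∀ i, Continuous (g i)) (hw : ∀ t, HasDerivAt w (v t) t)
    (hrel : ∀ s ∈ Set.Icc 0 T, ∀ t ∈ Set.Icc 0 T,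
      ⟪v t - v s, w t - w s⟫_ℝ = -c ^ 2 * ∑ i, ⟪∫ τ in s..t, g i τ, g i t - g i s⟫_ℝ)
    {t : ℝ} (ht : t ∈ Set.Icc 0 T) :
    ‖v t‖ ^ 2 + c ^ 2 * ∑ i, ‖g i t‖ ^ 2 = ‖v 0‖ ^ 2 + c ^ 2 * ∑ i, ‖g i 0‖ ^ 2 := by
  have hwc : Continuous w := continuous_iff_continuousAt.2 fun t => (hw t).continuousAt
  set P : Fin 3 → ℝ → H := fun i t => ∫ τ in (0 : ℝ)..t, g i τ with hP
  have hPd : ∀ i t, HasDerivAt (P i) (g i t) t := fun i t =>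
    intervalIntegral.integral_hasDerivAt_right ((hg i).intervalIntegrable _ _)
      (hg i).stronglyMeasurable.stronglyMeasurableAtFilter (hg i).continuousAt
  have hPs : ∀ i s t, ∫ τ in s..t, g i τ = P i t - P i s := fun i s t =>
    (intervalIntegral.integral_interval_sub_left ((hg i).intervalIntegrable _ _)
      ((hg i).intervalIntegrable _ _)).symm
  set E : ℝ → ℝ → ℝ := fun h t =>
    ‖w (t + h) - w t‖ ^ 2 + c ^ 2 * ∑ i, ‖P i (t + h) - P i t‖ ^ 2 with hE
  have hEd : ∀ h t, 0 ≤ t → 0 ≤ h → t + h ≤ T → HasDerivAt (E h) 0 t := by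
    intro h t h0 hh h1
    have a1 : ∀ {f : ℝ → H} {f' : ℝ → H}, (∀ t, HasDerivAt f (f' t) t) →
        HasDerivAt (fun t => ‖f (t + h) - f t‖ ^ 2)
          (2 * ⟪f (t + h) - f t, f' (t + h) - f' t⟫_ℝ) t := by
      intro f f' hf
      exact (((hf (t + h)).comp_add_const t h).sub (hf t)).norm_sq
    have a2 := (a1 hw).add ((HasDerivAt.fun_sum fun i (_ : i ∈ Finset.univ) =>
      a1 (hPd i)).const_mul (c ^ 2))
    have := hrel t ⟨h0, by linarith⟩ (t + h) ⟨by linarith, h1⟩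
    simp only [hPs] at this
    rw [real_inner_comm] at this
    rw [this, ← Finset.mul_sum, show ∀ a : ℝ, 2 * (-c ^ 2 * a) + c ^ 2 * (2 * a) = 0 by
      intro a; ring] at a2
    exact a2
  have hconst : ∀ h t, 0 ≤ t → 0 ≤ h → t + h ≤ T → E h t = E h 0 := by
    intro h t h0 hh h1
    refine constant_of_has_deriv_right_zero (a := 0) (b := t) (f := E h) ?_ ?_ t ⟨h0, le_rfl⟩
    · intro s hs
      exact (hEd h s hs.1 hh (by linarith [hs.2])).continuousAt.continuousWithinAt
    · intro s hs
      exact (hEd h s hs.1 hh (by linarith [hs.2])).hasDerivWithinAt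
  have hlim : ∀ t, Tendsto (fun h => (h⁻¹) ^ 2 * E h t) (𝓝[>] 0)
      (𝓝 (‖v t‖ ^ 2 + c ^ 2 * ∑ i, ‖g i t‖ ^ 2)) := by
    intro t
    have b1 : ∀ {f : ℝ → H} {f' : H}, HasDerivAt f f' t →
        Tendsto (fun h => ‖h⁻¹ • (f (t + h) - f t)‖ ^ 2) (𝓝[>] 0) (𝓝 (‖f'‖ ^ 2)) := by
      intro f f' hf
      exact ((hf.tendsto_slope_zero_right).norm).pow 2
    have b2 := (b1 (hw t)).add ((tendsto_finsetSum Finset.univ fun i _ =>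
      b1 (hPd i t)).const_mul (c ^ 2))
    refine b2.congr fun h => ?_
    simp only [hE, norm_smul, mul_pow, norm_inv, Real.norm_eq_abs, ← Finset.mul_sum, inv_pow,
      sq_abs]
    ring
  have hlt : ∀ t, 0 ≤ t → t < T →
      ‖v t‖ ^ 2 + c ^ 2 * ∑ i, ‖g i t‖ ^ 2 = ‖v 0‖ ^ 2 + c ^ 2 * ∑ i, ‖g i 0‖ ^ 2 := by
    intro t h0 h1
    refine tendsto_nhds_unique ((hlim t).congr' ?_) (hlim 0)
    have : Set.Ioo (0 : ℝ) (T - t) ∈ 𝓝[>] (0 : ℝ) := Ioo_mem_nhdsGT (by linarith)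
    filter_upwards [this] with h hh
    rw [hconst h t h0 hh.1.le (by linarith [hh.2])]
  rcases ht.2.lt_or_eq with h | h
  · exact hlt t ht.1 h
  rcases ht.1.eq_or_lt with h0 | h0
  · rw [← h0]
  have hcl : t ∈ closure (Set.Ico 0 t) := by
    rw [closure_Ico h0.ne]; exact ⟨h0.le, le_rfl⟩
  have hc1 : Continuous fun t => ‖v t‖ ^ 2 + c ^ 2 * ∑ i, ‖g i t‖ ^ 2 := by fun_prop
  have : Set.Ico 0 t ⊆ {t | ‖v t‖ ^ 2 + c ^ 2 * ∑ i, ‖g i t‖ ^ 2 =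
      ‖v 0‖ ^ 2 + c ^ 2 * ∑ i, ‖g i 0‖ ^ 2} := fun s hs => hlt s hs.1 (by rw [← h]; exact hs.2)
  exact (closure_minimal this (isClosed_eq hc1 continuous_const)) hcl

open scoped InnerProductSpace in
lemma energy_of_hasDerivWithinAt {H : Type*} [NormedAddCommGroup H] [InnerProductSpace ℝ H]
    [CompleteSpace H] {c T : ℝ} (hT : 0 < T) {w v : ℝ → H} {g : Fin 3 → ℝ → H}
    (hv : ContinuousOn v (Set.Icc 0 T)) (hg : ∀ i, ContinuousOn (g i) (Set.Icc 0 T))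
    (hw : ∀ t ∈ Set.Icc 0 T, HasDerivWithinAt w (v t) (Set.Icc 0 T) t)
    (hrel : ∀ s ∈ Set.Icc 0 T, ∀ t ∈ Set.Icc 0 T,
      ⟪v t - v s, w t - w s⟫_ℝ = -c ^ 2 * ∑ i, ⟪∫ τ in s..t, g i τ, g i t - g i s⟫_ℝ)
    {t : ℝ} (ht : t ∈ Set.Icc 0 T) :
    ‖v t‖ ^ 2 + c ^ 2 * ∑ i, ‖g i t‖ ^ 2 = ‖v 0‖ ^ 2 + c ^ 2 * ∑ i, ‖g i 0‖ ^ 2 ∧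
      w t - w 0 = ∫ τ in (0 : ℝ)..t, v τ := by
  set v' : ℝ → H := Set.IccExtend hT.le ((Set.Icc 0 T).domRestrict v) with hv'
  set g' : Fin 3 → ℝ → H := fun i => Set.IccExtend hT.le ((Set.Icc 0 T).domRestrict (g i)) with hg'
  have cv : Continuous v' := (continuousOn_iff_continuous_domRestrict.1 hv).Icc_extend'
  have cg : ∀ i, Continuous (g' i) := fun i =>
    (continuousOn_iff_continuous_domRestrict.1 (hg i)).Icc_extend'
  have ev : ∀ t ∈ Set.Icc 0 T, v' t = v t := fun t ht => Set.IccExtend_of_mem _ _ ht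
  have eg : ∀ i, ∀ t ∈ Set.Icc 0 T, g' i t = g i t := fun i t ht => Set.IccExtend_of_mem _ _ ht
  set w' : ℝ → H := fun t => w 0 + ∫ τ in (0 : ℝ)..t, v' τ with hw'
  have hwd : ∀ t, HasDerivAt w' (v' t) t := fun t => by
    have := (intervalIntegral.integral_hasDerivAt_right (cv.intervalIntegrable 0 t)
      cv.stronglyMeasurable.stronglyMeasurableAtFilter cv.continuousAt).const_add (w 0)
    exact this
  have sub : ∀ {s t : ℝ}, s ∈ Set.Icc 0 T → t ∈ Set.Icc 0 T → Set.uIcc s t ⊆ Set.Icc 0 T :=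
    fun hs ht => (Set.ordConnected_Icc).uIcc_subset hs ht
  have h0 : (0 : ℝ) ∈ Set.Icc 0 T := ⟨le_rfl, hT.le⟩
  have ew : ∀ t ∈ Set.Icc 0 T, w t - w 0 = ∫ τ in (0 : ℝ)..t, v' τ := by
    intro t ht
    refine (intervalIntegral.integral_eq_sub_of_hasDeriv_right_of_le ht.1 ?_ ?_
      (cv.intervalIntegrable _ _)).symm
    · intro s hs
      exact ((hw s ⟨hs.1, hs.2.trans ht.2⟩).continuousWithinAt).mono
        (Set.Icc_subset_Icc le_rfl ht.2)
    · intro s hs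
      have hs' : s ∈ Set.Icc 0 T := ⟨hs.1.le, hs.2.le.trans ht.2⟩
      rw [ev s hs']
      refine (hw s hs').mono_of_mem_nhdsWithin ?_
      exact mem_of_superset (Ioc_mem_nhdsGT (hs.2.trans_le ht.2))
        fun x hx => ⟨hs.1.le.trans hx.1.le, hx.2⟩
  have ew' : ∀ t ∈ Set.Icc 0 T, w' t = w t := fun t ht => by
    simp only [hw', ← ew t ht]; abel
  have key := energy_of_hasDerivAt (c := c) (T := T) cv cg hwd (fun s hs t ht => by
    rw [ev s hs, ev t ht, ew' s hs, ew' t ht, hrel s hs t ht]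
    congr 1
    refine Finset.sum_congr rfl fun i _ => ?_
    rw [eg i s hs, eg i t ht]
    congr 1
    exact intervalIntegral.integral_congr fun τ hτ => (eg i τ (sub hs ht hτ)).symm) ht
  rw [ev t ht, ev 0 h0] at key
  simp only [eg _ t ht, eg _ 0 h0] at key
  refine ⟨key, (ew t ht).trans ?_⟩
  exact intervalIntegral.integral_congr fun τ hτ => ev τ (sub h0 ht hτ)

/-! ### Curves in `L²` -/

open Classical in
/-- The class in `L²(ℝ³)` of a function (zero if it is not square integrable). -/
noncomputable def toL2 (f : E3 → ℝ) : Lp ℝ 2 (volume : Measure E3) :=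
  if h : MemLp f 2 volume then h.toLp f else 0

lemma toL2_of_memLp {f : E3 → ℝ} (h : MemLp f 2 volume) : toL2 f = h.toLp f := dif_pos h

lemma toL2_sub {f g : E3 → ℝ} (hf : MemLp f 2 volume) (hg : MemLp g 2 volume) :
    toL2 (f - g) = toL2 f - toL2 g := by
  rw [toL2_of_memLp hf, toL2_of_memLp hg, toL2_of_memLp (hf.sub hg), MemLp.toLp_sub]

lemma toL2_smul {f : E3 → ℝ} (hf : MemLp f 2 volume) (a : ℝ) : toL2 (a • f) = a • toL2 f := by
  rw [toL2_of_memLp hf, toL2_of_memLp (hf.const_smul a), MemLp.toLp_const_smul]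

lemma ofReal_norm_toL2_sq {f : E3 → ℝ} (hf : MemLp f 2 volume) :
    ENNReal.ofReal (‖toL2 f‖ ^ 2) = eLpNorm f 2 volume ^ 2 := by
  rw [toL2_of_memLp hf, ENNReal.ofReal_pow (norm_nonneg _), Lp.norm_toLp,
    ENNReal.ofReal_toReal hf.2.ne]

lemma inner_toL2 {f g : E3 → ℝ} (hf : MemLp f 2 volume) (hg : MemLp g 2 volume) :
    inner ℝ (toL2 f) (toL2 g) = ∫ x, f x * g x := by
  rw [toL2_of_memLp hf, toL2_of_memLp hg, L2.inner_def]
  refine integral_congr_ae ?_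
  filter_upwards [hf.coeFn_toLp, hg.coeFn_toLp] with x h1 h2
  simp [h1, h2, mul_comm]

lemma IsTest.memLp {b : E3 → ℝ} (h : IsTest b) : MemLp b 2 volume :=
  h.continuous.memLp_of_hasCompactSupport h.compact

lemma tendsto_toL2_of_sobolevSq {α : Type*} {l : Filter α} {k : ℕ} {f : α → E3 → ℝ}
    (hf : ∀ᶠ a in l, MemLp (f a) 2 volume)
    (h : Tendsto (fun a => sobolevSq k (f a)) l (𝓝 0)) : Tendsto (fun a => toL2 (f a)) l (𝓝 0) := by
  have h1 : Tendsto (fun a => eLpNorm (f a) 2 volume ^ 2) l (𝓝 0) :=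
    tendsto_of_tendsto_of_tendsto_of_le_of_le tendsto_const_nhds h (fun _ => bot_le)
      fun a => eLpNorm_sq_le_sobolevSq k (f a)
  have h2 := (ENNReal.tendsto_toReal ENNReal.zero_ne_top).comp h1
  have h3 : Tendsto (fun a => ‖toL2 (f a)‖ ^ 2) l (𝓝 0) := by
    refine (h2.congr' ?_)
    filter_upwards [hf] with a ha
    simp only [Function.comp, ← ofReal_norm_toL2_sq ha]
    exact ENNReal.toReal_ofReal (sq_nonneg _)
  rw [tendsto_zero_iff_norm_tendsto_zero]
  have h4 := h3.sqrt
  simpa using h4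

lemma ContInH.continuousOn_toL2 {k : ℕ} {T : ℝ} {U : ℝ → E3 → ℝ} (h : ContInH k T U) :
    ContinuousOn (fun t => toL2 (U t)) (Set.Icc 0 T) := by
  intro t₀ ht₀
  have h1 := tendsto_sobolevNorm_iff.1 (h.2 t₀ ht₀)
  have hm : ∀ᶠ t in 𝓝[Set.Icc 0 T] t₀, MemLp (U t - U t₀) 2 volume := by
    filter_upwards [self_mem_nhdsWithin] with t ht
    exact (h.1 t ht).memLp.sub (h.1 t₀ ht₀).memLp
  have h2 := tendsto_toL2_of_sobolevSq hm h1
  have h3 : Tendsto (fun t => toL2 (U t) - toL2 (U t₀)) (𝓝[Set.Icc 0 T] t₀) (𝓝 0) := by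
    refine h2.congr' ?_
    filter_upwards [self_mem_nhdsWithin] with t ht
    exact toL2_sub (h.1 t ht).memLp (h.1 t₀ ht₀).memLp
  exact tendsto_sub_nhds_zero_iff.1 h3

lemma HasTimeDerivInH.hasDerivWithinAt_toL2 {k : ℕ} {T : ℝ} {U V : ℝ → E3 → ℝ}
    (h : HasTimeDerivInH k T U V) (hU : ∀ t ∈ Set.Icc 0 T, MemLp (U t) 2 volume)
    (hV : ∀ t ∈ Set.Icc 0 T, MemLp (V t) 2 volume) {t₀ : ℝ} (ht₀ : t₀ ∈ Set.Icc 0 T) :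
    HasDerivWithinAt (fun t => toL2 (U t)) (toL2 (V t₀)) (Set.Icc 0 T) t₀ := by
  rw [hasDerivWithinAt_iff_tendsto_slope]
  have h1 := tendsto_sobolevNorm_iff.1 (h t₀ ht₀)
  have hm : ∀ᶠ t in 𝓝[Set.Icc 0 T \ {t₀}] t₀,
      MemLp ((t - t₀)⁻¹ • (U t - U t₀) - V t₀) 2 volume := by
    filter_upwards [self_mem_nhdsWithin] with t ht
    exact (((hU t ht.1).sub (hU t₀ ht₀)).const_smul _).sub (hV t₀ ht₀)
  have h2 := tendsto_toL2_of_sobolevSq hm h1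
  refine tendsto_sub_nhds_zero_iff.1 (h2.congr' ?_)
  filter_upwards [self_mem_nhdsWithin] with t ht
  rw [toL2_sub (((hU t ht.1).sub (hU t₀ ht₀)).const_smul _) (hV t₀ ht₀),
    toL2_smul ((hU t ht.1).sub (hU t₀ ht₀)), toL2_sub (hU t ht.1) (hU t₀ ht₀), slope_def_module]

/-! ### Weak solutions: from the distributional equation to an integrated form -/

/-- The lemma of du Bois-Reymond: a continuous function on `[0, T]` with vanishing distributional
derivative is constant. -/
lemma eq_of_forall_integral_deriv_mul_eq_zero {T : ℝ} (hT : 0 < T) {m : ℝ → ℝ}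
    (hm : ContinuousOn m (Set.Icc 0 T))
    (h : ∀ a : ℝ → ℝ, ContDiff ℝ ∞ a → HasCompactSupport a → tsupport a ⊆ Set.Ioo 0 T →
      ∫ t in (0 : ℝ)..T, deriv a t * m t = 0) {t : ℝ} (ht : t ∈ Set.Icc 0 T) : m t = m 0 := by
  let B : ContDiffBump (T / 2) := ⟨T / 8, T / 4, by positivity, by linarith⟩
  set k : ℝ → ℝ := B.normed volume with hk
  have hkc : ContDiff ℝ ∞ k := B.contDiff_normed
  have hk1 : ∫ t, k t = 1 := B.integral_normed
  have hks : HasCompactSupport k := B.hasCompactSupport_normed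
  have hkt : tsupport k ⊆ Set.Ioo 0 T := by
    rw [hk, B.tsupport_normed_eq, Real.closedBall_eq_Icc]
    exact fun x hx => ⟨by linarith [hx.1, show B.rOut = T / 4 from rfl],
      by linarith [hx.2, show B.rOut = T / 4 from rfl]⟩
  set κ : ℝ := ∫ t in (0 : ℝ)..T, k t * m t with hκ
  have hmi : IntervalIntegrable m volume 0 T :=
    (hm.mono (by rw [Set.uIcc_of_le hT.le])).intervalIntegrable
  have hci : ∀ {f : ℝ → ℝ}, Continuous f → IntervalIntegrable (fun t => f t * m t) volume 0 T :=
    fun hf => ((hf.continuousOn.mul hm).mono (by rw [Set.uIcc_of_le hT.le])).intervalIntegrable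
  have hfull : ∀ {f : ℝ → ℝ}, tsupport f ⊆ Set.Ioo 0 T → ∫ t in (0 : ℝ)..T, f t = ∫ t, f t := by
    intro f hf
    rw [intervalIntegral.integral_eq_integral_of_support_subset]
    exact (subset_tsupport f).trans (hf.trans Set.Ioo_subset_Ioc_self)
  have hzero : ∀ᵐ t ∂(volume : Measure ℝ), t ∈ Set.Ioo 0 T → m t - κ = 0 := by
    refine IsOpen.ae_eq_zero_of_integral_contDiff_smul_eq_zero isOpen_Ioo ?_ ?_
    · exact ((hm.mono Set.Ioo_subset_Icc_self).sub continuousOn_const).locallyIntegrableOn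
        measurableSet_Ioo
    intro η hη hηc hηs
    set I : ℝ := ∫ t, η t with hI
    set d : ℝ → ℝ := fun t => η t - I * k t with hd
    have hdc : ContDiff ℝ ∞ d := hη.sub (contDiff_const.mul hkc)
    set a : ℝ → ℝ := fun t => ∫ s in (0 : ℝ)..t, d s with ha
    have had : ∀ t, HasDerivAt a (d t) t := fun t =>
      intervalIntegral.integral_hasDerivAt_right (hdc.continuous.intervalIntegrable _ _)
        hdc.continuous.stronglyMeasurable.stronglyMeasurableAtFilter hdc.continuous.continuousAt
    have hda : deriv a = d := funext fun t => (had t).deriv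
    have hac : ContDiff ℝ ∞ a :=
      contDiff_infty_iff_deriv.2 ⟨fun t => (had t).differentiableAt, by rw [hda]; exact hdc⟩
    -- both supports lie in a compact subinterval, off which the primitive vanishes
    have hKc : IsCompact (tsupport η ∪ tsupport k) := hηc.isCompact.union hks.isCompact
    have hKs : tsupport η ∪ tsupport k ⊆ Set.Ioo 0 T := Set.union_subset hηs hkt
    have hdK : ∀ t, t ∉ tsupport η ∪ tsupport k → d t = 0 := by
      intro t ht
      rw [Set.mem_union, not_or] at ht
      simp [hd, image_eq_zero_of_notMem_tsupport ht.1, image_eq_zero_of_notMem_tsupport ht.2]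
    have hne : (tsupport η ∪ tsupport k).Nonempty := by
      refine ⟨T / 2, Or.inr ?_⟩
      rw [hk, B.tsupport_normed_eq]
      exact Metric.mem_closedBall_self B.rOut_pos.le
    obtain ⟨α, hα, hαl⟩ := hKc.exists_isLeast hne
    obtain ⟨γ, hγ, hγl⟩ := hKc.exists_isGreatest hne
    have hα0 := hKs hα
    have hγ0 := hKs hγ
    have hdtot : ∫ t, d t = 0 := by
      simp only [hd]
      rw [integral_sub (hη.continuous.integrable_of_hasCompactSupport hηc)
        ((hkc.continuous.integrable_of_hasCompactSupport hks).const_mul _), integral_const_mul,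
        hk1]
      ring
    have haz : ∀ t, t ∉ Set.Icc α γ → a t = 0 := by
      intro t ht
      rw [Set.mem_Icc, not_and_or, not_le, not_le] at ht
      rcases ht with ht | ht
      · refine intervalIntegral.integral_zero_ae
          (Eventually.of_forall fun s hs => hdK s fun hc => ?_)
        have h1 := hαl hc
        rw [Set.mem_uIoc] at hs
        rcases hs with hs | hs <;> linarith [hs.2, hα0.1]
      · have : a t = ∫ s, d s := by
          simp only [ha]
          rw [intervalIntegral.integral_eq_integral_of_support_subset]
          intro s hs
          have hsK : s ∈ tsupport η ∪ tsupport k := by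
            by_contra hc; exact hs (hdK s hc)
          exact ⟨(hKs hsK).1, (hγl hsK).trans ht.le⟩
        rw [this, hdtot]
    have hasup : tsupport a ⊆ Set.Icc α γ := closure_minimal (fun t ht => by
      by_contra hc; exact ht (haz t hc)) isClosed_Icc
    have key := h a hac (HasCompactSupport.intro isCompact_Icc fun t ht => haz t ht)
      (hasup.trans fun t ht => ⟨hα0.1.trans_le ht.1, ht.2.trans_lt hγ0.2⟩)
    rw [hda] at key
    have e1 : ∫ t, η t • (m t - κ) = ∫ t in (0 : ℝ)..T, η t * (m t - κ) := by
      rw [hfull]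
      · rfl
      · exact (tsupport_mul_subset_left).trans hηs
    rw [e1]
    have e2 : ∫ t in (0 : ℝ)..T, η t * (m t - κ) =
        (∫ t in (0 : ℝ)..T, η t * m t) - κ * I := by
      simp only [mul_sub]
      rw [intervalIntegral.integral_sub (hci hη.continuous)
        (show IntervalIntegrable (fun t => η t * κ) volume 0 T from
          (hη.continuous.mul continuous_const).intervalIntegrable _ _),
        intervalIntegral.integral_mul_const, hfull hηs, mul_comm κ]
    have e3 : ∫ t in (0 : ℝ)..T, d t * m t =
        (∫ t in (0 : ℝ)..T, η t * m t) - I * κ := by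
      simp only [hd, sub_mul, mul_assoc]
      rw [intervalIntegral.integral_sub (hci hη.continuous)
        ((hci hkc.continuous).const_mul _), intervalIntegral.integral_const_mul]
    rw [e2, mul_comm κ, ← e3, key]
  have hae : m =ᵐ[volume.restrict (Set.Icc 0 T)] fun _ => κ := by
    rw [EventuallyEq, ← Measure.restrict_congr_set Ioo_ae_eq_Icc,
      ae_restrict_iff' measurableSet_Ioo]
    filter_upwards [hzero] with t h1 h2
    linarith [h1 h2]
  have := Measure.eqOn_Icc_of_ae_eq volume hT.ne hae hm continuousOn_const
  rw [this ht, this ⟨le_rfl, hT.le⟩]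

/-- The Laplacian as the sum of the iterated partial derivatives. -/
noncomputable def lap (b : E3 → ℝ) : E3 → ℝ := fun x => ∑ i, pd i (pd i b) x

lemma isTest_lap {b : E3 → ℝ} (h : IsTest b) : IsTest (lap b) := by
  have : lap b = pd 0 (pd 0 b) + pd 1 (pd 1 b) + pd 2 (pd 2 b) := by
    funext x; simp [lap, Fin.sum_univ_three]
  rw [this]
  exact ⟨((((h.pd 0).pd 0).smooth.add ((h.pd 1).pd 1).smooth).add ((h.pd 2).pd 2).smooth),
    ((((h.pd 0).pd 0).compact.add ((h.pd 1).pd 1).compact).add ((h.pd 2).pd 2).compact)⟩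

lemma pd_pd_eq {b : E3 → ℝ} {x : E3} (h : ContDiffAt ℝ 2 b x) (i j : Fin 3) :
    pd i (pd j b) x =
      fderiv ℝ (fderiv ℝ b) x (EuclideanSpace.single i 1) (EuclideanSpace.single j 1) := by
  have h1 : DifferentiableAt ℝ (fderiv ℝ b) x :=
    (h.fderiv_right (m := 1) (by norm_num)).differentiableAt (by norm_num)
  have h2 := (h1.hasFDerivAt.clm_apply (hasFDerivAt_const (EuclideanSpace.single j (1 : ℝ)) x))
  have : pd j b = fun y => fderiv ℝ b y (EuclideanSpace.single j 1) := rfl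
  rw [pd, this, h2.fderiv]
  simp

lemma laplacian_eq_sum_pd {b : E3 → ℝ} {x : E3} (h : ContDiffAt ℝ 2 b x) :
    (Δ b) x = ∑ i, pd i (pd i b) x := by
  rw [InnerProductSpace.laplacian_eq_iteratedFDeriv_orthonormalBasis b
    (EuclideanSpace.basisFun (Fin 3) ℝ)]
  refine Finset.sum_congr rfl fun i _ => ?_
  rw [iteratedFDeriv_two_apply, pd_pd_eq h]
  simp

lemma contDiffAt_two {b : E3 → ℝ} (h : ContDiff ℝ ∞ b) (x : E3) : ContDiffAt ℝ 2 b x :=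
  (contDiff_infty.1 h 2).contDiffAt

lemma pd_comm {b : E3 → ℝ} (h : ContDiff ℝ ∞ b) (i j : Fin 3) :
    pd i (pd j b) = pd j (pd i b) := by
  funext x
  have hx : ContDiffAt ℝ 2 b x := contDiffAt_two h x
  rw [pd_pd_eq hx, pd_pd_eq hx]
  exact hx.isSymmSndFDerivAt (by simp) _ _

lemma pd_lap {b : E3 → ℝ} (h : ContDiff ℝ ∞ b) (i : Fin 3) :
    pd i (lap b) = lap (pd i b) := by
  funext x
  have h1 : ∀ j ∈ Finset.univ, DifferentiableAt ℝ (pd j (pd j b)) x := fun j _ =>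
    (contDiff_pd (contDiff_pd h j) j).differentiable (by simp) x
  have : pd i (lap b) x = ∑ j, pd i (pd j (pd j b)) x := by
    have h2 : fderiv ℝ (lap b) x = ∑ j, fderiv ℝ (pd j (pd j b)) x := fderiv_fun_sum h1
    simp only [pd] at h2 ⊢
    rw [h2]
    simp
  rw [this]
  refine Finset.sum_congr rfl fun j _ => ?_
  rw [pd_comm (contDiff_pd h j) i j, pd_comm h i j]

/-- Solutions of the wave equation in `C([0,T]; H^{k+1}) ∩ C¹([0,T]; H^k)`, with time derivative
`V`; the equation is tested with functions of `x` and integrated once in time. -/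
structure IsMild (c T : ℝ) (k : ℕ) (U V : ℝ → E3 → ℝ) : Prop where
  contU : ContInH (k + 1) T U
  contV : ContInH k T V
  deriv : HasTimeDerivInH k T U V
  eq : ∀ b, IsTest b → ∀ t ∈ Set.Icc 0 T,
    (∫ x, V t x * b x) - (∫ x, V 0 x * b x) = c ^ 2 * ∫ s in (0 : ℝ)..t, ∫ x, U s x * lap b x

lemma ContInH.integral_mul_eq {k : ℕ} {T : ℝ} {U : ℝ → E3 → ℝ} (h : ContInH k T U) {b : E3 → ℝ}
    (hb : IsTest b) : ∀ t ∈ Set.Icc 0 T, ∫ x, U t x * b x = inner ℝ (toL2 (U t)) (toL2 b) :=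
  fun t ht => (inner_toL2 (h.1 t ht).memLp hb.memLp).symm

lemma ContInH.continuousOn_integral_mul {k : ℕ} {T : ℝ} {U : ℝ → E3 → ℝ} (h : ContInH k T U)
    {b : E3 → ℝ} (hb : IsTest b) : ContinuousOn (fun t => ∫ x, U t x * b x) (Set.Icc 0 T) :=
  (h.continuousOn_toL2.inner continuousOn_const).congr (h.integral_mul_eq hb)

/-- The distributional wave equation, tested with `a(t) b(x)`, gives the integrated form. -/
lemma IsCauchySolution.exists_isMild {c T : ℝ} {k : ℕ} (hT : 0 < T) {Φ Ψ : E3 → ℝ}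
    {U : ℝ → E3 → ℝ} (h : IsCauchySolution c T k Φ Ψ U) :
    ∃ V, IsMild c T k U V ∧ U 0 =ᵐ[volume] Φ ∧ V 0 =ᵐ[volume] Ψ := by
  obtain ⟨hU, h0, ⟨V, hV, hd, hV0⟩, heq⟩ := h
  refine ⟨V, ⟨hU, hV, hd, fun b hb t ht => ?_⟩, h0, hV0⟩
  set f : ℝ → ℝ := fun t => ∫ x, U t x * b x with hf
  set f' : ℝ → ℝ := fun t => ∫ x, V t x * b x with hf'
  set q : ℝ → ℝ := fun t => ∫ x, U t x * lap b x with hq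
  have cf : ContinuousOn f (Set.Icc 0 T) := hU.continuousOn_integral_mul hb
  have cf' : ContinuousOn f' (Set.Icc 0 T) := hV.continuousOn_integral_mul hb
  have cq : ContinuousOn q (Set.Icc 0 T) := hU.continuousOn_integral_mul (isTest_lap hb)
  have df : ∀ t ∈ Set.Icc 0 T, HasDerivWithinAt f (f' t) (Set.Icc 0 T) t := by
    intro t ht
    have h1 := hd.hasDerivWithinAt_toL2 (fun t ht => (hU.1 t ht).memLp)
      (fun t ht => (hV.1 t ht).memLp) ht
    have h2 := (h1.inner ℝ (hasDerivWithinAt_const t (Set.Icc 0 T) (toL2 b))).congr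
      (f₁ := f) (hU.integral_mul_eq hb) (hU.integral_mul_eq hb t ht)
    rw [inner_zero_right, zero_add, ← hV.integral_mul_eq hb t ht] at h2
    exact h2
  have h00 : (0 : ℝ) ∈ Set.Icc 0 T := ⟨le_rfl, hT.le⟩
  have hqi : ∀ t ∈ Set.Icc 0 T, IntervalIntegrable q volume 0 t := fun t ht =>
    (cq.mono (by rw [Set.uIcc_of_le ht.1]; exact Set.Icc_subset_Icc le_rfl ht.2)).intervalIntegrable
  set Q : ℝ → ℝ := fun t => ∫ s in (0 : ℝ)..t, q s with hQ
  have cQ : ContinuousOn Q (Set.Icc 0 T) := by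
    have := intervalIntegral.continuousOn_primitive_interval (μ := volume) (f := q)
      (a := 0) (b := T) (by rw [Set.uIcc_of_le hT.le]; exact cq.integrableOn_Icc)
    rwa [Set.uIcc_of_le hT.le] at this
  have dQ : ∀ t ∈ Set.Ioo 0 T, HasDerivAt Q (q t) t := fun t ht =>
    intervalIntegral.integral_hasDerivAt_right (hqi t ⟨ht.1.le, ht.2.le⟩)
      ((cq.mono Set.Ioo_subset_Icc_self).stronglyMeasurableAtFilter isOpen_Ioo t ht)
      (cq.continuousAt (Icc_mem_nhds ht.1 ht.2))
  have key : ∀ t ∈ Set.Icc 0 T, f' t - c ^ 2 * Q t = f' 0 - c ^ 2 * Q 0 := by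
    intro t ht
    refine eq_of_forall_integral_deriv_mul_eq_zero hT (m := fun t => f' t - c ^ 2 * Q t)
      (cf'.sub (continuousOn_const.mul cQ)) (fun a ha hac has => ?_) ht
    have ha1 : ContDiff ℝ ∞ (deriv a) := (contDiff_infty_iff_deriv.1 ha).2
    have da : ∀ t, HasDerivAt a (deriv a t) t := fun t =>
      ((contDiff_infty_iff_deriv.1 ha).1 t).hasDerivAt
    have da1 : ∀ t, HasDerivAt (deriv a) (deriv (deriv a) t) t := fun t =>
      ((contDiff_infty_iff_deriv.1 ha1).1 t).hasDerivAt
    have hia : iteratedDeriv 2 a = deriv (deriv a) := by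
      rw [iteratedDeriv_succ, iteratedDeriv_one]
    -- the equation tested with `a(t) b(x)`
    have e0 : ∫ t in (0 : ℝ)..T, (deriv (deriv a) t * f t - c ^ 2 * (a t * q t)) = 0 := by
      have := heq (fun p => a p.1 * b p.2)
        ((ha.comp contDiff_fst).mul (hb.smooth.comp contDiff_snd)) ?_ ?_
      · rw [intervalIntegral.integral_of_le hT.le, ← Measure.restrict_congr_set Ioo_ae_eq_Ioc]
        refine Eq.trans ?_ this
        refine setIntegral_congr_fun measurableSet_Ioo fun t ht => ?_
        have i1 : Integrable (fun x => U t x * b x) volume :=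
          ((hU.1 t ⟨ht.1.le, ht.2.le⟩).memLp.locallyIntegrable (by norm_num)).integrable_mul_test
            hb.continuous hb.compact
        have i2 : Integrable (fun x => U t x * lap b x) volume :=
          ((hU.1 t ⟨ht.1.le, ht.2.le⟩).memLp.locallyIntegrable (by norm_num)).integrable_mul_test
            (isTest_lap hb).continuous (isTest_lap hb).compact
        simp only [hf, hq]
        rw [← integral_const_mul, ← integral_const_mul, ← integral_const_mul,
          ← integral_sub (i1.const_mul _) ((i2.const_mul _).const_mul _)]
        refine integral_congr_ae (Eventually.of_forall fun x => ?_)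
        have l1 : iteratedDeriv 2 (fun τ => a τ * b x) t = deriv (deriv a) t * b x := by
          rw [iteratedDeriv_succ, iteratedDeriv_one]
          have : deriv (fun τ => a τ * b x) = fun τ => deriv a τ * b x :=
            funext fun τ => ((da τ).mul_const _).deriv
          rw [this]
          exact ((da1 t).mul_const _).deriv
        have hb2 : ∀ y, ContDiffAt ℝ 2 b y := contDiffAt_two hb.smooth
        have l2 : (Δ (fun y => a t * b y)) x = a t * lap b x := by
          have := InnerProductSpace.laplacian_smul (a t) (hb2 x)
          rw [laplacian_eq_sum_pd (hb2 x)] at this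
          exact this
        simp only [l1, l2]
        ring
      · refine HasCompactSupport.intro (hac.isCompact.prod hb.compact.isCompact) fun p hp => ?_
        rw [Set.mem_prod, not_and_or] at hp
        rcases hp with hp | hp
        · simp [image_eq_zero_of_notMem_tsupport hp]
        · simp [image_eq_zero_of_notMem_tsupport hp]
      · intro p hp
        have hsub : tsupport (fun p : ℝ × E3 => a p.1 * b p.2) ⊆ Prod.fst ⁻¹' tsupport a := by
          refine closure_minimal (fun p hp => ?_) ((isClosed_tsupport a).preimage continuous_fst)
          by_contra hc
          exact hp (by simp [image_eq_zero_of_notMem_tsupport (show p.1 ∉ tsupport a from hc)])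
        exact ⟨has (hsub hp), Set.mem_univ _⟩
    have a0 : a 0 = 0 := image_eq_zero_of_notMem_tsupport fun hc => lt_irrefl _ (has hc).1
    have aT : a T = 0 := image_eq_zero_of_notMem_tsupport fun hc => lt_irrefl _ (has hc).2
    have a'0 : deriv a 0 = 0 := image_eq_zero_of_notMem_tsupport fun hc =>
      lt_irrefl _ (has (tsupport_deriv_subset hc)).1
    have a'T : deriv a T = 0 := image_eq_zero_of_notMem_tsupport fun hc =>
      lt_irrefl _ (has (tsupport_deriv_subset hc)).2
    have hcu : Set.uIcc 0 T = Set.Icc 0 T := Set.uIcc_of_le hT.le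
    have i1 : IntervalIntegrable (fun t => deriv (deriv a) t * f t - c ^ 2 * (a t * q t))
        volume 0 T := by
      refine ContinuousOn.intervalIntegrable ?_
      rw [hcu]
      exact ((contDiff_infty_iff_deriv.1 ha1).2.continuous.continuousOn.mul cf).sub
        (continuousOn_const.mul (ha.continuous.continuousOn.mul cq))
    have i2 : IntervalIntegrable (fun t => deriv a t * (f' t - c ^ 2 * Q t)) volume 0 T := by
      refine ContinuousOn.intervalIntegrable ?_
      rw [hcu]
      exact ha1.continuous.continuousOn.mul (cf'.sub (continuousOn_const.mul cQ))
    have ftc := intervalIntegral.integral_eq_sub_of_hasDeriv_right_of_le hT.le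
      (f := fun t => deriv a t * f t - c ^ 2 * (a t * Q t))
      (f' := fun t => (deriv (deriv a) t * f t - c ^ 2 * (a t * q t)) +
        deriv a t * (f' t - c ^ 2 * Q t))
      ((ha1.continuous.continuousOn.mul cf).sub
        (continuousOn_const.mul (ha.continuous.continuousOn.mul cQ)))
      (fun t ht => by
        have hft : HasDerivAt f (f' t) t :=
          (df t ⟨ht.1.le, ht.2.le⟩).hasDerivAt (Icc_mem_nhds ht.1 ht.2)
        have := ((da1 t).mul hft).sub (((da t).mul (dQ t ht)).const_mul (c ^ 2))
        refine (this.congr_deriv ?_).hasDerivWithinAt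
        ring) (i1.add i2)
    rw [intervalIntegral.integral_add i1 i2, e0, a0, aT, a'0, a'T] at ftc
    simpa using ftc
  have k1 := key t ht
  have hQ0 : Q 0 = 0 := by simp [hQ]
  rw [hQ0] at k1
  change f' t - f' 0 = c ^ 2 * Q t
  linarith

/-! ### The energy estimate for weak solutions -/

lemma ContInH.sub {k : ℕ} {T : ℝ} {U U' : ℝ → E3 → ℝ} (h : ContInH k T U) (h' : ContInH k T U') :
    ContInH k T (fun t => U t - U' t) := by
  refine ⟨fun t ht => (h.1 t ht).sub (h'.1 t ht), fun t₀ ht₀ => ?_⟩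
  rw [tendsto_sobolevNorm_iff]
  have h1 := tendsto_sobolevNorm_iff.1 (h.2 t₀ ht₀)
  have h2 := tendsto_sobolevNorm_iff.1 (h'.2 t₀ ht₀)
  have h3 := (ENNReal.Tendsto.const_mul (a := 2) h1 (Or.inr (by simp))).add
    (ENNReal.Tendsto.const_mul (a := 2) h2 (Or.inr (by simp)))
  simp only [mul_zero, add_zero] at h3
  refine tendsto_of_tendsto_of_tendsto_of_le_of_le' tendsto_const_nhds h3
    (Eventually.of_forall fun _ => bot_le) ?_
  filter_upwards [self_mem_nhdsWithin] with t ht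
  have := sobolevSq_sub_le k (f := U t - U t₀) (g := U' t - U' t₀) ((h.1 t ht).sub (h.1 t₀ ht₀)).1
  rwa [sub_sub_sub_comm] at this

lemma HasTimeDerivInH.sub {k : ℕ} {T : ℝ} {U U' V V' : ℝ → E3 → ℝ} (h : HasTimeDerivInH k T U V)
    (h' : HasTimeDerivInH k T U' V')
    (hm : ∀ t ∈ Set.Icc 0 T, AEStronglyMeasurable (U t) volume)
    (hv : ∀ t ∈ Set.Icc 0 T, AEStronglyMeasurable (V t) volume) :
    HasTimeDerivInH k T (fun t => U t - U' t) (fun t => V t - V' t) := by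
  intro t₀ ht₀
  rw [tendsto_sobolevNorm_iff]
  have h1 := tendsto_sobolevNorm_iff.1 (h t₀ ht₀)
  have h2 := tendsto_sobolevNorm_iff.1 (h' t₀ ht₀)
  have h3 := (ENNReal.Tendsto.const_mul (a := 2) h1 (Or.inr (by simp))).add
    (ENNReal.Tendsto.const_mul (a := 2) h2 (Or.inr (by simp)))
  simp only [mul_zero, add_zero] at h3
  refine tendsto_of_tendsto_of_tendsto_of_le_of_le' tendsto_const_nhds h3
    (Eventually.of_forall fun _ => bot_le) ?_
  filter_upwards [self_mem_nhdsWithin] with t ht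
  have := sobolevSq_sub_le k (f := (t - t₀)⁻¹ • (U t - U t₀) - V t₀)
    (g := (t - t₀)⁻¹ • (U' t - U' t₀) - V' t₀)
    ((((hm t ht.1).sub (hm t₀ ht₀)).const_smul _).sub (hv t₀ ht₀))
  rwa [sub_sub_sub_comm, ← smul_sub, sub_sub_sub_comm] at this

lemma MemH.integrable_mul_test {k : ℕ} {f b : E3 → ℝ} (h : MemH k f) (hb : IsTest b) :
    Integrable (fun x => f x * b x) volume :=
  (h.memLp.locallyIntegrable (by norm_num)).integrable_mul_test hb.continuous hb.compact

lemma ContInH.intervalIntegrable_integral_mul {k : ℕ} {T : ℝ} {U : ℝ → E3 → ℝ}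
    (h : ContInH k T U) {b : E3 → ℝ} (hb : IsTest b) {s t : ℝ} (hs : s ∈ Set.Icc 0 T)
    (ht : t ∈ Set.Icc 0 T) : IntervalIntegrable (fun t => ∫ x, U t x * b x) volume s t :=
  ((h.continuousOn_integral_mul hb).mono
    (Set.ordConnected_Icc.uIcc_subset hs ht)).intervalIntegrable

lemma uIcc_zero_subset {T t : ℝ} (ht : t ∈ Set.Icc 0 T) : Set.uIcc 0 t ⊆ Set.Icc 0 T :=
  Set.ordConnected_Icc.uIcc_subset ⟨le_rfl, ht.1.trans ht.2⟩ ht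

lemma IsMild.sub {c T : ℝ} {k : ℕ} {U U' V V' : ℝ → E3 → ℝ} (h : IsMild c T k U V)
    (h' : IsMild c T k U' V') :
    IsMild c T k (fun t => U t - U' t) (fun t => V t - V' t) where
  contU := h.contU.sub h'.contU
  contV := h.contV.sub h'.contV
  deriv := h.deriv.sub h'.deriv (fun t ht => (h.contU.1 t ht).1) (fun t ht => (h.contV.1 t ht).1)
  eq b hb t ht := by
    have h0 : (0 : ℝ) ∈ Set.Icc 0 T := ⟨le_rfl, ht.1.trans ht.2⟩
    have e : ∀ {k : ℕ} {W W' : ℝ → E3 → ℝ}, ContInH k T W → ContInH k T W' → ∀ {b : E3 → ℝ},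
        IsTest b → ∀ t ∈ Set.Icc 0 T, ∫ x, (W t - W' t) x * b x =
        (∫ x, W t x * b x) - ∫ x, W' t x * b x := by
      intro k W W' hW hW' b hb t ht
      simp only [Pi.sub_apply, sub_mul]
      exact integral_sub ((hW.1 t ht).integrable_mul_test hb) ((hW'.1 t ht).integrable_mul_test hb)
    have hl := isTest_lap hb
    have e2 : ∫ s in (0 : ℝ)..t, ∫ x, (U s - U' s) x * lap b x =
        (∫ s in (0 : ℝ)..t, ∫ x, U s x * lap b x) - ∫ s in (0 : ℝ)..t, ∫ x, U' s x * lap b x := by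
      rw [← intervalIntegral.integral_sub (h.contU.intervalIntegrable_integral_mul hl h0 ht)
        (h'.contU.intervalIntegrable_integral_mul hl h0 ht)]
      exact intervalIntegral.integral_congr fun s hs =>
        e h.contU h'.contU hl s (uIcc_zero_subset ht hs)
    rw [e h.contV h'.contV hb t ht, e h.contV h'.contV hb 0 h0, e2, mul_sub, ← h.eq b hb t ht,
      ← h'.eq b hb t ht]
    ring

lemma MemH.of_succ {k : ℕ} {f : E3 → ℝ} (h : MemH (k + 1) f) : MemH k f :=
  memH_iff.2 ⟨h.1, (sobolevSq_le_succ k f).trans_lt h.sobolevSq_lt_top⟩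

lemma ContInH.of_succ {k : ℕ} {T : ℝ} {U : ℝ → E3 → ℝ} (h : ContInH (k + 1) T U) :
    ContInH k T U := by
  refine ⟨fun t ht => (h.1 t ht).of_succ, fun t₀ ht₀ => ?_⟩
  rw [tendsto_sobolevNorm_iff]
  exact tendsto_of_tendsto_of_tendsto_of_le_of_le tendsto_const_nhds
    (tendsto_sobolevNorm_iff.1 (h.2 t₀ ht₀)) (fun _ => bot_le) fun t => sobolevSq_le_succ _ _

lemma IsMild.of_succ {c T : ℝ} {k : ℕ} {U V : ℝ → E3 → ℝ} (h : IsMild c T (k + 1) U V) :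
    IsMild c T k U V where
  contU := h.contU.of_succ
  contV := h.contV.of_succ
  deriv t₀ ht₀ := by
    rw [tendsto_sobolevNorm_iff]
    exact tendsto_of_tendsto_of_tendsto_of_le_of_le tendsto_const_nhds
      (tendsto_sobolevNorm_iff.1 (h.deriv t₀ ht₀)) (fun _ => bot_le) fun t => sobolevSq_le_succ _ _
  eq := h.eq

/-- Weak partial derivatives of a curve in `C([0,T]; H^{k+1})` form curves in `C([0,T]; H^k)`. -/
lemma ContInH.exists_weakPartial {k : ℕ} {T : ℝ} {U : ℝ → E3 → ℝ} (h : ContInH (k + 1) T U) :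
    ∃ G : Fin 3 → ℝ → E3 → ℝ, (∀ i, ∀ t ∈ Set.Icc 0 T, HasWeakPartial i (U t) (G i t)) ∧
      ∀ i, ContInH k T (G i) := by
  have : ∀ t, ∃ g : Fin 3 → E3 → ℝ, t ∈ Set.Icc 0 T → (∀ i, HasWeakPartial i (U t) (g i)) ∧
      ∀ i, MemH k (g i) := by
    intro t
    by_cases ht : t ∈ Set.Icc 0 T
    · obtain ⟨g, hg⟩ := (h.1 t ht).exists_weakPartial
      exact ⟨g, fun _ => hg⟩
    · exact ⟨0, fun h => absurd h ht⟩
  choose g hg using this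
  refine ⟨fun i t => g t i, fun i t ht => (hg t ht).1 i, fun i =>
    ⟨fun t ht => (hg t ht).2 i, fun t₀ ht₀ => ?_⟩⟩
  rw [tendsto_sobolevNorm_iff]
  refine tendsto_of_tendsto_of_tendsto_of_le_of_le' tendsto_const_nhds
    (tendsto_sobolevNorm_iff.1 (h.2 t₀ ht₀)) (Eventually.of_forall fun _ => bot_le) ?_
  filter_upwards [self_mem_nhdsWithin] with t ht
  exact sobolevSq_weakPartial_le (((hg t ht).1 i).sub ((hg t₀ ht₀).1 i))

lemma HasWeakPartial.integral_eq {i : Fin 3} {f g b : E3 → ℝ} (h : HasWeakPartial i f g)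
    (hb : IsTest b) : ∫ x, g x * b x = - ∫ x, f x * pd i b x := by
  have := h.2.2 b hb.smooth hb.compact
  rw [show (∫ x, f x * pd i b x) = _ from this, neg_neg]

/-- Spatial derivatives of a weak solution are weak solutions. -/
lemma IsMild.exists_weakPartial {c T : ℝ} {k : ℕ} {U V : ℝ → E3 → ℝ}
    (h : IsMild c T (k + 1) U V) :
    ∃ G K : Fin 3 → ℝ → E3 → ℝ, (∀ i, ∀ t ∈ Set.Icc 0 T, HasWeakPartial i (U t) (G i t)) ∧
      (∀ i, ∀ t ∈ Set.Icc 0 T, HasWeakPartial i (V t) (K i t)) ∧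
      ∀ i, IsMild c T k (G i) (K i) := by
  obtain ⟨G, hG, hGc⟩ := h.contU.exists_weakPartial
  obtain ⟨K, hK, hKc⟩ := h.contV.exists_weakPartial
  refine ⟨G, K, hG, hK, fun i => ⟨hGc i, hKc i, fun t₀ ht₀ => ?_, fun b hb t ht => ?_⟩⟩
  · rw [tendsto_sobolevNorm_iff]
    refine tendsto_of_tendsto_of_tendsto_of_le_of_le' tendsto_const_nhds
      (tendsto_sobolevNorm_iff.1 (h.deriv t₀ ht₀)) (Eventually.of_forall fun _ => bot_le) ?_
    filter_upwards [self_mem_nhdsWithin] with t ht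
    exact sobolevSq_weakPartial_le
      ((((hG i t ht.1).sub (hG i t₀ ht₀)).const_smul _).sub (hK i t₀ ht₀))
  · have h0 : (0 : ℝ) ∈ Set.Icc 0 T := ⟨le_rfl, ht.1.trans ht.2⟩
    have := h.eq (pd i b) (hb.pd i) t ht
    rw [(hK i t ht).integral_eq hb, (hK i 0 h0).integral_eq hb]
    have e : ∫ s in (0 : ℝ)..t, ∫ x, G i s x * lap b x =
        - ∫ s in (0 : ℝ)..t, ∫ x, U s x * lap (pd i b) x := by
      rw [← intervalIntegral.integral_neg]
      refine intervalIntegral.integral_congr fun s hs => ?_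
      rw [(hG i s (uIcc_zero_subset ht hs)).integral_eq (isTest_lap hb), pd_lap hb.smooth]
    rw [e]
    linarith

open scoped InnerProductSpace in
/-- Conservation of energy for weak solutions with data in `H¹ × L²`. -/
lemma IsMild.energy {c T : ℝ} (hT : 0 < T) {U V : ℝ → E3 → ℝ} (h : IsMild c T 0 U V)
    {G : Fin 3 → ℝ → E3 → ℝ} (hG : ∀ i, ∀ t ∈ Set.Icc 0 T, HasWeakPartial i (U t) (G i t))
    (hGc : ∀ i, ContInH 0 T (G i)) {t : ℝ} (ht : t ∈ Set.Icc 0 T) :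
    ‖toL2 (V t)‖ ^ 2 + c ^ 2 * ∑ i, ‖toL2 (G i t)‖ ^ 2 =
      ‖toL2 (V 0)‖ ^ 2 + c ^ 2 * ∑ i, ‖toL2 (G i 0)‖ ^ 2 ∧
    toL2 (U t) - toL2 (U 0) = ∫ τ in (0 : ℝ)..t, toL2 (V τ) := by
  have h0 : (0 : ℝ) ∈ Set.Icc 0 T := ⟨le_rfl, hT.le⟩
  have gi : ∀ i, ∀ s ∈ Set.Icc 0 T, ∀ t ∈ Set.Icc 0 T,
      IntervalIntegrable (fun τ => toL2 (G i τ)) volume s t := fun i s hs t ht =>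
    ((hGc i).continuousOn_toL2.mono
    (Set.ordConnected_Icc.uIcc_subset hs ht)).intervalIntegrable
  refine energy_of_hasDerivWithinAt hT h.contV.continuousOn_toL2
    (fun i => (hGc i).continuousOn_toL2)
    (fun t ht => h.deriv.hasDerivWithinAt_toL2 (fun t ht => (h.contU.1 t ht).memLp)
      (fun t ht => (h.contV.1 t ht).memLp) ht) (fun s hs t ht => ?_) ht
  -- the identity tested with `b ∈ C_c^∞`
  have test : ∀ b, IsTest b → ⟪toL2 (V t) - toL2 (V s), toL2 b⟫_ℝ =
      -c ^ 2 * ∑ i, ⟪∫ τ in s..t, toL2 (G i τ), toL2 (pd i b)⟫_ℝ := by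
    intro b hb
    have e1 : ∀ i, ⟪∫ τ in s..t, toL2 (G i τ), toL2 (pd i b)⟫_ℝ =
        ∫ τ in s..t, ∫ x, G i τ x * pd i b x := by
      intro i
      rw [real_inner_comm]
      have := (innerSL ℝ (toL2 (pd i b))).intervalIntegral_comp_comm (gi i s hs t ht)
      simp only [innerSL_apply_apply] at this
      rw [← this]
      refine intervalIntegral.integral_congr fun τ hτ => ?_
      rw [real_inner_comm, (hGc i).integral_mul_eq (hb.pd i) τ
        (Set.ordConnected_Icc.uIcc_subset hs ht hτ)]
    have e2 : ∀ τ ∈ Set.Icc 0 T, ∑ i, ∫ x, G i τ x * pd i b x = -∫ x, U τ x * lap b x := by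
      intro τ hτ
      simp only [fun i => (hG i τ hτ).integral_eq (hb.pd i)]
      rw [Finset.sum_neg_distrib, ← integral_finsetSum _ fun i _ =>
        (h.contU.1 τ hτ).integrable_mul_test ((hb.pd i).pd i)]
      simp only [lap, Finset.mul_sum]
    have e3 : ∑ i, ∫ τ in s..t, ∫ x, G i τ x * pd i b x =
        -∫ τ in s..t, ∫ x, U τ x * lap b x := by
      rw [← intervalIntegral.integral_finsetSum fun i _ =>
        (hGc i).intervalIntegrable_integral_mul (hb.pd i) hs ht, ← intervalIntegral.integral_neg]
      exact intervalIntegral.integral_congr fun τ hτ =>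
        e2 τ (Set.ordConnected_Icc.uIcc_subset hs ht hτ)
    have e4 : ∫ τ in s..t, ∫ x, U τ x * lap b x =
        (∫ τ in (0 : ℝ)..t, ∫ x, U τ x * lap b x) - ∫ τ in (0 : ℝ)..s, ∫ x, U τ x * lap b x :=
      (intervalIntegral.integral_interval_sub_left
        (h.contU.intervalIntegrable_integral_mul (isTest_lap hb) h0 ht)
        (h.contU.intervalIntegrable_integral_mul (isTest_lap hb) h0 hs)).symm
    simp only [e1]
    rw [e3, e4, inner_sub_left, ← h.contV.integral_mul_eq hb t ht,
      ← h.contV.integral_mul_eq hb s hs]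
    have a1 := h.eq b hb t ht
    have a2 := h.eq b hb s hs
    linarith
  -- both sides are continuous in `b` for the `H¹` norm, in which test functions are dense
  set W : E3 → ℝ := U t - U s with hW
  have hWm : MemH 1 W := (h.contU.1 t ht).sub (h.contU.1 s hs)
  have hWp : ∀ i, HasWeakPartial i W (G i t - G i s) := fun i => (hG i t ht).sub (hG i s hs)
  have : ∀ n : ℕ, ∃ b, IsTest b ∧ sobolevSq 1 (W - b) < ENNReal.ofReal (1 / ((n : ℝ) + 1)) := by
    intro n
    obtain ⟨b, hb, h1, _⟩ := exists_test_sobolevSq_sub_lt 1 hWm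
      (η := ENNReal.ofReal (1 / ((n : ℝ) + 1))) (by simpa using by positivity)
    exact ⟨b, hb, h1⟩
  choose b hb hbl using this
  have hlim : Tendsto (fun n => sobolevSq 1 (W - b n)) atTop (𝓝 0) := by
    have := ENNReal.tendsto_ofReal (tendsto_one_div_add_atTop_nhds_zero_nat (𝕜 := ℝ))
    rw [ENNReal.ofReal_zero] at this
    exact tendsto_of_tendsto_of_tendsto_of_le_of_le tendsto_const_nhds this (fun _ => bot_le)
      fun n => (hbl n).le
  have l1 : Tendsto (fun n => toL2 (b n)) atTop (𝓝 (toL2 W)) := by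
    have := tendsto_toL2_of_sobolevSq (Eventually.of_forall fun n => hWm.memLp.sub (hb n).memLp)
      hlim
    simp only [fun n => toL2_sub hWm.memLp (hb n).memLp] at this
    simpa using (tendsto_const_nhds (x := toL2 W)).sub this
  have l2 : ∀ i, Tendsto (fun n => toL2 (pd i (b n))) atTop (𝓝 (toL2 (G i t - G i s))) := by
    intro i
    have hGm : MemLp (G i t - G i s) 2 volume := ((hGc i).1 t ht).memLp.sub ((hGc i).1 s hs).memLp
    have hl : Tendsto (fun n => sobolevSq 0 ((G i t - G i s) - pd i (b n))) atTop (𝓝 0) :=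
      tendsto_of_tendsto_of_tendsto_of_le_of_le tendsto_const_nhds hlim (fun _ => bot_le)
        fun n => sobolevSq_weakPartial_le
          ((hWp i).sub (hasWeakPartial_of_contDiff (hb n).smooth i))
    have := tendsto_toL2_of_sobolevSq (Eventually.of_forall fun n => hGm.sub ((hb n).pd i).memLp) hl
    simp only [fun n => toL2_sub hGm ((hb n).pd i).memLp] at this
    simpa using (tendsto_const_nhds (x := toL2 (G i t - G i s))).sub this
  have r1 : Tendsto (fun n => ⟪toL2 (V t) - toL2 (V s), toL2 (b n)⟫_ℝ) atTop
      (𝓝 ⟪toL2 (V t) - toL2 (V s), toL2 W⟫_ℝ) := tendsto_const_nhds.inner l1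
  have r2 : Tendsto (fun n => -c ^ 2 * ∑ i, ⟪∫ τ in s..t, toL2 (G i τ), toL2 (pd i (b n))⟫_ℝ) atTop
      (𝓝 (-c ^ 2 * ∑ i, ⟪∫ τ in s..t, toL2 (G i τ), toL2 (G i t - G i s)⟫_ℝ)) :=
    (tendsto_finsetSum _ fun i _ => tendsto_const_nhds.inner (l2 i)).const_mul _
  have := tendsto_nhds_unique (r1.congr fun n => test (b n) (hb n)) r2
  rw [hW, toL2_sub (h.contU.1 t ht).memLp (h.contU.1 s hs).memLp] at this
  simp only [fun i => toL2_sub ((hGc i).1 t ht).memLp ((hGc i).1 s hs).memLp] at this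
  exact this

/-- The energy estimate in `H^{k+1} × H^k`. -/
lemma exists_sobolevSq_le_of_isMild {c T : ℝ} (hc : 0 < c) (hT : 0 < T) (k : ℕ) :
    ∃ C : ENNReal, C ≠ ⊤ ∧ ∀ U V : ℝ → E3 → ℝ, IsMild c T k U V → ∀ t ∈ Set.Icc 0 T,
      sobolevSq (k + 1) (U t) ≤ C * (sobolevSq (k + 1) (U 0) + sobolevSq k (V 0)) := by
  induction k with
  | zero =>
    set C : ℝ := 2 + (2 * T ^ 2 + (c ^ 2)⁻¹) * (1 + c ^ 2) with hC
    refine ⟨ENNReal.ofReal C, by simp, fun U V h t ht => ?_⟩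
    have h0 : (0 : ℝ) ∈ Set.Icc 0 T := ⟨le_rfl, hT.le⟩
    obtain ⟨G, hG, hGc⟩ := h.contU.exists_weakPartial
    have hs : ∀ t ∈ Set.Icc 0 T, sobolevSq (0 + 1) (U t) =
        ENNReal.ofReal (‖toL2 (U t)‖ ^ 2 + ∑ i, ‖toL2 (G i t)‖ ^ 2) := by
      intro t ht
      rw [sobolevSq_succ_eq fun i => hG i t ht, ENNReal.ofReal_add (by positivity) (by positivity),
        ofReal_norm_toL2_sq (h.contU.1 t ht).memLp,
        ENNReal.ofReal_sum_of_nonneg fun i _ => by positivity]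
      simp only [fun i => ofReal_norm_toL2_sq ((hGc i).1 t ht).memLp]
      rfl
    have hv : sobolevSq 0 (V 0) = ENNReal.ofReal (‖toL2 (V 0)‖ ^ 2) :=
      (ofReal_norm_toL2_sq (h.contV.1 0 h0).memLp).symm
    rw [hs t ht, hs 0 h0, hv, ← ENNReal.ofReal_add (by positivity) (by positivity),
      ← ENNReal.ofReal_mul (by positivity)]
    refine ENNReal.ofReal_le_ofReal ?_
    obtain ⟨en, fund⟩ := h.energy hT hG hGc ht
    set E : ℝ := ‖toL2 (V 0)‖ ^ 2 + c ^ 2 * ∑ i, ‖toL2 (G i 0)‖ ^ 2 with hE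
    have hE0 : 0 ≤ E := by positivity
    have hvb : ∀ τ ∈ Set.uIoc 0 t, ‖toL2 (V τ)‖ ≤ √E := by
      intro τ hτ
      have := (h.energy hT hG hGc (uIcc_zero_subset ht (Set.uIoc_subset_uIcc hτ))).1
      refine Real.le_sqrt_of_sq_le ?_
      rw [hE, ← this]
      have : 0 ≤ c ^ 2 * ∑ i, ‖toL2 (G i τ)‖ ^ 2 := by positivity
      linarith
    have hi := intervalIntegral.norm_integral_le_of_norm_le_const hvb
    rw [← fund, sub_zero, abs_of_nonneg ht.1] at hi
    have h1 : ‖toL2 (U t)‖ ≤ ‖toL2 (U 0)‖ + √E * t := by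
      have := norm_add_le (toL2 (U 0)) (toL2 (U t) - toL2 (U 0))
      rw [add_sub_cancel] at this
      linarith
    have h2 : ‖toL2 (U t)‖ ^ 2 ≤ 2 * ‖toL2 (U 0)‖ ^ 2 + 2 * T ^ 2 * E := by
      have hsq : √E ^ 2 = E := Real.sq_sqrt hE0
      have ht2 : t ^ 2 ≤ T ^ 2 := by nlinarith [ht.1, ht.2]
      have : ‖toL2 (U t)‖ ^ 2 ≤ (‖toL2 (U 0)‖ + √E * t) ^ 2 :=
        pow_le_pow_left₀ (norm_nonneg _) h1 2
      have h3 : (√E * t) ^ 2 ≤ T ^ 2 * E := by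
        rw [mul_pow, hsq, mul_comm]; exact mul_le_mul_of_nonneg_right ht2 hE0
      nlinarith [sq_nonneg (‖toL2 (U 0)‖ - √E * t)]
    have h3 : ∑ i, ‖toL2 (G i t)‖ ^ 2 ≤ (c ^ 2)⁻¹ * E := by
      rw [le_inv_mul_iff₀ (by positivity)]
      nlinarith [sq_nonneg ‖toL2 (V t)‖]
    have h4 : E ≤ (1 + c ^ 2) * (‖toL2 (V 0)‖ ^ 2 + ∑ i, ‖toL2 (G i 0)‖ ^ 2) := by
      have : 0 ≤ ∑ i, ‖toL2 (G i 0)‖ ^ 2 := by positivity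
      nlinarith [mul_nonneg (sq_nonneg c) (sq_nonneg ‖toL2 (V 0)‖)]
    have h5 : (2 * T ^ 2 + (c ^ 2)⁻¹) * E ≤ (2 * T ^ 2 + (c ^ 2)⁻¹) *
        ((1 + c ^ 2) * (‖toL2 (V 0)‖ ^ 2 + ∑ i, ‖toL2 (G i 0)‖ ^ 2)) :=
      mul_le_mul_of_nonneg_left h4 (by positivity)
    have h6 : 0 ≤ (2 * T ^ 2 + (c ^ 2)⁻¹) * (1 + c ^ 2) * ‖toL2 (U 0)‖ ^ 2 := by positivity
    have h7 : 0 ≤ ∑ i, ‖toL2 (G i 0)‖ ^ 2 := by positivity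
    rw [hC]
    nlinarith [sq_nonneg ‖toL2 (V 0)‖]
  | succ k ih =>
    obtain ⟨C, hCt, hC⟩ := ih
    refine ⟨C + ∑ _i : Fin 3, C, by simp [ENNReal.add_eq_top, ENNReal.mul_eq_top, hCt],
      fun U V h t ht => ?_⟩
    have h0 : (0 : ℝ) ∈ Set.Icc 0 T := ⟨le_rfl, hT.le⟩
    obtain ⟨G, K, hG, hK, hGK⟩ := h.exists_weakPartial
    rw [sobolevSq_succ_eq fun i => hG i t ht, add_mul, Finset.sum_mul]
    refine add_le_add ?_ (Finset.sum_le_sum fun i _ => ?_)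
    · refine (eLpNorm_sq_le_sobolevSq (k + 1) _).trans ((hC U V h.of_succ t ht).trans ?_)
      gcongr
      · exact sobolevSq_le_succ _ _
      · exact sobolevSq_le_succ _ _
    · refine (hC _ _ (hGK i) t ht).trans ?_
      gcongr
      · exact sobolevSq_weakPartial_le (hG i 0 h0)
      · exact sobolevSq_weakPartial_le (hK i 0 h0)

/-! ### Radial functions: weak derivatives and norms in terms of the profile -/

lemma hasFDerivAt_norm {x : E3} (hx : x ≠ 0) :
    HasFDerivAt (fun y : E3 => ‖y‖) (‖x‖⁻¹ • innerSL ℝ x) x := by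
  have h1 := (hasStrictFDerivAt_norm_sq x).hasFDerivAt
  have h2 := h1.sqrt (by positivity)
  have e : (fun y : E3 => √(‖y‖ ^ 2)) = fun y => ‖y‖ := by
    funext y; exact Real.sqrt_sq (norm_nonneg y)
  rw [e, Real.sqrt_sq (norm_nonneg x)] at h2
  refine h2.congr_fderiv ?_
  ext v
  have : ‖x‖ ≠ 0 := norm_ne_zero_iff.2 hx
  simp
  field_simp

lemma inner_single (x : E3) (i : Fin 3) :
    inner ℝ x (EuclideanSpace.single i (1 : ℝ)) = x i := by
  rw [EuclideanSpace.inner_single_right]; simp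

lemma hasFDerivAt_comp_norm {h : ℝ → ℝ} {h' : ℝ} {x : E3} (hx : x ≠ 0)
    (hh : HasDerivAt h h' ‖x‖) :
    HasFDerivAt (fun y : E3 => h ‖y‖) (h' • ‖x‖⁻¹ • innerSL ℝ x) x :=
  hh.comp_hasFDerivAt x (hasFDerivAt_norm hx)

lemma pd_comp_norm {h : ℝ → ℝ} {h' : ℝ} {x : E3} (hx : x ≠ 0) (hh : HasDerivAt h h' ‖x‖)
    (i : Fin 3) : pd i (fun y => h ‖y‖) x = h' * (x i / ‖x‖) := by
  rw [pd, (hasFDerivAt_comp_norm hx hh).fderiv]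
  simp only [smul_apply, innerSL_apply_apply, inner_single, smul_eq_mul]
  ring

/-- The radial function with profile `h` is weakly differentiable, with radial derivative `h'`. -/
def HasRadialDeriv (h h' : ℝ → ℝ) : Prop :=
  ∀ i, HasWeakPartial i (fun x => h ‖x‖) (fun x => h' ‖x‖ * (x i / ‖x‖))

lemma abs_apply_div_norm_le (x : E3) (i : Fin 3) : |x i / ‖x‖| ≤ 1 := by
  rw [abs_div, abs_norm]
  refine div_le_one_of_le₀ ?_ (norm_nonneg _)
  exact PiLp.norm_apply_le x i

lemma ae_norm_ne (a : ℝ) : ∀ᵐ x : E3, ‖x‖ ≠ a := by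
  have := Measure.addHaar_sphere (volume : Measure E3) 0 a
  rw [measure_eq_zero_iff_ae_notMem] at this
  filter_upwards [this] with x hx
  simpa using hx

lemma ae_norm_pos : ∀ᵐ x : E3, 0 < ‖x‖ := by
  filter_upwards [ae_norm_ne 0] with x hx
  exact lt_of_le_of_ne (norm_nonneg x) (Ne.symm hx)

/-- Lipschitz profiles that are differentiable off one point are weakly differentiable. -/
lemma hasRadialDeriv_of_lipschitzWith {h h' : ℝ → ℝ} {C : NNReal} {ε : ℝ}
    (hl : LipschitzWith C h) (hd : ∀ r, 0 < r → r ≠ ε → HasDerivAt h (h' r) r) :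
    HasRadialDeriv h h' := by
  intro i
  set F : E3 → ℝ := fun x => h ‖x‖ with hF
  have hFl : LipschitzWith (C * 1) F := hl.comp lipschitzWith_one_norm
  have hae : ∀ᵐ x : E3, lineDeriv ℝ F x (EuclideanSpace.single i 1) =
      h' ‖x‖ * (x i / ‖x‖) := by
    filter_upwards [ae_norm_pos, ae_norm_ne ε] with x h0 h1
    have hx : x ≠ 0 := norm_pos_iff.1 h0
    have := hasFDerivAt_comp_norm hx (hd _ h0 h1)
    rw [this.differentiableAt.lineDeriv_eq_fderiv]
    exact pd_comp_norm hx (hd _ h0 h1) i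
  refine ⟨hFl.continuous.locallyIntegrable,
    (hFl.locallyIntegrable_lineDeriv _).congr hae, fun η h1 h2 => ?_⟩
  have t : IsTest η := ⟨h1, h2⟩
  obtain ⟨D, hD⟩ := h1.lipschitzWith_of_hasCompactSupport h2 (by simp)
  have key := hFl.integral_lineDeriv_mul_eq (μ := volume) hD h2 (EuclideanSpace.single i (1 : ℝ))
  have e1 : ∫ x, lineDeriv ℝ F x (EuclideanSpace.single i 1) * η x =
      ∫ x, h' ‖x‖ * (x i / ‖x‖) * η x :=
    integral_congr_ae (by filter_upwards [hae] with x hx; rw [hx])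
  have e2 : ∫ x, lineDeriv ℝ η x (-(EuclideanSpace.single i (1 : ℝ))) * F x =
      - ∫ x, F x * fderiv ℝ η x (EuclideanSpace.single i 1) := by
    rw [← integral_neg]
    refine integral_congr_ae (Eventually.of_forall fun x => ?_)
    simp only
    rw [(h1.differentiable (by simp) x).lineDeriv_eq_fderiv, map_neg]
    ring
  rw [e1, e2] at key
  rw [key, neg_neg]

lemma HasRadialDeriv.sub {h h' g g' : ℝ → ℝ} (hh : HasRadialDeriv h h')
    (hg : HasRadialDeriv g g') :
    HasRadialDeriv (fun r => h r - g r) (fun r => h' r - g' r) := by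
  intro i
  have := (hh i).sub (hg i)
  refine this.congr (EventuallyEq.refl _ _) (Eventually.of_forall fun x => ?_)
  simp only [Pi.sub_apply]; ring

lemma HasRadialDeriv.const_mul {h h' : ℝ → ℝ} (hh : HasRadialDeriv h h') (a : ℝ) :
    HasRadialDeriv (fun r => a * h r) (fun r => a * h' r) := by
  intro i
  have := (hh i).const_smul a
  refine this.congr (EventuallyEq.refl _ _) (Eventually.of_forall fun x => ?_)
  simp only [Pi.smul_apply, smul_eq_mul]; ring

lemma HasRadialDeriv.weakPartial {h k : ℝ → ℝ} (hh : HasRadialDeriv h fun r => r * k r)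
    (i : Fin 3) : HasWeakPartial i (fun x => h ‖x‖) (fun x => x i * k ‖x‖) := by
  refine (hh i).congr (EventuallyEq.refl _ _) ?_
  filter_upwards [ae_norm_pos] with x hx
  field_simp

lemma pd_coord (i j : Fin 3) (x : E3) : pd j (fun x : E3 => x i) x = if i = j then 1 else 0 := by
  have : HasFDerivAt (fun x : E3 => x i) (EuclideanSpace.proj i : E3 →L[ℝ] ℝ) x :=
    (EuclideanSpace.proj i : E3 →L[ℝ] ℝ).hasFDerivAt
  rw [pd, this.fderiv]
  simp

lemma contDiff_coord (i : Fin 3) : ContDiff ℝ ∞ (fun x : E3 => x i) :=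
  (EuclideanSpace.proj i : E3 →L[ℝ] ℝ).contDiff

/-- Second weak derivatives of a radial function whose profile has derivative `r k(r)`. -/
lemma HasRadialDeriv.weakPartial_weakPartial {k k' : ℝ → ℝ} (hk : HasRadialDeriv k k')
    (i j : Fin 3) : HasWeakPartial j (fun x : E3 => x i * k ‖x‖)
      (fun x => x i * (k' ‖x‖ * (x j / ‖x‖)) + (if i = j then 1 else 0) * k ‖x‖) := by
  refine ((hk j).smooth_mul (contDiff_coord i)).congr (EventuallyEq.refl _ _)
    (Eventually.of_forall fun x => ?_)
  simp only [pd_coord]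

/-- The square of the `L²(ℝ³)`-norm of the radial function with profile `g`. -/
noncomputable def radSq (g : ℝ → ℝ) : ENNReal := ∫⁻ x : E3, ‖g ‖x‖‖ₑ ^ 2

lemma radSq_eq (g : ℝ → ℝ) : radSq g = eLpNorm (fun x : E3 => g ‖x‖) 2 volume ^ 2 :=
  (eLpNorm_sq_eq _).symm

lemma eLpNorm_sq_le_radSq {f : E3 → ℝ} {g : ℝ → ℝ} (H : ∀ x, |f x| ≤ |g ‖x‖|) :
    eLpNorm f 2 volume ^ 2 ≤ radSq g := by
  rw [eLpNorm_sq_eq]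
  refine lintegral_mono fun x => ?_
  simp only [enorm_sq_eq_ofReal]
  exact ENNReal.ofReal_le_ofReal (sq_le_sq.2 (H x))

lemma sobolevSq_one_radial_le {h h' : ℝ → ℝ} (hh : HasRadialDeriv h h') :
    sobolevSq 1 (fun x => h ‖x‖) ≤ radSq h + 3 * radSq h' := by
  rw [sobolevSq_succ_eq hh]
  refine add_le_add (radSq_eq h).ge ?_
  calc _ ≤ ∑ _i : Fin 3, radSq h' := Finset.sum_le_sum fun i _ => eLpNorm_sq_le_radSq fun x => by
        rw [abs_mul]
        exact mul_le_of_le_one_right (abs_nonneg _) (abs_apply_div_norm_le x i)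
    _ = _ := by simp

lemma abs_apply_le (x : E3) (i : Fin 3) : |x i| ≤ ‖x‖ := PiLp.norm_apply_le x i

lemma sobolevSq_two_radial_le {h k k' : ℝ → ℝ} (hh : HasRadialDeriv h fun r => r * k r)
    (hk : HasRadialDeriv k k') :
    sobolevSq 2 (fun x => h ‖x‖) ≤ radSq h + 3 * (radSq (fun r => r * k r) +
      3 * (2 * radSq (fun r => r * k' r) + 2 * radSq k)) := by
  rw [sobolevSq_succ_eq hh.weakPartial]
  refine add_le_add (radSq_eq h).ge ?_
  calc _ ≤ ∑ _i : Fin 3, (radSq (fun r => r * k r) +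
        3 * (2 * radSq (fun r => r * k' r) + 2 * radSq k)) := Finset.sum_le_sum fun i _ => ?_
    _ = _ := by
        rw [Finset.sum_const]
        simp only [Finset.card_univ, Fintype.card_fin, nsmul_eq_mul, Nat.cast_ofNat]
  rw [sobolevSq_succ_eq fun j => hk.weakPartial_weakPartial i j]
  refine add_le_add (eLpNorm_sq_le_radSq fun x => ?_) ?_
  · rw [abs_mul, abs_mul, abs_norm]
    exact mul_le_mul_of_nonneg_right (abs_apply_le x i) (abs_nonneg _)
  calc _ ≤ ∑ _j : Fin 3, (2 * radSq (fun r => r * k' r) + 2 * radSq k) :=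
        Finset.sum_le_sum fun j _ => ?_
    _ = _ := by
        rw [Finset.sum_const]
        simp only [Finset.card_univ, Fintype.card_fin, nsmul_eq_mul, Nat.cast_ofNat]
  have hm : AEStronglyMeasurable (fun x : E3 => x i * (k' ‖x‖ * (x j / ‖x‖))) volume :=
    (contDiff_coord i).continuous.aestronglyMeasurable.mul (hk j).2.1.aestronglyMeasurable
  refine (eLpNorm_sq_add_le (f := fun x : E3 => x i * (k' ‖x‖ * (x j / ‖x‖)))
    (g := fun x => (if i = j then 1 else 0) * k ‖x‖) hm).trans ?_
  gcongr
  · refine eLpNorm_sq_le_radSq fun x => ?_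
    rw [abs_mul, abs_mul, abs_mul, abs_norm]
    refine mul_le_mul (abs_apply_le x i) ?_ (by positivity) (norm_nonneg _)
    exact mul_le_of_le_one_right (abs_nonneg _) (abs_apply_div_norm_le x j)
  · refine eLpNorm_sq_le_radSq fun x => ?_
    split_ifs <;> simp

lemma radSq_le_of_bound {g : ℝ → ℝ} {M R : ℝ} (hM : ∀ r, 0 < r → |g r| ≤ M)
    (hR : ∀ r, R < r → g r = 0) :
    radSq g ≤ ENNReal.ofReal (M ^ 2) * volume (Metric.closedBall (0 : E3) R) := by
  rw [← lintegral_indicator_const Metric.isClosed_closedBall.measurableSet]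
  refine lintegral_mono_ae ?_
  filter_upwards [ae_norm_pos] with x hx
  by_cases h : ‖x‖ ≤ R
  · rw [Set.indicator_of_mem (by simpa using h), enorm_sq_eq_ofReal]
    exact ENNReal.ofReal_le_ofReal (sq_le_sq' (by linarith [(abs_le.1 (hM _ hx)).1])
      (abs_le.1 (hM _ hx)).2)
  · rw [hR _ (not_le.1 h)]; simp

/-- Polar coordinates: a pointwise bound `r² g(r)² ≤ Θ(r)` controls the norm. -/
lemma radSq_le_of_sq_mul_sq_le {g Θ : ℝ → ℝ} (hΘ : IntegrableOn Θ (Set.Ioi 0))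
    (h : ∀ r, 0 < r → r ^ 2 * g r ^ 2 ≤ Θ r) :
    radSq g ≤ ENNReal.ofReal
      (3 * (volume : Measure E3).real (Metric.ball 0 1) * ∫ r in Set.Ioi 0, Θ r) := by
  set f : ℝ → ℝ := fun r => Θ r / r ^ 2 with hf
  have hfr : Set.EqOn (fun y : ℝ => y ^ (Module.finrank ℝ E3 - 1) • f y) Θ (Set.Ioi 0) := by
    intro r hr
    have : r ≠ 0 := (Set.mem_Ioi.1 hr).ne'
    simp only [hf, finrank_euclideanSpace, Fintype.card_fin, smul_eq_mul]
    field_simp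
    ring
  have hi : Integrable (fun x : E3 => f ‖x‖) volume := by
    rw [integrable_fun_norm_addHaar]
    exact hΘ.congr_fun hfr.symm measurableSet_Ioi
  have hle : ∀ r, 0 < r → g r ^ 2 ≤ f r := by
    intro r hr
    simp only [hf]
    rw [le_div_iff₀ (by positivity)]
    linarith [h r hr]
  calc radSq g ≤ ∫⁻ x : E3, ENNReal.ofReal (f ‖x‖) := by
        refine lintegral_mono_ae ?_
        filter_upwards [ae_norm_pos] with x hx
        rw [enorm_sq_eq_ofReal]
        exact ENNReal.ofReal_le_ofReal (hle _ hx)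
    _ = ENNReal.ofReal (∫ x : E3, f ‖x‖) := by
        rw [ofReal_integral_eq_lintegral_ofReal hi]
        filter_upwards [ae_norm_pos] with x hx
        exact (sq_nonneg _).trans (hle _ hx)
    _ = _ := by
        rw [integral_fun_norm_addHaar, setIntegral_congr_fun measurableSet_Ioi hfr]
        simp only [finrank_euclideanSpace, Fintype.card_fin, smul_eq_mul, nsmul_eq_mul]
        push_cast
        ring_nf

/-- The profile `h(max r ε)`, which is constant for `r ≤ ε`. -/
lemma hasRadialDeriv_max {h h' : ℝ → ℝ} {ε C : ℝ}
    (hd : ∀ r, ε ≤ r → HasDerivAt h (h' r) r) (hC : ∀ r, ε ≤ r → |h' r| ≤ C) :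
    HasRadialDeriv (fun r => h (max r ε)) (fun r => if ε < r then h' r else 0) := by
  have hC0 : 0 ≤ C := (abs_nonneg _).trans (hC ε le_rfl)
  have hl : LipschitzOnWith C.toNNReal h (Set.Ici ε) :=
    (convex_Ici ε).lipschitzOnWith_of_nnnorm_hasDerivWithin_le
      (fun r hr => (hd r hr).hasDerivWithinAt) fun r hr => by
        rw [← NNReal.coe_le_coe, Real.coe_toNNReal C hC0]; exact hC r hr
  have hl2 : LipschitzWith (C.toNNReal * 1) (fun r => h (max r ε)) := by
    have hm : LipschitzWith 1 fun r : ℝ => max r ε := LipschitzWith.id.max_const ε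
    have := hl.comp (hm.lipschitzOnWith (s := Set.univ)) fun r _ => le_max_right r ε
    rwa [lipschitzOnWith_univ] at this
  refine hasRadialDeriv_of_lipschitzWith (ε := ε) hl2 fun r _ hr => ?_
  rcases lt_or_gt_of_ne hr with h1 | h1
  · rw [if_neg h1.not_gt]
    refine (hasDerivAt_const r (h ε)).congr_of_eventuallyEq ?_
    filter_upwards [gt_mem_nhds h1] with s hs
    rw [max_eq_right hs.le]
  · rw [if_pos h1]
    refine (hd r h1.le).congr_of_eventuallyEq ?_
    filter_upwards [lt_mem_nhds h1] with s hs
    rw [max_eq_left hs.le]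

/-! ### Curves of radial functions -/

/-- A time-dependent profile on `[0, T]`, bounded and supported in `r ≤ R` at each time, that
depends continuously on time in the supremum norm. -/
structure ProfileCurve (T R : ℝ) (h : ℝ → ℝ → ℝ) : Prop where
  zero : ∀ t ∈ Set.Icc 0 T, ∀ r, R < r → h t r = 0
  bdd : ∀ t ∈ Set.Icc 0 T, ∃ M, ∀ r, 0 < r → |h t r| ≤ M
  cont : ∀ t₀ ∈ Set.Icc 0 T, ∀ δ, 0 < δ → ∀ᶠ t in 𝓝[Set.Icc 0 T] t₀, ∀ r, 0 < r →
    |h t r - h t₀ r| ≤ δ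

lemma ProfileCurve.radSq_lt_top {T R : ℝ} {h : ℝ → ℝ → ℝ} (hh : ProfileCurve T R h) {t : ℝ}
    (ht : t ∈ Set.Icc 0 T) : radSq (h t) < ⊤ := by
  obtain ⟨M, hM⟩ := hh.bdd t ht
  exact (radSq_le_of_bound hM (hh.zero t ht)).trans_lt
    (ENNReal.mul_lt_top (by simp) measure_closedBall_lt_top)

/-- Uniformly small profiles with common support have small norm. -/
lemma tendsto_radSq_of_uniform {α : Type*} {l : Filter α} {R : ℝ} {g : α → ℝ → ℝ}
    (h0 : ∀ᶠ a in l, ∀ r, R < r → g a r = 0)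
    (h1 : ∀ δ, 0 < δ → ∀ᶠ a in l, ∀ r, 0 < r → |g a r| ≤ δ) :
    Tendsto (fun a => radSq (g a)) l (𝓝 0) := by
  rw [ENNReal.tendsto_nhds_zero]
  intro η hη
  have hlim : Tendsto (fun δ : ℝ => ENNReal.ofReal (δ ^ 2) *
      volume (Metric.closedBall (0 : E3) R)) (𝓝[>] 0) (𝓝 0) := by
    have : Tendsto (fun δ : ℝ => ENNReal.ofReal (δ ^ 2)) (𝓝[>] 0) (𝓝 0) := by
      have h2 : Tendsto (fun δ : ℝ => δ ^ 2) (𝓝[>] 0) (𝓝 (0 ^ 2)) :=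
        ((continuous_pow 2).tendsto 0).mono_left nhdsWithin_le_nhds
      simpa using ENNReal.tendsto_ofReal h2
    simpa using ENNReal.Tendsto.mul_const this
      (Or.inr (measure_closedBall_lt_top (μ := (volume : Measure E3)) (x := 0) (r := R)).ne)
  obtain ⟨δ, hδ, hδ0⟩ := ((hlim.eventually (ge_mem_nhds hη)).and self_mem_nhdsWithin).exists
  filter_upwards [h0, h1 δ hδ0] with a ha hb
  exact (radSq_le_of_bound hb ha).trans hδ

lemma ProfileCurve.tendsto_radSq {T R : ℝ} {h : ℝ → ℝ → ℝ} (hh : ProfileCurve T R h) {t₀ : ℝ}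
    (ht₀ : t₀ ∈ Set.Icc 0 T) :
    Tendsto (fun t => radSq (fun r => h t r - h t₀ r)) (𝓝[Set.Icc 0 T] t₀) (𝓝 0) := by
  refine tendsto_radSq_of_uniform (R := R) ?_ (hh.cont t₀ ht₀)
  filter_upwards [self_mem_nhdsWithin] with t ht r hr
  rw [hh.zero t ht r hr, hh.zero t₀ ht₀ r hr, sub_zero]

lemma tendsto_zero_of_le_radSq {α : Type*} {l : Filter α} {f a b c d : α → ENNReal}
    (ha : Tendsto a l (𝓝 0)) (hb : Tendsto b l (𝓝 0)) (hc : Tendsto c l (𝓝 0))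
    (hd : Tendsto d l (𝓝 0))
    (h : ∀ᶠ x in l, f x ≤ a x + 3 * (b x + 3 * (2 * c x + 2 * d x))) : Tendsto f l (𝓝 0) := by
  have m : ∀ (u : ENNReal) {g : α → ENNReal}, u ≠ ⊤ → Tendsto g l (𝓝 0) →
      Tendsto (fun x => u * g x) l (𝓝 0) := fun u g hu hg => by
    simpa using ENNReal.Tendsto.const_mul hg (Or.inr hu)
  have p : ∀ {g g' : α → ENNReal}, Tendsto g l (𝓝 0) → Tendsto g' l (𝓝 0) →
      Tendsto (fun x => g x + g' x) l (𝓝 0) := fun hg hg' => by simpa using hg.add hg'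
  have h1 := p ha (m 3 (by simp) (p hb (m 3 (by simp) (p (m 2 (by simp) hc)
    (m 2 (by simp) hd)))))
  exact tendsto_of_tendsto_of_tendsto_of_le_of_le' tendsto_const_nhds
    h1 (Eventually.of_forall fun _ => bot_le) h

lemma contInH_one_of_profile {T R : ℝ} {h h' : ℝ → ℝ → ℝ}
    (hd : ∀ t ∈ Set.Icc 0 T, HasRadialDeriv (h t) (h' t)) (c0 : ProfileCurve T R h)
    (c1 : ProfileCurve T R h') : ContInH 1 T (fun t x => h t ‖x‖) := by
  refine ⟨fun t ht => memH_iff.2 ⟨(hd t ht 0).1.aestronglyMeasurable, ?_⟩, fun t₀ ht₀ => ?_⟩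
  · refine (sobolevSq_one_radial_le (hd t ht)).trans_lt (ENNReal.add_lt_top.2
      ⟨c0.radSq_lt_top ht, ENNReal.mul_lt_top (by simp) (c1.radSq_lt_top ht)⟩)
  · rw [tendsto_sobolevNorm_iff]
    refine tendsto_zero_of_le_radSq (c0.tendsto_radSq ht₀) (c1.tendsto_radSq ht₀)
      tendsto_const_nhds tendsto_const_nhds ?_
    filter_upwards [self_mem_nhdsWithin] with t ht
    have := sobolevSq_one_radial_le ((hd t ht).sub (hd t₀ ht₀))
    change sobolevSq 1 (fun x => h t ‖x‖ - h t₀ ‖x‖) ≤ _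
    simpa using this

lemma contInH_two_of_profile {T R : ℝ} {h k k' : ℝ → ℝ → ℝ}
    (hd : ∀ t ∈ Set.Icc 0 T, HasRadialDeriv (h t) (fun r => r * k t r))
    (hd' : ∀ t ∈ Set.Icc 0 T, HasRadialDeriv (k t) (k' t)) (c0 : ProfileCurve T R h)
    (c1 : ProfileCurve T R fun t r => r * k t r) (c2 : ProfileCurve T R k)
    (c3 : ProfileCurve T R fun t r => r * k' t r) : ContInH 2 T (fun t x => h t ‖x‖) := by
  refine ⟨fun t ht => memH_iff.2 ⟨(hd t ht 0).1.aestronglyMeasurable, ?_⟩, fun t₀ ht₀ => ?_⟩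
  · refine (sobolevSq_two_radial_le (hd t ht) (hd' t ht)).trans_lt ?_
    have h0 := c0.radSq_lt_top ht
    have h1 := c1.radSq_lt_top ht
    have h2 := c2.radSq_lt_top ht
    have h3 := c3.radSq_lt_top ht
    have m : ∀ {u v : ENNReal}, u ≠ ⊤ → v < ⊤ → u * v < ⊤ := fun hu hv =>
      ENNReal.mul_lt_top hu.lt_top hv
    exact ENNReal.add_lt_top.2 ⟨h0, m (by simp) (ENNReal.add_lt_top.2 ⟨h1, m (by simp)
      (ENNReal.add_lt_top.2 ⟨m (by simp) h3, m (by simp) h2⟩)⟩)⟩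
  · rw [tendsto_sobolevNorm_iff]
    refine tendsto_zero_of_le_radSq (c0.tendsto_radSq ht₀) (c1.tendsto_radSq ht₀)
      (c3.tendsto_radSq ht₀) (c2.tendsto_radSq ht₀) ?_
    filter_upwards [self_mem_nhdsWithin] with t ht
    have h1 : HasRadialDeriv (fun r => h t r - h t₀ r) (fun r => r * (k t r - k t₀ r)) := by
      have := (hd t ht).sub (hd t₀ ht₀)
      simpa only [← mul_sub] using this
    have := sobolevSq_two_radial_le h1 ((hd' t ht).sub (hd' t₀ ht₀))
    change sobolevSq 2 (fun x => h t ‖x‖ - h t₀ ‖x‖) ≤ _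
    simpa only [mul_sub] using this

/-- Profiles read off from a jointly continuous function on a compact rectangle. -/
lemma profileCurve_of_continuousOn {T R a b : ℝ} {F : ℝ × ℝ → ℝ} {h : ℝ → ℝ → ℝ}
    (hF : ContinuousOn F (Set.Icc 0 T ×ˢ Set.Icc a b))
    (hz : ∀ t ∈ Set.Icc 0 T, ∀ r, R < r → h t r = 0)
    (hh : ∀ r, 0 < r → (∀ t ∈ Set.Icc 0 T, h t r = 0) ∨
      ∃ r' ∈ Set.Icc a b, ∀ t ∈ Set.Icc 0 T, h t r = F (t, r')) : ProfileCurve T R h := by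
  have hK : IsCompact (Set.Icc 0 T ×ˢ Set.Icc a b) := isCompact_Icc.prod isCompact_Icc
  refine ⟨hz, fun t ht => ?_, fun t₀ ht₀ δ hδ => ?_⟩
  · obtain ⟨M, hM⟩ := hK.exists_bound_of_continuousOn hF
    refine ⟨max M 0, fun r hr => ?_⟩
    rcases hh r hr with h1 | ⟨r', hr', h1⟩
    · rw [h1 t ht]; simp
    · rw [h1 t ht]
      exact (hM (t, r') ⟨ht, hr'⟩).trans (le_max_left _ _)
  · have hu := hK.uniformContinuousOn_of_continuous hF
    rw [Metric.uniformContinuousOn_iff] at hu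
    obtain ⟨ρ, hρ, hu⟩ := hu δ hδ
    have hball : Metric.ball t₀ ρ ∈ 𝓝[Set.Icc 0 T] t₀ :=
      mem_nhdsWithin_of_mem_nhds (Metric.ball_mem_nhds t₀ hρ)
    filter_upwards [self_mem_nhdsWithin, hball] with t ht htρ r hr
    rcases hh r hr with h1 | ⟨r', hr', h1⟩
    · rw [h1 t ht, h1 t₀ ht₀]; simpa using hδ.le
    · rw [h1 t ht, h1 t₀ ht₀]
      have := hu (t, r') ⟨ht, hr'⟩ (t₀, r') ⟨ht₀, hr'⟩ (by
        rw [Prod.dist_eq, dist_self]; exact max_lt htρ hρ)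
      exact this.le

/-! ### Weighted averages over `[-1, 1]` -/

/-- Smooth compactly supported functions on the line. -/
structure IsLineTest (κ : ℝ → ℝ) : Prop where
  smooth : ContDiff ℝ ∞ κ
  compact : HasCompactSupport κ

lemma IsLineTest.deriv {κ : ℝ → ℝ} (h : IsLineTest κ) : IsLineTest (deriv κ) :=
  ⟨(contDiff_infty_iff_deriv.1 h.smooth).2, h.compact.deriv⟩

lemma IsLineTest.hasDerivAt {κ : ℝ → ℝ} (h : IsLineTest κ) (x : ℝ) :
    HasDerivAt κ (_root_.deriv κ x) x :=
  ((contDiff_infty_iff_deriv.1 h.smooth).1 x).hasDerivAt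

lemma IsLineTest.continuous {κ : ℝ → ℝ} (h : IsLineTest κ) : Continuous κ := h.smooth.continuous

lemma IsLineTest.exists_bound {κ : ℝ → ℝ} (h : IsLineTest κ) : ∃ M, 0 ≤ M ∧ ∀ x, |κ x| ≤ M := by
  obtain ⟨M, hM⟩ := h.continuous.bounded_above_of_compact_support h.compact
  exact ⟨M, (abs_nonneg _).trans (hM 0), hM⟩

lemma abs_sub_le_of_abs_deriv_le {f f' : ℝ → ℝ} {M : ℝ} (hf : ∀ x, HasDerivAt f (f' x) x)
    (hM : ∀ x, |f' x| ≤ M) (x y : ℝ) : |f x - f y| ≤ M * |x - y| :=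
  Convex.norm_image_sub_le_of_norm_hasDerivWithin_le (s := Set.univ)
    (fun x _ => (hf x).hasDerivWithinAt) (fun x _ => hM x) convex_univ trivial trivial

lemma IsLineTest.abs_sub_le {κ : ℝ → ℝ} (h : IsLineTest κ) {M : ℝ}
    (hM : ∀ x, |_root_.deriv κ x| ≤ M) (x y : ℝ) : |κ x - κ y| ≤ M * |x - y| :=
  abs_sub_le_of_abs_deriv_le h.hasDerivAt hM x y

lemma IsLineTest.abs_sub_sub_le {κ : ℝ → ℝ} (h : IsLineTest κ) {M : ℝ}
    (hM : ∀ x, |_root_.deriv (_root_.deriv κ) x| ≤ M) (x y : ℝ) :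
    |κ x - κ y - (x - y) * _root_.deriv κ y| ≤ M * |x - y| ^ 2 := by
  have hf : ∀ z, HasDerivAt (fun z => κ z - (z - y) * _root_.deriv κ y)
      (_root_.deriv κ z - _root_.deriv κ y) z := fun z => by
    have := (h.hasDerivAt z).sub (((hasDerivAt_id z).sub_const y).mul_const (_root_.deriv κ y))
    exact this.congr_deriv (by ring)
  have := Convex.norm_image_sub_le_of_norm_hasDerivWithin_le (s := Set.uIcc y x)
    (C := M * |x - y|) (fun z _ => (hf z).hasDerivWithinAt) (fun z hz => by
      refine (h.deriv.abs_sub_le hM z y).trans ?_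
      refine mul_le_mul_of_nonneg_left ?_ ((abs_nonneg _).trans (hM 0))
      exact Set.abs_sub_left_of_mem_uIcc hz) (convex_uIcc y x) Set.left_mem_uIcc Set.right_mem_uIcc
  simp only [Real.norm_eq_abs] at this
  calc _ = |κ x - (x - y) * _root_.deriv κ y - (κ y - (y - y) * _root_.deriv κ y)| := by
        congr 1; ring
    _ ≤ _ := this.trans_eq (by ring)

/-- `∫ κ(τ + r s) (1 - s²)^m ds` over `-1 ≤ s ≤ 1`. For `m = 0` this is
`(K(τ + r) - K(τ - r)) / r` with `K' = κ`, continued smoothly to `r = 0`. -/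
noncomputable def wavg (m : ℕ) (κ : ℝ → ℝ) (τ r : ℝ) : ℝ :=
  ∫ s in (-1 : ℝ)..1, κ (τ + r * s) * (1 - s ^ 2) ^ m

lemma abs_le_one_of_mem_uIoc {s : ℝ} (hs : s ∈ Set.uIoc (-1 : ℝ) 1) : |s| ≤ 1 := by
  rw [Set.uIoc_of_le (by norm_num)] at hs
  exact abs_le.2 ⟨hs.1.le, hs.2⟩

lemma abs_weight_le {s : ℝ} (hs : |s| ≤ 1) (m : ℕ) : |(1 - s ^ 2) ^ m| ≤ 1 := by
  rw [abs_pow]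
  refine pow_le_one₀ (abs_nonneg _) ?_
  have : s ^ 2 ≤ 1 := (sq_le_one_iff_abs_le_one s).2 hs
  rw [abs_le]; constructor <;> nlinarith [sq_nonneg s]

lemma continuous_wavg_integrand {κ : ℝ → ℝ} (hκ : Continuous κ) (m : ℕ) (τ r : ℝ) :
    Continuous fun s : ℝ => κ (τ + r * s) * (1 - s ^ 2) ^ m := by fun_prop

lemma abs_integral_le_two_mul {f : ℝ → ℝ} {M : ℝ} (h : ∀ s, |s| ≤ 1 → |f s| ≤ M) :
    |∫ s in (-1 : ℝ)..1, f s| ≤ 2 * M := by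
  have := intervalIntegral.norm_integral_le_of_norm_le_const (f := f) (a := -1) (b := 1) (C := M)
    fun s hs => h s (abs_le_one_of_mem_uIoc hs)
  refine this.trans_eq ?_
  norm_num
  ring

lemma abs_wavg_le {κ : ℝ → ℝ} {M : ℝ} (hM : ∀ x, |κ x| ≤ M) (m : ℕ) (τ r : ℝ) :
    |wavg m κ τ r| ≤ 2 * M := abs_integral_le_two_mul fun s hs => by
  rw [abs_mul]
  exact (mul_le_of_le_one_right (abs_nonneg _) (abs_weight_le hs m)).trans (hM _)

lemma abs_wavg_sub_le {κ : ℝ → ℝ} (h : IsLineTest κ) {M : ℝ} (hM : ∀ x, |deriv κ x| ≤ M)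
    (m : ℕ) (τ τ' r r' : ℝ) :
    |wavg m κ τ r - wavg m κ τ' r'| ≤ 2 * (M * (|τ - τ'| + |r - r'|)) := by
  have c := fun τ r => (continuous_wavg_integrand h.continuous m τ r).intervalIntegrable
    (μ := volume) (-1) 1
  rw [wavg, wavg, ← intervalIntegral.integral_sub (c _ _) (c _ _)]
  refine abs_integral_le_two_mul fun s hs => ?_
  rw [← sub_mul, abs_mul]
  refine (mul_le_of_le_one_right (abs_nonneg _) (abs_weight_le hs m)).trans ?_
  refine (h.abs_sub_le hM _ _).trans
    (mul_le_mul_of_nonneg_left ?_ ((abs_nonneg _).trans (hM 0)))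
  calc |τ + r * s - (τ' + r' * s)| = |(τ - τ') + (r - r') * s| := by congr 1; ring
    _ ≤ |τ - τ'| + |(r - r') * s| := abs_add_le _ _
    _ ≤ _ := by
      rw [abs_mul]
      exact add_le_add le_rfl (mul_le_of_le_one_right (abs_nonneg _) hs)

lemma abs_wavg_sub_sub_le {κ : ℝ → ℝ} (h : IsLineTest κ) {M : ℝ}
    (hM : ∀ x, |deriv (deriv κ) x| ≤ M) (m : ℕ) (τ τ' r : ℝ) :
    |wavg m κ τ r - wavg m κ τ' r - (τ - τ') * wavg m (deriv κ) τ' r| ≤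
      2 * (M * |τ - τ'| ^ 2) := by
  have c := fun τ r => (continuous_wavg_integrand h.continuous m τ r).intervalIntegrable
    (μ := volume) (-1) 1
  have c' := fun τ r => (continuous_wavg_integrand h.deriv.continuous m τ r).intervalIntegrable
    (μ := volume) (-1) 1
  rw [wavg, wavg, wavg, ← intervalIntegral.integral_const_mul,
    ← intervalIntegral.integral_sub (c _ _) (c _ _),
    ← intervalIntegral.integral_sub ((c _ _).sub (c _ _)) ((c' _ _).const_mul _)]
  refine abs_integral_le_two_mul fun s hs => ?_
  have := h.abs_sub_sub_le hM (τ + r * s) (τ' + r * s)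
  rw [add_sub_add_right_eq_sub] at this
  refine le_trans ?_ this
  rw [← sub_mul, ← mul_assoc, ← sub_mul, abs_mul]
  exact mul_le_of_le_one_right (abs_nonneg _) (abs_weight_le hs m)

lemma hasDerivAt_wavg_aux {κ : ℝ → ℝ} (h : IsLineTest κ) (m : ℕ) (τ r : ℝ) :
    HasDerivAt (wavg m κ τ) (∫ s in (-1 : ℝ)..1, deriv κ (τ + r * s) * s * (1 - s ^ 2) ^ m) r := by
  obtain ⟨M, hM0, hM⟩ := h.deriv.exists_bound
  have hc : Continuous (deriv κ) := h.deriv.continuous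
  refine (intervalIntegral.hasDerivAt_integral_of_dominated_loc_of_deriv_le (μ := volume)
    (F := fun r s => κ (τ + r * s) * (1 - s ^ 2) ^ m)
    (F' := fun r s => deriv κ (τ + r * s) * s * (1 - s ^ 2) ^ m) (bound := fun _ => M)
    (s := Set.univ) univ_mem ?_ ?_ ?_ ?_ ?_ ?_).2
  · exact Eventually.of_forall fun r =>
      (continuous_wavg_integrand h.continuous m τ r).aestronglyMeasurable
  · exact (continuous_wavg_integrand h.continuous m τ r).intervalIntegrable _ _
  · exact (Continuous.aestronglyMeasurable (by fun_prop))
  · refine Eventually.of_forall fun s hs r _ => ?_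
    have hs' := abs_le_one_of_mem_uIoc hs
    rw [Real.norm_eq_abs, abs_mul, abs_mul]
    exact (mul_le_of_le_one_right (by positivity) (abs_weight_le hs' m)).trans
      ((mul_le_of_le_one_right (by positivity) hs').trans (hM _))
  · exact intervalIntegrable_const
  · refine Eventually.of_forall fun s _ r _ => ?_
    have h1 : HasDerivAt (fun r => τ + r * s) s r := by
      simpa using ((hasDerivAt_id r).mul_const s).const_add τ
    exact ((h.hasDerivAt _).comp r h1).mul_const _

lemma hasDerivAt_comp_affine {κ : ℝ → ℝ} (h : IsLineTest κ) (τ r s : ℝ) :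
    HasDerivAt (fun s => κ (τ + r * s)) (deriv κ (τ + r * s) * r) s := by
  have h1 : HasDerivAt (fun s => τ + r * s) r s := by
    simpa using ((hasDerivAt_id s).const_mul r).const_add τ
  exact (h.hasDerivAt _).comp s h1

lemma hasDerivAt_one_sub_sq (s : ℝ) : HasDerivAt (fun s : ℝ => 1 - s ^ 2) (-(2 * s)) s := by
  simpa using ((hasDerivAt_pow 2 s).const_sub 1)

/-- Integrating by parts in `s` produces the factor `r`, which makes `x ↦ wavg m κ τ |x|` smooth. -/
lemma hasDerivAt_wavg {κ : ℝ → ℝ} (h : IsLineTest κ) (m : ℕ) (τ r : ℝ) :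
    HasDerivAt (wavg m κ τ) (r / (2 * (m + 1)) * wavg (m + 1) (deriv (deriv κ)) τ r) r := by
  refine (hasDerivAt_wavg_aux h m τ r).congr_deriv ?_
  have hd := fun s => (hasDerivAt_comp_affine h.deriv τ r s).mul
    ((hasDerivAt_one_sub_sq s).pow (m + 1))
  have hc : Continuous (deriv κ) := h.deriv.continuous
  have hc2 : Continuous (deriv (deriv κ)) := h.deriv.deriv.continuous
  have e := intervalIntegral.integral_eq_sub_of_hasDerivAt (a := -1) (b := 1)
    (fun s _ => hd s) (Continuous.intervalIntegrable (by fun_prop) _ _)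
  have e2 : ∫ s in (-1 : ℝ)..1, (deriv (deriv κ) (τ + r * s) * r * (1 - s ^ 2) ^ (m + 1) +
      deriv κ (τ + r * s) * (((m + 1 : ℕ) : ℝ) * (1 - s ^ 2) ^ (m + 1 - 1) * (-(2 * s)))) =
      r * wavg (m + 1) (deriv (deriv κ)) τ r -
      2 * (m + 1) * ∫ s in (-1 : ℝ)..1, deriv κ (τ + r * s) * s * (1 - s ^ 2) ^ m := by
    rw [wavg, ← intervalIntegral.integral_const_mul, ← intervalIntegral.integral_const_mul,
      ← intervalIntegral.integral_sub (Continuous.intervalIntegrable (by fun_prop) _ _)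
      (Continuous.intervalIntegrable (by fun_prop) _ _)]
    refine intervalIntegral.integral_congr fun s _ => ?_
    simp only [Nat.add_sub_cancel]
    push_cast
    ring
  simp only [Pi.pow_apply] at e
  rw [e2] at e
  norm_num at e
  rw [div_mul_eq_mul_div, eq_div_iff (by positivity)]
  linarith

lemma mul_wavg_zero {K : ℝ → ℝ} (hK : ∀ x, HasDerivAt K (deriv K x) x)
    (hc : Continuous (deriv K)) (τ r : ℝ) :
    r * wavg 0 (deriv K) τ r = K (τ + r) - K (τ - r) := by
  have hd : ∀ s, HasDerivAt (fun s => K (τ + r * s)) (deriv K (τ + r * s) * r) s := fun s => by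
    have h1 : HasDerivAt (fun s => τ + r * s) r s := by
      simpa using ((hasDerivAt_id s).const_mul r).const_add τ
    exact (hK _).comp s h1
  have e := intervalIntegral.integral_eq_sub_of_hasDerivAt (a := -1) (b := 1)
    (fun s _ => hd s) (Continuous.intervalIntegrable (by fun_prop) _ _)
  rw [wavg, ← intervalIntegral.integral_const_mul]
  simp only [pow_zero, mul_one] at e ⊢
  rw [show τ - r = τ + r * (-1) by ring, ← e]
  exact intervalIntegral.integral_congr fun s _ => mul_comm _ _

/-- With `k = wavg 1 κ`, the radial function `k` satisfies `r k' + 3 k = 2 wavg 0 κ`. -/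
lemma wavg_one_identity {κ : ℝ → ℝ} (h : IsLineTest κ) (τ r : ℝ) :
    r * (r / 4 * wavg 2 (deriv (deriv κ)) τ r) + 3 * wavg 1 κ τ r = 2 * wavg 0 κ τ r := by
  have h1 := (hasDerivAt_wavg h 1 τ r).unique (hasDerivAt_wavg_aux h 1 τ r)
  have hc : Continuous (deriv κ) := h.deriv.continuous
  have hc0 : Continuous κ := h.continuous
  have hd := fun s => (hasDerivAt_comp_affine h τ r s).mul
    ((hasDerivAt_id s).mul (hasDerivAt_one_sub_sq s))
  have e := intervalIntegral.integral_eq_sub_of_hasDerivAt (a := -1) (b := 1)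
    (fun s _ => hd s) (Continuous.intervalIntegrable (by simp only [id]; fun_prop) _ _)
  have e2 : (∫ s in (-1 : ℝ)..1, (deriv κ (τ + r * s) * r * (s * (1 - s ^ 2)) +
      κ (τ + r * s) * (1 * (1 - s ^ 2) + s * (-(2 * s))))) =
      r * (∫ s in (-1 : ℝ)..1, deriv κ (τ + r * s) * s * (1 - s ^ 2) ^ 1) +
        3 * wavg 1 κ τ r - 2 * wavg 0 κ τ r := by
    rw [wavg, wavg, ← intervalIntegral.integral_const_mul, ← intervalIntegral.integral_const_mul,
      ← intervalIntegral.integral_const_mul,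
      ← intervalIntegral.integral_add (Continuous.intervalIntegrable (by fun_prop) _ _)
      (Continuous.intervalIntegrable (by fun_prop) _ _),
      ← intervalIntegral.integral_sub (Continuous.intervalIntegrable (by fun_prop) _ _)
      (Continuous.intervalIntegrable (by fun_prop) _ _)]
    refine intervalIntegral.integral_congr fun s _ => ?_
    simp only [pow_zero, pow_one]
    ring
  simp only [Pi.mul_apply, id] at e
  rw [e2, ← h1] at e
  norm_num at e
  linarith

/-! ### The explicit radial solution for smooth data -/

/-- Curves that are twice differentiable in time and satisfy the wave equation at each time are
solutions in the integrated sense. -/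
lemma isMild_of_hasTimeDerivInH {c T : ℝ} {k : ℕ} {U V A : ℝ → E3 → ℝ}
    (hU : ContInH (k + 1) T U) (hV : ContInH k T V) (hd : HasTimeDerivInH k T U V)
    (hA : ContInH 0 T A) (hd' : HasTimeDerivInH 0 T V A)
    (heq : ∀ t ∈ Set.Icc 0 T, ∀ b, IsTest b →
      ∫ x, A t x * b x = c ^ 2 * ∫ x, U t x * lap b x) : IsMild c T k U V := by
  refine ⟨hU, hV, hd, fun b hb t ht => ?_⟩
  have df : ∀ s ∈ Set.Icc 0 T, HasDerivWithinAt (fun s => ∫ x, V s x * b x)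
      (c ^ 2 * ∫ x, U s x * lap b x) (Set.Icc 0 T) s := by
    intro s hs
    have h1 := hd'.hasDerivWithinAt_toL2 (fun t ht => (hV.1 t ht).memLp)
      (fun t ht => (hA.1 t ht).memLp) hs
    have h2 := (h1.inner ℝ (hasDerivWithinAt_const s (Set.Icc 0 T) (toL2 b))).congr
      (f₁ := fun s => ∫ x, V s x * b x) (hV.integral_mul_eq hb) (hV.integral_mul_eq hb s hs)
    rw [inner_zero_right, zero_add, ← hA.integral_mul_eq hb s hs, heq s hs b hb] at h2
    exact h2
  have hsub : Set.Icc 0 t ⊆ Set.Icc 0 T := Set.Icc_subset_Icc le_rfl ht.2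
  have cq : ContinuousOn (fun s => c ^ 2 * ∫ x, U s x * lap b x) (Set.Icc 0 t) :=
    continuousOn_const.mul ((hU.continuousOn_integral_mul (isTest_lap hb)).mono hsub)
  rw [← intervalIntegral.integral_const_mul]
  refine (intervalIntegral.integral_eq_sub_of_hasDeriv_right_of_le ht.1
    (f := fun s => ∫ x, V s x * b x)
    (fun s hs => ((df s (hsub hs)).continuousWithinAt).mono hsub) (fun s hs => ?_)
    (ContinuousOn.intervalIntegrable (by rwa [Set.uIcc_of_le ht.1]))).symm
  refine (df s (hsub ⟨hs.1.le, hs.2.le⟩)).mono_of_mem_nhdsWithin ?_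
  exact mem_of_superset (Ioc_mem_nhdsGT (hs.2.trans_le ht.2))
    fun x hx => ⟨hs.1.le.trans hx.1.le, hx.2⟩

lemma tendsto_of_abs_le_mul {c : ℝ} {t₀ : ℝ} {l : Filter ℝ} (hl : l ≤ 𝓝 t₀) (C δ : ℝ)
    (hδ : 0 < δ) : ∀ᶠ t in l, C * |c * t - c * t₀| ≤ δ := by
  have h : Tendsto (fun t => C * |c * t - c * t₀|) (𝓝 t₀) (𝓝 (C * |c * t₀ - c * t₀|)) :=
    (Continuous.tendsto (by fun_prop) t₀)
  rw [sub_self, abs_zero, mul_zero] at h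
  exact hl ((h.eventually (gt_mem_nhds hδ)).mono fun _ h => h.le)

lemma profileCurve_wavg {κ : ℝ → ℝ} (h : IsLineTest κ) {w : ℝ → ℝ} {B c T R : ℝ} (m : ℕ)
    (hw : ∀ r, 0 < r → r ≤ R → |w r| ≤ B)
    (hz : ∀ t ∈ Set.Icc 0 T, ∀ r, R < r → w r * wavg m κ (c * t) r = 0) :
    ProfileCurve T R fun t r => w r * wavg m κ (c * t) r := by
  obtain ⟨M, hM0, hM⟩ := h.exists_bound
  obtain ⟨M', hM0', hM'⟩ := h.deriv.exists_bound
  refine ⟨hz, fun t ht => ⟨max 0 (B * (2 * M)), fun r hr => ?_⟩, fun t₀ ht₀ δ hδ => ?_⟩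
  · rcases le_or_gt r R with h1 | h1
    · rw [abs_mul]
      exact (mul_le_mul (hw r hr h1) (abs_wavg_le hM m _ r) (abs_nonneg _)
        ((abs_nonneg _).trans (hw r hr h1))).trans (le_max_right _ _)
    · rw [hz t ht r h1, abs_zero]; exact le_max_left _ _
  · filter_upwards [tendsto_of_abs_le_mul (c := c) (nhdsWithin_le_nhds (s := Set.Icc 0 T))
      (B * (2 * M')) δ hδ, self_mem_nhdsWithin] with t h2 ht r hr
    rcases le_or_gt r R with h1 | h1
    · rw [← mul_sub, abs_mul]
      refine le_trans (mul_le_mul (hw r hr h1) (abs_wavg_sub_le h hM' m _ _ r r) (abs_nonneg _)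
        ((abs_nonneg _).trans (hw r hr h1))) (le_trans (le_of_eq ?_) h2)
      rw [sub_self, abs_zero, add_zero]; ring
    · rw [hz t ht r h1, hz t₀ ht₀ r h1, sub_zero, abs_zero]; exact hδ.le

lemma tendsto_radSq_quot_wavg {κ : ℝ → ℝ} (h : IsLineTest κ) {w : ℝ → ℝ} {B c T R : ℝ} (m : ℕ)
    (hw : ∀ r, 0 < r → r ≤ R → |w r| ≤ B)
    (hz : ∀ t ∈ Set.Icc 0 T, ∀ r, R < r → w r * wavg m κ (c * t) r = 0)
    (hz' : ∀ t ∈ Set.Icc 0 T, ∀ r, R < r → w r * (c * wavg m (deriv κ) (c * t) r) = 0)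
    {t₀ : ℝ} (ht₀ : t₀ ∈ Set.Icc 0 T) :
    Tendsto (fun t => radSq fun r => (t - t₀)⁻¹ * (w r * wavg m κ (c * t) r -
      w r * wavg m κ (c * t₀) r) - w r * (c * wavg m (deriv κ) (c * t₀) r))
      (𝓝[Set.Icc 0 T \ {t₀}] t₀) (𝓝 0) := by
  obtain ⟨M, hM0, hM⟩ := h.deriv.deriv.exists_bound
  refine tendsto_radSq_of_uniform (R := R) ?_ fun δ hδ => ?_
  · filter_upwards [self_mem_nhdsWithin] with t ht r hr
    rw [hz t ht.1 r hr, hz t₀ ht₀ r hr, hz' t₀ ht₀ r hr]; simp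
  · filter_upwards [tendsto_of_abs_le_mul (c := c)
      (nhdsWithin_le_nhds (s := Set.Icc 0 T \ {t₀})) (B * (2 * (M * |c|))) δ hδ,
      self_mem_nhdsWithin] with t h2 ht r hr
    have hne : t - t₀ ≠ 0 := sub_ne_zero.2 ht.2
    rcases le_or_gt r R with h1 | h1
    · have e : (t - t₀)⁻¹ * (w r * wavg m κ (c * t) r - w r * wavg m κ (c * t₀) r) -
          w r * (c * wavg m (deriv κ) (c * t₀) r) = w r * ((t - t₀)⁻¹ *
          (wavg m κ (c * t) r - wavg m κ (c * t₀) r -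
            (c * t - c * t₀) * wavg m (deriv κ) (c * t₀) r)) := by
        field_simp
      rw [e, abs_mul]
      refine le_trans (mul_le_mul (d := 2 * (M * |c|) * |c * t - c * t₀|) (hw r hr h1) ?_
        (abs_nonneg _) ((abs_nonneg _).trans (hw r hr h1))) (le_trans (le_of_eq ?_) h2)
      · rw [abs_mul, abs_inv]
        refine (mul_le_mul_of_nonneg_left (abs_wavg_sub_sub_le h hM m _ _ r)
          (by positivity)).trans_eq ?_
        rw [← mul_sub, abs_mul]
        have : |t - t₀| ≠ 0 := abs_ne_zero.2 hne
        field_simp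
      · ring
    · rw [hz t ht.1 r h1, hz t₀ ht₀ r h1, hz' t₀ ht₀ r h1]; simpa using hδ.le

lemma hasRadialDeriv_wavg {κ : ℝ → ℝ} (h : IsLineTest κ) (m : ℕ) (τ : ℝ) :
    HasRadialDeriv (wavg m κ τ)
      fun r => r * (1 / (2 * (m + 1)) * wavg (m + 1) (deriv (deriv κ)) τ r) := by
  obtain ⟨M, hM0, hM⟩ := h.deriv.exists_bound
  refine hasRadialDeriv_of_lipschitzWith (C := (2 * M).toNNReal) (ε := 0)
    (LipschitzWith.of_dist_le_mul fun r r' => ?_) fun r _ _ => ?_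
  · rw [Real.coe_toNNReal _ (by positivity), Real.dist_eq, Real.dist_eq]
    refine (abs_wavg_sub_le h hM m τ τ r r').trans_eq ?_
    rw [sub_self, abs_zero, zero_add]; ring
  · exact (hasDerivAt_wavg h m τ r).congr_deriv (by ring)

/-- Smooth functions on the line that are constant, with the same value, near `±∞`. For such `K`,
`(K(ct + r) - K(ct - r)) / r` is the profile of a compactly supported solution of the wave
equation. -/
structure IsWaveProfile (R : ℝ) (K : ℝ → ℝ) : Prop where
  smooth : ContDiff ℝ ∞ K
  const : ∀ r, R ≤ |r| → K r = K R

namespace IsWaveProfile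

variable {R c T : ℝ} {K : ℝ → ℝ}

lemma hasDerivAt (hK : IsWaveProfile R K) (x : ℝ) : HasDerivAt K (deriv K x) x :=
  ((contDiff_infty_iff_deriv.1 hK.smooth).1 x).hasDerivAt

lemma deriv_eq_zero (hK : IsWaveProfile R K) {r : ℝ} (hr : R < |r|) : deriv K r = 0 := by
  have : K =ᶠ[𝓝 r] fun _ => K R := by
    filter_upwards [(continuous_abs.tendsto r).eventually (lt_mem_nhds hr)] with s hs
    exact hK.const s hs.le
  rw [this.deriv_eq]; simp

lemma isLineTest_deriv (hK : IsWaveProfile R K) : IsLineTest (deriv K) := by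
  refine ⟨(contDiff_infty_iff_deriv.1 hK.smooth).2,
    HasCompactSupport.intro (isCompact_closedBall (0 : ℝ) R) fun r hr => ?_⟩
  rw [mem_closedBall_zero_iff, Real.norm_eq_abs, not_le] at hr
  exact hK.deriv_eq_zero hr

lemma deriv_deriv_eq_zero (hK : IsWaveProfile R K) {r : ℝ} (hr : R < |r|) :
    deriv (deriv K) r = 0 := by
  have : deriv K =ᶠ[𝓝 r] fun _ => 0 := by
    filter_upwards [(continuous_abs.tendsto r).eventually (lt_mem_nhds hr)] with s hs
    exact hK.deriv_eq_zero hs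
  rw [this.deriv_eq]; simp

lemma lt_abs (hc : 0 < c) {t r : ℝ} (ht : t ∈ Set.Icc 0 T)
    (hr : R + c * T < r) : R < |c * t + r| ∧ R < |c * t - r| := by
  have h1 : c * t ≤ c * T := mul_le_mul_of_nonneg_left ht.2 hc.le
  have h2 : 0 ≤ c * t := mul_nonneg hc.le ht.1
  exact ⟨lt_of_lt_of_le (by linarith) (le_abs_self _), lt_of_lt_of_le (by linarith) (neg_le_abs _)⟩

lemma wavg_eq_zero (hK : IsWaveProfile R K) (hR : 0 ≤ R) (hc : 0 < c) {t r : ℝ}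
    (ht : t ∈ Set.Icc 0 T) (hr : R + c * T < r) : wavg 0 (deriv K) (c * t) r = 0 := by
  have h := mul_wavg_zero hK.hasDerivAt hK.isLineTest_deriv.continuous (c * t) r
  obtain ⟨h1, h2⟩ := lt_abs (R := R) hc ht hr
  rw [hK.const _ h1.le, hK.const _ h2.le, sub_self] at h
  have h0 : 0 ≤ c * T := mul_nonneg hc.le (ht.1.trans ht.2)
  exact (mul_eq_zero.1 h).resolve_left (by linarith)

lemma wavg_deriv_eq_zero {κ : ℝ → ℝ} (hκ : IsLineTest κ) (h0 : ∀ r, R < |r| → κ r = 0)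
    (hR : 0 ≤ R) (hc : 0 < c) {t r : ℝ}
    (ht : t ∈ Set.Icc 0 T) (hr : R + c * T < r) : wavg 0 (deriv κ) (c * t) r = 0 := by
  have h := mul_wavg_zero hκ.hasDerivAt hκ.deriv.continuous (c * t) r
  obtain ⟨h1, h2⟩ := lt_abs (R := R) hc ht hr
  rw [h0 _ h1, h0 _ h2, sub_self] at h
  have h0 : 0 ≤ c * T := mul_nonneg hc.le (ht.1.trans ht.2)
  exact (mul_eq_zero.1 h).resolve_left (by linarith)

/-- Where a radial function vanishes for `r > R`, so does its derivative divided by `r`. -/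
lemma wavg_succ_eq_zero {κ : ℝ → ℝ} (hκ : IsLineTest κ) {m : ℕ} {τ R' : ℝ} (hR : 0 ≤ R')
    (h : ∀ r, R' < r → wavg m κ τ r = 0) {r : ℝ} (hr : R' < r) :
    wavg (m + 1) (deriv (deriv κ)) τ r = 0 := by
  have h1 := hasDerivAt_wavg hκ m τ r
  have h2 : wavg m κ τ =ᶠ[𝓝 r] fun _ => 0 := by
    filter_upwards [lt_mem_nhds hr] with s hs using h s hs
  have h3 := h1.unique ((hasDerivAt_const r (0 : ℝ)).congr_of_eventuallyEq h2)
  refine (mul_eq_zero.1 h3).resolve_left ?_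
  have : 0 < r := hR.trans_lt hr
  positivity

end IsWaveProfile

/-- The solution with profile `(K(ct + r) - K(ct - r)) / r`. -/
noncomputable def waveU (c : ℝ) (K : ℝ → ℝ) (t : ℝ) (x : E3) : ℝ :=
  wavg 0 (deriv K) (c * t) ‖x‖

/-- The time derivative of `waveU c K`. -/
noncomputable def waveV (c : ℝ) (K : ℝ → ℝ) (t : ℝ) (x : E3) : ℝ :=
  c * wavg 0 (deriv (deriv K)) (c * t) ‖x‖

lemma integral_wavg_mul_lap {κ : ℝ → ℝ} (h : IsLineTest κ) (τ : ℝ) {b : E3 → ℝ} (hb : IsTest b) :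
    ∫ x, wavg 0 κ τ ‖x‖ * lap b x = ∫ x, wavg 0 (deriv (deriv κ)) τ ‖x‖ * b x := by
  set k : ℝ → ℝ := fun r => 1 / 2 * wavg 1 (deriv (deriv κ)) τ r with hk
  set k' : ℝ → ℝ := fun r =>
    1 / 2 * (r * (1 / 4 * wavg 2 (deriv (deriv (deriv (deriv κ)))) τ r)) with hk'
  have d0 : HasRadialDeriv (wavg 0 κ τ) fun r => r * k r := by
    have := hasRadialDeriv_wavg h 0 τ
    norm_num at this
    simpa only [hk, one_div] using this
  have d1 : HasRadialDeriv k k' := by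
    have := (hasRadialDeriv_wavg h.deriv.deriv 1 τ).const_mul (1 / 2)
    norm_num at this
    simpa only [hk, hk', one_div] using this
  have p0 := fun i => d0.weakPartial i
  have p1 := fun i => d1.weakPartial_weakPartial i i
  have step : ∀ i : Fin 3, ∫ x, wavg 0 κ τ ‖x‖ * pd i (pd i b) x =
      ∫ x, (x i * (k' ‖x‖ * (x i / ‖x‖)) + k ‖x‖) * b x := fun i => by
    have h0 := (p0 i).2.2 _ (hb.pd i).smooth (hb.pd i).compact
    have h1 := (p1 i).2.2 _ hb.smooth hb.compact
    simp only [if_true, one_mul] at h1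
    refine h0.trans ?_
    change - ∫ x, _ * fderiv ℝ b x _ = _
    rw [h1, neg_neg]
  have i0 : ∀ i : Fin 3, Integrable fun x => wavg 0 κ τ ‖x‖ * pd i (pd i b) x := fun i =>
    (p0 0).1.integrable_mul_test ((hb.pd i).pd i).continuous ((hb.pd i).pd i).compact
  have i1 : ∀ i : Fin 3, Integrable fun x => (x i * (k' ‖x‖ * (x i / ‖x‖)) + k ‖x‖) * b x :=
    fun i => by
      have := (p1 i).2.1.integrable_mul_test hb.continuous hb.compact
      simpa only [if_true, one_mul] using this
  calc ∫ x, wavg 0 κ τ ‖x‖ * lap b x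
      = ∑ i, ∫ x, wavg 0 κ τ ‖x‖ * pd i (pd i b) x := by
        rw [← integral_finsetSum _ fun i _ => i0 i]
        simp only [lap, Finset.mul_sum]
    _ = ∫ x, ∑ i : Fin 3, (x i * (k' ‖x‖ * (x i / ‖x‖)) + k ‖x‖) * b x := by
        rw [integral_finsetSum _ fun i _ => i1 i]
        exact Finset.sum_congr rfl fun i _ => step i
    _ = _ := by
        refine integral_congr_ae ?_
        filter_upwards [ae_norm_pos] with x hx
        have hn : ∑ i : Fin 3, x i * x i = ‖x‖ * ‖x‖ := by
          rw [← real_inner_self_eq_norm_mul_norm x, PiLp.inner_apply]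
          rfl
        have id := wavg_one_identity h.deriv.deriv τ ‖x‖
        have e : ∑ i : Fin 3, (x i * (k' ‖x‖ * (x i / ‖x‖)) + k ‖x‖) * b x =
            (k' ‖x‖ / ‖x‖ * ∑ i : Fin 3, x i * x i + 3 * k ‖x‖) * b x := by
          simp only [Fin.sum_univ_three]
          ring
        rw [e, hn]
        congr 1
        have : k' ‖x‖ / ‖x‖ * (‖x‖ * ‖x‖) = ‖x‖ * k' ‖x‖ := by field_simp
        rw [this]
        simp only [hk, hk']
        linarith

lemma hasRadialDeriv_wavg_zero {κ : ℝ → ℝ} (h : IsLineTest κ) (τ : ℝ) :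
    HasRadialDeriv (wavg 0 κ τ) fun r => r * (1 / 2 * wavg 1 (deriv (deriv κ)) τ r) := by
  have := hasRadialDeriv_wavg h 0 τ
  norm_num at this
  simpa only [one_div] using this

lemma hasRadialDeriv_half_wavg_one {κ : ℝ → ℝ} (h : IsLineTest κ) (τ : ℝ) :
    HasRadialDeriv (fun r => 1 / 2 * wavg 1 κ τ r)
      fun r => r * (1 / 8 * wavg 2 (deriv (deriv κ)) τ r) := by
  have := (hasRadialDeriv_wavg h 1 τ).const_mul (1 / 2)
  refine (congrArg (HasRadialDeriv _) (funext fun r => ?_)).mp this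
  push_cast
  ring

lemma abs_mul_le_of_pos_of_le {R' r : ℝ} (h0 : 0 < r) (h1 : r ≤ R') {a b : ℝ} (h : |a| ≤ b) :
    |r * a| ≤ R' * b := by
  rw [abs_mul, abs_of_pos h0]
  exact mul_le_mul h1 h (abs_nonneg _) (h0.le.trans h1)

namespace IsWaveProfile

variable {R c T : ℝ} {K : ℝ → ℝ}

lemma wavg_zero_deriv (hK : IsWaveProfile R K) (hR : 0 ≤ R) (hc : 0 < c) {t : ℝ}
    (ht : t ∈ Set.Icc 0 T) (r : ℝ) (hr : R + c * T < r) :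
    wavg 0 (deriv (deriv K)) (c * t) r = 0 :=
  wavg_deriv_eq_zero hK.isLineTest_deriv (fun _ hr => hK.deriv_eq_zero hr) hR hc ht hr

lemma wavg_zero_deriv_deriv (hK : IsWaveProfile R K) (hR : 0 ≤ R) (hc : 0 < c) {t : ℝ}
    (ht : t ∈ Set.Icc 0 T) (r : ℝ) (hr : R + c * T < r) :
    wavg 0 (deriv (deriv (deriv K))) (c * t) r = 0 :=
  wavg_deriv_eq_zero hK.isLineTest_deriv.deriv (fun _ hr => hK.deriv_deriv_eq_zero hr) hR hc ht hr

lemma support_nonneg (hR : 0 ≤ R) (hc : 0 < c) {t : ℝ} (ht : t ∈ Set.Icc 0 T) : 0 ≤ R + c * T :=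
  add_nonneg hR (mul_nonneg hc.le (ht.1.trans ht.2))

lemma wavg_one (hK : IsWaveProfile R K) (hR : 0 ≤ R) (hc : 0 < c) {t : ℝ}
    (ht : t ∈ Set.Icc 0 T) (r : ℝ) (hr : R + c * T < r) :
    wavg 1 (deriv (deriv (deriv K))) (c * t) r = 0 :=
  wavg_succ_eq_zero hK.isLineTest_deriv (support_nonneg hR hc ht)
    (fun _ hr => hK.wavg_eq_zero hR hc ht hr) hr

lemma wavg_one_deriv (hK : IsWaveProfile R K) (hR : 0 ≤ R) (hc : 0 < c) {t : ℝ}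
    (ht : t ∈ Set.Icc 0 T) (r : ℝ) (hr : R + c * T < r) :
    wavg 1 (deriv (deriv (deriv (deriv K)))) (c * t) r = 0 :=
  wavg_succ_eq_zero hK.isLineTest_deriv.deriv (support_nonneg hR hc ht)
    (hK.wavg_zero_deriv hR hc ht) hr

lemma wavg_two (hK : IsWaveProfile R K) (hR : 0 ≤ R) (hc : 0 < c) {t : ℝ}
    (ht : t ∈ Set.Icc 0 T) (r : ℝ) (hr : R + c * T < r) :
    wavg 2 (deriv (deriv (deriv (deriv (deriv K))))) (c * t) r = 0 :=
  wavg_succ_eq_zero hK.isLineTest_deriv.deriv.deriv (support_nonneg hR hc ht)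
    (hK.wavg_one hR hc ht) hr

lemma contInH_waveU (hK : IsWaveProfile R K) (hR : 0 ≤ R) (hc : 0 < c) :
    ContInH 2 T (waveU c K) := by
  have h := hK.isLineTest_deriv
  refine contInH_two_of_profile (R := R + c * T)
    (fun t _ => hasRadialDeriv_wavg_zero h (c * t))
    (fun t _ => hasRadialDeriv_half_wavg_one h.deriv.deriv (c * t)) ?_ ?_ ?_ ?_
  · have := profileCurve_wavg (c := c) (T := T) (R := R + c * T) (w := fun _ => 1)
      (B := |1|) h 0 (fun _ _ _ => le_rfl)
      fun t ht r hr => by rw [hK.wavg_eq_zero hR hc ht hr, mul_zero]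
    simpa only [one_mul] using this
  · have := profileCurve_wavg (c := c) (T := T) (R := R + c * T)
      (w := fun r => r * (1 / 2)) h.deriv.deriv 1
      (fun r h0 h1 => abs_mul_le_of_pos_of_le h0 h1 le_rfl)
      fun t ht r hr => by rw [hK.wavg_one hR hc ht r hr, mul_zero]
    simpa only [mul_assoc] using this
  · exact profileCurve_wavg (w := fun _ => 1 / 2) h.deriv.deriv 1 (fun _ _ _ => le_rfl)
      fun t ht r hr => by rw [hK.wavg_one hR hc ht r hr, mul_zero]
  · have := profileCurve_wavg (c := c) (T := T) (R := R + c * T)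
      (w := fun r => r * (r * (1 / 8))) h.deriv.deriv.deriv.deriv 2
      (fun r h0 h1 => abs_mul_le_of_pos_of_le h0 h1 (abs_mul_le_of_pos_of_le h0 h1 le_rfl))
      fun t ht r hr => by rw [hK.wavg_two hR hc ht r hr, mul_zero]
    simpa only [mul_assoc] using this

lemma contInH_waveV (hK : IsWaveProfile R K) (hR : 0 ≤ R) (hc : 0 < c) :
    ContInH 1 T (waveV c K) := by
  have h := hK.isLineTest_deriv
  refine contInH_one_of_profile (R := R + c * T)
    (fun t _ => (hasRadialDeriv_wavg_zero h.deriv (c * t)).const_mul c) ?_ ?_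
  · exact profileCurve_wavg (w := fun _ => c) h.deriv 0 (fun _ _ _ => le_rfl)
      fun t ht r hr => by rw [hK.wavg_zero_deriv hR hc ht r hr, mul_zero]
  · have := profileCurve_wavg (c := c) (T := T) (R := R + c * T)
      (w := fun r => r * (c / 2)) h.deriv.deriv.deriv 1
      (fun r h0 h1 => abs_mul_le_of_pos_of_le h0 h1 le_rfl)
      fun t ht r hr => by rw [hK.wavg_one_deriv hR hc ht r hr, mul_zero]
    refine (congrArg (ProfileCurve T (R + c * T)) (funext fun t => funext fun r => ?_)).mp this
    ring

lemma contInH_waveA (hK : IsWaveProfile R K) (hR : 0 ≤ R) (hc : 0 < c) :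
    ContInH 0 T fun t x => c ^ 2 * wavg 0 (deriv (deriv (deriv K))) (c * t) ‖x‖ := by
  have h := hK.isLineTest_deriv
  have hp : ProfileCurve T (R + c * T)
      fun t r => c ^ 2 * wavg 0 (deriv (deriv (deriv K))) (c * t) r :=
    profileCurve_wavg (w := fun _ => c ^ 2) h.deriv.deriv 0 (fun _ _ _ => le_rfl)
      fun t ht r hr => by rw [hK.wavg_zero_deriv_deriv hR hc ht r hr, mul_zero]
  have hd := fun t => (hasRadialDeriv_wavg h.deriv.deriv 0 (c * t)).const_mul (c ^ 2)
  refine ⟨fun t ht => memH_iff.2 ⟨(hd t 0).1.aestronglyMeasurable, ?_⟩, fun t₀ ht₀ => ?_⟩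
  · have := hp.radSq_lt_top ht
    rwa [radSq_eq] at this
  · rw [tendsto_sobolevNorm_iff]
    refine (hp.tendsto_radSq ht₀).congr fun t => ?_
    rw [radSq_eq, sobolevSq]
    rfl

lemma hasTimeDerivInH_waveU (hK : IsWaveProfile R K) (hR : 0 ≤ R) (hc : 0 < c) :
    HasTimeDerivInH 1 T (waveU c K) (waveV c K) := by
  have h := hK.isLineTest_deriv
  intro t₀ ht₀
  rw [tendsto_sobolevNorm_iff]
  have q0 := tendsto_radSq_quot_wavg (R := R + c * T) (w := fun _ => 1) (c := c) h 0
    (fun _ _ _ => le_rfl)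
    (fun t ht r hr => by rw [hK.wavg_eq_zero hR hc ht hr, mul_zero])
    (fun t ht r hr => by rw [hK.wavg_zero_deriv hR hc ht r hr, mul_zero, mul_zero]) ht₀
  have q1 := tendsto_radSq_quot_wavg (R := R + c * T) (w := fun r => r * (1 / 2)) (c := c)
    h.deriv.deriv 1 (fun r h0 h1 => abs_mul_le_of_pos_of_le h0 h1 le_rfl)
    (fun t ht r hr => by rw [hK.wavg_one hR hc ht r hr, mul_zero])
    (fun t ht r hr => by rw [hK.wavg_one_deriv hR hc ht r hr, mul_zero, mul_zero]) ht₀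
  have hq : Tendsto (fun t => radSq (fun r => (t - t₀)⁻¹ * (wavg 0 (deriv K) (c * t) r -
      wavg 0 (deriv K) (c * t₀) r) - c * wavg 0 (deriv (deriv K)) (c * t₀) r) +
      3 * radSq (fun r => (t - t₀)⁻¹ * (r * (1 / 2 * wavg 1 (deriv (deriv (deriv K))) (c * t) r) -
      r * (1 / 2 * wavg 1 (deriv (deriv (deriv K))) (c * t₀) r)) -
      c * (r * (1 / 2 * wavg 1 (deriv (deriv (deriv (deriv K)))) (c * t₀) r))))
      (𝓝[Set.Icc 0 T \ {t₀}] t₀) (𝓝 0) := by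
    have q2 := ENNReal.Tendsto.const_mul (a := 3) q1 (Or.inr (by simp))
    have q3 := q0.add q2
    rw [mul_zero, add_zero] at q3
    refine q3.congr fun t => ?_
    simp only [one_mul]
    refine congrArg₂ _ rfl (congrArg _ (congrArg _ (funext fun r => ?_)))
    ring
  refine tendsto_of_tendsto_of_tendsto_of_le_of_le tendsto_const_nhds hq
    (fun _ => bot_le) fun t => ?_
  have hr := (((hasRadialDeriv_wavg_zero h (c * t)).sub
    (hasRadialDeriv_wavg_zero h (c * t₀))).const_mul (t - t₀)⁻¹).sub
    ((hasRadialDeriv_wavg_zero h.deriv (c * t₀)).const_mul c)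
  refine le_trans (le_of_eq ?_) (sobolevSq_one_radial_le hr)
  refine congrArg (sobolevSq 1) (funext fun x => ?_)
  simp only [Pi.sub_apply, Pi.smul_apply, waveU, waveV, smul_eq_mul]

lemma hasTimeDerivInH_waveV (hK : IsWaveProfile R K) (hR : 0 ≤ R) (hc : 0 < c) :
    HasTimeDerivInH 0 T (waveV c K)
      fun t x => c ^ 2 * wavg 0 (deriv (deriv (deriv K))) (c * t) ‖x‖ := by
  have h := hK.isLineTest_deriv
  intro t₀ ht₀
  rw [tendsto_sobolevNorm_iff]
  refine (tendsto_radSq_quot_wavg (R := R + c * T) (w := fun _ => c) (c := c) h.deriv 0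
    (fun _ _ _ => le_rfl)
    (fun t ht r hr => by rw [hK.wavg_zero_deriv hR hc ht r hr, mul_zero])
    (fun t ht r hr => by rw [hK.wavg_zero_deriv_deriv hR hc ht r hr, mul_zero, mul_zero])
    ht₀).congr fun t => ?_
  rw [radSq_eq, sobolevSq]
  refine congrArg (fun f => eLpNorm f 2 volume ^ 2) (funext fun x => ?_)
  simp only [Pi.sub_apply, Pi.smul_apply, waveV, smul_eq_mul]
  ring

/-- The explicit solution is a solution in `C([0,T]; H²) ∩ C¹([0,T]; H¹)`. -/
lemma isMild (hK : IsWaveProfile R K) (hR : 0 ≤ R) (hc : 0 < c) :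
    IsMild c T 1 (waveU c K) (waveV c K) := by
  refine isMild_of_hasTimeDerivInH (hK.contInH_waveU hR hc) (hK.contInH_waveV hR hc)
    (hK.hasTimeDerivInH_waveU hR hc) (hK.contInH_waveA hR hc) (hK.hasTimeDerivInH_waveV hR hc)
    fun t _ b hb => ?_
  simp only [waveU]
  rw [integral_wavg_mul_lap hK.isLineTest_deriv (c * t) hb, ← integral_const_mul]
  refine integral_congr_ae (Eventually.of_forall fun x => ?_)
  simp only
  ring

end IsWaveProfile

/-! ### Superpositions of an incoming and an outgoing wave -/

/-- `G(τ + r) + H(τ - r)`. With `τ = c t` and after division by `r` this is the general radial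
solution of the wave equation away from the origin. -/
noncomputable def twoWave (G H : ℝ → ℝ) (τ r : ℝ) : ℝ := G (τ + r) + H (τ - r)

/-- The function `(G(ct + |x|) + H(ct - |x|)) / |x|`. -/
noncomputable def extWave (c : ℝ) (G H : ℝ → ℝ) (t : ℝ) (x : E3) : ℝ :=
  twoWave G H (c * t) ‖x‖ / ‖x‖

lemma hasDerivAt_of_contDiff {G : ℝ → ℝ} (hG : ContDiff ℝ ∞ G) (x : ℝ) :
    HasDerivAt G (deriv G x) x :=
  ((contDiff_infty_iff_deriv.1 hG).1 x).hasDerivAt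

lemma contDiff_deriv {G : ℝ → ℝ} (hG : ContDiff ℝ ∞ G) : ContDiff ℝ ∞ (deriv G) :=
  (contDiff_infty_iff_deriv.1 hG).2

lemma hasDerivAt_twoWave {G H : ℝ → ℝ} (hG : ContDiff ℝ ∞ G) (hH : ContDiff ℝ ∞ H) (τ r : ℝ) :
    HasDerivAt (twoWave G H τ) (twoWave (deriv G) (-deriv H) τ r) r := by
  have h1 : HasDerivAt (fun r => τ + r) 1 r := (hasDerivAt_id r).const_add τ
  have h2 : HasDerivAt (fun r => τ - r) (-1) r := (hasDerivAt_id r).const_sub τ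
  have := ((hasDerivAt_of_contDiff hG _).comp r h1).add ((hasDerivAt_of_contDiff hH _).comp r h2)
  refine this.congr_deriv ?_
  simp [twoWave]

lemma hasDerivAt_twoWave_deriv {G H : ℝ → ℝ} (hG : ContDiff ℝ ∞ G) (hH : ContDiff ℝ ∞ H)
    (τ r : ℝ) : HasDerivAt (twoWave (deriv G) (-deriv H) τ)
      (twoWave (deriv (deriv G)) (deriv (deriv H)) τ r) r := by
  refine (hasDerivAt_twoWave (contDiff_deriv hG) (contDiff_deriv hH).neg τ r).congr_deriv ?_
  simp [twoWave]

lemma hasDerivAt_twoWave_time {G H : ℝ → ℝ} (hG : ContDiff ℝ ∞ G) (hH : ContDiff ℝ ∞ H)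
    (c r t : ℝ) : HasDerivAt (fun t => twoWave G H (c * t) r)
      (c * twoWave (deriv G) (deriv H) (c * t) r) t := by
  have h1 : HasDerivAt (fun t => c * t + r) c t := by
    simpa using ((hasDerivAt_id t).const_mul c).add_const r
  have h2 : HasDerivAt (fun t => c * t - r) c t := by
    simpa using ((hasDerivAt_id t).const_mul c).sub_const r
  have := ((hasDerivAt_of_contDiff hG _).comp t h1).add ((hasDerivAt_of_contDiff hH _).comp t h2)
  refine this.congr_deriv ?_
  simp only [twoWave]; ring

lemma hasDerivAt_div_self {v : ℝ → ℝ} {v₁ r : ℝ} (hv : HasDerivAt v v₁ r) (hr : r ≠ 0) :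
    HasDerivAt (fun r => v r / r) (r * (v₁ / r ^ 2 - v r / r ^ 3)) r := by
  refine (hv.div (hasDerivAt_id r) hr).congr_deriv ?_
  simp only [id]
  field_simp

lemma hasDerivAt_div_sq_sub {v v₁ : ℝ → ℝ} {v₂ r : ℝ} (hv : HasDerivAt v (v₁ r) r)
    (hv₁ : HasDerivAt v₁ v₂ r) (hr : r ≠ 0) :
    HasDerivAt (fun r => v₁ r / r ^ 2 - v r / r ^ 3)
      (v₂ / r ^ 2 - 3 * v₁ r / r ^ 3 + 3 * v r / r ^ 4) r := by
  have h2 := hv₁.div (hasDerivAt_pow 2 r) (pow_ne_zero 2 hr)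
  have h3 := hv.div (hasDerivAt_pow 3 r) (pow_ne_zero 3 hr)
  refine (h2.sub h3).congr_deriv ?_
  push_cast
  field_simp
  ring

lemma contDiffAt_extWave {G H : ℝ → ℝ} (hG : ContDiff ℝ ∞ G) (hH : ContDiff ℝ ∞ H) (c : ℝ)
    {p : ℝ × E3} (hp : p.2 ≠ 0) :
    ContDiffAt ℝ ∞ (fun p : ℝ × E3 => extWave c G H p.1 p.2) p := by
  have hn : ContDiffAt ℝ ∞ (fun p : ℝ × E3 => ‖p.2‖) p := contDiffAt_snd.norm ℝ hp
  have ht : ContDiffAt ℝ ∞ (fun p : ℝ × E3 => c * p.1) p := contDiffAt_const.mul contDiffAt_fst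
  exact ((hG.contDiffAt.comp p (ht.add hn)).add (hH.contDiffAt.comp p (ht.sub hn))).div hn
    (norm_ne_zero_iff.2 hp)

/-- The Laplacian of a radial function with profile `v(r) / r` is `v''(r) / r`. -/
lemma laplacian_radial {v v₁ v₂ : ℝ → ℝ} (hv : ∀ r, HasDerivAt v (v₁ r) r)
    (hv₁ : ∀ r, HasDerivAt v₁ (v₂ r) r) {x : E3} (hx : x ≠ 0)
    (hs : ContDiffAt ℝ 2 (fun y : E3 => v ‖y‖ / ‖y‖) x) :
    (Δ (fun y : E3 => v ‖y‖ / ‖y‖)) x = v₂ ‖x‖ / ‖x‖ := by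
  set k : ℝ → ℝ := fun r => v₁ r / r ^ 2 - v r / r ^ 3 with hk
  have h0 : ‖x‖ ≠ 0 := norm_ne_zero_iff.2 hx
  have key : ∀ i, pd i (pd i (fun y : E3 => v ‖y‖ / ‖y‖)) x =
      x i * ((v₂ ‖x‖ / ‖x‖ ^ 2 - 3 * v₁ ‖x‖ / ‖x‖ ^ 3 + 3 * v ‖x‖ / ‖x‖ ^ 4) * (x i / ‖x‖)) +
        k ‖x‖ := by
    intro i
    have e : pd i (fun y : E3 => v ‖y‖ / ‖y‖) =ᶠ[𝓝 x] fun y => y i * k ‖y‖ := by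
      filter_upwards [isOpen_ne.mem_nhds hx] with y hy
      have hy0 : ‖y‖ ≠ 0 := norm_ne_zero_iff.2 hy
      rw [pd_comp_norm hy (hasDerivAt_div_self (hv _) hy0)]
      simp only [hk]
      field_simp
    have h1 : HasFDerivAt (fun y : E3 => y i) (EuclideanSpace.proj i : E3 →L[ℝ] ℝ) x :=
      (EuclideanSpace.proj i : E3 →L[ℝ] ℝ).hasFDerivAt
    have hd : HasDerivAt k _ ‖x‖ := hasDerivAt_div_sq_sub (hv ‖x‖) (hv₁ ‖x‖) h0
    have h2 := hasFDerivAt_comp_norm hx hd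
    have h3 := pd_comp_norm hx hd i
    rw [pd, h2.fderiv] at h3
    have h4 : HasFDerivAt (fun y : E3 => y i * k ‖y‖) _ x := h1.mul h2
    rw [pd, e.fderiv_eq, h4.fderiv, add_apply, smul_apply, h3]
    simp
  rw [laplacian_eq_sum_pd hs]
  simp only [key]
  have hn : ∑ i : Fin 3, x i * x i = ‖x‖ * ‖x‖ := by
    rw [← real_inner_self_eq_norm_mul_norm x, PiLp.inner_apply]
    rfl
  rw [Fin.sum_univ_three] at hn ⊢
  set a := v₂ ‖x‖ / ‖x‖ ^ 2 - 3 * v₁ ‖x‖ / ‖x‖ ^ 3 + 3 * v ‖x‖ / ‖x‖ ^ 4 with ha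
  calc _ = a / ‖x‖ * (x 0 * x 0 + x 1 * x 1 + x 2 * x 2) + 3 * k ‖x‖ := by ring
    _ = _ := by
      rw [hn]
      simp only [ha, hk]
      field_simp
      ring

lemma iteratedDeriv_two_eq {f f' f'' : ℝ → ℝ} (h : ∀ t, HasDerivAt f (f' t) t)
    (h' : ∀ t, HasDerivAt f' (f'' t) t) (t : ℝ) : iteratedDeriv 2 f t = f'' t := by
  rw [iteratedDeriv_succ, iteratedDeriv_one, show deriv f = f' from funext fun s => (h s).deriv]
  exact (h' t).deriv

lemma isExteriorSolution_extWave {c T ε : ℝ} (hε : 0 < ε) {G H : ℝ → ℝ} (hG : ContDiff ℝ ∞ G)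
    (hH : ContDiff ℝ ∞ H) {Φ Ψ : E3 → ℝ}
    (h0 : ∀ x : E3, ε < ‖x‖ → twoWave G H 0 ‖x‖ = ‖x‖ * Φ x)
    (h1 : ∀ x : E3, ε < ‖x‖ → c * twoWave (deriv G) (deriv H) 0 ‖x‖ = ‖x‖ * Ψ x) :
    IsExteriorSolution c T ε Φ Ψ (extWave c G H) := by
  have ne : ∀ x : E3, ε ≤ ‖x‖ → x ≠ 0 := fun x hx => norm_pos_iff.1 (hε.trans_le hx)
  refine ⟨fun p hp => (contDiffAt_extWave hG hH c (ne _ hp.2)).contDiffWithinAt, ?_, ?_, ?_, ?_⟩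
  · intro t _ x y _ hxy
    simp only [extWave, hxy]
  · intro t _ x hx
    have hx0 := ne x hx.le
    have hs : ContDiffAt ℝ 2 (fun y : E3 => twoWave G H (c * t) ‖y‖ / ‖y‖) x :=
      ((contDiffAt_extWave hG hH c (p := (t, x)) hx0).comp x
        (contDiffAt_const.prodMk contDiffAt_id)).of_le (WithTop.coe_le_coe.2 le_top)
    have hl := laplacian_radial (fun r => hasDerivAt_twoWave hG hH (c * t) r)
      (fun r => hasDerivAt_twoWave_deriv hG hH (c * t) r) hx0 hs
    change _ = c ^ 2 * (Δ (fun y : E3 => twoWave G H (c * t) ‖y‖ / ‖y‖)) x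
    rw [hl, iteratedDeriv_two_eq (f := fun τ => extWave c G H τ x)
      (fun t => (hasDerivAt_twoWave_time hG hH c ‖x‖ t).div_const ‖x‖)
      (fun t => ((hasDerivAt_twoWave_time (contDiff_deriv hG) (contDiff_deriv hH) c ‖x‖ t).const_mul
        c).div_const ‖x‖)]
    ring
  · intro x hx
    have : ‖x‖ ≠ 0 := norm_ne_zero_iff.2 (ne x hx.le)
    rw [extWave, mul_zero, h0 x hx]
    field_simp
  · intro x hx
    have : ‖x‖ ≠ 0 := norm_ne_zero_iff.2 (ne x hx.le)
    have hd := (hasDerivAt_twoWave_time hG hH c ‖x‖ 0).div_const ‖x‖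
    rw [mul_zero, h1 x hx] at hd
    refine (hd.congr_deriv ?_).hasDerivWithinAt
    field_simp

/-- Where a radial wave vanishes for `r > R`, so does its radial derivative. -/
lemma twoWave_deriv_eq_zero {G H : ℝ → ℝ} (hG : ContDiff ℝ ∞ G) (hH : ContDiff ℝ ∞ H) {τ R : ℝ}
    (h : ∀ r, R < r → twoWave G H τ r = 0) (r : ℝ) (hr : R < r) :
    twoWave (deriv G) (-deriv H) τ r = 0 := by
  have h2 : twoWave G H τ =ᶠ[𝓝 r] fun _ => 0 := by
    filter_upwards [lt_mem_nhds hr] with s hs using h s hs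
  exact (hasDerivAt_twoWave hG hH τ r).unique
    ((hasDerivAt_const r (0 : ℝ)).congr_of_eventuallyEq h2)

lemma twoWave_deriv_deriv_eq_zero {G H : ℝ → ℝ} (hG : ContDiff ℝ ∞ G) (hH : ContDiff ℝ ∞ H)
    {τ R : ℝ} (h : ∀ r, R < r → twoWave G H τ r = 0) (r : ℝ) (hr : R < r) :
    twoWave (deriv (deriv G)) (deriv (deriv H)) τ r = 0 := by
  have h2 : twoWave (deriv G) (-deriv H) τ =ᶠ[𝓝 r] fun _ => 0 := by
    filter_upwards [lt_mem_nhds hr] with s hs using twoWave_deriv_eq_zero hG hH h s hs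
  exact (hasDerivAt_twoWave_deriv hG hH τ r).unique
    ((hasDerivAt_const r (0 : ℝ)).congr_of_eventuallyEq h2)

lemma continuous_twoWave {G H : ℝ → ℝ} (hG : Continuous G) (hH : Continuous H) (c : ℝ) :
    Continuous fun p : ℝ × ℝ => twoWave G H (c * p.1) p.2 := by
  unfold twoWave; fun_prop

/-! ### Extended exterior solutions as curves in Sobolev spaces -/

section Extension

variable {c T R ε : ℝ} {G H : ℝ → ℝ}

/-- The radial derivative of `twoWave G H τ r / r`, divided by `r`. -/
noncomputable def waveSlope (G H : ℝ → ℝ) (τ r : ℝ) : ℝ :=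
  twoWave (deriv G) (-deriv H) τ r / r ^ 2 - twoWave G H τ r / r ^ 3

/-- The radial derivative of `waveSlope`. -/
noncomputable def waveSlopeDeriv (G H : ℝ → ℝ) (τ r : ℝ) : ℝ :=
  twoWave (deriv (deriv G)) (deriv (deriv H)) τ r / r ^ 2 -
    3 * twoWave (deriv G) (-deriv H) τ r / r ^ 3 + 3 * twoWave G H τ r / r ^ 4

lemma continuousOn_twoWave_div (hε : 0 < ε) (hG : Continuous G) (hH : Continuous H) (n : ℕ)
    (a : ℝ) : ContinuousOn (fun p : ℝ × ℝ => a * twoWave G H (c * p.1) p.2 / p.2 ^ n)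
      (Set.Icc 0 T ×ˢ Set.Icc ε R) :=
  (continuous_const.mul (continuous_twoWave hG hH c)).continuousOn.div
    (continuous_snd.pow n).continuousOn fun _ hp => (pow_pos (hε.trans_le hp.2.1) n).ne'

lemma continuousOn_waveSlope (hε : 0 < ε) (hG : ContDiff ℝ ∞ G) (hH : ContDiff ℝ ∞ H) :
    ContinuousOn (fun p : ℝ × ℝ => waveSlope G H (c * p.1) p.2)
      (Set.Icc 0 T ×ˢ Set.Icc ε R) := by
  have h1 := continuousOn_twoWave_div (c := c) (T := T) (R := R) hε (contDiff_deriv hG).continuous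
    (contDiff_deriv hH).continuous.neg 2 1
  have h0 := continuousOn_twoWave_div (c := c) (T := T) (R := R) hε hG.continuous hH.continuous 3 1
  simp only [one_mul] at h1 h0
  exact h1.sub h0

lemma continuousOn_waveSlopeDeriv (hε : 0 < ε) (hG : ContDiff ℝ ∞ G) (hH : ContDiff ℝ ∞ H) :
    ContinuousOn (fun p : ℝ × ℝ => waveSlopeDeriv G H (c * p.1) p.2)
      (Set.Icc 0 T ×ˢ Set.Icc ε R) := by
  have h2 := continuousOn_twoWave_div (c := c) (T := T) (R := R) hε
    (contDiff_deriv (contDiff_deriv hG)).continuous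
    (contDiff_deriv (contDiff_deriv hH)).continuous 2 1
  have h1 := continuousOn_twoWave_div (c := c) (T := T) (R := R) hε (contDiff_deriv hG).continuous
    (contDiff_deriv hH).continuous.neg 3 3
  have h0 := continuousOn_twoWave_div (c := c) (T := T) (R := R) hε hG.continuous hH.continuous 4 3
  simp only [one_mul] at h2
  exact (h2.sub h1).add h0

lemma hasDerivAt_twoWave_div (hG : ContDiff ℝ ∞ G) (hH : ContDiff ℝ ∞ H) (τ : ℝ) {r : ℝ}
    (hr : r ≠ 0) : HasDerivAt (fun r => twoWave G H τ r / r) (r * waveSlope G H τ r) r :=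
  hasDerivAt_div_self (hasDerivAt_twoWave hG hH τ r) hr

lemma hasDerivAt_waveSlope (hG : ContDiff ℝ ∞ G) (hH : ContDiff ℝ ∞ H) (τ : ℝ) {r : ℝ}
    (hr : r ≠ 0) : HasDerivAt (waveSlope G H τ) (waveSlopeDeriv G H τ r) r :=
  hasDerivAt_div_sq_sub (hasDerivAt_twoWave hG hH τ r) (hasDerivAt_twoWave_deriv hG hH τ r) hr

lemma waveSlope_eq_zero (hG : ContDiff ℝ ∞ G) (hH : ContDiff ℝ ∞ H) {τ : ℝ}
    (h : ∀ r, R < r → twoWave G H τ r = 0) (r : ℝ) (hr : R < r) : waveSlope G H τ r = 0 := by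
  rw [waveSlope, h r hr, twoWave_deriv_eq_zero hG hH h r hr]; simp

lemma waveSlopeDeriv_eq_zero (hG : ContDiff ℝ ∞ G) (hH : ContDiff ℝ ∞ H) {τ : ℝ}
    (h : ∀ r, R < r → twoWave G H τ r = 0) (r : ℝ) (hr : R < r) : waveSlopeDeriv G H τ r = 0 := by
  rw [waveSlopeDeriv, h r hr, twoWave_deriv_eq_zero hG hH h r hr,
    twoWave_deriv_deriv_eq_zero hG hH h r hr]; simp

lemma exists_bound_of_continuousOn_of_eq_zero {f : ℝ → ℝ} (hf : ContinuousOn f (Set.Icc ε R))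
    (hz : ∀ r, R < r → f r = 0) : ∃ C, ∀ r, ε ≤ r → |f r| ≤ C := by
  obtain ⟨M, hM⟩ := isCompact_Icc.exists_bound_of_continuousOn hf
  refine ⟨max M 0, fun r hr => ?_⟩
  rcases le_or_gt r R with h | h
  · exact (hM r ⟨hr, h⟩).trans (le_max_left _ _)
  · rw [hz r h, abs_zero]; exact le_max_right _ _

lemma continuousOn_slice {F : ℝ × ℝ → ℝ} (hF : ContinuousOn F (Set.Icc 0 T ×ˢ Set.Icc ε R)) {t : ℝ}
    (ht : t ∈ Set.Icc 0 T) : ContinuousOn (fun r => F (t, r)) (Set.Icc ε R) :=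
  hF.comp (by fun_prop) fun _ hr => ⟨ht, hr⟩

/-- The weak radial derivative of the extension by the boundary value. -/
lemma hasRadialDeriv_ext (hε : 0 < ε) (hG : ContDiff ℝ ∞ G) (hH : ContDiff ℝ ∞ H)
    (hz : ∀ t ∈ Set.Icc 0 T, ∀ r, R < r → twoWave G H (c * t) r = 0) {t : ℝ}
    (ht : t ∈ Set.Icc 0 T) :
    HasRadialDeriv (fun r => twoWave G H (c * t) (max r ε) / max r ε)
      fun r => r * if ε < r then waveSlope G H (c * t) r else 0 := by
  have hc : ContinuousOn (fun r => r * waveSlope G H (c * t) r) (Set.Icc ε R) :=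
    continuousOn_id.mul (continuousOn_slice (continuousOn_waveSlope (c := c) hε hG hH) ht)
  obtain ⟨C, hC⟩ := exists_bound_of_continuousOn_of_eq_zero hc fun r hr => by
    rw [waveSlope_eq_zero hG hH (hz t ht) r hr, mul_zero]
  have := hasRadialDeriv_max (h := fun r => twoWave G H (c * t) r / r) (ε := ε)
    (fun r hr => hasDerivAt_twoWave_div hG hH (c * t) (hε.trans_le hr).ne') hC
  simpa only [mul_ite, mul_zero] using this

/-- Under the Neumann condition `waveSlope` vanishes at `r = ε`, so that its extension by `0` is
weakly differentiable. -/
lemma hasRadialDeriv_slope_ext (hε : 0 < ε) (hG : ContDiff ℝ ∞ G) (hH : ContDiff ℝ ∞ H)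
    (hz : ∀ t ∈ Set.Icc 0 T, ∀ r, R < r → twoWave G H (c * t) r = 0) {t : ℝ}
    (ht : t ∈ Set.Icc 0 T) (h0 : waveSlope G H (c * t) ε = 0) :
    HasRadialDeriv (fun r => if ε < r then waveSlope G H (c * t) r else 0)
      fun r => if ε < r then waveSlopeDeriv G H (c * t) r else 0 := by
  obtain ⟨C, hC⟩ := exists_bound_of_continuousOn_of_eq_zero
    (continuousOn_slice (continuousOn_waveSlopeDeriv (c := c) hε hG hH) ht) fun r hr =>
      waveSlopeDeriv_eq_zero hG hH (hz t ht) r hr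
  have := hasRadialDeriv_max (h := waveSlope G H (c * t)) (ε := ε)
    (fun r hr => hasDerivAt_waveSlope hG hH (c * t) (hε.trans_le hr).ne') hC
  refine (congrArg₂ HasRadialDeriv (funext fun r => ?_) rfl).mp this
  split_ifs with h
  · rw [max_eq_left h.le]
  · rw [max_eq_right (not_lt.1 h), h0]

/-- A profile that vanishes for `r ≤ ε` and is given by a continuous function for `r > ε`. -/
lemma profileCurve_ite {F : ℝ × ℝ → ℝ} (hF : ContinuousOn F (Set.Icc 0 T ×ˢ Set.Icc ε R))
    (hεR : ε ≤ R) (hz : ∀ t ∈ Set.Icc 0 T, ∀ r, R < r → F (t, r) = 0) :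
    ProfileCurve T R fun t r => if ε < r then F (t, r) else 0 := by
  refine profileCurve_of_continuousOn hF (fun t ht r hr => ?_) fun r _ => ?_
  · rw [if_pos (hεR.trans_lt hr), hz t ht r hr]
  · rcases le_or_gt r ε with h | h
    · exact Or.inl fun t _ => if_neg h.not_gt
    rcases le_or_gt r R with h' | h'
    · exact Or.inr ⟨r, ⟨h.le, h'⟩, fun t _ => if_pos h⟩
    · exact Or.inl fun t ht => by rw [if_pos h, hz t ht r h']

lemma profileCurve_ext (hε : 0 < ε) (hεR : ε ≤ R) (hG : ContDiff ℝ ∞ G) (hH : ContDiff ℝ ∞ H)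
    (hz : ∀ t ∈ Set.Icc 0 T, ∀ r, R < r → twoWave G H (c * t) r = 0) :
    ProfileCurve T R fun t r => twoWave G H (c * t) (max r ε) / max r ε := by
  have hF := continuousOn_twoWave_div (c := c) (T := T) (R := R) hε hG.continuous hH.continuous 1 1
  simp only [one_mul, pow_one] at hF
  refine profileCurve_of_continuousOn hF (fun t ht r hr => ?_) fun r _ => ?_
  · rw [max_eq_left (hεR.trans hr.le), hz t ht r hr, zero_div]
  · rcases le_or_gt r R with h | h
    · exact Or.inr ⟨max r ε, ⟨le_max_right _ _, max_le h hεR⟩, fun t _ => rfl⟩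
    · exact Or.inl fun t ht => by rw [max_eq_left (hεR.trans h.le), hz t ht r h, zero_div]

lemma profileCurve_slope (hε : 0 < ε) (hεR : ε ≤ R) (hG : ContDiff ℝ ∞ G) (hH : ContDiff ℝ ∞ H)
    (hz : ∀ t ∈ Set.Icc 0 T, ∀ r, R < r → twoWave G H (c * t) r = 0) :
    ProfileCurve T R fun t r => r * if ε < r then waveSlope G H (c * t) r else 0 := by
  have := profileCurve_ite (T := T) (F := fun p => p.2 * waveSlope G H (c * p.1) p.2)
    (continuousOn_snd.mul (continuousOn_waveSlope (c := c) hε hG hH)) hεR fun t ht r hr => by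
      simp only [waveSlope_eq_zero hG hH (hz t ht) r hr, mul_zero]
  simpa only [mul_ite, mul_zero] using this

lemma contInH_one_ext (hε : 0 < ε) (hεR : ε ≤ R) (hG : ContDiff ℝ ∞ G) (hH : ContDiff ℝ ∞ H)
    (hz : ∀ t ∈ Set.Icc 0 T, ∀ r, R < r → twoWave G H (c * t) r = 0) :
    ContInH 1 T fun t x => twoWave G H (c * t) (max ‖x‖ ε) / max ‖x‖ ε :=
  contInH_one_of_profile (fun _ ht => hasRadialDeriv_ext hε hG hH hz ht)
    (profileCurve_ext hε hεR hG hH hz) (profileCurve_slope hε hεR hG hH hz)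

lemma contInH_two_ext (hε : 0 < ε) (hεR : ε ≤ R) (hG : ContDiff ℝ ∞ G) (hH : ContDiff ℝ ∞ H)
    (hz : ∀ t ∈ Set.Icc 0 T, ∀ r, R < r → twoWave G H (c * t) r = 0)
    (h0 : ∀ t ∈ Set.Icc 0 T, waveSlope G H (c * t) ε = 0) :
    ContInH 2 T fun t x => twoWave G H (c * t) (max ‖x‖ ε) / max ‖x‖ ε := by
  refine contInH_two_of_profile (fun _ ht => hasRadialDeriv_ext hε hG hH hz ht)
    (fun t ht => hasRadialDeriv_slope_ext hε hG hH hz ht (h0 t ht))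
    (profileCurve_ext hε hεR hG hH hz) (profileCurve_slope hε hεR hG hH hz) ?_ ?_
  · exact profileCurve_ite (continuousOn_waveSlope (c := c) hε hG hH) hεR fun t ht r hr =>
      waveSlope_eq_zero hG hH (hz t ht) r hr
  · have := profileCurve_ite (T := T) (F := fun p => p.2 * waveSlopeDeriv G H (c * p.1) p.2)
      (continuousOn_snd.mul (continuousOn_waveSlopeDeriv (c := c) hε hG hH)) hεR fun t ht r hr => by
        simp only [waveSlopeDeriv_eq_zero hG hH (hz t ht) r hr, mul_zero]
    simpa only [mul_ite, mul_zero] using this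

lemma extendConst_extWave (hε : 0 < ε) :
    extendConst ε (extWave c G H) =
      fun t x => twoWave G H (c * t) (max ‖x‖ ε) / max ‖x‖ ε := by
  funext t x
  simp only [extendConst, extWave]
  split_ifs with h
  · rw [max_eq_right h, norm_smul, norm_e₁, mul_one, Real.norm_of_nonneg hε.le]
  · rw [max_eq_left (not_le.1 h).le]

lemma extendZero_extWave {t : ℝ} (h0 : twoWave G H (c * t) ε = 0) :
    extendZero ε (extWave c G H) t =
      fun x => twoWave G H (c * t) (max ‖x‖ ε) / max ‖x‖ ε := by
  funext x
  simp only [extendZero, extWave]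
  split_ifs with h
  · rw [max_eq_right h, h0, zero_div]
  · rw [max_eq_left (not_le.1 h).le]

lemma contInH_congr {k : ℕ} {U U' : ℝ → E3 → ℝ} (h : ContInH k T U)
    (e : ∀ t ∈ Set.Icc 0 T, U' t = U t) : ContInH k T U' := by
  refine ⟨fun t ht => by rw [e t ht]; exact h.1 t ht, fun t₀ ht₀ => ?_⟩
  refine (h.2 t₀ ht₀).congr' ?_
  filter_upwards [self_mem_nhdsWithin] with t ht
  rw [e t ht, e t₀ ht₀]

end Extension

/-! ### d'Alembert's formula -/

/-- The profile of a smooth compactly supported radial function, continued evenly to `r < 0`. -/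
structure IsProfile (R : ℝ) (φ : ℝ → ℝ) : Prop where
  smooth : ContDiff ℝ ∞ φ
  even : ∀ r, φ (-r) = φ r
  zero : ∀ r, R ≤ |r| → φ r = 0

lemma IsSmoothRadial.profile_norm {Φ : E3 → ℝ} (h : IsSmoothRadial Φ) (x : E3) :
    profile Φ ‖x‖ = Φ x := by
  obtain ⟨-, -, φ, hφ⟩ := h
  rw [profile, hφ, hφ x, norm_smul, norm_e₁, mul_one, norm_norm]

lemma IsSmoothRadial.exists_isProfile {Φ : E3 → ℝ} (h : IsSmoothRadial Φ) :
    ∃ R, 0 ≤ R ∧ ∀ R', R ≤ R' → IsProfile R' (profile Φ) := by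
  obtain ⟨hs, hc, φ, hφ⟩ := h
  obtain ⟨R, hR⟩ := hc.isCompact.isBounded.subset_closedBall 0
  refine ⟨max 0 (R + 1), le_max_left _ _, fun R' hR' => ⟨?_, fun r => ?_, fun r hr => ?_⟩⟩
  · exact hs.comp (contDiff_id.smul contDiff_const)
  · rw [profile, profile, hφ, hφ, neg_smul, norm_neg]
  · refine image_eq_zero_of_notMem_tsupport (f := Φ) (x := r • e₁) fun hx => ?_
    have := hR hx
    rw [mem_closedBall_zero_iff, norm_smul, norm_e₁, mul_one, Real.norm_eq_abs] at this
    linarith [le_max_right 0 (R + 1)]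

/-- The wave `K` travelling inwards in d'Alembert's formula `K(ct + r) - K(ct - r)` for `r` times
the solution with data `p`, `q`. The outgoing part is `halfWave (-c) p q`. -/
noncomputable def halfWave (c : ℝ) (p q : ℝ → ℝ) (r : ℝ) : ℝ :=
  (r * p r + c⁻¹ * ∫ s in (0 : ℝ)..r, s * q s) / 2

section HalfWave

variable {c : ℝ} {p q : ℝ → ℝ}

lemma hasDerivAt_halfWave (hp : ContDiff ℝ ∞ p) (hq : ContDiff ℝ ∞ q) (c r : ℝ) :
    HasDerivAt (halfWave c p q) ((p r + r * deriv p r + c⁻¹ * (r * q r)) / 2) r := by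
  have hcq : Continuous fun s => s * q s := continuous_id.mul hq.continuous
  have h1 := intervalIntegral.integral_hasDerivAt_right (hcq.intervalIntegrable 0 r)
    hcq.stronglyMeasurable.stronglyMeasurableAtFilter hcq.continuousAt
  have h2 := (hasDerivAt_id r).mul (hasDerivAt_of_contDiff hp r)
  refine ((h2.add (h1.const_mul c⁻¹)).div_const 2).congr_deriv ?_
  simp only [id, one_mul]

lemma deriv_halfWave (hp : ContDiff ℝ ∞ p) (hq : ContDiff ℝ ∞ q) (c : ℝ) :
    deriv (halfWave c p q) = fun r => (p r + r * deriv p r + c⁻¹ * (r * q r)) / 2 :=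
  funext fun r => (hasDerivAt_halfWave hp hq c r).deriv

lemma contDiff_halfWave (hp : ContDiff ℝ ∞ p) (hq : ContDiff ℝ ∞ q) (c : ℝ) :
    ContDiff ℝ ∞ (halfWave c p q) := by
  rw [contDiff_infty_iff_deriv, deriv_halfWave hp hq]
  have hp' := contDiff_deriv hp
  exact ⟨fun r => (hasDerivAt_halfWave hp hq c r).differentiableAt, by fun_prop⟩

lemma deriv_deriv_halfWave (hp : ContDiff ℝ ∞ p) (hq : ContDiff ℝ ∞ q) (c : ℝ) :
    deriv (deriv (halfWave c p q)) = fun r =>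
      (2 * deriv p r + r * deriv (deriv p) r + c⁻¹ * (q r + r * deriv q r)) / 2 := by
  rw [deriv_halfWave hp hq]
  funext r
  have h1 := hasDerivAt_of_contDiff hp r
  have h2 := (hasDerivAt_id r).mul (hasDerivAt_of_contDiff (contDiff_deriv hp) r)
  have h3 := ((hasDerivAt_id r).mul (hasDerivAt_of_contDiff hq r)).const_mul c⁻¹
  refine (((h1.add h2).add h3).div_const 2).deriv.trans ?_
  simp only [id]
  ring

lemma halfWave_add_halfWave_neg (c : ℝ) (p q : ℝ → ℝ) (r : ℝ) :
    halfWave c p q r + halfWave (-c) p q r = r * p r := by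
  simp only [halfWave, inv_neg]; ring

lemma integral_mul_even (hq : ∀ r, q (-r) = q r) (r : ℝ) :
    ∫ s in (0 : ℝ)..(-r), s * q s = ∫ s in (0 : ℝ)..r, s * q s := by
  have := intervalIntegral.integral_comp_neg (f := fun s => s * q s) (a := 0) (b := r)
  rw [neg_zero] at this
  rw [intervalIntegral.integral_symm, ← this, ← intervalIntegral.integral_neg]
  refine intervalIntegral.integral_congr fun s _ => ?_
  simp only [hq]; ring

lemma halfWave_neg_speed (hp : ∀ r, p (-r) = p r) (hq : ∀ r, q (-r) = q r) (c r : ℝ) :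
    halfWave (-c) p q r = -halfWave c p q (-r) := by
  simp only [halfWave, integral_mul_even hq, hp, inv_neg]; ring

lemma IsProfile.isWaveProfile {R : ℝ} (hp : IsProfile R p) (hq : IsProfile R q)
    (c : ℝ) : IsWaveProfile R (halfWave c p q) := by
  refine ⟨contDiff_halfWave hp.smooth hq.smooth c, fun r hr => ?_⟩
  have key : ∀ s, R ≤ s → ∫ σ in (0 : ℝ)..s, σ * q σ = ∫ σ in (0 : ℝ)..R, σ * q σ := by
    intro s hs
    have hcq : Continuous fun s => s * q s := continuous_id.mul hq.smooth.continuous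
    rw [← intervalIntegral.integral_add_adjacent_intervals (hcq.intervalIntegrable 0 R)
      (hcq.intervalIntegrable R s)]
    have : ∫ σ in R..s, σ * q σ = ∫ σ in R..s, (0 : ℝ) := by
      refine intervalIntegral.integral_congr fun σ hσ => ?_
      rw [Set.uIcc_of_le hs] at hσ
      simp only [hq.zero σ (hσ.1.trans (le_abs_self σ)), mul_zero]
    rw [this]; simp
  have e : ∫ σ in (0 : ℝ)..r, σ * q σ = ∫ σ in (0 : ℝ)..R, σ * q σ := by
    rcases le_total 0 r with h | h
    · exact key r (by rwa [abs_of_nonneg h] at hr)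
    · rw [← integral_mul_even hq.even]
      exact key _ (by rwa [abs_of_nonpos h] at hr)
  rw [halfWave, halfWave, e, hp.zero r hr, hp.zero R (le_abs_self R)]
  simp

end HalfWave

lemma IsWaveProfile.wavg_eq_twoWave {R : ℝ} {K : ℝ → ℝ} (hK : IsWaveProfile R K) (τ : ℝ) {r : ℝ}
    (hr : 0 < r) : wavg 0 (deriv K) τ r = twoWave K (-K) τ r / r := by
  rw [eq_div_iff hr.ne', mul_comm,
    mul_wavg_zero hK.hasDerivAt hK.isLineTest_deriv.continuous, twoWave, Pi.neg_apply,
    sub_eq_add_neg]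

lemma waveU_zero {R c : ℝ} {φ ψ : ℝ → ℝ} (hφ : IsProfile R φ) (hψ : IsProfile R ψ) :
    waveU c (halfWave c φ ψ) 0 =ᵐ[volume] fun x => φ ‖x‖ := by
  filter_upwards [ae_norm_pos] with x hx
  have h := halfWave_neg_speed hφ.even hψ.even c ‖x‖
  have h2 := halfWave_add_halfWave_neg c φ ψ ‖x‖
  rw [waveU, (hφ.isWaveProfile hψ c).wavg_eq_twoWave _ hx, div_eq_iff hx.ne', mul_zero, twoWave,
    zero_add, zero_sub, Pi.neg_apply, ← h, h2, mul_comm]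

lemma deriv_even {φ : ℝ → ℝ} (h : ∀ r, φ (-r) = φ r) (r : ℝ) : deriv φ (-r) = -deriv φ r := by
  have := deriv_comp_neg φ r
  rw [show (fun x => φ (-x)) = φ from funext h] at this
  rw [this, neg_neg]

lemma waveV_zero {R c : ℝ} (hc : c ≠ 0) {φ ψ : ℝ → ℝ} (hφ : IsProfile R φ)
    (hψ : IsProfile R ψ) :
    waveV c (halfWave c φ ψ) 0 =ᵐ[volume] fun x => ψ ‖x‖ := by
  have hK := hφ.isWaveProfile hψ c
  filter_upwards [ae_norm_pos] with x hx
  have h := mul_wavg_zero hK.isLineTest_deriv.hasDerivAt hK.isLineTest_deriv.deriv.continuous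
    (c * 0) ‖x‖
  simp only [deriv_halfWave hφ.smooth hψ.smooth c, mul_zero, zero_add, zero_sub, hφ.even, hψ.even,
    deriv_even hφ.even] at h
  simp only [waveV, mul_zero, deriv_halfWave hφ.smooth hψ.smooth c]
  refine mul_left_cancel₀ hx.ne' (Eq.trans ?_ (?_ : c * (c⁻¹ * (‖x‖ * ψ ‖x‖)) = _))
  · rw [mul_left_comm, h]; ring
  · field_simp

/-! ### Exterior solutions with data that are constant near the obstacle -/

lemma deriv_eq_zero_of_le {f : ℝ → ℝ} (hf : Differentiable ℝ f) {a C : ℝ} (h : ∀ x, x ≤ a → f x = C)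
    {x : ℝ} (hx : x ≤ a) : deriv f x = 0 := by
  have h1 : HasDerivWithinAt f (deriv f x) (Set.Iic a) x := (hf x).hasDerivAt.hasDerivWithinAt
  have h2 : HasDerivWithinAt f 0 (Set.Iic a) x :=
    (hasDerivWithinAt_const x _ C).congr (fun y hy => h y hy) (h x hx)
  exact (uniqueDiffOn_Iic a x hx).eq_deriv _ h1 h2

/-- `g` for `r > ε`, continued by the constant `a`. -/
noncomputable def cutAt (ε a : ℝ) (g : ℝ → ℝ) (r : ℝ) : ℝ := if r ≤ ε then a else g r

lemma contDiff_cutAt {ε a : ℝ} {g : ℝ → ℝ} (hε : 0 < ε) (hg : ∀ r, 0 < r → ContDiffAt ℝ ∞ g r)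
    (ha : ∀ r, 0 < r → r ≤ ε → g r = a) : ContDiff ℝ ∞ (cutAt ε a g) := by
  rw [contDiff_iff_contDiffAt]
  intro r
  rcases lt_or_ge r ε with h | h
  · refine (contDiffAt_const (c := a)).congr_of_eventuallyEq ?_
    filter_upwards [gt_mem_nhds h] with s hs
    exact if_pos hs.le
  · have hr : 0 < r := hε.trans_le h
    refine (hg r hr).congr_of_eventuallyEq ?_
    filter_upwards [lt_mem_nhds hr] with s hs
    rw [cutAt]
    split_ifs with h'
    · exact (ha s hs h').symm
    · rfl

lemma cutAt_eq {ε a : ℝ} {g : ℝ → ℝ} (ha : ∀ r, 0 < r → r ≤ ε → g r = a) {r : ℝ} (hr : 0 < r) :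
    cutAt ε a g r = g r := by
  rw [cutAt]
  split_ifs with h'
  · exact (ha r hr h').symm
  · rfl

/-- Smooth initial profiles `p`, `q`, equal to constants `f`, `g` for `r ≤ ε` (also for negative
`r`, where they are not even) and to `0` for `r ≥ R`. -/
structure IsCutData (ε R f g : ℝ) (p q : ℝ → ℝ) : Prop where
  smooth : ContDiff ℝ ∞ p
  smooth' : ContDiff ℝ ∞ q
  const : ∀ r, r ≤ ε → p r = f
  const' : ∀ r, r ≤ ε → q r = g
  zero : ∀ r, R ≤ r → p r = 0
  zero' : ∀ r, R ≤ r → q r = 0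

/-- The outgoing wave: the free one, and the wave `b` reflected at `r = ε`. -/
noncomputable def outWave (c : ℝ) (p q b : ℝ → ℝ) (ε τ : ℝ) : ℝ :=
  halfWave (-c) p q (-τ) + b (τ + ε)

/-- `halfWave c p q` for constant `p = f` and `q = g`. -/
noncomputable def constWave (c f g ρ : ℝ) : ℝ := f / 2 * ρ + c⁻¹ * g / 4 * ρ ^ 2

namespace IsCutData

variable {c T ε R f g : ℝ} {p q b : ℝ → ℝ}

lemma halfWave_of_le (h : IsCutData ε R f g p q) (hε : 0 < ε) (c : ℝ) {ρ : ℝ} (hρ : ρ ≤ ε) :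
    halfWave c p q ρ = constWave c f g ρ := by
  have e : ∫ s in (0 : ℝ)..ρ, s * q s = ∫ s in (0 : ℝ)..ρ, s * g := by
    refine intervalIntegral.integral_congr fun s hs => ?_
    rcases le_total 0 ρ with h0 | h0
    · rw [Set.uIcc_of_le h0] at hs
      simp only [h.const' s (hs.2.trans hρ)]
    · rw [Set.uIcc_of_ge h0] at hs
      simp only [h.const' s (hs.2.trans hε.le)]
  rw [halfWave, e, h.const ρ hρ, intervalIntegral.integral_mul_const, integral_id, constWave]
  ring

lemma halfWave_add_eq_zero (h : IsCutData ε R f g p q) (c : ℝ) {ρ ρ' : ℝ} (hρ : R ≤ ρ)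
    (hρ' : R ≤ ρ') : halfWave c p q ρ + halfWave (-c) p q ρ' = 0 := by
  have hcq : Continuous fun s => s * q s := continuous_id.mul h.smooth'.continuous
  have e : (∫ s in (0 : ℝ)..ρ, s * q s) = ∫ s in (0 : ℝ)..ρ', s * q s := by
    rw [← intervalIntegral.integral_add_adjacent_intervals (hcq.intervalIntegrable 0 ρ')
      (hcq.intervalIntegrable ρ' ρ)]
    have : ∫ σ in ρ'..ρ, σ * q σ = ∫ σ in ρ'..ρ, (0 : ℝ) := by
      refine intervalIntegral.integral_congr fun σ hσ => ?_
      simp only [h.zero' σ ((le_min hρ' hρ).trans hσ.1), mul_zero]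
    rw [this]; simp
  rw [halfWave, halfWave, e, h.zero ρ hρ, h.zero ρ' hρ', inv_neg]
  ring

lemma contDiff_inWave (h : IsCutData ε R f g p q) (c : ℝ) : ContDiff ℝ ∞ (halfWave c p q) :=
  contDiff_halfWave h.smooth h.smooth' c

lemma contDiff_outWave (h : IsCutData ε R f g p q) (hb : ContDiff ℝ ∞ b) (c : ℝ) :
    ContDiff ℝ ∞ (outWave c p q b ε) :=
  ((h.contDiff_inWave (-c)).comp contDiff_neg).add (hb.comp (contDiff_id.add contDiff_const))

lemma deriv_outWave (h : IsCutData ε R f g p q) (hb : ContDiff ℝ ∞ b) (c : ℝ) :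
    deriv (outWave c p q b ε) = fun τ => -deriv (halfWave (-c) p q) (-τ) + deriv b (τ + ε) := by
  funext τ
  have h1 := (hasDerivAt_of_contDiff (h.contDiff_inWave (-c)) (-τ)).comp τ (hasDerivAt_neg τ)
  have h2 := (hasDerivAt_of_contDiff hb (τ + ε)).comp τ ((hasDerivAt_id τ).add_const ε)
  refine (h1.add h2).deriv.trans ?_
  ring

lemma deriv_deriv_outWave (h : IsCutData ε R f g p q) (hb : ContDiff ℝ ∞ b) (c : ℝ) :
    deriv (deriv (outWave c p q b ε)) =
      fun τ => deriv (deriv (halfWave (-c) p q)) (-τ) + deriv (deriv b) (τ + ε) := by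
  rw [h.deriv_outWave hb]
  funext τ
  have h1 := ((hasDerivAt_of_contDiff (contDiff_deriv (h.contDiff_inWave (-c))) (-τ)).comp τ
    (hasDerivAt_neg τ)).neg
  have h2 := (hasDerivAt_of_contDiff (contDiff_deriv hb) (τ + ε)).comp τ
    ((hasDerivAt_id τ).add_const ε)
  refine (h1.add h2).deriv.trans ?_
  ring

lemma isExteriorSolution (h : IsCutData ε R f g p q) (hc : c ≠ 0) (hε : 0 < ε)
    (hb : ContDiff ℝ ∞ b) (hb0 : ∀ τ, τ ≤ 0 → b τ = 0) {Φ Ψ : E3 → ℝ}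
    (hΦ : ∀ x, ε < ‖x‖ → Φ x = p ‖x‖) (hΨ : ∀ x, ε < ‖x‖ → Ψ x = q ‖x‖) :
    IsExteriorSolution c T ε Φ Ψ (extWave c (halfWave c p q) (outWave c p q b ε)) := by
  refine isExteriorSolution_extWave hε (h.contDiff_inWave c) (h.contDiff_outWave hb c)
    (fun x hx => ?_) fun x hx => ?_
  · rw [hΦ x hx, twoWave, outWave, zero_sub, neg_neg, zero_add, hb0 _ (by linarith), add_zero,
      halfWave_add_halfWave_neg]
  · have hd : deriv b (0 - ‖x‖ + ε) = 0 :=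
      deriv_eq_zero_of_le (hb.differentiable (by simp)) hb0 (by linarith)
    rw [hΨ x hx, twoWave, h.deriv_outWave hb, deriv_halfWave h.smooth h.smooth',
      deriv_halfWave h.smooth h.smooth']
    simp only [hd]
    simp only [zero_add, zero_sub, neg_neg, inv_neg, add_zero]
    field_simp
    ring

lemma twoWave_eq_zero (h : IsCutData ε R f g p q) (hc : 0 < c) (hε : 0 < ε) (hR : 0 ≤ R)
    (hb0 : ∀ τ, τ ≤ 0 → b τ = 0) {t : ℝ} (ht : t ∈ Set.Icc 0 T) (r : ℝ)
    (hr : R + ε + c * T < r) : twoWave (halfWave c p q) (outWave c p q b ε) (c * t) r = 0 := by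
  have h1 : c * t ≤ c * T := mul_le_mul_of_nonneg_left ht.2 hc.le
  have h2 : 0 ≤ c * t := mul_nonneg hc.le ht.1
  rw [twoWave, outWave, hb0 _ (by linarith), add_zero]
  exact h.halfWave_add_eq_zero c (by linarith) (by linarith)

end IsCutData

/-! ### The reflected wave -/

/-- The solution `b` of `b' + b / ε = S`, `b(0) = 0`. -/
noncomputable def robin (ε : ℝ) (S : ℝ → ℝ) (τ : ℝ) : ℝ :=
  Real.exp (-τ / ε) * ∫ σ in (0 : ℝ)..τ, Real.exp (σ / ε) * S σ

section Robin

variable {ε : ℝ} {S : ℝ → ℝ}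

lemma hasDerivAt_robin (hS : ContDiff ℝ ∞ S) (ε τ : ℝ) :
    HasDerivAt (robin ε S) (S τ - robin ε S τ / ε) τ := by
  have hcS : Continuous fun σ => Real.exp (σ / ε) * S σ :=
    (Real.continuous_exp.comp (continuous_id.div_const ε)).mul hS.continuous
  have h1 := intervalIntegral.integral_hasDerivAt_right (hcS.intervalIntegrable 0 τ)
    hcS.stronglyMeasurable.stronglyMeasurableAtFilter hcS.continuousAt
  have h2 : HasDerivAt (fun τ => Real.exp (-τ / ε)) (Real.exp (-τ / ε) * (-1 / ε)) τ :=
    ((hasDerivAt_neg τ).div_const ε).exp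
  refine (h2.mul h1).congr_deriv ?_
  have e : Real.exp (-τ / ε) * (Real.exp (τ / ε) * S τ) = S τ := by
    rw [← mul_assoc, ← Real.exp_add, neg_div, neg_add_cancel, Real.exp_zero, one_mul]
  rw [e, robin]
  ring

lemma deriv_robin (hS : ContDiff ℝ ∞ S) (ε : ℝ) :
    deriv (robin ε S) = fun τ => S τ - robin ε S τ / ε :=
  funext fun τ => (hasDerivAt_robin hS ε τ).deriv

lemma contDiff_robin (hS : ContDiff ℝ ∞ S) (ε : ℝ) : ContDiff ℝ ∞ (robin ε S) := by
  have hd : Differentiable ℝ (robin ε S) := fun τ => (hasDerivAt_robin hS ε τ).differentiableAt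
  have : ∀ n : ℕ, ContDiff ℝ n (robin ε S) := fun n => by
    induction n with
    | zero => exact contDiff_zero.2 hd.continuous
    | succ n ih =>
      rw [Nat.cast_succ, contDiff_succ_iff_deriv]
      refine ⟨hd, by simp, ?_⟩
      rw [deriv_robin hS]
      exact (contDiff_infty.1 hS n).sub (ih.div_const ε)
  exact contDiff_infty.2 this

lemma robin_eq_zero (hS : ∀ τ, τ ≤ 0 → S τ = 0) {τ : ℝ} (hτ : τ ≤ 0) : robin ε S τ = 0 := by
  rw [robin]
  have : ∫ σ in (0 : ℝ)..τ, Real.exp (σ / ε) * S σ = ∫ σ in (0 : ℝ)..τ, (0 : ℝ) := by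
    refine intervalIntegral.integral_congr fun σ hσ => ?_
    rw [Set.uIcc_of_ge hτ] at hσ
    simp only [hS σ hσ.2, mul_zero]
  rw [this]; simp

end Robin

/-- The right-hand side of the equation `b' + b / ε = S` that expresses the Neumann condition. -/
noncomputable def neumannSource (c ε f g : ℝ) (p q : ℝ → ℝ) (σ : ℝ) : ℝ :=
  deriv (halfWave c p q) (σ + ε) + deriv (constWave c f g) (σ - ε) -
    (halfWave c p q (σ + ε) - constWave c f g (σ - ε)) / ε

lemma hasDerivAt_constWave (c f g ρ : ℝ) :
    HasDerivAt (constWave c f g) (f / 2 + c⁻¹ * g / 2 * ρ) ρ := by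
  have := ((hasDerivAt_id ρ).const_mul (f / 2)).add ((hasDerivAt_pow 2 ρ).const_mul (c⁻¹ * g / 4))
  refine this.congr_deriv ?_
  push_cast
  ring

lemma deriv_constWave (c f g : ℝ) : deriv (constWave c f g) = fun ρ => f / 2 + c⁻¹ * g / 2 * ρ :=
  funext fun ρ => (hasDerivAt_constWave c f g ρ).deriv

lemma contDiff_constWave (c f g : ℝ) : ContDiff ℝ ∞ (constWave c f g) := by
  unfold constWave; fun_prop

namespace IsCutData

variable {c T ε R f g : ℝ} {p q b : ℝ → ℝ}

lemma deriv_halfWave_of_le (h : IsCutData ε R f g p q) (c : ℝ) {ρ : ℝ} (hρ : ρ ≤ ε) :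
    deriv (halfWave c p q) ρ = f / 2 + c⁻¹ * g / 2 * ρ := by
  rw [deriv_halfWave h.smooth h.smooth']
  simp only
  rw [h.const ρ hρ, h.const' ρ hρ,
    deriv_eq_zero_of_le (h.smooth.differentiable (by simp)) h.const hρ]
  ring

lemma contDiff_neumannSource (h : IsCutData ε R f g p q) (c : ℝ) :
    ContDiff ℝ ∞ (neumannSource c ε f g p q) := by
  have a : ∀ {F : ℝ → ℝ} (s : ℝ), ContDiff ℝ ∞ F → ContDiff ℝ ∞ fun σ => F (σ + s) :=
    fun s hF => hF.comp (contDiff_id.add contDiff_const)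
  exact ((a ε (contDiff_deriv (h.contDiff_inWave c))).add
    (a (-ε) (contDiff_deriv (contDiff_constWave c f g)))).sub
    (((a ε (h.contDiff_inWave c)).sub (a (-ε) (contDiff_constWave c f g))).div_const ε)

lemma neumannSource_eq_zero (h : IsCutData ε R f g p q) (hε : 0 < ε) (c : ℝ) {σ : ℝ}
    (hσ : σ ≤ 0) : neumannSource c ε f g p q σ = 0 := by
  rw [neumannSource, h.deriv_halfWave_of_le c (by linarith), h.halfWave_of_le hε c (by linarith),
    deriv_constWave, constWave, constWave]
  field_simp
  ring

/-- The Neumann condition at `r = ε`. -/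
lemma waveSlope_neumann (h : IsCutData ε R f g p q) (hc : 0 < c) (hε : 0 < ε) {t : ℝ}
    (ht : 0 ≤ t) : waveSlope (halfWave c p q)
      (outWave c p q (robin ε (neumannSource c ε f g p q)) ε) (c * t) ε = 0 := by
  have hS := h.contDiff_neumannSource c
  have h0 : 0 ≤ c * t := mul_nonneg hc.le ht
  have hM : ε - c * t ≤ ε := by linarith
  have e1 : -(c * t - ε) = ε - c * t := by ring
  have e2 : c * t - ε + ε = c * t := by ring
  simp only [waveSlope, twoWave, Pi.neg_apply, h.deriv_outWave (contDiff_robin hS ε), outWave,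
    deriv_robin hS, e1, e2, h.deriv_halfWave_of_le (-c) hM, h.halfWave_of_le hε (-c) hM,
    neumannSource, deriv_constWave, constWave, inv_neg]
  field_simp
  ring

/-- The Dirichlet condition at `r = ε`. -/
lemma twoWave_dirichlet (h : IsCutData ε R 0 0 p q) (hc : 0 < c) (hε : 0 < ε) {t : ℝ}
    (ht : 0 ≤ t) : twoWave (halfWave c p q)
      (outWave c p q (fun σ => -halfWave c p q (σ + ε)) ε) (c * t) ε = 0 := by
  have h0 : 0 ≤ c * t := mul_nonneg hc.le ht
  rw [twoWave, outWave, h.halfWave_of_le hε (-c) (by linarith), constWave, sub_add_cancel]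
  ring

end IsCutData

/-! ### The exterior Dirichlet and Neumann solutions -/

lemma IsNeumannCutoff.contDiffAt {β : ℝ → ℝ} (h : IsNeumannCutoff β) {s : ℝ} (hs : 0 < s) :
    ContDiffAt ℝ ∞ β s := h.smooth.contDiffAt (Ici_mem_nhds hs)

lemma IsDirichletCutoff.contDiffAt {χ : ℝ → ℝ} (h : IsDirichletCutoff χ) {s : ℝ} (hs : 0 < s) :
    ContDiffAt ℝ ∞ χ s := h.smooth.contDiffAt (Ici_mem_nhds hs)

/-- The Neumann data `φ(ε β(r / ε))`, continued by the constant `φ(ε)` to `r ≤ ε`. -/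
noncomputable def neumannCut (β : ℝ → ℝ) (ε : ℝ) (φ : ℝ → ℝ) : ℝ → ℝ :=
  cutAt ε (φ ε) fun r => φ (ε * β (r / ε))

/-- The Dirichlet data `χ(r / ε) φ(r)`, continued by zero to `r ≤ ε`. -/
noncomputable def dirichletCut (χ : ℝ → ℝ) (ε : ℝ) (φ : ℝ → ℝ) : ℝ → ℝ :=
  cutAt ε 0 fun r => χ (r / ε) * φ r

section Cut

variable {β χ φ : ℝ → ℝ} {ε R : ℝ}

lemma div_mem_Icc {r : ℝ} (hε : 0 < ε) (hr : 0 < r) (hr' : r ≤ ε) : r / ε ∈ Set.Icc (0 : ℝ) 1 :=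
  ⟨(div_pos hr hε).le, (div_le_one hε).2 hr'⟩

lemma neumannCut_eq (hβ : IsNeumannCutoff β) (hε : 0 < ε) (φ : ℝ → ℝ) {r : ℝ} (hr : 0 < r) :
    neumannCut β ε φ r = φ (ε * β (r / ε)) :=
  cutAt_eq (g := fun r => φ (ε * β (r / ε))) (fun s hs hs' => by
    rw [hβ.eq_one _ (div_mem_Icc hε hs hs'), mul_one]) hr

lemma dirichletCut_eq (hχ : IsDirichletCutoff χ) (hε : 0 < ε) (φ : ℝ → ℝ) {r : ℝ} (hr : 0 < r) :
    dirichletCut χ ε φ r = χ (r / ε) * φ r :=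
  cutAt_eq (g := fun r => χ (r / ε) * φ r) (fun s hs hs' => by
    rw [hχ.eq_zero _ (div_mem_Icc hε hs hs'), zero_mul]) hr

lemma contDiff_neumannCut (hβ : IsNeumannCutoff β) (hε : 0 < ε) (hφ : ContDiff ℝ ∞ φ) :
    ContDiff ℝ ∞ (neumannCut β ε φ) := by
  refine contDiff_cutAt hε (fun r hr => ?_) fun s hs hs' => by
    rw [hβ.eq_one _ (div_mem_Icc hε hs hs'), mul_one]
  have h1 : ContDiffAt ℝ ∞ (fun r => β (r / ε)) r :=
    (hβ.contDiffAt (div_pos hr hε)).comp r (contDiffAt_id.div_const ε)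
  exact hφ.contDiffAt.comp r (contDiffAt_const.mul h1)

lemma contDiff_dirichletCut (hχ : IsDirichletCutoff χ) (hε : 0 < ε) (hφ : ContDiff ℝ ∞ φ) :
    ContDiff ℝ ∞ (dirichletCut χ ε φ) := by
  refine contDiff_cutAt hε (fun r hr => ?_) fun s hs hs' => by
    rw [hχ.eq_zero _ (div_mem_Icc hε hs hs'), zero_mul]
  have h1 : ContDiffAt ℝ ∞ (fun r => χ (r / ε)) r :=
    (hχ.contDiffAt (div_pos hr hε)).comp r (contDiffAt_id.div_const ε)
  exact h1.mul hφ.contDiffAt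

lemma neumannCut_of_two_mul_le (hβ : IsNeumannCutoff β) (hε : 0 < ε) (φ : ℝ → ℝ) {r : ℝ}
    (hr : 2 * ε ≤ r) : neumannCut β ε φ r = φ r := by
  rw [neumannCut_eq hβ hε φ (by linarith), hβ.eq_self _ ((le_div_iff₀ hε).2 hr)]
  field_simp

lemma dirichletCut_of_two_mul_le (hχ : IsDirichletCutoff χ) (hε : 0 < ε) (φ : ℝ → ℝ) {r : ℝ}
    (hr : 2 * ε ≤ r) : dirichletCut χ ε φ r = φ r := by
  rw [dirichletCut_eq hχ hε φ (by linarith), hχ.eq_one _ ((le_div_iff₀ hε).2 hr), one_mul]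

variable {ψ : ℝ → ℝ}

lemma isCutData_neumann (hβ : IsNeumannCutoff β) (hε : 0 < ε) (hφ : IsProfile R φ)
    (hψ : IsProfile R ψ) : IsCutData ε (max R (2 * ε)) (φ ε) (ψ ε) (neumannCut β ε φ)
      (neumannCut β ε ψ) := by
  have z : ∀ {φ : ℝ → ℝ}, IsProfile R φ → ∀ r, max R (2 * ε) ≤ r → neumannCut β ε φ r = 0 :=
    fun hφ r hr => by
      rw [neumannCut_of_two_mul_le hβ hε _ ((le_max_right _ _).trans hr),
        hφ.zero r (((le_max_left _ _).trans hr).trans (le_abs_self r))]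
  exact ⟨contDiff_neumannCut hβ hε hφ.smooth, contDiff_neumannCut hβ hε hψ.smooth,
    fun r hr => if_pos hr, fun r hr => if_pos hr, z hφ, z hψ⟩

lemma isCutData_dirichlet (hχ : IsDirichletCutoff χ) (hε : 0 < ε) (hφ : IsProfile R φ)
    (hψ : IsProfile R ψ) : IsCutData ε (max R (2 * ε)) 0 0 (dirichletCut χ ε φ)
      (dirichletCut χ ε ψ) := by
  have z : ∀ {φ : ℝ → ℝ}, IsProfile R φ → ∀ r, max R (2 * ε) ≤ r → dirichletCut χ ε φ r = 0 :=
    fun hφ r hr => by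
      rw [dirichletCut_of_two_mul_le hχ hε _ ((le_max_right _ _).trans hr),
        hφ.zero r (((le_max_left _ _).trans hr).trans (le_abs_self r))]
  exact ⟨contDiff_dirichletCut hχ hε hφ.smooth, contDiff_dirichletCut hχ hε hψ.smooth,
    fun r hr => if_pos hr, fun r hr => if_pos hr, z hφ, z hψ⟩

end Cut

/-- The incoming part of the exterior Neumann solution. -/
noncomputable def neumannIn (c : ℝ) (β : ℝ → ℝ) (ε : ℝ) (φ ψ : ℝ → ℝ) : ℝ → ℝ :=
  halfWave c (neumannCut β ε φ) (neumannCut β ε ψ)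

/-- The reflected wave of the exterior Neumann solution. -/
noncomputable def neumannRefl (c : ℝ) (β : ℝ → ℝ) (ε : ℝ) (φ ψ : ℝ → ℝ) : ℝ → ℝ :=
  robin ε (neumannSource c ε (φ ε) (ψ ε) (neumannCut β ε φ) (neumannCut β ε ψ))

/-- The outgoing part of the exterior Neumann solution. -/
noncomputable def neumannOut (c : ℝ) (β : ℝ → ℝ) (ε : ℝ) (φ ψ : ℝ → ℝ) : ℝ → ℝ :=
  outWave c (neumannCut β ε φ) (neumannCut β ε ψ) (neumannRefl c β ε φ ψ) ε

/-- The incoming part of the exterior Dirichlet solution. -/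
noncomputable def dirichletIn (c : ℝ) (χ : ℝ → ℝ) (ε : ℝ) (φ ψ : ℝ → ℝ) : ℝ → ℝ :=
  halfWave c (dirichletCut χ ε φ) (dirichletCut χ ε ψ)

/-- The outgoing part of the exterior Dirichlet solution. -/
noncomputable def dirichletOut (c : ℝ) (χ : ℝ → ℝ) (ε : ℝ) (φ ψ : ℝ → ℝ) : ℝ → ℝ :=
  outWave c (dirichletCut χ ε φ) (dirichletCut χ ε ψ)
    (fun σ => -dirichletIn c χ ε φ ψ (σ + ε)) ε

section Existence

variable {c T ε R : ℝ} {β χ φ ψ : ℝ → ℝ} {Φ Ψ : E3 → ℝ}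

lemma contDiff_neumannIn (hβ : IsNeumannCutoff β) (hε : 0 < ε) (hφ : IsProfile R φ)
    (hψ : IsProfile R ψ) (c : ℝ) : ContDiff ℝ ∞ (neumannIn c β ε φ ψ) :=
  (isCutData_neumann hβ hε hφ hψ).contDiff_inWave c

lemma contDiff_neumannRefl (hβ : IsNeumannCutoff β) (hε : 0 < ε) (hφ : IsProfile R φ)
    (hψ : IsProfile R ψ) (c : ℝ) : ContDiff ℝ ∞ (neumannRefl c β ε φ ψ) :=
  contDiff_robin ((isCutData_neumann hβ hε hφ hψ).contDiff_neumannSource c) ε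

lemma contDiff_neumannOut (hβ : IsNeumannCutoff β) (hε : 0 < ε) (hφ : IsProfile R φ)
    (hψ : IsProfile R ψ) (c : ℝ) : ContDiff ℝ ∞ (neumannOut c β ε φ ψ) :=
  (isCutData_neumann hβ hε hφ hψ).contDiff_outWave (contDiff_neumannRefl hβ hε hφ hψ c) c

lemma neumannRefl_eq_zero (hβ : IsNeumannCutoff β) (hε : 0 < ε) (hφ : IsProfile R φ)
    (hψ : IsProfile R ψ) (c : ℝ) (τ : ℝ) (hτ : τ ≤ 0) : neumannRefl c β ε φ ψ τ = 0 :=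
  robin_eq_zero (fun _ hσ => (isCutData_neumann hβ hε hφ hψ).neumannSource_eq_zero hε c hσ) hτ

lemma contDiff_dirichletIn (hχ : IsDirichletCutoff χ) (hε : 0 < ε) (hφ : IsProfile R φ)
    (hψ : IsProfile R ψ) (c : ℝ) : ContDiff ℝ ∞ (dirichletIn c χ ε φ ψ) :=
  (isCutData_dirichlet hχ hε hφ hψ).contDiff_inWave c

lemma contDiff_dirichletRefl (hχ : IsDirichletCutoff χ) (hε : 0 < ε) (hφ : IsProfile R φ)
    (hψ : IsProfile R ψ) (c : ℝ) :
    ContDiff ℝ ∞ fun σ => -dirichletIn c χ ε φ ψ (σ + ε) :=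
  ((contDiff_dirichletIn hχ hε hφ hψ c).comp (contDiff_id.add contDiff_const)).neg

lemma contDiff_dirichletOut (hχ : IsDirichletCutoff χ) (hε : 0 < ε) (hφ : IsProfile R φ)
    (hψ : IsProfile R ψ) (c : ℝ) : ContDiff ℝ ∞ (dirichletOut c χ ε φ ψ) :=
  (isCutData_dirichlet hχ hε hφ hψ).contDiff_outWave (contDiff_dirichletRefl hχ hε hφ hψ c) c

lemma dirichletRefl_eq_zero (hχ : IsDirichletCutoff χ) (hε : 0 < ε) (hφ : IsProfile R φ)
    (hψ : IsProfile R ψ) (c : ℝ) (τ : ℝ) (hτ : τ ≤ 0) :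
    -dirichletIn c χ ε φ ψ (τ + ε) = 0 := by
  rw [dirichletIn, (isCutData_dirichlet hχ hε hφ hψ).halfWave_of_le hε c (by linarith), constWave]
  simp

lemma twoWave_neumann_eq_zero (hc : 0 < c) (hβ : IsNeumannCutoff β) (hε : 0 < ε)
    (hφ : IsProfile R φ) (hψ : IsProfile R ψ) :
    ∀ t ∈ Set.Icc 0 T, ∀ r, max R (2 * ε) + ε + c * T < r →
      twoWave (neumannIn c β ε φ ψ) (neumannOut c β ε φ ψ) (c * t) r = 0 :=
  fun _ ht r hr => (isCutData_neumann hβ hε hφ hψ).twoWave_eq_zero hc hε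
    ((by positivity : (0 : ℝ) ≤ 2 * ε).trans (le_max_right _ _))
    (neumannRefl_eq_zero hβ hε hφ hψ c) ht r hr

lemma twoWave_dirichlet_eq_zero (hc : 0 < c) (hχ : IsDirichletCutoff χ) (hε : 0 < ε)
    (hφ : IsProfile R φ) (hψ : IsProfile R ψ) :
    ∀ t ∈ Set.Icc 0 T, ∀ r, max R (2 * ε) + ε + c * T < r →
      twoWave (dirichletIn c χ ε φ ψ) (dirichletOut c χ ε φ ψ) (c * t) r = 0 :=
  fun _ ht r hr => (isCutData_dirichlet hχ hε hφ hψ).twoWave_eq_zero hc hε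
    ((by positivity : (0 : ℝ) ≤ 2 * ε).trans (le_max_right _ _))
    (dirichletRefl_eq_zero hχ hε hφ hψ c) ht r hr

lemma waveSlope_neumann_eq_zero (hc : 0 < c) (hβ : IsNeumannCutoff β) (hε : 0 < ε)
    (hφ : IsProfile R φ) (hψ : IsProfile R ψ) {t : ℝ} (ht : 0 ≤ t) :
    waveSlope (neumannIn c β ε φ ψ) (neumannOut c β ε φ ψ) (c * t) ε = 0 :=
  (isCutData_neumann hβ hε hφ hψ).waveSlope_neumann hc hε ht

lemma twoWave_dirichlet_boundary (hc : 0 < c) (hχ : IsDirichletCutoff χ) (hε : 0 < ε)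
    (hφ : IsProfile R φ) (hψ : IsProfile R ψ) {t : ℝ} (ht : 0 ≤ t) :
    twoWave (dirichletIn c χ ε φ ψ) (dirichletOut c χ ε φ ψ) (c * t) ε = 0 :=
  (isCutData_dirichlet hχ hε hφ hψ).twoWave_dirichlet hc hε ht

lemma isExteriorNeumannSolution (hc : 0 < c) (hβ : IsNeumannCutoff β) (hε : 0 < ε)
    (hΦ : IsProfile R (profile Φ)) (hΨ : IsProfile R (profile Ψ)) :
    IsExteriorNeumannSolution c T ε (neumannData β ε Φ) (neumannData β ε Ψ)
      (extWave c (neumannIn c β ε (profile Φ) (profile Ψ))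
        (neumannOut c β ε (profile Φ) (profile Ψ))) := by
  refine ⟨(isCutData_neumann hβ hε hΦ hΨ).isExteriorSolution hc.ne' hε
    (contDiff_neumannRefl hβ hε hΦ hΨ c) (neumannRefl_eq_zero hβ hε hΦ hΨ c)
    (fun x hx => (if_neg (not_le.2 hx)).symm) (fun x hx => (if_neg (not_le.2 hx)).symm),
    fun t ht e he => ?_⟩
  have h := (hasDerivAt_twoWave_div (contDiff_neumannIn hβ hε hΦ hΨ c)
    (contDiff_neumannOut hβ hε hΦ hΨ c) (c * t) hε.ne').hasDerivWithinAt (s := Set.Ici ε)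
  rw [waveSlope_neumann_eq_zero hc hβ hε hΦ hΨ ht.1.le, mul_zero] at h
  have key : ∀ r ∈ Set.Ici ε, extWave c (neumannIn c β ε (profile Φ) (profile Ψ))
      (neumannOut c β ε (profile Φ) (profile Ψ)) t (r • e) =
      twoWave (neumannIn c β ε (profile Φ) (profile Ψ))
        (neumannOut c β ε (profile Φ) (profile Ψ)) (c * t) r / r := fun r hr => by
    rw [extWave, norm_smul, he, mul_one, Real.norm_of_nonneg (hε.le.trans hr)]
  exact h.congr key (key ε Set.self_mem_Ici)

lemma isExteriorDirichletSolution (hc : 0 < c) (hχ : IsDirichletCutoff χ) (hε : 0 < ε)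
    (hs : IsSmoothRadial Φ) (hs' : IsSmoothRadial Ψ)
    (hΦ : IsProfile R (profile Φ)) (hΨ : IsProfile R (profile Ψ)) :
    IsExteriorDirichletSolution c T ε (dirichletData χ ε Φ) (dirichletData χ ε Ψ)
      (extWave c (dirichletIn c χ ε (profile Φ) (profile Ψ))
        (dirichletOut c χ ε (profile Φ) (profile Ψ))) := by
  refine ⟨(isCutData_dirichlet hχ hε hΦ hΨ).isExteriorSolution hc.ne' hε
    (contDiff_dirichletRefl hχ hε hΦ hΨ c) (dirichletRefl_eq_zero hχ hε hΦ hΨ c)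
    (fun x hx => ?_) (fun x hx => ?_), fun t ht x hx => ?_⟩
  · rw [dirichletCut_eq hχ hε _ (hε.trans hx), hs.profile_norm, dirichletData]
  · rw [dirichletCut_eq hχ hε _ (hε.trans hx), hs'.profile_norm, dirichletData]
  · rw [extWave, hx, twoWave_dirichlet_boundary hc hχ hε hΦ hΨ ht.1.le, zero_div]

lemma contInH_neumann (hc : 0 < c) (hT : 0 ≤ T) (hβ : IsNeumannCutoff β) (hε : 0 < ε)
    (hφ : IsProfile R φ) (hψ : IsProfile R ψ) :
    ContInH 2 T (extendConst ε (extWave c (neumannIn c β ε φ ψ) (neumannOut c β ε φ ψ))) := by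
  rw [extendConst_extWave hε]
  have h1 : 0 ≤ c * T := mul_nonneg hc.le hT
  exact contInH_two_ext hε (by linarith [le_max_right R (2 * ε)]) (contDiff_neumannIn hβ hε hφ hψ c)
    (contDiff_neumannOut hβ hε hφ hψ c) (twoWave_neumann_eq_zero hc hβ hε hφ hψ)
    fun t ht => waveSlope_neumann_eq_zero hc hβ hε hφ hψ ht.1

lemma contInH_dirichlet (hc : 0 < c) (hT : 0 ≤ T) (hχ : IsDirichletCutoff χ) (hε : 0 < ε)
    (hφ : IsProfile R φ) (hψ : IsProfile R ψ) :
    ContInH 1 T (extendZero ε (extWave c (dirichletIn c χ ε φ ψ) (dirichletOut c χ ε φ ψ))) := by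
  have h1 : 0 ≤ c * T := mul_nonneg hc.le hT
  exact contInH_congr (contInH_one_ext hε (by linarith [le_max_right R (2 * ε)])
    (contDiff_dirichletIn hχ hε hφ hψ c) (contDiff_dirichletOut hχ hε hφ hψ c)
    (twoWave_dirichlet_eq_zero hc hχ hε hφ hψ))
    fun t ht => extendZero_extWave (twoWave_dirichlet_boundary hc hχ hε hφ hψ ht.1)

end Existence

/-! ### Smallness of weighted profiles -/

lemma integral_exp_neg_abs {ε : ℝ} (hε : 0 < ε) (τ : ℝ) :
    ∫ r, Real.exp (-|τ - r| / ε) = 2 * ε := by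
  have h1 := integral_sub_left_eq_self (fun r => Real.exp (-|r| / ε)) (volume : Measure ℝ) τ
  have h2 := integral_comp_abs (f := fun r => Real.exp (-1 / ε * r))
  have h3 := integral_exp_mul_Ioi (a := -1 / ε) (div_neg_of_neg_of_pos (by norm_num) hε) 0
  rw [h3] at h2
  rw [h1]
  refine Eq.trans (integral_congr_ae (Eventually.of_forall fun r => ?_)) (h2.trans ?_)
  · simp only
    congr 1
    ring
  · rw [mul_zero, Real.exp_zero]
    field_simp

lemma integrable_exp_neg_abs {ε : ℝ} (hε : 0 < ε) (τ : ℝ) :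
    Integrable fun r : ℝ => Real.exp (-|τ - r| / ε) := by
  by_contra h
  have := integral_undef h
  rw [integral_exp_neg_abs hε] at this
  linarith

lemma intervalIntegral_exp_neg_abs_le {ε : ℝ} (hε : 0 < ε) (τ : ℝ) {a b : ℝ} (hab : a ≤ b) :
    ∫ r in a..b, Real.exp (-|τ - r| / ε) ≤ 2 * ε := by
  rw [intervalIntegral.integral_of_le hab, ← integral_exp_neg_abs hε τ]
  exact setIntegral_le_integral (integrable_exp_neg_abs hε τ)
    (Eventually.of_forall fun r => (Real.exp_pos _).le)

/-- A bound for `r² g(r)²`, where `g` is the profile of a difference between the free and the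
exterior solution, or of one of its derivatives: `g` is bounded on `r ≤ ε`, and for larger `r`
there are errors of size `ε`, errors of size `ε / r`, and a boundary layer at the characteristic
`r = τ`. -/
noncomputable def layer (ε τ R r : ℝ) : ℝ :=
  (Set.Iic ε).indicator (fun _ => 1) r + (Set.Iic R).indicator (fun _ => ε ^ 2) r +
    (Set.Ioi ε).indicator (fun r => ε ^ 2 * r ^ (-2 : ℝ)) r + Real.exp (-|τ - r| / ε)

lemma layer_nonneg (ε τ R : ℝ) {r : ℝ} (hr : 0 < r) : 0 ≤ layer ε τ R r := by
  refine add_nonneg (add_nonneg (add_nonneg ?_ ?_) ?_) (Real.exp_pos _).le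
  · exact Set.indicator_nonneg (fun _ _ => zero_le_one) _
  · exact Set.indicator_nonneg (fun _ _ => sq_nonneg _) _
  · rw [Set.indicator_apply]
    split_ifs
    · positivity
    · exact le_rfl

lemma one_le_layer {ε τ R r : ℝ} (hr : 0 < r) (h : r ≤ ε) : 1 ≤ layer ε τ R r := by
  have h2 : 0 ≤ (Set.Iic R).indicator (fun _ => ε ^ 2) r :=
    Set.indicator_nonneg (fun _ _ => sq_nonneg _) _
  have h3 : 0 ≤ (Set.Ioi ε).indicator (fun r => ε ^ 2 * r ^ (-2 : ℝ)) r := by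
    rw [Set.indicator_apply]; split_ifs <;> positivity
  have h4 := Real.exp_pos (-|τ - r| / ε)
  rw [layer, Set.indicator_of_mem (Set.mem_Iic.2 h)]
  linarith

lemma le_layer {ε τ R r : ℝ} (hr : 0 < r) (h : ε < r) (hR : r ≤ R) :
    ε ^ 2 + ε ^ 2 / r ^ 2 + Real.exp (-|τ - r| / ε) ≤ layer ε τ R r := by
  rw [layer, Set.indicator_of_mem (Set.mem_Iic.2 hR), Set.indicator_of_mem (Set.mem_Ioi.2 h),
    Set.indicator_of_notMem (by simpa using h), Real.rpow_neg hr.le, Real.rpow_two]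
  apply le_of_eq
  ring

lemma integrableOn_layer {ε : ℝ} (hε : 0 < ε) (τ R : ℝ) :
    IntegrableOn (layer ε τ R) (Set.Ioi 0) ∧
      ∫ r in Set.Ioi 0, layer ε τ R r ≤ ε + ε ^ 2 * max R 0 + ε + 2 * ε := by
  have c : ∀ a b : ℝ, IntegrableOn ((Set.Iic b).indicator fun _ => a) (Set.Ioi 0) ∧
      ∫ r in Set.Ioi 0, (Set.Iic b).indicator (fun _ => a) r = max b 0 * a := fun a b => by
    constructor
    · rw [IntegrableOn, integrable_indicator_iff measurableSet_Iic, IntegrableOn,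
        Measure.restrict_restrict measurableSet_Iic, Set.Iic_inter_Ioi]
      exact integrableOn_const (by simp)
    · rw [setIntegral_indicator measurableSet_Iic, Set.inter_comm, Set.Iic_inter_Ioi,
        setIntegral_const]
      simp only [Measure.real, Real.volume_Ioc, sub_zero, ENNReal.toReal_ofReal', smul_eq_mul]
  have h3 : IntegrableOn ((Set.Ioi ε).indicator fun r => ε ^ 2 * r ^ (-2 : ℝ)) (Set.Ioi 0) ∧
      ∫ r in Set.Ioi 0, (Set.Ioi ε).indicator (fun r => ε ^ 2 * r ^ (-2 : ℝ)) r = ε := by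
    constructor
    · rw [IntegrableOn, integrable_indicator_iff measurableSet_Ioi, IntegrableOn,
        Measure.restrict_restrict measurableSet_Ioi, Set.Ioi_inter_Ioi, max_eq_left hε.le]
      exact (integrableOn_Ioi_rpow_of_lt (by norm_num) hε).const_mul _
    · rw [setIntegral_indicator measurableSet_Ioi, Set.Ioi_inter_Ioi, max_eq_right hε.le,
        integral_const_mul, integral_Ioi_rpow_of_lt (by norm_num) hε]
      norm_num
      rw [Real.rpow_neg_one]
      field_simp
  have h4 := (integrable_exp_neg_abs hε τ).integrableOn (s := Set.Ioi 0)
  have h12 := (c 1 ε).1.add (c (ε ^ 2) R).1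
  have h123 := h12.add h3.1
  refine ⟨h123.add h4, ?_⟩
  have e : ∫ r in Set.Ioi 0, layer ε τ R r = ((max ε 0 * 1 + max R 0 * ε ^ 2) + ε) +
      ∫ r in Set.Ioi 0, Real.exp (-|τ - r| / ε) := by
    refine (integral_add' h123 h4).trans ?_
    rw [integral_add' h12 h3.1, integral_add' (c 1 ε).1 (c (ε ^ 2) R).1, (c 1 ε).2,
      (c (ε ^ 2) R).2, h3.2]
  have h5 : ∫ r in Set.Ioi 0, Real.exp (-|τ - r| / ε) ≤ 2 * ε := by
    rw [← integral_exp_neg_abs hε τ]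
    exact setIntegral_le_integral (integrable_exp_neg_abs hε τ)
      (Eventually.of_forall fun r => (Real.exp_pos _).le)
  rw [e, max_eq_left hε.le]
  linarith

/-- Profiles controlled by `layer` have norm `O(√ε)`. -/
lemma radSq_le_of_le_layer {g : ℝ → ℝ} {C ε τ R : ℝ} (hC : 0 ≤ C) (hε : 0 < ε) (hε1 : ε ≤ 1)
    (h : ∀ r, 0 < r → r ^ 2 * g r ^ 2 ≤ C * layer ε τ R r) :
    radSq g ≤ ENNReal.ofReal
      (3 * (volume : Measure E3).real (Metric.ball 0 1) * (C * (4 + max R 0)) * ε) := by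
  obtain ⟨h1, h2⟩ := integrableOn_layer hε τ R
  refine (radSq_le_of_sq_mul_sq_le (h1.const_mul C) h).trans (ENNReal.ofReal_le_ofReal ?_)
  rw [integral_const_mul]
  have h3 : ε ^ 2 * max R 0 ≤ ε * max R 0 := by
    refine mul_le_mul_of_nonneg_right ?_ (le_max_right _ _)
    nlinarith
  have h4 : C * ∫ r in Set.Ioi 0, layer ε τ R r ≤ C * (4 + max R 0) * ε := by
    rw [mul_assoc]
    exact mul_le_mul_of_nonneg_left (by linarith) hC
  calc _ ≤ 3 * (volume : Measure E3).real (Metric.ball 0 1) * (C * (4 + max R 0) * ε) :=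
        mul_le_mul_of_nonneg_left h4 (by positivity)
    _ = _ := by ring

/-- Integration from the edge of the support: the layer contributes `O(ε)`. -/
lemma abs_le_of_abs_deriv_le_layer {f f' : ℝ → ℝ} {C ε τ R : ℝ} (hC : 0 ≤ C) (hε : 0 < ε)
    (hR : 0 ≤ R) (hf : ∀ r, HasDerivAt f (f' r) r) (hf' : Continuous f')
    (hb : ∀ r, ε ≤ r → |f' r| ≤ C * (ε + Real.exp (-|τ - r| / ε)))
    (hz : ∀ r, R < r → f r = 0) (r : ℝ) (hr : ε ≤ r) : |f r| ≤ C * (R + 3) * ε := by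
  rcases lt_or_ge R r with h | h
  · rw [hz r h, abs_zero]; positivity
  have hle : r ≤ R + 1 := by linarith
  have e := intervalIntegral.integral_eq_sub_of_hasDerivAt (fun x _ => hf x)
    (hf'.intervalIntegrable r (R + 1))
  rw [hz (R + 1) (by linarith), zero_sub] at e
  have hi : IntervalIntegrable (fun s => Real.exp (-|τ - s| / ε)) volume r (R + 1) :=
    (integrable_exp_neg_abs hε τ).intervalIntegrable
  have h1 := intervalIntegral.norm_integral_le_of_norm_le hle
    (g := fun s => C * (ε + Real.exp (-|τ - s| / ε))) (f := f')
    (Eventually.of_forall fun s hs => hb s (hr.trans hs.1.le))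
    ((intervalIntegrable_const.add hi).const_mul C)
  rw [e, norm_neg, Real.norm_eq_abs, intervalIntegral.integral_const_mul,
    intervalIntegral.integral_add intervalIntegrable_const hi, intervalIntegral.integral_const,
    smul_eq_mul] at h1
  have h2 := intervalIntegral_exp_neg_abs_le hε τ hle
  refine h1.trans ?_
  rw [mul_assoc]
  refine mul_le_mul_of_nonneg_left ?_ hC
  nlinarith

/-! ### Estimates for the difference of the free and the exterior solution -/

lemma IsWaveProfile.half_wavg_one_eq {R : ℝ} {K : ℝ → ℝ} (hK : IsWaveProfile R K) (τ : ℝ) {r : ℝ}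
    (hr : 0 < r) : 1 / 2 * wavg 1 (deriv (deriv (deriv K))) τ r = waveSlope K (-K) τ r := by
  have h1 := hasDerivAt_wavg hK.isLineTest_deriv 0 τ r
  have h2 : HasDerivAt (wavg 0 (deriv K) τ) (r * waveSlope K (-K) τ r) r :=
    (hasDerivAt_twoWave_div hK.smooth hK.smooth.neg τ hr.ne').congr_of_eventuallyEq (by
      filter_upwards [lt_mem_nhds hr] with s hs
      exact hK.wavg_eq_twoWave τ hs)
  have h3 := h1.unique h2
  norm_num at h3
  refine mul_left_cancel₀ hr.ne' (Eq.trans ?_ h3)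
  ring

lemma IsWaveProfile.wavg_two_eq {R : ℝ} {K : ℝ → ℝ} (hK : IsWaveProfile R K) (τ : ℝ) {r : ℝ}
    (hr : 0 < r) : r * (1 / 8 * wavg 2 (deriv (deriv (deriv (deriv (deriv K))))) τ r) =
      waveSlopeDeriv K (-K) τ r := by
  have h1 := (hasDerivAt_wavg hK.isLineTest_deriv.deriv.deriv 1 τ r).const_mul (1 / 2)
  have h2 : HasDerivAt (fun r => 1 / 2 * wavg 1 (deriv (deriv (deriv K))) τ r)
      (waveSlopeDeriv K (-K) τ r) r :=
    (hasDerivAt_waveSlope hK.smooth hK.smooth.neg τ hr.ne').congr_of_eventuallyEq (by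
      filter_upwards [lt_mem_nhds hr] with s hs
      exact hK.half_wavg_one_eq τ hs)
  refine Eq.trans ?_ (h1.unique h2)
  push_cast
  ring

lemma sq_mul_sq_le_layer {g : ℝ → ℝ} {B D ε τ R : ℝ} (hε1 : ε ≤ 1) (hD0 : 0 ≤ D)
    (hB : ∀ r, 0 < r → r ≤ ε → |g r| ≤ B)
    (hD : ∀ r, 0 < r → ε < r → r ≤ R →
      (r * g r) ^ 2 ≤ D * (ε ^ 2 + ε ^ 2 / r ^ 2 + Real.exp (-|τ - r| / ε)))
    (hz : ∀ r, ε < r → R < r → g r = 0) (r : ℝ) (hr : 0 < r) :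
    r ^ 2 * g r ^ 2 ≤ (B ^ 2 + D) * layer ε τ R r := by
  have h0 := layer_nonneg ε τ R hr
  rcases le_or_gt r ε with h | h
  · have h1 := one_le_layer (τ := τ) (R := R) hr h
    have h2 : g r ^ 2 ≤ B ^ 2 := sq_le_sq.2 ((hB r hr h).trans (le_abs_self B))
    have h3 : r ^ 2 ≤ 1 := by nlinarith
    calc r ^ 2 * g r ^ 2 ≤ 1 * B ^ 2 := mul_le_mul h3 h2 (sq_nonneg _) zero_le_one
      _ ≤ (B ^ 2 + D) * 1 := by linarith
      _ ≤ _ := mul_le_mul_of_nonneg_left h1 (by positivity)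
  rcases le_or_gt r R with h' | h'
  · rw [← mul_pow]
    refine (hD r hr h h').trans ?_
    refine mul_le_mul (by nlinarith [sq_nonneg B]) (le_layer hr h h') (by positivity)
      (by positivity)
  · rw [hz r h h']
    have : 0 ≤ (B ^ 2 + D) * layer ε τ R r := mul_nonneg (by positivity) h0
    simpa using this

lemma deriv_neg_eq (K : ℝ → ℝ) : deriv (-K) = -deriv K := by
  funext x
  simp

lemma IsWaveProfile.contDiff_neg {R : ℝ} {K : ℝ → ℝ} (hK : IsWaveProfile R K) :
    ContDiff ℝ ∞ (-K) := hK.smooth.neg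

lemma IsWaveProfile.twoWave_eq_zero {R c T : ℝ} {K : ℝ → ℝ} (hK : IsWaveProfile R K) (hc : 0 < c)
    {t r : ℝ} (ht : t ∈ Set.Icc 0 T) (hr : R + c * T < r) : twoWave K (-K) (c * t) r = 0 := by
  obtain ⟨h1, h2⟩ := IsWaveProfile.lt_abs hc ht hr
  rw [twoWave, Pi.neg_apply, hK.const _ h1.le, hK.const _ h2.le, add_neg_cancel]

/-- The extension of an exterior solution by its boundary value. -/
noncomputable def extProfile (G H : ℝ → ℝ) (ε τ r : ℝ) : ℝ := twoWave G H τ (max r ε) / max r ε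

lemma abs_wavg_sub_extProfile_le {R ε τ M C : ℝ} {K G H : ℝ → ℝ} (hK : IsWaveProfile R K)
    (hε : 0 < ε) (hM : ∀ x, |deriv K x| ≤ M)
    (hw : |twoWave K (-K) τ ε - twoWave G H τ ε| ≤ C * ε) (r : ℝ) (hr : r ≤ ε) :
    |wavg 0 (deriv K) τ r - extProfile G H ε τ r| ≤ 4 * M + C := by
  have e : wavg 0 (deriv K) τ r - extProfile G H ε τ r = wavg 0 (deriv K) τ r -
      wavg 0 (deriv K) τ ε + (twoWave K (-K) τ ε - twoWave G H τ ε) / ε := by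
    rw [extProfile, max_eq_right hr, hK.wavg_eq_twoWave τ hε]; ring
  have h1 := abs_wavg_le hM 0 τ r
  have h2 := abs_wavg_le hM 0 τ ε
  have h3 : |(twoWave K (-K) τ ε - twoWave G H τ ε) / ε| ≤ C := by
    rw [abs_div, abs_of_pos hε, div_le_iff₀ hε]; exact hw
  rw [e]
  refine (abs_add_le _ _).trans ?_
  have := abs_sub (wavg 0 (deriv K) τ r) (wavg 0 (deriv K) τ ε)
  linarith

lemma sq_add_exp_le {ε x : ℝ} (hε : 0 < ε) (hx : 0 ≤ x) :
    (ε + Real.exp (-x / ε)) ^ 2 ≤ 2 * (ε ^ 2 + Real.exp (-x / ε)) := by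
  have h1 : Real.exp (-x / ε) ≤ 1 :=
    Real.exp_le_one_iff.2 (div_nonpos_of_nonpos_of_nonneg (by linarith) hε.le)
  have h2 := Real.exp_pos (-x / ε)
  nlinarith [sq_nonneg (ε - Real.exp (-x / ε))]

lemma ofReal_four_mul_le {a : ENNReal} {b : ENNReal} {x : ℝ} (ha : a ≤ ENNReal.ofReal x)
    (hb : b ≤ ENNReal.ofReal x) : a + 3 * b ≤ ENNReal.ofReal (4 * x) := by
  rw [ENNReal.ofReal_mul (by norm_num), ENNReal.ofReal_ofNat]
  calc a + 3 * b ≤ ENNReal.ofReal x + 3 * ENNReal.ofReal x := by gcongr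
    _ = 4 * ENNReal.ofReal x := by ring

lemma ofReal_forty_mul_le {a b d e : ENNReal} {x : ℝ} (ha : a ≤ ENNReal.ofReal x)
    (hb : b ≤ ENNReal.ofReal x) (hd : d ≤ ENNReal.ofReal x) (he : e ≤ ENNReal.ofReal x) :
    a + 3 * (b + 3 * (2 * d + 2 * e)) ≤ ENNReal.ofReal (40 * x) := by
  rw [ENNReal.ofReal_mul (by norm_num), ENNReal.ofReal_ofNat]
  calc a + 3 * (b + 3 * (2 * d + 2 * e)) ≤ ENNReal.ofReal x + 3 * (ENNReal.ofReal x +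
        3 * (2 * ENNReal.ofReal x + 2 * ENNReal.ofReal x)) := by gcongr
    _ = 40 * ENNReal.ofReal x := by ring

section Difference

variable {R R' c T : ℝ} {K : ℝ → ℝ}

/-- Closeness in `H¹`, from a bound for the first radial derivative of `r` times the difference. -/
lemma exists_sobolevSq_one_sub_le (hK : IsWaveProfile R K) (hR : 0 ≤ R) (hc : 0 < c) (hT : 0 ≤ T)
    {C : ℝ} (hC : 0 ≤ C) (hR' : R + c * T ≤ R') :
    ∃ C', ∀ ε, 0 < ε → ε ≤ 1 → ∀ G H : ℝ → ℝ, ContDiff ℝ ∞ G → ContDiff ℝ ∞ H →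
      (∀ t ∈ Set.Icc 0 T, ∀ r, R' < r → twoWave G H (c * t) r = 0) →
      (∀ t ∈ Set.Icc 0 T, ∀ r, ε ≤ r →
        |twoWave (deriv K) (deriv K) (c * t) r - twoWave (deriv G) (-deriv H) (c * t) r| ≤
          C * (ε + Real.exp (-|c * t - r| / ε))) →
      ∀ t ∈ Set.Icc 0 T, sobolevSq 1 (waveU c K t - fun x => extProfile G H ε (c * t) ‖x‖) ≤
        ENNReal.ofReal (C' * ε) := by
  have hR0 : 0 ≤ R' := le_trans (add_nonneg hR (mul_nonneg hc.le hT)) hR'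
  obtain ⟨M, hM0, hM⟩ := hK.isLineTest_deriv.exists_bound
  obtain ⟨M', hM0', hM'⟩ := hK.isLineTest_deriv.deriv.deriv.exists_bound
  set C₀ := C * (R' + 3) with hC₀
  have hC₀0 : 0 ≤ C₀ := by positivity
  set B := 4 * M + C₀ + M' with hB
  set D := 4 * C ^ 2 + 2 * C₀ ^ 2 with hD
  have hD0 : 0 ≤ D := by positivity
  set A := 3 * (volume : Measure E3).real (Metric.ball 0 1) * ((B ^ 2 + D) * (4 + max R' 0))
  refine ⟨4 * A, fun ε hε hε1 G H hG hH hz hb t ht => ?_⟩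
  set τ := c * t with hτ
  set w₀ : ℝ → ℝ := fun r => twoWave K (-K) τ r - twoWave G H τ r with hw₀
  set w₁ : ℝ → ℝ := fun r => twoWave (deriv K) (deriv K) τ r -
    twoWave (deriv G) (-deriv H) τ r with hw₁
  have zG : ∀ r, R' < r → twoWave G H τ r = 0 := hz t ht
  have zK : ∀ r, R' < r → twoWave K (-K) τ r = 0 := fun r hr =>
    hK.twoWave_eq_zero hc ht (hR'.trans_lt hr)
  have hKd : ∀ r, HasDerivAt (twoWave K (-K) τ) (twoWave (deriv K) (deriv K) τ r) r := fun r => by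
    have := hasDerivAt_twoWave hK.smooth hK.contDiff_neg τ r
    rwa [deriv_neg_eq, neg_neg] at this
  have hw : ∀ r, HasDerivAt w₀ (w₁ r) r := fun r => (hKd r).sub (hasDerivAt_twoWave hG hH τ r)
  have hw1c : Continuous w₁ := by
    have c1 := (contDiff_deriv hK.smooth).continuous
    have c2 := (contDiff_deriv hG).continuous
    have c3 := (contDiff_deriv hH).continuous
    simp only [hw₁, twoWave, Pi.neg_apply]
    fun_prop
  have b0 : ∀ r, ε ≤ r → |w₀ r| ≤ C₀ * ε :=
    abs_le_of_abs_deriv_le_layer hC hε hR0 hw hw1c (hb t ht) fun r hr => by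
      simp only [hw₀, zK r hr, zG r hr, sub_zero]
  have hd := (hasRadialDeriv_wavg_zero hK.isLineTest_deriv τ).sub
    (hasRadialDeriv_ext (c := c) hε hG hH hz ht)
  refine (sobolevSq_one_radial_le hd).trans ?_
  have s0 : ∀ {r : ℝ}, ε < r → (wavg 0 (deriv K) τ r - twoWave G H τ (max r ε) / max r ε) =
      w₀ r / r := fun {r} hr => by
    rw [max_eq_left hr.le, hK.wavg_eq_twoWave τ (hε.trans hr)]
    simp only [hw₀]; ring
  have s1 : ∀ {r : ℝ}, ε < r → r * (1 / 2 * wavg 1 (deriv (deriv (deriv K))) τ r) -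
      (r * if ε < r then waveSlope G H τ r else 0) = w₁ r / r - w₀ r / r ^ 2 := fun {r} hr => by
    have h0 : r ≠ 0 := (hε.trans hr).ne'
    rw [if_pos hr, hK.half_wavg_one_eq τ (hε.trans hr), waveSlope, waveSlope, deriv_neg_eq, neg_neg]
    simp only [hw₀, hw₁]
    field_simp
    ring
  have zw : ∀ {r : ℝ}, R' < r → w₀ r = 0 ∧ w₁ r = 0 := fun {r} hr => by
    have h1 := twoWave_deriv_eq_zero hK.smooth hK.contDiff_neg zK r hr
    rw [deriv_neg_eq, neg_neg] at h1
    simp only [hw₀, hw₁, zK r hr, zG r hr, h1,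
      twoWave_deriv_eq_zero hG hH zG r hr, sub_zero, and_self]
  have e0 : ∀ r, 0 ≤ Real.exp (-|τ - r| / ε) := fun r => (Real.exp_pos _).le
  have g0 : radSq (fun r => wavg 0 (deriv K) τ r - twoWave G H τ (max r ε) / max r ε) ≤
      ENNReal.ofReal (A * ε) := by
    refine radSq_le_of_le_layer (τ := τ) (R := R') (by positivity) hε hε1
      (sq_mul_sq_le_layer hε1 hD0 (fun r _ h => ?_) (fun r hr h _ => ?_) fun r h h' => ?_)
    · have := abs_wavg_sub_extProfile_le hK hε hM (b0 ε le_rfl) r h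
      exact this.trans (by linarith)
    · rw [s0 h, mul_div_cancel₀ _ hr.ne']
      have h1 : w₀ r ^ 2 ≤ (C₀ * ε) ^ 2 := sq_le_sq' (by linarith [(abs_le.1 (b0 r h.le)).1])
        (abs_le.1 (b0 r h.le)).2
      have h2 : C₀ ^ 2 * ε ^ 2 ≤ D * ε ^ 2 :=
        mul_le_mul_of_nonneg_right (by nlinarith [sq_nonneg C, sq_nonneg C₀]) (sq_nonneg _)
      have h3 : D * ε ^ 2 ≤ D * (ε ^ 2 + ε ^ 2 / r ^ 2 + Real.exp (-|τ - r| / ε)) :=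
        mul_le_mul_of_nonneg_left (by linarith [e0 r, (by positivity : 0 ≤ ε ^ 2 / r ^ 2)]) hD0
      rw [mul_pow] at h1
      linarith
    · rw [s0 h, (zw h').1, zero_div]
  have g1 : radSq (fun r => r * (1 / 2 * wavg 1 (deriv (deriv (deriv K))) τ r) -
      (r * if ε < r then waveSlope G H τ r else 0)) ≤ ENNReal.ofReal (A * ε) := by
    refine radSq_le_of_le_layer (τ := τ) (R := R') (by positivity) hε hε1
      (sq_mul_sq_le_layer hε1 hD0 (fun r hr h => ?_) (fun r hr h _ => ?_) fun r h h' => ?_)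
    · rw [if_neg (not_lt.2 h), mul_zero, sub_zero, abs_mul, abs_mul, abs_of_pos hr]
      have h1 := abs_wavg_le hM' 1 τ r
      have h2 : |(1 / 2 : ℝ)| * |wavg 1 (deriv (deriv (deriv K))) τ r| ≤ M' := by
        rw [abs_of_pos (by norm_num)]; linarith
      calc _ ≤ 1 * M' := mul_le_mul (h.trans hε1) h2 (by positivity) zero_le_one
        _ ≤ B := by rw [one_mul, hB]; linarith
    · rw [s1 h]
      have h0 : r ≠ 0 := hr.ne'
      have e : r * (w₁ r / r - w₀ r / r ^ 2) = w₁ r - w₀ r / r := by field_simp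
      have h1 : w₀ r ^ 2 ≤ (C₀ * ε) ^ 2 := sq_le_sq' (by linarith [(abs_le.1 (b0 r h.le)).1])
        (abs_le.1 (b0 r h.le)).2
      have h2 : (w₀ r / r) ^ 2 ≤ C₀ ^ 2 * (ε ^ 2 / r ^ 2) := by
        rw [div_pow, ← mul_div_assoc, ← mul_pow]
        exact div_le_div_of_nonneg_right h1 (sq_nonneg r)
      have h3 : w₁ r ^ 2 ≤ (C * (ε + Real.exp (-|τ - r| / ε))) ^ 2 :=
        sq_le_sq.2 ((hb t ht r h.le).trans (le_abs_self _))
      have h4 := sq_add_exp_le hε (abs_nonneg (τ - r))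
      have h5 : C ^ 2 * (ε + Real.exp (-|τ - r| / ε)) ^ 2 ≤
          C ^ 2 * (2 * (ε ^ 2 + Real.exp (-|τ - r| / ε))) :=
        mul_le_mul_of_nonneg_left h4 (sq_nonneg C)
      have h6 : 0 ≤ ε ^ 2 / r ^ 2 := by positivity
      rw [e, hD]
      rw [mul_pow] at h3
      nlinarith [sq_nonneg (w₁ r + w₀ r / r), mul_nonneg (sq_nonneg C) h6,
        mul_nonneg (sq_nonneg C₀) (sq_nonneg ε), mul_nonneg (sq_nonneg C₀) (e0 r)]
    · rw [s1 h, (zw h').1, (zw h').2, zero_div, zero_div, sub_zero]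
  rw [mul_assoc]
  exact ofReal_four_mul_le g0 g1

set_option maxHeartbeats 1000000 in
/-- Closeness in `H²`, from a bound for the second radial derivative of `r` times the difference
and the Neumann condition. -/
lemma exists_sobolevSq_two_sub_le (hK : IsWaveProfile R K) (hR : 0 ≤ R) (hc : 0 < c) (hT : 0 ≤ T)
    {C : ℝ} (hC : 0 ≤ C) (hR' : R + c * T ≤ R') :
    ∃ C', ∀ ε, 0 < ε → ε ≤ 1 → ∀ G H : ℝ → ℝ, ContDiff ℝ ∞ G → ContDiff ℝ ∞ H →
      (∀ t ∈ Set.Icc 0 T, ∀ r, R' < r → twoWave G H (c * t) r = 0) →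
      (∀ t ∈ Set.Icc 0 T, waveSlope G H (c * t) ε = 0) →
      (∀ t ∈ Set.Icc 0 T, ∀ r, ε ≤ r →
        |twoWave (deriv (deriv K)) (-deriv (deriv K)) (c * t) r -
          twoWave (deriv (deriv G)) (deriv (deriv H)) (c * t) r| ≤
          C * (ε + Real.exp (-|c * t - r| / ε))) →
      ∀ t ∈ Set.Icc 0 T, sobolevSq 2 (waveU c K t - fun x => extProfile G H ε (c * t) ‖x‖) ≤
        ENNReal.ofReal (C' * ε) := by
  have hR0 : 0 ≤ R' := le_trans (add_nonneg hR (mul_nonneg hc.le hT)) hR'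
  obtain ⟨M, hM0, hM⟩ := hK.isLineTest_deriv.exists_bound
  obtain ⟨M', hM0', hM'⟩ := hK.isLineTest_deriv.deriv.deriv.exists_bound
  obtain ⟨M₄, hM0₄, hM₄⟩ := hK.isLineTest_deriv.deriv.deriv.deriv.deriv.exists_bound
  set C₁ := C * (R' + 3) with hC₁
  have hC₁0 : 0 ≤ C₁ := by positivity
  set C₀ := C₁ * (R' + 3) with hC₀
  have hC₀0 : 0 ≤ C₀ := by positivity
  set C₂ := M' + C₁ with hC₂
  have hC₂0 : 0 ≤ C₂ := by positivity
  set B := 4 * M + C₀ + M' + M₄ with hB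
  set D := C₀ ^ 2 + 4 * C ^ 2 + 18 * C₂ ^ 2 with hD
  have hD0 : 0 ≤ D := by positivity
  set A := 3 * (volume : Measure E3).real (Metric.ball 0 1) * ((B ^ 2 + D) * (4 + max R' 0))
  refine ⟨40 * A, fun ε hε hε1 G H hG hH hz hN hb t ht => ?_⟩
  set τ := c * t with hτ
  set w₀ : ℝ → ℝ := fun r => twoWave K (-K) τ r - twoWave G H τ r with hw₀
  set w₁ : ℝ → ℝ := fun r => twoWave (deriv K) (deriv K) τ r -
    twoWave (deriv G) (-deriv H) τ r with hw₁
  set w₂ : ℝ → ℝ := fun r => twoWave (deriv (deriv K)) (-deriv (deriv K)) τ r -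
    twoWave (deriv (deriv G)) (deriv (deriv H)) τ r with hw₂
  have zG : ∀ r, R' < r → twoWave G H τ r = 0 := hz t ht
  have zK : ∀ r, R' < r → twoWave K (-K) τ r = 0 := fun r hr =>
    hK.twoWave_eq_zero hc ht (hR'.trans_lt hr)
  have hKd : ∀ r, HasDerivAt (twoWave K (-K) τ) (twoWave (deriv K) (deriv K) τ r) r := fun r => by
    have := hasDerivAt_twoWave hK.smooth hK.contDiff_neg τ r
    rwa [deriv_neg_eq, neg_neg] at this
  have hKd' : ∀ r, HasDerivAt (twoWave (deriv K) (deriv K) τ)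
      (twoWave (deriv (deriv K)) (-deriv (deriv K)) τ r) r :=
    hasDerivAt_twoWave (contDiff_deriv hK.smooth) (contDiff_deriv hK.smooth) τ
  have hw : ∀ r, HasDerivAt w₀ (w₁ r) r := fun r => (hKd r).sub (hasDerivAt_twoWave hG hH τ r)
  have hw' : ∀ r, HasDerivAt w₁ (w₂ r) r := fun r =>
    (hKd' r).sub (hasDerivAt_twoWave_deriv hG hH τ r)
  have hw1c : Continuous w₁ := continuous_iff_continuousAt.2 fun r => (hw' r).continuousAt
  have hw2c : Continuous w₂ := by
    have c1 := (contDiff_deriv (contDiff_deriv hK.smooth)).continuous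
    have c2 := (contDiff_deriv (contDiff_deriv hG)).continuous
    have c3 := (contDiff_deriv (contDiff_deriv hH)).continuous
    simp only [hw₂, twoWave, Pi.neg_apply]
    fun_prop
  have e0 : ∀ r, 0 ≤ Real.exp (-|τ - r| / ε) := fun r => (Real.exp_pos _).le
  have zw : ∀ {r : ℝ}, R' < r → w₀ r = 0 ∧ w₁ r = 0 ∧ w₂ r = 0 := fun {r} hr => by
    have h1 := twoWave_deriv_eq_zero hK.smooth hK.contDiff_neg zK r hr
    have h2 := twoWave_deriv_deriv_eq_zero hK.smooth hK.contDiff_neg zK r hr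
    rw [deriv_neg_eq, neg_neg] at h1
    rw [deriv_neg_eq, deriv_neg_eq] at h2
    simp only [hw₀, hw₁, hw₂, zK r hr, zG r hr, h1, h2,
      twoWave_deriv_eq_zero hG hH zG r hr,
      twoWave_deriv_deriv_eq_zero hG hH zG r hr, sub_zero, and_self]
  have b1 : ∀ r, ε ≤ r → |w₁ r| ≤ C₁ * ε :=
    abs_le_of_abs_deriv_le_layer hC hε hR0 hw' hw2c (hb t ht) fun r hr => (zw hr).2.1
  have b0 : ∀ r, ε ≤ r → |w₀ r| ≤ C₀ * ε :=
    abs_le_of_abs_deriv_le_layer (τ := τ) hC₁0 hε hR0 hw hw1c (fun r hr => (b1 r hr).trans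
      (mul_le_mul_of_nonneg_left (by linarith [e0 r]) hC₁0)) fun r hr => (zw hr).1
  -- the combination `z = r w' - w` has derivative `r w''`, and the Neumann condition makes
  -- `z(ε)` of order `ε³`
  set z : ℝ → ℝ := fun r => r * w₁ r - w₀ r with hzdef
  have hzd : ∀ r, HasDerivAt z (r * w₂ r) r := fun r => by
    have := ((hasDerivAt_id r).mul (hw' r)).sub (hw r)
    refine this.congr_deriv ?_
    simp only [id]; ring
  have slope : ∀ {r : ℝ}, 0 < r → 1 / 2 * wavg 1 (deriv (deriv (deriv K))) τ r -
      waveSlope G H τ r = z r / r ^ 3 := fun {r} hr => by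
    rw [hK.half_wavg_one_eq τ hr, waveSlope, waveSlope, deriv_neg_eq, neg_neg]
    simp only [hzdef, hw₀, hw₁]
    field_simp
    ring
  have half : ∀ r, |1 / 2 * wavg 1 (deriv (deriv (deriv K))) τ r| ≤ M' := fun r => by
    rw [abs_mul, abs_of_pos (by norm_num : (0 : ℝ) < 1 / 2)]
    linarith [abs_wavg_le hM' 1 τ r]
  have zε : |z ε| ≤ M' * ε ^ 3 := by
    have h1 := slope hε
    rw [hN t ht, sub_zero] at h1
    have h2 := half ε
    rw [h1, abs_div, abs_of_pos (pow_pos hε 3), div_le_iff₀ (pow_pos hε 3)] at h2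
    exact h2
  have bz : ∀ r, ε ≤ r → r ≤ R' → |z r| ≤ r * (C₂ * ε) := fun r hr hrR => by
    have hr0 : 0 < r := hε.trans_le hr
    have hi : IntervalIntegrable (fun s => Real.exp (-|τ - s| / ε)) volume ε r :=
      (integrable_exp_neg_abs hε τ).intervalIntegrable
    have e := intervalIntegral.integral_eq_sub_of_hasDerivAt (fun x _ => hzd x)
      ((continuous_id.mul hw2c).intervalIntegrable ε r)
    have h1 := intervalIntegral.norm_integral_le_of_norm_le hr
      (g := fun s => r * (C * (ε + Real.exp (-|τ - s| / ε)))) (f := fun s => s * w₂ s)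
      (Eventually.of_forall fun s hs => by
        have hs0 : 0 < s := hε.trans hs.1
        rw [norm_mul, Real.norm_of_nonneg hs0.le]
        exact mul_le_mul hs.2 (hb t ht s hs.1.le) (norm_nonneg _) hr0.le)
      (((intervalIntegrable_const.add hi).const_mul C).const_mul r)
    rw [e, Real.norm_eq_abs, intervalIntegral.integral_const_mul,
      intervalIntegral.integral_const_mul,
      intervalIntegral.integral_add intervalIntegrable_const hi, intervalIntegral.integral_const,
      smul_eq_mul] at h1
    have h2 := intervalIntegral_exp_neg_abs_le hε τ hr
    have h3 : C * ((r - ε) * ε + ∫ s in ε..r, Real.exp (-|τ - s| / ε)) ≤ C₁ * ε := by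
      rw [hC₁, mul_assoc]
      refine mul_le_mul_of_nonneg_left ?_ hC
      nlinarith
    have h4 : r * (C * ((r - ε) * ε + ∫ s in ε..r, Real.exp (-|τ - s| / ε))) ≤ r * (C₁ * ε) :=
      mul_le_mul_of_nonneg_left h3 hr0.le
    have h5 : ε ^ 3 ≤ r * ε := by
      have : ε ^ 2 ≤ r := by nlinarith
      calc ε ^ 3 = ε ^ 2 * ε := by ring
        _ ≤ r * ε := mul_le_mul_of_nonneg_right this hε.le
    have h6 := abs_sub_abs_le_abs_sub (z r) (z ε)
    have h7 : M' * ε ^ 3 ≤ M' * (r * ε) := mul_le_mul_of_nonneg_left h5 hM0'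
    rw [hC₂]
    nlinarith
  have bzr : ∀ {r : ℝ}, 0 < r → ε < r → r ≤ R' → (z r / r) ^ 2 ≤ C₂ ^ 2 * ε ^ 2 :=
    fun {r} hr h h' => by
      rw [← mul_pow]
      refine sq_le_sq.2 ?_
      rw [abs_of_nonneg (mul_nonneg hC₂0 hε.le), abs_div, abs_of_pos hr, div_le_iff₀ hr,
        mul_comm]
      exact bz r h.le h'
  have zz : ∀ {r : ℝ}, R' < r → z r = 0 := fun {r} h => by
    simp only [hzdef, (zw h).1, (zw h).2.1, mul_zero, sub_zero]
  have hd := (hasRadialDeriv_wavg_zero hK.isLineTest_deriv τ).sub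
    (hasRadialDeriv_ext (c := c) hε hG hH hz ht)
  have hd' := (hasRadialDeriv_half_wavg_one hK.isLineTest_deriv.deriv.deriv τ).sub
    (hasRadialDeriv_slope_ext (c := c) hε hG hH hz ht (hN t ht))
  simp only [← mul_sub] at hd
  have s0 : ∀ {r : ℝ}, ε < r → (wavg 0 (deriv K) τ r - twoWave G H τ (max r ε) / max r ε) =
      w₀ r / r := fun {r} hr => by
    rw [max_eq_left hr.le, hK.wavg_eq_twoWave τ (hε.trans hr)]
    simp only [hw₀]; ring
  have s2 : ∀ {r : ℝ}, ε < r → 1 / 2 * wavg 1 (deriv (deriv (deriv K))) τ r -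
      (if ε < r then waveSlope G H τ r else 0) = z r / r ^ 3 := fun {r} hr => by
    rw [if_pos hr, slope (hε.trans hr)]
  have s3 : ∀ {r : ℝ}, ε < r →
      r * (1 / 8 * wavg 2 (deriv (deriv (deriv (deriv (deriv K))))) τ r) -
      (if ε < r then waveSlopeDeriv G H τ r else 0) = w₂ r / r ^ 2 - 3 * z r / r ^ 4 :=
    fun {r} hr => by
      have h0 : r ≠ 0 := (hε.trans hr).ne'
      rw [if_pos hr, hK.wavg_two_eq τ (hε.trans hr), waveSlopeDeriv, waveSlopeDeriv, deriv_neg_eq,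
        deriv_neg_eq, neg_neg]
      simp only [hzdef, hw₀, hw₁, hw₂]
      field_simp
      ring
  have hε2 : ∀ r : ℝ, 0 ≤ ε ^ 2 / r ^ 2 := fun r => by positivity
  have hA : 0 ≤ B ^ 2 + D := by positivity
  have g0 : radSq (fun r => wavg 0 (deriv K) τ r - twoWave G H τ (max r ε) / max r ε) ≤
      ENNReal.ofReal (A * ε) := by
    refine radSq_le_of_le_layer (τ := τ) (R := R') hA hε hε1
      (sq_mul_sq_le_layer hε1 hD0 (fun r _ h => ?_) (fun r hr h _ => ?_) fun r h h' => ?_)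
    · have := abs_wavg_sub_extProfile_le hK hε hM (b0 ε le_rfl) r h
      exact this.trans (by linarith)
    · rw [s0 h, mul_div_cancel₀ _ hr.ne']
      have h1 : w₀ r ^ 2 ≤ (C₀ * ε) ^ 2 :=
        sq_le_sq.2 ((b0 r h.le).trans (le_abs_self _))
      rw [mul_pow] at h1
      have h3 : D * ε ^ 2 ≤ D * (ε ^ 2 + ε ^ 2 / r ^ 2 + Real.exp (-|τ - r| / ε)) :=
        mul_le_mul_of_nonneg_left (by linarith [e0 r, hε2 r]) hD0
      have h2 : C₀ ^ 2 * ε ^ 2 ≤ D * ε ^ 2 :=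
        mul_le_mul_of_nonneg_right (by nlinarith [sq_nonneg C, sq_nonneg C₂]) (sq_nonneg _)
      linarith
    · rw [s0 h, (zw h').1, zero_div]
  have g1 : radSq (fun r => r * (1 / 2 * wavg 1 (deriv (deriv (deriv K))) τ r -
      if ε < r then waveSlope G H τ r else 0)) ≤ ENNReal.ofReal (A * ε) := by
    refine radSq_le_of_le_layer (τ := τ) (R := R') hA hε hε1
      (sq_mul_sq_le_layer hε1 hD0 (fun r hr h => ?_) (fun r hr h h' => ?_) fun r h h' => ?_)
    · rw [if_neg (not_lt.2 h), sub_zero, abs_mul, abs_of_pos hr]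
      calc _ ≤ 1 * M' := mul_le_mul (h.trans hε1) (half r) (abs_nonneg _) zero_le_one
        _ ≤ B := by rw [one_mul, hB]; linarith
    · rw [s2 h]
      have h0 : r ≠ 0 := hr.ne'
      have e : r * (r * (z r / r ^ 3)) = z r / r := by field_simp
      rw [e]
      have h3 : D * ε ^ 2 ≤ D * (ε ^ 2 + ε ^ 2 / r ^ 2 + Real.exp (-|τ - r| / ε)) :=
        mul_le_mul_of_nonneg_left (by linarith [e0 r, hε2 r]) hD0
      have h2 : C₂ ^ 2 * ε ^ 2 ≤ D * ε ^ 2 :=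
        mul_le_mul_of_nonneg_right (by nlinarith [sq_nonneg C, sq_nonneg C₂, sq_nonneg C₀])
          (sq_nonneg _)
      linarith [bzr hr h h']
    · rw [s2 h, zz h', zero_div, mul_zero]
  have g2 : radSq (fun r => 1 / 2 * wavg 1 (deriv (deriv (deriv K))) τ r -
      if ε < r then waveSlope G H τ r else 0) ≤ ENNReal.ofReal (A * ε) := by
    refine radSq_le_of_le_layer (τ := τ) (R := R') hA hε hε1
      (sq_mul_sq_le_layer hε1 hD0 (fun r hr h => ?_) (fun r hr h h' => ?_) fun r h h' => ?_)
    · rw [if_neg (not_lt.2 h), sub_zero]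
      exact (half r).trans (by rw [hB]; linarith)
    · rw [s2 h]
      have h0 : r ≠ 0 := hr.ne'
      have e : (r * (z r / r ^ 3)) ^ 2 = (z r / r) ^ 2 / r ^ 2 := by field_simp
      rw [e]
      have h1 : (z r / r) ^ 2 / r ^ 2 ≤ C₂ ^ 2 * (ε ^ 2 / r ^ 2) := by
        rw [← mul_div_assoc]
        exact div_le_div_of_nonneg_right (bzr hr h h') (sq_nonneg r)
      have h3 : D * (ε ^ 2 / r ^ 2) ≤ D * (ε ^ 2 + ε ^ 2 / r ^ 2 + Real.exp (-|τ - r| / ε)) :=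
        mul_le_mul_of_nonneg_left (by linarith [e0 r, sq_nonneg ε]) hD0
      have h2 : C₂ ^ 2 * (ε ^ 2 / r ^ 2) ≤ D * (ε ^ 2 / r ^ 2) :=
        mul_le_mul_of_nonneg_right (by nlinarith [sq_nonneg C, sq_nonneg C₂, sq_nonneg C₀])
          (hε2 r)
      linarith
    · rw [s2 h, zz h', zero_div]
  have g3 : radSq (fun r => r * (r * (1 / 8 *
      wavg 2 (deriv (deriv (deriv (deriv (deriv K))))) τ r) -
      if ε < r then waveSlopeDeriv G H τ r else 0)) ≤ ENNReal.ofReal (A * ε) := by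
    refine radSq_le_of_le_layer (τ := τ) (R := R') hA hε hε1
      (sq_mul_sq_le_layer hε1 hD0 (fun r hr h => ?_) (fun r hr h h' => ?_) fun r h h' => ?_)
    · rw [if_neg (not_lt.2 h), sub_zero, abs_mul, abs_mul, abs_of_pos hr]
      have h1 : |1 / 8 * wavg 2 (deriv (deriv (deriv (deriv (deriv K))))) τ r| ≤ M₄ := by
        rw [abs_mul, abs_of_pos (by norm_num : (0 : ℝ) < 1 / 8)]
        linarith [abs_wavg_le hM₄ 2 τ r]
      have h2 : r * |1 / 8 * wavg 2 (deriv (deriv (deriv (deriv (deriv K))))) τ r| ≤ 1 * M₄ :=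
        mul_le_mul (h.trans hε1) h1 (abs_nonneg _) zero_le_one
      calc _ ≤ 1 * (1 * M₄) := mul_le_mul (h.trans hε1) h2 (by positivity) zero_le_one
        _ ≤ B := by rw [one_mul, one_mul, hB]; linarith
    · rw [s3 h]
      have h0 : r ≠ 0 := hr.ne'
      have e : r * (r * (w₂ r / r ^ 2 - 3 * z r / r ^ 4)) = w₂ r - 3 * (z r / r ^ 2) := by
        field_simp
      have h2 : (z r / r ^ 2) ^ 2 ≤ C₂ ^ 2 * (ε ^ 2 / r ^ 2) := by
        have : (z r / r ^ 2) ^ 2 = (z r / r) ^ 2 / r ^ 2 := by field_simp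
        rw [this, ← mul_div_assoc]
        exact div_le_div_of_nonneg_right (bzr hr h h') (sq_nonneg r)
      have h3 : w₂ r ^ 2 ≤ (C * (ε + Real.exp (-|τ - r| / ε))) ^ 2 :=
        sq_le_sq.2 ((hb t ht r h.le).trans (le_abs_self _))
      have h4 := sq_add_exp_le hε (abs_nonneg (τ - r))
      have h5 : C ^ 2 * (ε + Real.exp (-|τ - r| / ε)) ^ 2 ≤
          C ^ 2 * (2 * (ε ^ 2 + Real.exp (-|τ - r| / ε))) :=
        mul_le_mul_of_nonneg_left h4 (sq_nonneg C)
      rw [e, hD]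
      rw [mul_pow] at h3
      have h7 : (w₂ r - 3 * (z r / r ^ 2)) ^ 2 ≤ 2 * w₂ r ^ 2 + 18 * (z r / r ^ 2) ^ 2 := by
        nlinarith [sq_nonneg (w₂ r + 3 * (z r / r ^ 2))]
      have p1 := mul_nonneg (sq_nonneg C) (hε2 r)
      have p2 := mul_nonneg (sq_nonneg C₂) (sq_nonneg ε)
      have p3 := mul_nonneg (sq_nonneg C₂) (e0 r)
      have p4 : 0 ≤ C₀ ^ 2 * (ε ^ 2 + ε ^ 2 / r ^ 2 + Real.exp (-|τ - r| / ε)) :=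
        mul_nonneg (sq_nonneg C₀) (by linarith [e0 r, hε2 r, sq_nonneg ε])
      linarith
    · rw [s3 h, zz h', (zw h').2.2]; simp
  refine (sobolevSq_two_radial_le hd hd').trans ?_
  rw [mul_assoc]
  exact ofReal_forty_mul_le g0 g1 g3 g2

end Difference

/-! ### Bounds for the data near the obstacle -/

lemma IsProfile.isLineTest {R : ℝ} {φ : ℝ → ℝ} (h : IsProfile R φ) : IsLineTest φ :=
  ⟨h.smooth, HasCompactSupport.intro (isCompact_closedBall (0 : ℝ) R) fun r hr => by
    rw [mem_closedBall_zero_iff, Real.norm_eq_abs, not_le] at hr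
    exact h.zero r hr.le⟩

lemma deriv_eqOn_Ici {f g : ℝ → ℝ} (hf : ContDiff ℝ ∞ f) (hg : ContDiff ℝ ∞ g) {a : ℝ}
    (h : ∀ x, a ≤ x → f x = g x) (x : ℝ) (hx : a ≤ x) : deriv f x = deriv g x :=
  (uniqueDiffOn_Ici a x hx).eq_deriv _ (hasDerivAt_of_contDiff hf x).hasDerivWithinAt
    ((hasDerivAt_of_contDiff hg x).hasDerivWithinAt.congr (fun y hy => h y hy) (h x hx))

lemma exists_bound_Icc {f : ℝ → ℝ} (hf : ∀ s, 0 < s → ContDiffAt ℝ ∞ f s) :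
    ∃ B, 0 ≤ B ∧ ∀ s ∈ Set.Icc (1 : ℝ) 2, |f s| ≤ B := by
  obtain ⟨B, hB⟩ := (isCompact_Icc (a := (1 : ℝ)) (b := 2)).exists_bound_of_continuousOn
    (f := f) fun s hs => (hf s (by linarith [hs.1])).continuousAt.continuousWithinAt
  exact ⟨B, (abs_nonneg _).trans (hB 1 ⟨le_rfl, one_le_two⟩), hB⟩

lemma contDiffAt_deriv {f : ℝ → ℝ} {s : ℝ} (hf : ContDiffAt ℝ ∞ f s) :
    ContDiffAt ℝ ∞ (deriv f) s := by
  have h1 : ContDiffAt ℝ ∞ (fderiv ℝ f) s := hf.fderiv_right (m := ∞) (by simp)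
  exact h1.clm_apply contDiffAt_const

lemma hasDerivAt_of_contDiffAt {f : ℝ → ℝ} {s : ℝ} (hf : ContDiffAt ℝ ∞ f s) :
    HasDerivAt f (deriv f s) s := (hf.differentiableAt (by simp)).hasDerivAt

section CutBounds

variable {β χ φ ψ : ℝ → ℝ} {ε R c : ℝ}

lemma deriv_dirichletCut (hχ : IsDirichletCutoff χ) (hε : 0 < ε) (hφ : ContDiff ℝ ∞ φ) {r : ℝ}
    (hr : 0 < r) : deriv (dirichletCut χ ε φ) r =
      deriv χ (r / ε) * ε⁻¹ * φ r + χ (r / ε) * deriv φ r := by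
  have e : dirichletCut χ ε φ =ᶠ[𝓝 r] fun r => χ (r / ε) * φ r := by
    filter_upwards [lt_mem_nhds hr] with s hs using dirichletCut_eq hχ hε φ hs
  rw [e.deriv_eq]
  have h1 : HasDerivAt (fun r => r / ε) ε⁻¹ r := by
    simpa using (hasDerivAt_id r).div_const ε
  exact (((hasDerivAt_of_contDiffAt (hχ.contDiffAt (div_pos hr hε))).comp r h1).mul
    (hasDerivAt_of_contDiff hφ r)).deriv

lemma hasDerivAt_comp_neumannCut (hβ : IsNeumannCutoff β) (hε : 0 < ε) (hφ : ContDiff ℝ ∞ φ)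
    {r : ℝ} (hr : 0 < r) : HasDerivAt (fun r => φ (ε * β (r / ε)))
      (deriv φ (ε * β (r / ε)) * deriv β (r / ε)) r := by
  have h1 : HasDerivAt (fun r => r / ε) ε⁻¹ r := by
    simpa using (hasDerivAt_id r).div_const ε
  have h2 := ((hasDerivAt_of_contDiffAt (hβ.contDiffAt (div_pos hr hε))).comp r h1).const_mul ε
  refine ((hasDerivAt_of_contDiff hφ _).comp r h2).congr_deriv ?_
  simp only [Function.comp_apply]
  field_simp

lemma deriv_neumannCut (hβ : IsNeumannCutoff β) (hε : 0 < ε) (hφ : ContDiff ℝ ∞ φ) {r : ℝ}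
    (hr : 0 < r) : deriv (neumannCut β ε φ) r = deriv φ (ε * β (r / ε)) * deriv β (r / ε) := by
  have e : neumannCut β ε φ =ᶠ[𝓝 r] fun r => φ (ε * β (r / ε)) := by
    filter_upwards [lt_mem_nhds hr] with s hs using neumannCut_eq hβ hε φ hs
  rw [e.deriv_eq]
  exact (hasDerivAt_comp_neumannCut hβ hε hφ hr).deriv

lemma deriv_deriv_neumannCut (hβ : IsNeumannCutoff β) (hε : 0 < ε) (hφ : ContDiff ℝ ∞ φ) {r : ℝ}
    (hr : 0 < r) : deriv (deriv (neumannCut β ε φ)) r =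
      deriv (deriv φ) (ε * β (r / ε)) * deriv β (r / ε) ^ 2 +
        deriv φ (ε * β (r / ε)) * (deriv (deriv β) (r / ε) * ε⁻¹) := by
  have e : deriv (neumannCut β ε φ) =ᶠ[𝓝 r]
      fun r => deriv φ (ε * β (r / ε)) * deriv β (r / ε) := by
    filter_upwards [lt_mem_nhds hr] with s hs using deriv_neumannCut hβ hε hφ hs
  rw [e.deriv_eq]
  have h1 : HasDerivAt (fun r => r / ε) ε⁻¹ r := by
    simpa using (hasDerivAt_id r).div_const ε
  have h2 := (hasDerivAt_of_contDiffAt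
    (contDiffAt_deriv (hβ.contDiffAt (div_pos hr hε)))).comp r h1
  refine ((hasDerivAt_comp_neumannCut hβ hε (contDiff_deriv hφ) hr).mul h2).deriv.trans ?_
  simp only [Function.comp_apply]
  ring

lemma div_mem_Icc_one_two {ρ : ℝ} (hε : 0 < ε) (h1 : ε < ρ) (h2 : ρ ≤ 2 * ε) :
    ρ / ε ∈ Set.Icc (1 : ℝ) 2 :=
  ⟨(one_le_div hε).2 h1.le, (div_le_iff₀ hε).2 h2⟩

/-- In `0 ≤ ρ ≤ 2ε` the derivative of the cut-off data costs a factor `1 / ε`, which the factor `ρ`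
in the formula for the travelling wave compensates. -/
lemma exists_bound_deriv_dirichlet (hχ : IsDirichletCutoff χ) (hφ : IsProfile R φ)
    (hψ : IsProfile R ψ) (c : ℝ) : ∃ C, 0 ≤ C ∧ ∀ ε, 0 < ε → ε ≤ 1 → ∀ ρ, ρ ≤ 2 * ε →
      |deriv (halfWave c (dirichletCut χ ε φ) (dirichletCut χ ε ψ)) ρ| ≤ C := by
  obtain ⟨B, hB0, hB⟩ := exists_bound_Icc fun s hs => hχ.contDiffAt hs
  obtain ⟨B', hB0', hB'⟩ := exists_bound_Icc fun s hs => contDiffAt_deriv (hχ.contDiffAt hs)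
  obtain ⟨M, hM0, hM⟩ := hφ.isLineTest.exists_bound
  obtain ⟨M', hM0', hM'⟩ := hφ.isLineTest.deriv.exists_bound
  obtain ⟨N, hN0, hN⟩ := hψ.isLineTest.exists_bound
  refine ⟨(B * M + (2 * B' * M + 2 * B * M') + |c⁻¹| * (2 * (B * N))) / 2, by positivity,
    fun ε hε hε1 ρ hρ => ?_⟩
  have hcut := isCutData_dirichlet hχ hε hφ hψ
  rcases le_or_gt ρ ε with h | h
  · rw [hcut.deriv_halfWave_of_le c h]
    simp only [zero_div, mul_zero, zero_mul, add_zero, abs_zero]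
    positivity
  have hρ0 : 0 < ρ := hε.trans h
  have hs := div_mem_Icc_one_two hε h hρ
  rw [deriv_halfWave hcut.smooth hcut.smooth']
  simp only
  rw [deriv_dirichletCut hχ hε hφ.smooth hρ0, dirichletCut_eq hχ hε φ hρ0,
    dirichletCut_eq hχ hε ψ hρ0, abs_div, abs_two]
  refine div_le_div_of_nonneg_right ?_ two_pos.le
  have e : ρ * (deriv χ (ρ / ε) * ε⁻¹ * φ ρ + χ (ρ / ε) * deriv φ ρ) =
      ρ / ε * deriv χ (ρ / ε) * φ ρ + ρ * χ (ρ / ε) * deriv φ ρ := by ring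
  have hs2 : |ρ / ε| ≤ 2 := by rw [abs_of_nonneg (by linarith [hs.1])]; exact hs.2
  have hr2 : |ρ| ≤ 2 := by rw [abs_of_nonneg hρ0.le]; linarith
  rw [e]
  refine (abs_add_le _ _).trans (add_le_add ((abs_add_le _ _).trans (add_le_add ?_
    ((abs_add_le _ _).trans (add_le_add ?_ ?_)))) ?_) <;> simp only [abs_mul]
  · gcongr
    exacts [hB _ hs, hM _]
  · gcongr
    exacts [hB' _ hs, hM _]
  · gcongr
    exacts [hB _ hs, hM' _]
  · gcongr
    exacts [hB _ hs, hN _]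

lemma IsCutData.deriv_deriv_halfWave_of_le {f g : ℝ} {p q : ℝ → ℝ} (h : IsCutData ε R f g p q)
    (c : ℝ) {ρ : ℝ} (hρ : ρ ≤ ε) : deriv (deriv (halfWave c p q)) ρ = c⁻¹ * g / 2 := by
  have d : ∀ {p : ℝ → ℝ} {f : ℝ}, ContDiff ℝ ∞ p → (∀ r, r ≤ ε → p r = f) →
      ∀ r, r ≤ ε → deriv p r = 0 := fun hp hc r hr =>
    deriv_eq_zero_of_le (hp.differentiable (by simp)) hc hr
  rw [deriv_deriv_halfWave h.smooth h.smooth']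
  simp only
  rw [h.const' ρ hρ, d h.smooth h.const ρ hρ, d h.smooth' h.const' ρ hρ,
    d (contDiff_deriv h.smooth) (d h.smooth h.const) ρ hρ]
  ring

lemma exists_bound_deriv_deriv_neumann (hβ : IsNeumannCutoff β) (hφ : IsProfile R φ)
    (hψ : IsProfile R ψ) (c : ℝ) : ∃ C, 0 ≤ C ∧ ∀ ε, 0 < ε → ε ≤ 1 → ∀ ρ, ρ ≤ 2 * ε →
      |deriv (deriv (halfWave c (neumannCut β ε φ) (neumannCut β ε ψ))) ρ| ≤ C := by
  obtain ⟨B, hB0, hB⟩ := exists_bound_Icc fun s hs => contDiffAt_deriv (hβ.contDiffAt hs)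
  obtain ⟨B', hB0', hB'⟩ := exists_bound_Icc fun s hs =>
    contDiffAt_deriv (contDiffAt_deriv (hβ.contDiffAt hs))
  obtain ⟨M, hM0, hM⟩ := hφ.isLineTest.deriv.exists_bound
  obtain ⟨M', hM0', hM'⟩ := hφ.isLineTest.deriv.deriv.exists_bound
  obtain ⟨N, hN0, hN⟩ := hψ.isLineTest.exists_bound
  obtain ⟨N', hN0', hN'⟩ := hψ.isLineTest.deriv.exists_bound
  refine ⟨(2 * (M * B) + (2 * (M' * B ^ 2) + 2 * (M * B')) + |c⁻¹| * (N + 2 * (N' * B))) / 2,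
    by positivity, fun ε hε hε1 ρ hρ => ?_⟩
  have hcut := isCutData_neumann hβ hε hφ hψ
  rcases le_or_gt ρ ε with h | h
  · rw [hcut.deriv_deriv_halfWave_of_le c h, abs_div, abs_two, abs_mul]
    refine div_le_div_of_nonneg_right ?_ two_pos.le
    calc |c⁻¹| * |ψ ε| ≤ |c⁻¹| * (N + 2 * (N' * B)) := by
          gcongr
          exact (hN _).trans (le_add_of_nonneg_right (by positivity))
      _ ≤ _ := le_add_of_nonneg_left (by positivity)
  have hρ0 : 0 < ρ := hε.trans h
  have hs := div_mem_Icc_one_two hε h hρ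
  rw [deriv_deriv_halfWave hcut.smooth hcut.smooth']
  simp only
  rw [deriv_deriv_neumannCut hβ hε hφ.smooth hρ0, deriv_neumannCut hβ hε hφ.smooth hρ0,
    deriv_neumannCut hβ hε hψ.smooth hρ0, neumannCut_eq hβ hε ψ hρ0, abs_div, abs_two]
  refine div_le_div_of_nonneg_right ?_ two_pos.le
  set s := ρ / ε with hs'
  have e : ρ * (deriv (deriv φ) (ε * β s) * deriv β s ^ 2 +
      deriv φ (ε * β s) * (deriv (deriv β) s * ε⁻¹)) =
      ρ * (deriv (deriv φ) (ε * β s) * deriv β s ^ 2) +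
        s * (deriv φ (ε * β s) * deriv (deriv β) s) := by rw [hs']; ring
  have hs2 : |s| ≤ 2 := by rw [abs_of_nonneg (by linarith [hs.1])]; exact hs.2
  have hr2 : |ρ| ≤ 2 := by rw [abs_of_nonneg hρ0.le]; linarith
  rw [e]
  refine (abs_add_le _ _).trans (add_le_add ((abs_add_le _ _).trans (add_le_add ?_
    ((abs_add_le _ _).trans (add_le_add ?_ ?_)))) ?_)
  · rw [abs_mul, abs_mul, abs_two]
    gcongr
    exacts [hM _, hB _ hs]
  · rw [abs_mul, abs_mul, abs_pow]
    gcongr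
    exacts [hM' _, hB _ hs]
  · rw [abs_mul, abs_mul]
    gcongr
    exacts [hM _, hB' _ hs]
  · rw [abs_mul]
    refine mul_le_mul_of_nonneg_left ((abs_add_le _ _).trans (add_le_add (hN _) ?_))
      (abs_nonneg _)
    rw [abs_mul, abs_mul]
    gcongr
    exacts [hN' _, hB _ hs]

/-- Beyond `2ε` the data are not modified, and neither are the derivatives of the incoming wave. -/
lemma deriv_halfWave_congr {p q : ℝ → ℝ} {a : ℝ} (hp : ContDiff ℝ ∞ p) (hq : ContDiff ℝ ∞ q)
    (hφ : ContDiff ℝ ∞ φ) (hψ : ContDiff ℝ ∞ ψ) (h : ∀ x, a ≤ x → p x = φ x)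
    (h' : ∀ x, a ≤ x → q x = ψ x) (c : ℝ) (ρ : ℝ) (hρ : a ≤ ρ) :
    deriv (halfWave c p q) ρ = deriv (halfWave c φ ψ) ρ := by
  rw [deriv_halfWave hp hq, deriv_halfWave hφ hψ]
  simp only
  rw [h ρ hρ, h' ρ hρ, deriv_eqOn_Ici hp hφ h ρ hρ]

lemma deriv_halfWave_neg_speed (hφ : IsProfile R φ) (hψ : IsProfile R ψ) (c : ℝ) :
    deriv (halfWave (-c) φ ψ) = fun ρ => deriv (halfWave c φ ψ) (-ρ) := by
  funext ρ
  rw [show halfWave (-c) φ ψ = fun r => -halfWave c φ ψ (-r) from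
    funext (halfWave_neg_speed hφ.even hψ.even c)]
  refine (((hφ.isWaveProfile hψ c).hasDerivAt (-ρ)).comp ρ (hasDerivAt_neg ρ)).neg.deriv.trans ?_
  ring

lemma deriv_deriv_halfWave_neg_speed (hφ : IsProfile R φ) (hψ : IsProfile R ψ) (c : ℝ) :
    deriv (deriv (halfWave (-c) φ ψ)) = fun ρ => -deriv (deriv (halfWave c φ ψ)) (-ρ) := by
  rw [deriv_halfWave_neg_speed hφ hψ]
  funext ρ
  exact deriv_comp_neg _ _

end CutBounds

lemma le_mul_exp_of_abs_le {A ε τ x : ℝ} (hε : 0 < ε) (hx : x ≤ A) (hA : 0 ≤ A)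
    (h : |τ| ≤ 2 * ε) : x ≤ A * Real.exp 2 * Real.exp (-|τ| / ε) := by
  rw [mul_assoc, ← Real.exp_add]
  refine hx.trans (le_mul_of_one_le_right hA (Real.one_le_exp ?_))
  rw [neg_div, ← sub_eq_add_neg, sub_nonneg, div_le_iff₀ hε]
  exact h

/-! ### Distance between the free and the exterior waves -/

section Dirichlet

variable {χ φ ψ : ℝ → ℝ} {R c : ℝ}

/-- The free and the exterior Dirichlet wave differ by `O(ε)` away from the boundary layer
`|ct - r| ≲ ε` of the outgoing cone: the reflected wave `-K(τ + 2ε)` is close to `-K(τ)`. -/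
lemma exists_bound_dirichlet (hc : 0 < c) (hχ : IsDirichletCutoff χ) (hφ : IsProfile R φ)
    (hψ : IsProfile R ψ) : ∃ C, 0 ≤ C ∧ ∀ ε, 0 < ε → ε ≤ 1 → ∀ t, 0 ≤ t → ∀ r, ε ≤ r →
      |twoWave (deriv (halfWave c φ ψ)) (deriv (halfWave c φ ψ)) (c * t) r -
        twoWave (deriv (dirichletIn c χ ε φ ψ)) (-deriv (dirichletOut c χ ε φ ψ)) (c * t) r| ≤
      C * (ε + Real.exp (-|c * t - r| / ε)) := by
  obtain ⟨C₁, hC₁, hL⟩ := exists_bound_deriv_dirichlet hχ hφ hψ c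
  obtain ⟨C₂, hC₂, hN⟩ := exists_bound_deriv_dirichlet hχ hφ hψ (-c)
  have hK := hφ.isWaveProfile hψ c
  obtain ⟨M, hM0, hM⟩ := hK.isLineTest_deriv.exists_bound
  obtain ⟨M', hM0', hM'⟩ := hK.isLineTest_deriv.deriv.exists_bound
  refine ⟨(M + C₁) * Real.exp 2 + ((M + C₂ + C₁) * Real.exp 2 + 2 * M'), by positivity,
    fun ε hε hε1 t ht r hr => ?_⟩
  have hcut := isCutData_dirichlet hχ hε hφ hψ
  have hct : 0 ≤ c * t := mul_nonneg hc.le ht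
  have agree : ∀ c ρ, 2 * ε ≤ ρ →
      deriv (halfWave c (dirichletCut χ ε φ) (dirichletCut χ ε ψ)) ρ =
        deriv (halfWave c φ ψ) ρ := fun c =>
    deriv_halfWave_congr hcut.smooth hcut.smooth' hφ.smooth hψ.smooth
      (fun _ => dirichletCut_of_two_mul_le hχ hε φ) (fun _ => dirichletCut_of_two_mul_le hχ hε ψ) c
  have dH : deriv (dirichletOut c χ ε φ ψ) (c * t - r) =
      -deriv (halfWave (-c) (dirichletCut χ ε φ) (dirichletCut χ ε ψ)) (-(c * t - r)) -
        deriv (dirichletIn c χ ε φ ψ) (c * t - r + 2 * ε) := by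
    rw [dirichletOut, hcut.deriv_outWave (contDiff_dirichletRefl hχ hε hφ hψ c)]
    have h1 := ((hasDerivAt_of_contDiff (contDiff_dirichletIn hχ hε hφ hψ c)
      (c * t - r + ε + ε)).comp_add_const (c * t - r + ε) ε).neg
    have h2 := h1.deriv
    rw [add_assoc (c * t - r), ← two_mul] at h2
    exact congrArg₂ (· + ·) rfl h2
  simp only [twoWave, Pi.neg_apply]
  rw [dH]
  set K := halfWave c φ ψ
  set τ := c * t - r with hτ
  have hE : 0 < Real.exp (-|τ| / ε) := Real.exp_pos _
  have b1 : |deriv K (c * t + r) - deriv (dirichletIn c χ ε φ ψ) (c * t + r)| ≤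
      (M + C₁) * Real.exp 2 * Real.exp (-|τ| / ε) := by
    rcases le_total (2 * ε) (c * t + r) with h | h
    · rw [dirichletIn, agree c _ h, sub_self, abs_zero]
      positivity
    · refine le_mul_exp_of_abs_le hε ((abs_sub _ _).trans
        (add_le_add (hM _) (hL ε hε hε1 _ h))) (by positivity) ?_
      rw [abs_le]
      constructor <;> linarith
  have b2 : |deriv K τ - deriv (halfWave (-c) (dirichletCut χ ε φ) (dirichletCut χ ε ψ)) (-τ) -
      deriv (dirichletIn c χ ε φ ψ) (τ + 2 * ε)| ≤
      (M + C₂ + C₁) * Real.exp 2 * Real.exp (-|τ| / ε) + 2 * M' * ε := by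
    rcases lt_or_ge 0 τ with h | h
    -- after the reflection: `K'(τ) - K'(τ + 2ε) = O(ε)`
    · rw [hcut.deriv_halfWave_of_le (-c) (by linarith), dirichletIn, agree c _ (by linarith)]
      have := hK.isLineTest_deriv.abs_sub_le hM' τ (τ + 2 * ε)
      rw [show τ - (τ + 2 * ε) = -(2 * ε) by ring, abs_neg, abs_of_pos (mul_pos two_pos hε)] at this
      simp only [zero_div, mul_zero, zero_mul, add_zero, sub_zero]
      change |deriv K τ - deriv K (τ + 2 * ε)| ≤ _
      have h0 : 0 ≤ (M + C₂ + C₁) * Real.exp 2 * Real.exp (-|τ| / ε) := by positivity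
      linarith
    · have h0 : 0 ≤ 2 * M' * ε := by positivity
      rcases le_total τ (-(2 * ε)) with h' | h'
      -- only unmodified data have arrived, and there is no reflected wave
      · rw [agree (-c) _ (by linarith), deriv_halfWave_neg_speed hφ hψ, dirichletIn,
          hcut.deriv_halfWave_of_le c (by linarith)]
        simp only [neg_neg, zero_div, mul_zero, zero_mul, add_zero, sub_self, abs_zero, K]
        positivity
      · refine (le_mul_exp_of_abs_le hε ((abs_sub _ _).trans (add_le_add ((abs_sub _ _).trans
          (add_le_add (hM _) (hN ε hε hε1 _ (by linarith)))) (hL ε hε hε1 _ (by linarith))))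
          (by positivity) ?_).trans (le_add_of_nonneg_right h0)
        rw [abs_of_nonpos h]
        linarith
  have e : deriv K (c * t + r) + deriv K τ - (deriv (dirichletIn c χ ε φ ψ) (c * t + r) +
      -(-deriv (halfWave (-c) (dirichletCut χ ε φ) (dirichletCut χ ε ψ)) (-τ) -
        deriv (dirichletIn c χ ε φ ψ) (τ + 2 * ε))) =
      (deriv K (c * t + r) - deriv (dirichletIn c χ ε φ ψ) (c * t + r)) +
      (deriv K τ - deriv (halfWave (-c) (dirichletCut χ ε φ) (dirichletCut χ ε ψ)) (-τ) -
        deriv (dirichletIn c χ ε φ ψ) (τ + 2 * ε)) := by ring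
  rw [e]
  refine (abs_add_le _ _).trans ((add_le_add b1 b2).trans ?_)
  have p1 : 0 ≤ (M + C₁) * Real.exp 2 * ε := by positivity
  have p2 : 0 ≤ (M + C₂ + C₁) * Real.exp 2 * ε := by positivity
  have p3 : 0 ≤ 2 * M' * Real.exp (-|τ| / ε) := by positivity
  nlinarith

end Dirichlet

/-- Gronwall's inequality for `y' + y / ε`. -/
lemma abs_le_of_abs_deriv_add_div_le {y y' : ℝ → ℝ} {ε M a b : ℝ} (hε : 0 < ε) (hM : 0 ≤ M)
    (hy : ∀ σ, HasDerivAt y (y' σ) σ) (h : ∀ σ ∈ Set.Ico a b, |y' σ + y σ / ε| ≤ M) {σ : ℝ}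
    (hσ : σ ∈ Set.Icc a b) : |y σ| ≤ |y a| * Real.exp (-(σ - a) / ε) + ε * M := by
  have hE : ∀ σ, HasDerivAt (fun σ => Real.exp ((σ - a) / ε)) (Real.exp ((σ - a) / ε) / ε) σ :=
    fun σ => by
      have := (((hasDerivAt_id σ).sub_const a).div_const ε).exp
      exact this.congr_deriv (by simp [div_eq_mul_inv])
  have hz : ∀ σ, HasDerivAt (fun σ => Real.exp ((σ - a) / ε) * y σ)
      (Real.exp ((σ - a) / ε) * (y' σ + y σ / ε)) σ := fun σ =>
    ((hE σ).mul (hy σ)).congr_deriv (by ring)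
  have hB : ∀ σ, HasDerivAt (fun σ => |y a| + ε * M * Real.exp ((σ - a) / ε))
      (ε * M * (Real.exp ((σ - a) / ε) / ε)) σ := fun σ => ((hE σ).const_mul _).const_add _
  have key := image_norm_le_of_norm_deriv_right_le_deriv_boundary
    (fun σ _ => (hz σ).continuousAt.continuousWithinAt) (fun σ _ => (hz σ).hasDerivWithinAt)
    (by simpa using mul_nonneg hε.le hM) hB (fun σ hσ => by
      rw [norm_mul, Real.norm_of_nonneg (Real.exp_pos _).le, Real.norm_eq_abs]
      calc _ ≤ Real.exp ((σ - a) / ε) * M := by gcongr; exact h σ hσ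
        _ = _ := by field_simp) hσ
  rw [norm_mul, Real.norm_of_nonneg (Real.exp_pos _).le, Real.norm_eq_abs] at key
  have e : Real.exp (-(σ - a) / ε) * Real.exp ((σ - a) / ε) = 1 := by
    rw [← Real.exp_add, neg_div, neg_add_cancel, Real.exp_zero]
  calc |y σ| = Real.exp (-(σ - a) / ε) * (Real.exp ((σ - a) / ε) * |y σ|) := by
        rw [← mul_assoc, e, one_mul]
    _ ≤ Real.exp (-(σ - a) / ε) * (|y a| + ε * M * Real.exp ((σ - a) / ε)) := by gcongr
    _ = |y a| * Real.exp (-(σ - a) / ε) +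
        ε * M * (Real.exp (-(σ - a) / ε) * Real.exp ((σ - a) / ε)) := by ring
    _ = _ := by rw [e, mul_one]

section Neumann

variable {β φ ψ : ℝ → ℝ} {ε R c f g : ℝ} {p q : ℝ → ℝ}

lemma IsCutData.hasDerivAt_neumannSource (h : IsCutData ε R f g p q) (c σ : ℝ) :
    HasDerivAt (neumannSource c ε f g p q) (deriv (deriv (halfWave c p q)) (σ + ε) + c⁻¹ * g / 2 -
      (deriv (halfWave c p q) (σ + ε) - deriv (constWave c f g) (σ - ε)) / ε) σ := by
  have hL := h.contDiff_inWave c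
  have h1 := (hasDerivAt_of_contDiff (contDiff_deriv hL) (σ + ε)).comp_add_const σ ε
  have h2 := (hasDerivAt_of_contDiff hL (σ + ε)).comp_add_const σ ε
  have h3 : HasDerivAt (fun σ => deriv (constWave c f g) (σ - ε)) (c⁻¹ * g / 2) σ := by
    simp only [deriv_constWave]
    simpa using (((hasDerivAt_id σ).sub_const ε).const_mul (c⁻¹ * g / 2)).const_add (f / 2)
  have h4 : HasDerivAt (fun σ => constWave c f g (σ - ε)) (deriv (constWave c f g) (σ - ε)) σ :=
    (hasDerivAt_of_contDiff (contDiff_constWave c f g) (σ - ε)).comp_sub_const σ ε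
  exact (h1.add h3).sub ((h2.sub h4).div_const ε)

/-- Up to time `ε / c` the reflected wave is governed by the data in `r ≤ 2ε`. Since `S'` is
bounded there, `y = b'` with `y' + y / ε = S'` is of order `ε`, and `b'' = S' - b' / ε` is bounded. -/
lemma IsCutData.abs_deriv_deriv_robin_le (h : IsCutData ε R f g p q) (hε : 0 < ε) {C D : ℝ}
    (hC : ∀ ρ, ρ ≤ 2 * ε → |deriv (deriv (halfWave c p q)) ρ| ≤ C) (hD : |c⁻¹ * g / 2| ≤ D)
    {σ : ℝ} (hσ : σ ∈ Set.Icc (-ε) ε) :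
    |deriv (deriv (robin ε (neumannSource c ε f g p q))) σ| ≤ 6 * (C + D) := by
  have hL := h.contDiff_inWave c
  have hS := h.contDiff_neumannSource c
  have hb := contDiff_deriv (contDiff_robin hS ε)
  have hC0 : 0 ≤ C := (abs_nonneg _).trans (hC 0 (by positivity))
  have hD0 : 0 ≤ D := (abs_nonneg _).trans hD
  have ode : ∀ σ, deriv (deriv (robin ε (neumannSource c ε f g p q))) σ =
      deriv (neumannSource c ε f g p q) σ - deriv (robin ε (neumannSource c ε f g p q)) σ / ε :=
    fun σ => by
      have := ((hasDerivAt_of_contDiff hS σ).sub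
        ((hasDerivAt_of_contDiff (contDiff_robin hS ε) σ).div_const ε)).deriv
      rw [← this]
      exact congrArg (fun F => deriv F σ) (deriv_robin hS ε)
  have hS' : ∀ σ ∈ Set.Icc (-ε) ε, |deriv (neumannSource c ε f g p q) σ| ≤ 3 * (C + D) := by
    intro σ hσ
    rw [(h.hasDerivAt_neumannSource c σ).deriv]
    have h1 : |deriv (halfWave c p q) (σ + ε) - f / 2| ≤ C * (2 * ε) := by
      have := Convex.norm_image_sub_le_of_norm_hasDerivWithin_le (s := Set.Icc 0 (2 * ε)) (C := C)
        (fun z _ => (hasDerivAt_of_contDiff (contDiff_deriv hL) z).hasDerivWithinAt)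
        (fun z hz => hC z hz.2) (convex_Icc _ _) (x := 0) (y := σ + ε)
        ⟨le_rfl, by positivity⟩ ⟨by linarith [hσ.1], by linarith [hσ.2]⟩
      rw [h.deriv_halfWave_of_le c (ρ := 0) hε.le, mul_zero, add_zero, sub_zero,
        Real.norm_eq_abs, Real.norm_eq_abs, abs_of_nonneg (by linarith [hσ.1] : 0 ≤ σ + ε)] at this
      refine this.trans (mul_le_mul_of_nonneg_left ?_ hC0)
      linarith [hσ.2]
    have h2 : |deriv (constWave c f g) (σ - ε) - f / 2| ≤ D * (2 * ε) := by
      rw [deriv_constWave]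
      simp only
      rw [add_sub_cancel_left, abs_mul]
      refine mul_le_mul hD ?_ (abs_nonneg _) hD0
      rw [abs_of_nonpos (by linarith [hσ.2])]
      linarith [hσ.1]
    have h3 : |(deriv (halfWave c p q) (σ + ε) - deriv (constWave c f g) (σ - ε)) / ε| ≤
        2 * (C + D) := by
      rw [abs_div, abs_of_pos hε, div_le_iff₀ hε]
      have := abs_sub_le (deriv (halfWave c p q) (σ + ε)) (f / 2)
        (deriv (constWave c f g) (σ - ε))
      rw [abs_sub_comm (f / 2)] at this
      linarith
    have h4 := hC (σ + ε) (by linarith [hσ.2])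
    refine (abs_sub _ _).trans
      ((add_le_add ((abs_add_le _ _).trans (add_le_add h4 hD)) h3).trans ?_)
    linarith
  have b1 := abs_le_of_abs_deriv_add_div_le (a := -ε) (b := ε) hε
    (by positivity : 0 ≤ 3 * (C + D)) (hasDerivAt_of_contDiff hb)
    (fun σ hσ => by
      rw [ode, sub_add_cancel]; exact hS' σ ⟨hσ.1, hσ.2.le⟩) hσ
  have b2 : deriv (robin ε (neumannSource c ε f g p q)) (-ε) = 0 :=
    deriv_eq_zero_of_le ((contDiff_robin hS ε).differentiable (by simp))
      (fun _ hσ => robin_eq_zero (fun _ hσ => h.neumannSource_eq_zero hε c hσ) hσ)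
      (neg_nonpos.2 hε.le)
  rw [b2, abs_zero, zero_mul, zero_add] at b1
  rw [ode]
  have b3 : |deriv (robin ε (neumannSource c ε f g p q)) σ / ε| ≤ 3 * (C + D) := by
    rw [abs_div, abs_of_pos hε, div_le_iff₀ hε]
    linarith
  refine (abs_sub _ _).trans ((add_le_add (hS' σ hσ) b3).trans ?_)
  linarith

/-- For `σ ≥ ε` the reflected wave `b` satisfies `b'' ≈ P'' - K''(σ - ε)` up to `O(ε)` and an
exponentially decaying term, since the equation `b' + b / ε = S` relaxes at the rate `1 / ε`. -/
lemma IsCutData.abs_add_deriv_deriv_robin_le (h : IsCutData ε R f g p q) (hε : 0 < ε) {R' : ℝ}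
    {K : ℝ → ℝ} (hK : IsWaveProfile R' K)
    (hKL : ∀ ρ, 2 * ε ≤ ρ → deriv (halfWave c p q) ρ = deriv K ρ) {M Y : ℝ}
    (hM : ∀ x, |deriv (deriv (deriv K)) x| ≤ M)
    (hY : |-deriv (deriv K) 0 + c⁻¹ * g / 2 -
      deriv (deriv (robin ε (neumannSource c ε f g p q))) ε| ≤ Y) {τ : ℝ} (hτ : 0 ≤ τ) :
    |-deriv (deriv K) τ + c⁻¹ * g / 2 -
      deriv (deriv (robin ε (neumannSource c ε f g p q))) (τ + ε)| ≤
      Y * Real.exp (-τ / ε) + ε * (4 * M) := by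
  have hL := contDiff_deriv (h.contDiff_inWave c)
  have hS := h.contDiff_neumannSource c
  have hb := contDiff_deriv (contDiff_deriv (contDiff_robin hS ε))
  have hM0 : 0 ≤ M := (abs_nonneg _).trans (hM 0)
  have hK2 := hK.isLineTest_deriv.deriv
  have hL2 : ∀ ρ, 2 * ε ≤ ρ → deriv (deriv (halfWave c p q)) ρ = deriv (deriv K) ρ :=
    deriv_eqOn_Ici hL hK.isLineTest_deriv.smooth hKL
  have hL3 : ∀ ρ, 2 * ε ≤ ρ → deriv (deriv (deriv (halfWave c p q))) ρ =
      deriv (deriv (deriv K)) ρ := deriv_eqOn_Ici (contDiff_deriv hL) hK2.smooth hL2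
  have ode : ∀ σ, deriv (deriv (deriv (robin ε (neumannSource c ε f g p q)))) σ =
      deriv (deriv (deriv (halfWave c p q))) (σ + ε) -
        (deriv (deriv (halfWave c p q)) (σ + ε) - c⁻¹ * g / 2) / ε -
        deriv (deriv (robin ε (neumannSource c ε f g p q))) σ / ε := fun σ => by
    have e : deriv (deriv (robin ε (neumannSource c ε f g p q))) = fun σ =>
        deriv (deriv (halfWave c p q)) (σ + ε) + c⁻¹ * g / 2 -
        (deriv (halfWave c p q) (σ + ε) - deriv (constWave c f g) (σ - ε)) / ε -
        deriv (robin ε (neumannSource c ε f g p q)) σ / ε := by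
      funext σ
      have := ((h.hasDerivAt_neumannSource c σ).sub
        ((hasDerivAt_of_contDiff (contDiff_robin hS ε) σ).div_const ε)).deriv
      rw [← this]
      exact congrArg (fun F => deriv F σ) (deriv_robin hS ε)
    have h1 := (hasDerivAt_of_contDiff (contDiff_deriv hL) (σ + ε)).comp_add_const σ ε
    have h2 := (hasDerivAt_of_contDiff hL (σ + ε)).comp_add_const σ ε
    have h3 : HasDerivAt (fun σ => deriv (constWave c f g) (σ - ε)) (c⁻¹ * g / 2) σ := by
      simp only [deriv_constWave]
      simpa using (((hasDerivAt_id σ).sub_const ε).const_mul (c⁻¹ * g / 2)).const_add (f / 2)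
    have h4 := (hasDerivAt_of_contDiff (contDiff_deriv (contDiff_robin hS ε)) σ).div_const ε
    have := (((h1.add_const (c⁻¹ * g / 2)).sub ((h2.sub h3).div_const ε)).sub h4).deriv
    rw [← this]
    exact congrArg (fun F => deriv F σ) e
  have hy : ∀ σ, HasDerivAt (fun σ => -deriv (deriv K) (σ - ε) + c⁻¹ * g / 2 -
      deriv (deriv (robin ε (neumannSource c ε f g p q))) σ) (-deriv (deriv (deriv K)) (σ - ε) -
      deriv (deriv (deriv (robin ε (neumannSource c ε f g p q)))) σ) σ := fun σ =>
    (((hK2.hasDerivAt (σ - ε)).comp_sub_const σ ε).neg.add_const _).sub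
      (hasDerivAt_of_contDiff hb σ)
  have key := abs_le_of_abs_deriv_add_div_le (a := ε) (b := τ + ε) hε
    (by positivity : 0 ≤ 4 * M) hy (fun σ hσ => by
      rw [ode, hL3 _ (by linarith [hσ.1]), hL2 _ (by linarith [hσ.1])]
      have e : -deriv (deriv (deriv K)) (σ - ε) - (deriv (deriv (deriv K)) (σ + ε) -
          (deriv (deriv K) (σ + ε) - c⁻¹ * g / 2) / ε -
          deriv (deriv (robin ε (neumannSource c ε f g p q))) σ / ε) +
          (-deriv (deriv K) (σ - ε) + c⁻¹ * g / 2 -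
          deriv (deriv (robin ε (neumannSource c ε f g p q))) σ) / ε =
          -deriv (deriv (deriv K)) (σ - ε) - deriv (deriv (deriv K)) (σ + ε) +
          (deriv (deriv K) (σ + ε) - deriv (deriv K) (σ - ε)) / ε := by ring
      rw [e]
      have h1 := hK2.abs_sub_le hM (σ + ε) (σ - ε)
      rw [show σ + ε - (σ - ε) = 2 * ε by ring, abs_of_pos (mul_pos two_pos hε)] at h1
      have h2 : |(deriv (deriv K) (σ + ε) - deriv (deriv K) (σ - ε)) / ε| ≤ 2 * M := by
        rw [abs_div, abs_of_pos hε, div_le_iff₀ hε]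
        linarith
      refine (abs_add_le _ _).trans ((add_le_add ((abs_sub _ _).trans
        (add_le_add ((abs_neg _).trans_le (hM _)) (hM _))) h2).trans ?_)
      linarith) (σ := τ + ε) ⟨by linarith, le_rfl⟩
  simp only [add_sub_cancel_right, sub_self] at key
  refine key.trans (add_le_add (mul_le_mul_of_nonneg_right hY (Real.exp_pos _).le) le_rfl)

/-- The free and the exterior Neumann wave differ by `O(ε)` in second derivatives away from the
boundary layer of the outgoing cone. -/
lemma exists_bound_neumann (hc : 0 < c) (hβ : IsNeumannCutoff β) (hφ : IsProfile R φ)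
    (hψ : IsProfile R ψ) : ∃ C, 0 ≤ C ∧ ∀ ε, 0 < ε → ε ≤ 1 → ∀ t, 0 ≤ t → ∀ r, ε ≤ r →
      |twoWave (deriv (deriv (halfWave c φ ψ))) (-deriv (deriv (halfWave c φ ψ))) (c * t) r -
        twoWave (deriv (deriv (neumannIn c β ε φ ψ)))
          (deriv (deriv (neumannOut c β ε φ ψ))) (c * t) r| ≤
      C * (ε + Real.exp (-|c * t - r| / ε)) := by
  obtain ⟨C₁, hC₁, hL⟩ := exists_bound_deriv_deriv_neumann hβ hφ hψ c
  obtain ⟨C₂, hC₂, hN⟩ := exists_bound_deriv_deriv_neumann hβ hφ hψ (-c)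
  have hK := hφ.isWaveProfile hψ c
  obtain ⟨M, hM0, hM⟩ := hK.isLineTest_deriv.deriv.exists_bound
  obtain ⟨M', hM0', hM'⟩ := hK.isLineTest_deriv.deriv.deriv.exists_bound
  obtain ⟨D, hD0, hD⟩ : ∃ D, 0 ≤ D ∧ ∀ ε, |c⁻¹ * ψ ε / 2| ≤ D := by
    obtain ⟨N, hN0, hN⟩ := hψ.isLineTest.exists_bound
    refine ⟨|c⁻¹| * N / 2, by positivity, fun ε => ?_⟩
    rw [abs_div, abs_mul, abs_two]
    gcongr
    exact hN ε
  set E := 6 * (C₁ + D) with hE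
  set Y := M + D + E with hY
  have hE0 : 0 ≤ E := by positivity
  have hY0 : 0 ≤ Y := by positivity
  refine ⟨(M + C₁) * Real.exp 2 + ((M + C₂ + E) * Real.exp 2 + Y + 4 * M'), by positivity,
    fun ε hε hε1 t ht r hr => ?_⟩
  have hcut := isCutData_neumann hβ hε hφ hψ
  have hct : 0 ≤ c * t := mul_nonneg hc.le ht
  have agree : ∀ c ρ, 2 * ε ≤ ρ →
      deriv (halfWave c (neumannCut β ε φ) (neumannCut β ε ψ)) ρ =
        deriv (halfWave c φ ψ) ρ := fun c =>
    deriv_halfWave_congr hcut.smooth hcut.smooth' hφ.smooth hψ.smooth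
      (fun _ => neumannCut_of_two_mul_le hβ hε φ) (fun _ => neumannCut_of_two_mul_le hβ hε ψ) c
  have agree2 : ∀ c ρ, 2 * ε ≤ ρ →
      deriv (deriv (halfWave c (neumannCut β ε φ) (neumannCut β ε ψ))) ρ =
        deriv (deriv (halfWave c φ ψ)) ρ := fun c =>
    deriv_eqOn_Ici (contDiff_deriv (hcut.contDiff_inWave c))
      (contDiff_deriv (contDiff_halfWave hφ.smooth hψ.smooth c)) (agree c)
  have dH : deriv (deriv (neumannOut c β ε φ ψ)) (c * t - r) =
      deriv (deriv (halfWave (-c) (neumannCut β ε φ) (neumannCut β ε ψ))) (-(c * t - r)) +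
        deriv (deriv (neumannRefl c β ε φ ψ)) (c * t - r + ε) := by
    rw [neumannOut, hcut.deriv_deriv_outWave (contDiff_neumannRefl hβ hε hφ hψ c)]
  have refl_le : ∀ σ ∈ Set.Icc (-ε) ε, |deriv (deriv (neumannRefl c β ε φ ψ)) σ| ≤ E :=
    fun σ hσ => hcut.abs_deriv_deriv_robin_le hε (hL ε hε hε1) (hD ε) hσ
  simp only [twoWave, Pi.neg_apply]
  rw [dH]
  set K := halfWave c φ ψ
  set τ := c * t - r with hτ
  have b1 : |deriv (deriv K) (c * t + r) - deriv (deriv (neumannIn c β ε φ ψ)) (c * t + r)| ≤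
      (M + C₁) * Real.exp 2 * Real.exp (-|τ| / ε) := by
    rcases le_total (2 * ε) (c * t + r) with h | h
    · rw [neumannIn, agree2 c _ h, sub_self, abs_zero]
      positivity
    · refine le_mul_exp_of_abs_le hε ((abs_sub _ _).trans
        (add_le_add (hM _) (hL ε hε hε1 _ h))) (by positivity) ?_
      rw [abs_le]
      constructor <;> linarith
  have b2 : |-deriv (deriv K) τ -
      deriv (deriv (halfWave (-c) (neumannCut β ε φ) (neumannCut β ε ψ))) (-τ) -
      deriv (deriv (neumannRefl c β ε φ ψ)) (τ + ε)| ≤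
      ((M + C₂ + E) * Real.exp 2 + Y) * Real.exp (-|τ| / ε) + 4 * M' * ε := by
    have h0 : 0 ≤ (M + C₂ + E) * Real.exp 2 * Real.exp (-|τ| / ε) := by positivity
    have h0' : 0 ≤ Y * Real.exp (-|τ| / ε) := by positivity
    have h0'' : 0 ≤ 4 * M' * ε := by positivity
    rcases lt_or_ge 0 τ with h | h
    -- after the reflection: `K''(τ)` is compensated by the reflected wave
    · rw [hcut.deriv_deriv_halfWave_of_le (-c) (by linarith), inv_neg, neg_mul, neg_div,
        sub_neg_eq_add]
      have := hcut.abs_add_deriv_deriv_robin_le hε hK (agree c) hM' (Y := Y)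
        ((abs_sub _ _).trans (add_le_add ((abs_add_le _ _).trans
          (add_le_add ((abs_neg _).trans_le (hM _)) (hD ε)))
          (refl_le ε ⟨by linarith, le_rfl⟩))) h.le
      rw [abs_of_pos h]
      rw [abs_of_pos h] at h0 h0'
      refine this.trans ?_
      linarith
    · rcases le_total τ (-(2 * ε)) with h' | h'
      -- only unmodified data have arrived, and there is no reflected wave
      · have z : deriv (deriv (neumannRefl c β ε φ ψ)) (τ + ε) = 0 := by
          have hb := contDiff_neumannRefl hβ hε hφ hψ c
          refine deriv_eq_zero_of_le ((contDiff_deriv hb).differentiable (by simp)) (a := 0)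
            (C := 0) (fun x hx => deriv_eq_zero_of_le (hb.differentiable (by simp))
              (neumannRefl_eq_zero hβ hε hφ hψ c) hx) (by linarith)
        rw [agree2 (-c) _ (by linarith), deriv_deriv_halfWave_neg_speed hφ hψ, z]
        simp only [neg_neg, K, sub_self, abs_zero]
        positivity
      · have := le_mul_exp_of_abs_le (τ := τ) hε ((abs_sub _ _).trans (add_le_add
          ((abs_sub _ _).trans (add_le_add ((abs_neg _).trans_le (hM τ))
            (hN ε hε hε1 (-τ) (by linarith)))) (refl_le (τ + ε) ⟨by linarith, by linarith⟩)))
          (by positivity) (by rw [abs_of_nonpos h]; linarith)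
        linarith
  have e : deriv (deriv K) (c * t + r) + -deriv (deriv K) τ -
      (deriv (deriv (neumannIn c β ε φ ψ)) (c * t + r) +
      (deriv (deriv (halfWave (-c) (neumannCut β ε φ) (neumannCut β ε ψ))) (-τ) +
        deriv (deriv (neumannRefl c β ε φ ψ)) (τ + ε))) =
      (deriv (deriv K) (c * t + r) - deriv (deriv (neumannIn c β ε φ ψ)) (c * t + r)) +
      (-deriv (deriv K) τ -
      deriv (deriv (halfWave (-c) (neumannCut β ε φ) (neumannCut β ε ψ))) (-τ) -
      deriv (deriv (neumannRefl c β ε φ ψ)) (τ + ε)) := by ring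
  rw [e]
  refine (abs_add_le _ _).trans ((add_le_add b1 b2).trans ?_)
  have p1 : 0 ≤ (M + C₁) * Real.exp 2 * ε := by positivity
  have p2 : 0 ≤ ((M + C₂ + E) * Real.exp 2 + Y) * ε := by positivity
  have p3 : 0 ≤ 4 * M' * Real.exp (-|τ| / ε) := by positivity
  nlinarith

end Neumann

/-! ### Convergence of the exterior solutions -/

section SmoothData

variable {c T : ℝ} {β χ : ℝ → ℝ} {Φ Ψ : E3 → ℝ}

lemma IsSmoothRadial.exists_isProfile_pair (hΦ : IsSmoothRadial Φ) (hΨ : IsSmoothRadial Ψ) :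
    ∃ R, 0 ≤ R ∧ IsProfile R (profile Φ) ∧ IsProfile R (profile Ψ) := by
  obtain ⟨R₁, h0, h1⟩ := hΦ.exists_isProfile
  obtain ⟨R₂, -, h2⟩ := hΨ.exists_isProfile
  exact ⟨max R₁ R₂, h0.trans (le_max_left _ _), h1 _ (le_max_left _ _), h2 _ (le_max_right _ _)⟩

/-- The Cauchy solution for smooth radial data, by d'Alembert's formula. -/
noncomputable def freeWave (c : ℝ) (Φ Ψ : E3 → ℝ) : ℝ → E3 → ℝ :=
  waveU c (halfWave c (profile Φ) (profile Ψ))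

/-- The exterior Neumann solution with data `(Φ, Ψ)`. -/
noncomputable def neumannSolution (c : ℝ) (β : ℝ → ℝ) (Φ Ψ : E3 → ℝ) (ε : ℝ) : ℝ → E3 → ℝ :=
  extWave c (neumannIn c β ε (profile Φ) (profile Ψ)) (neumannOut c β ε (profile Φ) (profile Ψ))

/-- The exterior Dirichlet solution with data `(Φ, Ψ)`. -/
noncomputable def dirichletSolution (c : ℝ) (χ : ℝ → ℝ) (Φ Ψ : E3 → ℝ) (ε : ℝ) : ℝ → E3 → ℝ :=
  extWave c (dirichletIn c χ ε (profile Φ) (profile Ψ))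
    (dirichletOut c χ ε (profile Φ) (profile Ψ))

lemma exists_isMild_freeWave (hc : 0 < c) (T : ℝ) (hΦ : IsSmoothRadial Φ)
    (hΨ : IsSmoothRadial Ψ) : ∃ V, IsMild c T 1 (freeWave c Φ Ψ) V ∧
      freeWave c Φ Ψ 0 =ᵐ[volume] Φ ∧ V 0 =ᵐ[volume] Ψ := by
  obtain ⟨R, hR, h1, h2⟩ := hΦ.exists_isProfile_pair hΨ
  refine ⟨_, (h1.isWaveProfile h2 c).isMild hR hc, (waveU_zero h1 h2).trans ?_,
    (waveV_zero hc.ne' h1 h2).trans ?_⟩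
  · exact Eventually.of_forall hΦ.profile_norm
  · exact Eventually.of_forall hΨ.profile_norm

lemma exists_sobolevSq_sub_neumann_le (hc : 0 < c) (hT : 0 ≤ T) (hβ : IsNeumannCutoff β)
    (hΦ : IsSmoothRadial Φ) (hΨ : IsSmoothRadial Ψ) :
    ∃ C, ∀ ε, 0 < ε → ε ≤ 1 → ∀ t ∈ Set.Icc 0 T,
      sobolevSq 2 (freeWave c Φ Ψ t - extendConst ε (neumannSolution c β Φ Ψ ε) t) ≤
        ENNReal.ofReal (C * ε) := by
  obtain ⟨R, hR, h1, h2⟩ := hΦ.exists_isProfile_pair hΨ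
  obtain ⟨C, hC, hb⟩ := exists_bound_neumann hc hβ h1 h2
  obtain ⟨C', hC'⟩ := exists_sobolevSq_two_sub_le (T := T) (R' := max R 2 + 1 + c * T)
    (h1.isWaveProfile h2 c) hR hc hT hC (by linarith [le_max_left R 2])
  refine ⟨C', fun ε hε hε1 t ht => ?_⟩
  have hm : max R (2 * ε) ≤ max R 2 := max_le_max_left _ (by linarith)
  have := hC' ε hε hε1 _ _ (contDiff_neumannIn hβ hε h1 h2 c) (contDiff_neumannOut hβ hε h1 h2 c)
    (fun t ht r hr => twoWave_neumann_eq_zero hc hβ hε h1 h2 t ht r (by linarith))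
    (fun t ht => waveSlope_neumann_eq_zero hc hβ hε h1 h2 ht.1)
    (fun t ht r hr => hb ε hε hε1 t ht.1 r hr) t ht
  rwa [neumannSolution, extendConst_extWave hε]

lemma exists_sobolevSq_sub_dirichlet_le (hc : 0 < c) (hT : 0 ≤ T) (hχ : IsDirichletCutoff χ)
    (hΦ : IsSmoothRadial Φ) (hΨ : IsSmoothRadial Ψ) :
    ∃ C, ∀ ε, 0 < ε → ε ≤ 1 → ∀ t ∈ Set.Icc 0 T,
      sobolevSq 1 (freeWave c Φ Ψ t - extendZero ε (dirichletSolution c χ Φ Ψ ε) t) ≤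
        ENNReal.ofReal (C * ε) := by
  obtain ⟨R, hR, h1, h2⟩ := hΦ.exists_isProfile_pair hΨ
  obtain ⟨C, hC, hb⟩ := exists_bound_dirichlet hc hχ h1 h2
  obtain ⟨C', hC'⟩ := exists_sobolevSq_one_sub_le (T := T) (R' := max R 2 + 1 + c * T)
    (h1.isWaveProfile h2 c) hR hc hT hC (by linarith [le_max_left R 2])
  refine ⟨C', fun ε hε hε1 t ht => ?_⟩
  have hm : max R (2 * ε) ≤ max R 2 := max_le_max_left _ (by linarith)
  have := hC' ε hε hε1 _ _ (contDiff_dirichletIn hχ hε h1 h2 c)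
    (contDiff_dirichletOut hχ hε h1 h2 c)
    (fun t ht r hr => twoWave_dirichlet_eq_zero hc hχ hε h1 h2 t ht r (by linarith))
    (fun t ht r hr => hb ε hε hε1 t ht.1 r hr) t ht
  rwa [dirichletSolution, extendZero_extWave (twoWave_dirichlet_boundary hc hχ hε h1 h2 ht.1)]

end SmoothData

/-- Diagonal sequences: `m(ε)` grows so slowly that `C (m(ε)) ε` still tends to zero. -/
lemma exists_diagonal (C : ℕ → ℝ) : ∃ m : ℝ → ℕ, Tendsto m (𝓝[>] 0) atTop ∧
    ∀ᶠ ε in 𝓝[>] (0 : ℝ), C (m ε) * ε ≤ 1 / ((m ε : ℝ) + 1) := by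
  classical
  set P : ℝ → ℕ → Prop := fun ε n => C n * ε ≤ 1 / ((n : ℝ) + 1) with hP
  set m : ℝ → ℕ := fun ε => Nat.findGreatest (P ε) ⌊ε⁻¹⌋₊ with hm
  have hmt : Tendsto m (𝓝[>] 0) atTop := by
    rw [tendsto_atTop]
    intro N
    have h1 : ∀ᶠ ε in 𝓝[>] (0 : ℝ), N ≤ ⌊ε⁻¹⌋₊ :=
      (tendsto_nat_floor_atTop.comp tendsto_inv_nhdsGT_zero).eventually (eventually_ge_atTop N)
    have h2 : ∀ᶠ ε in 𝓝[>] (0 : ℝ), P ε N := by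
      have : Tendsto (fun ε : ℝ => C N * ε) (𝓝[>] 0) (𝓝 (C N * 0)) :=
        ((continuous_const_mul (C N)).tendsto 0).mono_left nhdsWithin_le_nhds
      rw [mul_zero] at this
      exact this.eventually_le_const (by positivity)
    filter_upwards [h1, h2] with ε h1 h2 using Nat.le_findGreatest h1 h2
  refine ⟨m, hmt, ?_⟩
  filter_upwards [hmt.eventually (eventually_ge_atTop 1)] with ε hε
  exact Nat.findGreatest_of_ne_zero (P := P ε) (n := ⌊ε⁻¹⌋₊) (m := m ε) rfl (by lia)

lemma exists_seq_isSmoothRadial {k : ℕ} {f : E3 → ℝ} (hf : MemH k f) (hr : IsRadialAE f) :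
    ∃ g : ℕ → E3 → ℝ, (∀ n, IsSmoothRadial (g n)) ∧
      Tendsto (fun n => sobolevSq k (f - g n)) atTop (𝓝 0) := by
  have : ∀ n : ℕ, ∃ g, IsSmoothRadial g ∧ sobolevSq k (f - g) ≤ ((n : ENNReal))⁻¹ := fun n => by
    obtain ⟨g, -, h1, h2⟩ := exists_test_sobolevSq_sub_lt k hf (η := ((n : ENNReal))⁻¹) (by simp)
    exact ⟨g, h2 hr, h1.le⟩
  choose g hg hle using this
  exact ⟨g, hg, tendsto_of_tendsto_of_tendsto_of_le_of_le tendsto_const_nhds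
    ENNReal.tendsto_inv_nat_nhds_zero (fun _ => bot_le) hle⟩

lemma exists_seq_data {k : ℕ} {Φ Ψ : E3 → ℝ} (hΦ : MemH (k + 1) Φ) (hΦr : IsRadialAE Φ)
    (hΨ : MemH k Ψ) (hΨr : IsRadialAE Ψ) : ∃ F G : ℕ → E3 → ℝ,
      (∀ n, IsSmoothRadial (F n)) ∧ (∀ n, IsSmoothRadial (G n)) ∧
      (IsSmoothRadial Φ → IsSmoothRadial Ψ → ∀ n, F n = Φ ∧ G n = Ψ) ∧
      Tendsto (fun n => sobolevSq (k + 1) (Φ - F n)) atTop (𝓝 0) ∧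
      Tendsto (fun n => sobolevSq k (Ψ - G n)) atTop (𝓝 0) := by
  by_cases h : IsSmoothRadial Φ ∧ IsSmoothRadial Ψ
  · refine ⟨fun _ => Φ, fun _ => Ψ, fun _ => h.1, fun _ => h.2, fun _ _ _ => ⟨rfl, rfl⟩, ?_, ?_⟩ <;>
      simp only [sub_self, sobolevSq_zero, tendsto_const_nhds]
  · obtain ⟨F, hF, hF'⟩ := exists_seq_isSmoothRadial hΦ hΦr
    obtain ⟨G, hG, hG'⟩ := exists_seq_isSmoothRadial hΨ hΨr
    exact ⟨F, G, hF, hG, fun h1 h2 => absurd ⟨h1, h2⟩ h, hF', hG'⟩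

/-- If `W Φ Ψ ε` approximates the Cauchy solution at a rate `O(ε)` for all smooth radial data, then
by density and the continuous dependence of the Cauchy solution on its data it does so along
a diagonal sequence for data of finite energy. -/
lemma exists_data_tendsto {c T : ℝ} (hc : 0 < c) (hT : 0 < T) {k : ℕ}
    (W : (E3 → ℝ) → (E3 → ℝ) → ℝ → ℝ → E3 → ℝ)
    (hfree : ∀ Φ Ψ, IsSmoothRadial Φ → IsSmoothRadial Ψ → ∃ V, IsMild c T k (freeWave c Φ Ψ) V ∧
      freeWave c Φ Ψ 0 =ᵐ[volume] Φ ∧ V 0 =ᵐ[volume] Ψ)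
    (hW : ∀ Φ Ψ, IsSmoothRadial Φ → IsSmoothRadial Ψ → ∃ C, ∀ ε, 0 < ε → ε ≤ 1 →
      ∀ t ∈ Set.Icc 0 T, sobolevSq (k + 1) (freeWave c Φ Ψ t - W Φ Ψ ε t) ≤ ENNReal.ofReal (C * ε))
    {Φ Ψ : E3 → ℝ} (hΦ : MemH (k + 1) Φ) (hΦr : IsRadialAE Φ) (hΨ : MemH k Ψ)
    (hΨr : IsRadialAE Ψ) {U : ℝ → E3 → ℝ} (hU : IsCauchySolution c T k Φ Ψ U) :
    ∃ Φ₀ Ψ₀ : ℝ → E3 → ℝ, (∀ ε, IsSmoothRadial (Φ₀ ε)) ∧ (∀ ε, IsSmoothRadial (Ψ₀ ε)) ∧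
      (IsSmoothRadial Φ → IsSmoothRadial Ψ → ∀ ε, Φ₀ ε = Φ ∧ Ψ₀ ε = Ψ) ∧
      Tendsto (fun ε => sobolevNorm (k + 1) (Φ - Φ₀ ε)) (𝓝[>] 0) (𝓝 0) ∧
      Tendsto (fun ε => sobolevNorm k (Ψ - Ψ₀ ε)) (𝓝[>] 0) (𝓝 0) ∧
      Tendsto (fun ε => ⨆ t ∈ Set.Icc 0 T, sobolevNorm (k + 1) (U t - W (Φ₀ ε) (Ψ₀ ε) ε t))
        (𝓝[>] 0) (𝓝 0) := by
  obtain ⟨V, hUV, hU0, hV0⟩ := hU.exists_isMild hT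
  obtain ⟨F, G, hF, hG, hFG, hF', hG'⟩ := exists_seq_data hΦ hΦr hΨ hΨr
  choose C hC using fun n => hW (F n) (G n) (hF n) (hG n)
  obtain ⟨m, hm, hmC⟩ := exists_diagonal C
  obtain ⟨B, hB, hest⟩ := exists_sobolevSq_le_of_isMild hc hT k
  refine ⟨fun ε => F (m ε), fun ε => G (m ε), fun ε => hF _, fun ε => hG _,
    fun h1 h2 ε => hFG h1 h2 _, tendsto_sobolevNorm_iff.2 (hF'.comp hm),
    tendsto_sobolevNorm_iff.2 (hG'.comp hm), ?_⟩
  set a : ℕ → ENNReal := fun n => sobolevSq (k + 1) (Φ - F n) + sobolevSq k (Ψ - G n) with ha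
  set b : ℕ → ENNReal := fun n =>
    2 * (B * a n) + 2 * ENNReal.ofReal (1 / ((n : ℝ) + 1)) with hb
  have hb0 : Tendsto b atTop (𝓝 0) := by
    have h1 : Tendsto a atTop (𝓝 0) := by simpa using hF'.add hG'
    have h2 : Tendsto (fun n => B * a n) atTop (𝓝 0) := by
      simpa using ENNReal.Tendsto.const_mul h1 (Or.inr hB)
    have h3 : Tendsto (fun n : ℕ => ENNReal.ofReal (1 / ((n : ℝ) + 1))) atTop (𝓝 0) := by
      simpa using ENNReal.tendsto_ofReal (tendsto_one_div_add_atTop_nhds_zero_nat (𝕜 := ℝ))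
    have := (ENNReal.Tendsto.const_mul h2 (Or.inr (ENNReal.ofNat_ne_top (n := 2)))).add
      (ENNReal.Tendsto.const_mul h3 (Or.inr (ENNReal.ofNat_ne_top (n := 2))))
    rwa [mul_zero, add_zero] at this
  have hb1 : Tendsto (fun ε => b (m ε) ^ (1 / 2 : ℝ)) (𝓝[>] 0) (𝓝 0) := by
    have := (ENNReal.continuous_rpow_const (y := 1 / 2)).tendsto 0 |>.comp (hb0.comp hm)
    simpa [Function.comp_def] using this
  refine tendsto_of_tendsto_of_tendsto_of_le_of_le' tendsto_const_nhds hb1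
    (Eventually.of_forall fun _ => bot_le) ?_
  filter_upwards [hmC, Ioc_mem_nhdsGT (zero_lt_one (α := ℝ))] with ε hε1 hε
  refine iSup₂_le fun t ht => ENNReal.rpow_le_rpow ?_ (by norm_num)
  obtain ⟨V', hmild, h0, h0'⟩ := hfree (F (m ε)) (G (m ε)) (hF _) (hG _)
  have e1 := hest _ _ (hUV.sub hmild) t ht
  rw [sobolevSq_congr (hU0.sub h0), sobolevSq_congr (hV0.sub h0')] at e1
  refine (sobolevSq_triangle (k + 1) (hUV.contU.1 t ht).1 (hmild.contU.1 t ht).1).trans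
    (add_le_add (mul_le_mul_right e1 2) (mul_le_mul_right ?_ 2))
  exact (hC (m ε) ε hε.1 hε.2 t ht).trans (ENNReal.ofReal_le_ofReal hε1)

end RadialWave

theorem theorem1 (c T : ℝ) (hc : 0 < c) (hT : 0 < T) :
    -- (i) Neumann, convergence in `C([0,T]; H²)`
    (∀ β : ℝ → ℝ, IsNeumannCutoff β →
      ∀ Φ Ψ : E3 → ℝ, MemH 2 Φ → IsRadialAE Φ → MemH 1 Ψ → IsRadialAE Ψ →
      ∀ U : ℝ → E3 → ℝ, IsCauchySolution c T 1 Φ Ψ U →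
      ∃ (Φ₀ Ψ₀ : ℝ → E3 → ℝ) (V : ℝ → ℝ → E3 → ℝ),
        (∀ ε : ℝ, 0 < ε →
          IsSmoothRadial (Φ₀ ε) ∧ IsSmoothRadial (Ψ₀ ε) ∧
          IsExteriorNeumannSolution c T ε
            (neumannData β ε (Φ₀ ε)) (neumannData β ε (Ψ₀ ε)) (V ε) ∧
          ContInH 2 T (extendConst ε (V ε))) ∧
        (IsSmoothRadial Φ → IsSmoothRadial Ψ → ∀ ε : ℝ, 0 < ε → Φ₀ ε = Φ ∧ Ψ₀ ε = Ψ) ∧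
        Tendsto (fun ε => sobolevNorm 2 (Φ - Φ₀ ε)) (𝓝[>] 0) (𝓝 0) ∧
        Tendsto (fun ε => sobolevNorm 1 (Ψ - Ψ₀ ε)) (𝓝[>] 0) (𝓝 0) ∧
        Tendsto (fun ε => ⨆ t ∈ Set.Icc 0 T, sobolevNorm 2 (U t - extendConst ε (V ε) t))
          (𝓝[>] 0) (𝓝 0)) ∧
    -- (ii) Dirichlet, convergence in `C([0,T]; H¹)`
    (∀ χ : ℝ → ℝ, IsDirichletCutoff χ →
      ∀ Φ Ψ : E3 → ℝ, MemH 1 Φ → IsRadialAE Φ → MemH 0 Ψ → IsRadialAE Ψ →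
      ∀ U : ℝ → E3 → ℝ, IsCauchySolution c T 0 Φ Ψ U →
      ∃ (Φ₀ Ψ₀ : ℝ → E3 → ℝ) (V : ℝ → ℝ → E3 → ℝ),
        (∀ ε : ℝ, 0 < ε →
          IsSmoothRadial (Φ₀ ε) ∧ IsSmoothRadial (Ψ₀ ε) ∧
          IsExteriorDirichletSolution c T ε
            (dirichletData χ ε (Φ₀ ε)) (dirichletData χ ε (Ψ₀ ε)) (V ε) ∧
          ContInH 1 T (extendZero ε (V ε))) ∧
        (IsSmoothRadial Φ → IsSmoothRadial Ψ → ∀ ε : ℝ, 0 < ε → Φ₀ ε = Φ ∧ Ψ₀ ε = Ψ) ∧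
        Tendsto (fun ε => sobolevNorm 1 (Φ - Φ₀ ε)) (𝓝[>] 0) (𝓝 0) ∧
        Tendsto (fun ε => sobolevNorm 0 (Ψ - Ψ₀ ε)) (𝓝[>] 0) (𝓝 0) ∧
        Tendsto (fun ε => ⨆ t ∈ Set.Icc 0 T, sobolevNorm 1 (U t - extendZero ε (V ε) t))
          (𝓝[>] 0) (𝓝 0)) := by
  refine ⟨fun β hβ Φ Ψ hΦ hΦr hΨ hΨr U hU => ?_, fun χ hχ Φ Ψ hΦ hΦr hΨ hΨr U hU => ?_⟩
  · obtain ⟨Φ₀, Ψ₀, h1, h2, h3, h4, h5, h6⟩ := exists_data_tendsto hc hT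
      (fun Φ Ψ ε => extendConst ε (neumannSolution c β Φ Ψ ε))
      (fun _ _ => exists_isMild_freeWave hc T)
      (fun _ _ => exists_sobolevSq_sub_neumann_le hc hT.le hβ) hΦ hΦr hΨ hΨr hU
    refine ⟨Φ₀, Ψ₀, fun ε => neumannSolution c β (Φ₀ ε) (Ψ₀ ε) ε, fun ε hε => ?_,
      fun a b ε _ => h3 a b ε, h4, h5, h6⟩
    obtain ⟨R, -, p1, p2⟩ := (h1 ε).exists_isProfile_pair (h2 ε)
    exact ⟨h1 ε, h2 ε, isExteriorNeumannSolution hc hβ hε p1 p2,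
      contInH_neumann hc hT.le hβ hε p1 p2⟩
  · obtain ⟨Φ₀, Ψ₀, h1, h2, h3, h4, h5, h6⟩ := exists_data_tendsto hc hT
      (fun Φ Ψ ε => extendZero ε (dirichletSolution c χ Φ Ψ ε))
      (fun _ _ h h' => (exists_isMild_freeWave hc T h h').imp fun _ hV => ⟨hV.1.of_succ, hV.2⟩)
      (fun _ _ => exists_sobolevSq_sub_dirichlet_le hc hT.le hχ) hΦ hΦr hΨ hΨr hU
    refine ⟨Φ₀, Ψ₀, fun ε => dirichletSolution c χ (Φ₀ ε) (Ψ₀ ε) ε, fun ε hε => ?_,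
      fun a b ε _ => h3 a b ε, h4, h5, h6⟩
    obtain ⟨R, -, p1, p2⟩ := (h1 ε).exists_isProfile_pair (h2 ε)
    exact ⟨h1 ε, h2 ε, isExteriorDirichletSolution hc hχ hε (h1 ε) (h2 ε) p1 p2,
      contInH_dirichlet hc hT.le hχ hε p1 p2⟩
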